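/- For a finite group $G$, an unrefinable chain of length $t$ is a chain of subgroups $G=G_0>G_1>\cdots>G_t=1$ in which each $G_i$ is a maximal subgroup of $G_{i-1}$, and the depth $\lambda(G)$ is the minimal length of an unrefinable chain of $G$. For a positive integer $n$, let $\Omega(n)$ be the number of prime divisors of $n$ counted with multiplicity, and let $\pi(n)$ be the set of prime divisors of $n$. Write $L_2(q)=\mathrm{PSL}_2(\mathbb{F}_q)$. Let $p$ be a prime and let $k\geqslant 1$ be an odd integer with $(p,k)\neq(2,1)$. Then $$\lambda(L_2(p^k))=\begin{cases}\Omega(k)+1+\min\{\Omega(2^r-1),\,\Omega(2^r+1) : r\in\pi(k)\} & \text{if } p=2,\\ \Omega(k)+\lambda(L_2(p)) & \text{if } p\geqslant 3.\end{cases}$$ Moreover, for $p\geqslant 3$, $$\lambda(L_2(p))=\begin{cases}2 & \text{if } p=3,\\ 3 & \text{if } p\geqslant 5 \text{ and either } (p-1)/2 \text{ or } (p+1)/2 \text{ is prime, or } p\equiv\pm3,\pm13 \pmod{40},\\ 4 & \text{otherwise.}\end{cases}$$ -/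

import Mathlib

open scoped ArithmeticFunction.Omega

/-- `H 0 > H 1 > ⋯ > H t` is an unrefinable chain of length `t` of `G`: it starts at `G`, ends at
the trivial subgroup, and each `H (i + 1)` is a maximal subgroup of `H i`. (For subgroups,
`K ⋖ L` says that `K` is a proper subgroup of `L` and no subgroup lies strictly between them.) -/
def IsUnrefinableChain {G : Type*} [Group G] (t : ℕ) (H : Fin (t + 1) → Subgroup G) : Prop :=
  H 0 = ⊤ ∧ H (Fin.last t) = ⊥ ∧ ∀ i : Fin t, H i.succ ⋖ H i.castSucc

/-- The depth of a (finite) group: the minimal length of an unrefinable chain. -/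
noncomputable def depth (G : Type*) [Group G] : ℕ :=
  sInf {t : ℕ | ∃ H : Fin (t + 1) → Subgroup G, IsUnrefinableChain t H}

/-- A finite group has an unrefinable chain, so that the infimum defining its depth is a minimum
and is attained. -/
theorem exists_isUnrefinableChain_depth (G : Type*) [Group G] [Finite G] :
    ∃ H : Fin (depth G + 1) → Subgroup G, IsUnrefinableChain (depth G) H := by
  have key : ∀ K : Subgroup G, ∃ t : ℕ, ∃ H : Fin (t + 1) → Subgroup G,
      H 0 = K ∧ H (Fin.last t) = ⊥ ∧ ∀ i : Fin t, H i.succ ⋖ H i.castSucc := by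
    intro K
    induction K using WellFoundedLT.induction with
    | ind K ih =>
      by_cases hK : K = ⊥
      · exact ⟨0, fun _ => K, rfl, hK, fun i => i.elim0⟩
      · obtain ⟨L, -, hL⟩ := exists_le_covBy_of_lt (bot_lt_iff_ne_bot.mpr hK)
        obtain ⟨t, H, h0, h1, h2⟩ := ih L hL.lt
        refine ⟨t + 1, Fin.cons K H, rfl, ?_, ?_⟩
        · rw [← Fin.succ_last, Fin.cons_succ, h1]
        · intro i
          refine Fin.cases ?_ (fun j => ?_) i
          · simpa [h0] using hL
          · simpa [← Fin.succ_castSucc] using h2 j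
  exact Nat.sInf_mem (s := {t : ℕ | ∃ H : Fin (t + 1) → Subgroup G, IsUnrefinableChain t H})
    (key ⊤)

/-- The group `L₂(F) = PSL₂(F)`. -/
abbrev L2 (F : Type*) [Field F] : Type _ := Matrix.ProjectiveSpecialLinearGroup (Fin 2) F

/-! A shortest chain starts with a maximal subgroup `M` satisfying `depth G = depth M + 1`, so
everything rests on knowing the maximal subgroups of `L₂(q)` and bounding their depths. Two general
bounds serve: `depth_le_cardFactors` (depth at most `Ω` of the order) and
`depth_add_cardFactors_ker_le` (a cyclic normal subgroup of order `n` costs at least `Ω n` on top of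
the depth of the quotient).

The maximal subgroups are found by counting orbits. Over a finite extension `K` of `F` in which all
the polynomials `X² - τX + 1` split, every nontrivial element of `L₂(F)` fixes one point (unipotent)
or two points of the projective line. A subgroup `H` therefore satisfies the class equation `∑
(|H_x| + |U_x| - 2) = 2(|H| - 1)`, which leaves room for at most three orbits with nontrivial
stabilizers, as in the classification of finite rotation groups. The outcome
(`IsPolarAction.classification`) is: a fixed point, a stabilizer of index two without unipotents, a
polyhedral group of order 12, 24 or 60, an orbit on which `H` acts like `PSL₂(Q)` or `PGL₂(Q)`, or
order 60 in characteristic 3. Translated back, a maximal subgroup is a Borel subgroup, the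
normalizer of a torus, polyhedral, or conjugate to `L₂` of a subfield.

Oddness of `k` enters because square roots then descend to subfields. Hence groups with a
`PSL₂(Q)`-like orbit are defined over the field of `Q` elements. Likewise a polyhedral group, whose
traces solve equations of the type `τ² ∈ {0, 1, 2}` or `(2τ ± 1)² = 5`, is conjugate into `L₂(p)`,
and so is maximal only when `k = 1`. Order 60 in characteristic 3 is impossible since 5 does not
divide `|L₂(3ᵏ)|`.

The formula in `k` follows by induction. A maximal subgroup over `L₂(p^(k/r))`, with `r` prime, must
have the same order by divisibility, so an extension of prime degree raises the depth by at most
one. Conversely Borel subgroups and torus normalizers involve cyclic groups of order `(q ± 1)/gcd(2,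
q - 1)`, and `Ω(xⁿ ± 1) ≥ Ω(x ± 1) + Ω(n)` shows that these are never a shorter way down. In
characteristic two the descent must stop at `L₂(2^r)` with `r` prime, where a Borel subgroup or a
torus normalizer has to be used; this gives the minimum.

For `L₂(p)` no maximal subgroup has prime order when `p ≥ 5`, so the depth is at least 3. Borel
subgroups and torus normalizers reach 3 when `(p ∓ 1)/2` is prime, and a polyhedral maximal subgroup
gives at most 4. A polyhedral route of length 3 needs a maximal subgroup of order 12. One exists
when neither 24 nor 5 divides the group order, which is what the congruences modulo 40 ensure. If 2
or 5 is a square modulo `p`, an octahedral or icosahedral overgroup prevents it. -/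

/-! ### Depth: invariance, passage to a maximal subgroup, first bounds -/

theorem depth_le_of_chain {G : Type*} [Group G] {t : ℕ} (H : Fin (t + 1) → Subgroup G)
    (hH : IsUnrefinableChain t H) : depth G ≤ t := Nat.sInf_le ⟨H, hH⟩

theorem depth_le_of_mulEquiv {G G' : Type*} [Group G] [Finite G] [Group G'] (e : G ≃* G') :
    depth G' ≤ depth G := by
  obtain ⟨H, h0, h1, h2⟩ := exists_isUnrefinableChain_depth G
  refine depth_le_of_chain (fun i => (H i).map e.toMonoidHom) ⟨?_, ?_, fun i => ?_⟩
  · simp only [h0]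
    exact Subgroup.map_top_of_surjective _ e.surjective
  · simp [h1]
  · exact (apply_covBy_apply_iff e.mapSubgroup).2 (h2 i)

theorem depth_congr {G G' : Type*} [Group G] [Finite G] [Group G'] (e : G ≃* G') :
    depth G = depth G' :=
  have : Finite G' := Finite.of_equiv G e.toEquiv
  le_antisymm (depth_le_of_mulEquiv e.symm) (depth_le_of_mulEquiv e)

theorem depth_le_depth_add_one {G : Type*} [Group G] [Finite G] {M : Subgroup G}
    (hM : IsCoatom M) : depth G ≤ depth M + 1 := by
  obtain ⟨H, h0, h1, h2⟩ := exists_isUnrefinableChain_depth M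
  refine depth_le_of_chain (Fin.cons ⊤ fun i => (H i).map M.subtype) ⟨rfl, ?_, fun i => ?_⟩
  · rw [← Fin.succ_last, Fin.cons_succ, h1, Subgroup.map_bot]
  · refine Fin.cases ?_ (fun j => ?_) i
    · simp only [Fin.cons_succ, h0, Fin.castSucc_zero, Fin.cons_zero]
      rw [← MonoidHom.range_eq_map, Subgroup.range_subtype]
      exact hM.covBy_top
    · rw [← Fin.succ_castSucc, Fin.cons_succ, Fin.cons_succ]
      have := (apply_covBy_apply_iff (Subgroup.MapSubtype.orderIso M)).2 (h2 j)
      refine ⟨?_, fun c hc1 hc2 => ?_⟩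
      · exact (Subgroup.map_subtype_lt_map_subtype).2 (h2 j).lt
      · have hcM : c ≤ M := hc2.le.trans (Subgroup.map_subtype_le _)
        refine (h2 j).2 (c := c.subgroupOf M) ?_ ?_
        · rw [← Subgroup.map_subtype_lt_map_subtype, Subgroup.map_subgroupOf_eq_of_le hcM]
          exact hc1
        · rw [← Subgroup.map_subtype_lt_map_subtype, Subgroup.map_subgroupOf_eq_of_le hcM]
          exact hc2

/-- The second term of a shortest chain works: the rest of the chain is a chain of that subgroup,
and conversely any chain of a maximal subgroup extends by the whole group. -/
theorem exists_isCoatom_depth_eq {G : Type*} [Group G] [Finite G] [Nontrivial G] :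
    ∃ M : Subgroup G, IsCoatom M ∧ depth G = depth M + 1 := by
  obtain ⟨H, h0, h1, h2⟩ := exists_isUnrefinableChain_depth G
  obtain ⟨t, ht⟩ : ∃ t, depth G = t + 1 := by
    refine Nat.exists_eq_succ_of_ne_zero fun h => ?_
    have : Fin.last (depth G) = 0 := by ext; simp [h]
    rw [this, h0] at h1
    exact top_ne_bot h1
  revert H
  rw [ht]
  intro H h0 h1 h2
  have hM : IsCoatom (H 1) := by
    have := h2 0
    simp only [Fin.succ_zero_eq_one, Fin.castSucc_zero, h0] at this
    exact covBy_top_iff.1 this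
  have hup := depth_le_depth_add_one hM
  rw [ht] at hup
  refine ⟨H 1, hM, le_antisymm hup ?_⟩
  have hle : ∀ i : Fin (t + 1), H i.succ ≤ H 1 := by
    intro i
    induction i using Fin.induction with
    | zero => simp
    | succ i ih =>
      have := (h2 i.succ).lt.le
      rw [← Fin.succ_castSucc] at this
      exact this.trans ih
  refine Nat.add_le_add_right (depth_le_of_chain (fun i => (H i.succ).subgroupOf (H 1))
    ⟨?_, ?_, fun i => ?_⟩) 1
  · simp
  · simp only [Fin.succ_last, h1, Subgroup.bot_subgroupOf]
  · have hc := h2 i.succ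
    rw [← Fin.succ_castSucc] at hc
    refine ⟨?_, fun c hc1 hc2 => ?_⟩
    · rw [← Subgroup.map_subtype_lt_map_subtype, Subgroup.map_subgroupOf_eq_of_le (hle _),
        Subgroup.map_subgroupOf_eq_of_le (hle _)]
      exact hc.lt
    · rw [← Subgroup.map_subtype_lt_map_subtype, Subgroup.map_subgroupOf_eq_of_le (hle _)] at hc1 hc2
      exact hc.2 hc1 hc2

theorem depth_eq_zero_of_subsingleton {G : Type*} [Group G] [Subsingleton G] : depth G = 0 :=
  Nat.le_zero.1 (depth_le_of_chain (t := 0) (fun _ => ⊤)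
    ⟨rfl, Subsingleton.elim _ _, fun i => i.elim0⟩)

theorem one_le_depth {G : Type*} [Group G] [Finite G] [Nontrivial G] : 1 ≤ depth G := by
  obtain ⟨M, -, h⟩ := exists_isCoatom_depth_eq (G := G)
  omega

theorem Nat.one_le_cardFactors {n : ℕ} (h : 1 < n) : 1 ≤ Ω n := by
  rw [Nat.one_le_iff_ne_zero, Ne, ArithmeticFunction.cardFactors_eq_zero_iff_eq_zero_or_one]
  omega

theorem Nat.cardFactors_add_one_le_of_dvd_of_lt {m n : ℕ} (h : m ∣ n) (hlt : m < n) (hm : m ≠ 0) :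
    Ω m + 1 ≤ Ω n := by
  obtain ⟨c, rfl⟩ := h
  have hc : 1 < c := by
    by_contra hc
    interval_cases c <;> omega
  rw [ArithmeticFunction.cardFactors_mul hm (by omega)]
  have := Nat.one_le_cardFactors hc
  omega

theorem Nat.cardFactors_le_of_dvd {m n : ℕ} (h : m ∣ n) (hn : n ≠ 0) : Ω m ≤ Ω n := by
  obtain ⟨c, rfl⟩ := h
  rw [ArithmeticFunction.cardFactors_mul (by rintro rfl; simp at hn) (by rintro rfl; simp at hn)]
  omega

/-- Each step down a chain replaces the order by a proper divisor, so it loses at least one prime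
factor. -/
theorem depth_le_cardFactors (n : ℕ) : ∀ (G : Type*) [Group G] [Finite G], Nat.card G = n →
    depth G ≤ Ω n := by
  induction n using Nat.strong_induction_on with
  | _ n ih =>
    intro G _ _ hn
    rcases subsingleton_or_nontrivial G with h | h
    · rw [depth_eq_zero_of_subsingleton]; exact Nat.zero_le _
    · obtain ⟨M, hM, h⟩ := exists_isCoatom_depth_eq (G := G)
      have hdvd := M.card_subgroup_dvd_card
      have hpos : 0 < Nat.card G := Nat.card_pos
      have hlt : Nat.card M < Nat.card G := by
        refine lt_of_le_of_ne (Nat.le_of_dvd hpos hdvd) fun h => hM.1 ?_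
        exact Subgroup.eq_top_of_card_eq _ h
      have := ih _ (hn ▸ hlt) M rfl
      have := Nat.cardFactors_add_one_le_of_dvd_of_lt hdvd hlt Nat.card_pos.ne'
      rw [hn] at this
      omega

/-- In depth one the trivial subgroup is maximal, so any element of prime order generates the whole
group. -/
theorem two_le_depth {G : Type*} [Group G] [Finite G] (h1 : 1 < Nat.card G)
    (hp : ¬ (Nat.card G).Prime) : 2 ≤ depth G := by
  have : Nontrivial G := Finite.one_lt_card_iff_nontrivial.1 h1
  obtain ⟨M, hM, h⟩ := exists_isCoatom_depth_eq (G := G)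
  by_contra hlt
  have hM0 : ¬ Nontrivial M := fun hM' => by
    have := one_le_depth (G := M)
    omega
  have hbot : M = ⊥ := by
    rw [Subgroup.nontrivial_iff_ne_bot] at hM0
    exact not_not.1 hM0
  subst hbot
  obtain ⟨r, hr, hrd⟩ := Nat.exists_prime_and_dvd (n := Nat.card G) (by omega)
  have := Fact.mk hr
  obtain ⟨x, hx⟩ := exists_prime_orderOf_dvd_card' r hrd
  have hz : Subgroup.zpowers x = ⊤ := by
    refine hM.2 _ (bot_lt_iff_ne_bot.2 fun h => ?_)
    rw [Subgroup.zpowers_eq_bot] at h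
    simp [h] at hx
    exact hr.one_lt.ne hx
  apply hp
  rw [← Subgroup.card_top, ← hz, Nat.card_zpowers, hx]
  exact hr

/-! ### Depth of quotients and cyclic normal subgroups -/

/-- Take a maximal subgroup `K` that realizes the depth. If `K` contains the kernel, its image is
maximal in `A` and induction applies to `K`. Otherwise `K` already maps onto `A`, either
isomorphically or again with a nontrivial kernel. -/
theorem depth_add_one_le_of_surjective (n : ℕ) : ∀ {G A : Type*} [Group G] [Finite G] [Group A]
    (f : G →* A), Nat.card G = n → Function.Surjective f → f.ker ≠ ⊥ →
    depth A + 1 ≤ depth G := by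
  induction n using Nat.strong_induction_on with
  | _ n ih =>
    intro G A _ _ _ f hn hf hker
    have : Finite A := Finite.of_surjective f hf
    have : Nontrivial G := by
      by_contra h
      rw [not_nontrivial_iff_subsingleton] at h
      exact hker (Subsingleton.elim _ _)
    obtain ⟨K, hK, h⟩ := exists_isCoatom_depth_eq (G := G)
    have hlt : Nat.card K < n := by
      rw [← hn]
      refine lt_of_le_of_ne (Nat.le_of_dvd Nat.card_pos K.card_subgroup_dvd_card) fun h => hK.1 ?_
      exact Subgroup.eq_top_of_card_eq _ h
    by_cases hle : f.ker ≤ K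
    · have hco : IsCoatom (K.map f) := by
        have hcm : (K.map f).comap f = K := by
          rw [Subgroup.comap_map_eq, sup_eq_left.2 hle]
        refine ⟨fun htop => hK.1 ?_, fun L hL => ?_⟩
        · rw [← hcm, htop, Subgroup.comap_top]
        · have h1 : K < L.comap f := by
            rw [← hcm]
            exact (Subgroup.comap_lt_comap_of_surjective hf).2 hL
          have h2 := hK.2 _ h1
          rw [← Subgroup.map_comap_eq_self_of_surjective hf L, h2,
            Subgroup.map_top_of_surjective f hf]
      have h1 := depth_le_depth_add_one hco
      have h2 := ih _ hlt (f.subgroupMap K) rfl (f.subgroupMap_surjective K) (by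
        intro hb
        obtain ⟨⟨x, hx⟩, hx1⟩ := Subgroup.ne_bot_iff_exists_ne_one.1 hker
        have : (⟨x, hle hx⟩ : K) ∈ (f.subgroupMap K).ker := by
          rw [MonoidHom.mem_ker]; ext; exact hx
        rw [hb, Subgroup.mem_bot] at this
        have h1 : x = 1 := congrArg Subtype.val this
        exact hx1 (Subtype.ext h1))
      omega
    · have hsup : K ⊔ f.ker = ⊤ := hK.2 _ (by
        refine lt_of_le_of_ne le_sup_left fun h => hle ?_
        rw [h]; exact le_sup_right)
      have hs : Function.Surjective (f.comp K.subtype) := by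
        intro a
        obtain ⟨g, rfl⟩ := hf a
        have hg : g ∈ K ⊔ f.ker := hsup ▸ Subgroup.mem_top g
        obtain ⟨y, hy, z, hz, rfl⟩ := Subgroup.mem_sup_of_normal_right.1 hg
        refine ⟨⟨y, hy⟩, ?_⟩
        simp [MonoidHom.mem_ker.1 hz]
      by_cases hinj : (f.comp K.subtype).ker = ⊥
      · have := depth_congr (MulEquiv.ofBijective (f.comp K.subtype)
          ⟨(MonoidHom.ker_eq_bot_iff _).1 hinj, hs⟩)
        omega
      · have := ih _ hlt (f.comp K.subtype) rfl hs hinj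
        omega

theorem Subgroup.normal_of_le_isCyclic_normal {G : Type*} [Group G] {C P : Subgroup G} [C.Normal]
    [IsCyclic C] (h : P ≤ C) : P.Normal := by
  obtain ⟨⟨c, hc⟩, hgen⟩ := IsCyclic.exists_generator (α := C)
  refine ⟨fun x hx g => ?_⟩
  obtain ⟨j, hj⟩ := Subgroup.mem_zpowers_iff.1 (hgen ⟨x, h hx⟩)
  obtain ⟨m, hm⟩ := Subgroup.mem_zpowers_iff.1
    (hgen ⟨g * c * g⁻¹, Subgroup.Normal.conj_mem inferInstance c hc g⟩)
  have hj' : c ^ j = x := congrArg Subtype.val hj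
  have hm' : c ^ m = g * c * g⁻¹ := congrArg Subtype.val hm
  have : g * x * g⁻¹ = x ^ m := by
    rw [← hj', ← conj_zpow, ← hm', ← zpow_mul, ← zpow_mul, mul_comm]
  rw [this]
  exact P.zpow_mem hx m

/-- All subgroups of a cyclic normal subgroup are normal, so the kernel can be divided out one prime
at a time, each quotient lowering the depth by at least one. -/
theorem depth_add_cardFactors_ker_le (n : ℕ) : ∀ {G A : Type*} [Group G] [Finite G] [Group A]
    (f : G →* A), Nat.card f.ker = n → Function.Surjective f → IsCyclic f.ker →
    depth A + Ω n ≤ depth G := by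
  induction n using Nat.strong_induction_on with
  | _ n ih =>
    intro G A _ _ _ f hn hf hcyc
    have : Finite A := Finite.of_surjective f hf
    by_cases hn1 : n = 1
    · have hb : f.ker = ⊥ := Subgroup.card_eq_one.1 (hn.trans hn1)
      have := depth_congr (MulEquiv.ofBijective f ⟨(MonoidHom.ker_eq_bot_iff _).1 hb, hf⟩)
      rw [this, hn1, ArithmeticFunction.cardFactors_one]
      exact le_rfl
    obtain ⟨r, hr, hrd⟩ := Nat.exists_prime_and_dvd hn1
    have := Fact.mk hr
    obtain ⟨⟨x, hxk⟩, hx⟩ := exists_prime_orderOf_dvd_card' (G := f.ker) r (hn ▸ hrd)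
    have hx' : orderOf x = r := by rw [← hx, ← Subgroup.orderOf_coe]
    set P := Subgroup.zpowers x with hP
    have hPk : P ≤ f.ker := by rwa [hP, Subgroup.zpowers_le]
    have hPn : P.Normal := Subgroup.normal_of_le_isCyclic_normal hPk
    have hPcard : Nat.card P = r := by rw [hP, Nat.card_zpowers, hx']
    have h1 : depth (G ⧸ P) + 1 ≤ depth G :=
      depth_add_one_le_of_surjective _ (QuotientGroup.mk' P) rfl (QuotientGroup.mk'_surjective P)
        (by
          rw [QuotientGroup.ker_mk']
          intro h
          rw [h, Subgroup.card_bot] at hPcard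
          exact hr.one_lt.ne hPcard)
    let f' : G ⧸ P →* A := QuotientGroup.lift P f fun y hy => hPk hy
    have hf' : Function.Surjective f' := fun a => by
      obtain ⟨g, rfl⟩ := hf a
      exact ⟨QuotientGroup.mk g, rfl⟩
    have hker : f'.ker = f.ker.map (QuotientGroup.mk' P) := QuotientGroup.ker_lift P f hPk
    have hcyc' : IsCyclic f'.ker := by
      rw [hker]
      exact isCyclic_of_surjective _ ((QuotientGroup.mk' P).subgroupMap_surjective f.ker)
    have hc1 : Nat.card f.ker * Nat.card A = Nat.card G := by
      rw [← Subgroup.card_mul_index f.ker, Subgroup.index_ker, MonoidHom.range_eq_top.2 hf,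
        Subgroup.card_top]
    have hc2 : Nat.card f'.ker * Nat.card A = Nat.card (G ⧸ P) := by
      rw [← Subgroup.card_mul_index f'.ker, Subgroup.index_ker, MonoidHom.range_eq_top.2 hf',
        Subgroup.card_top]
    have hc3 := Subgroup.card_eq_card_quotient_mul_card_subgroup P
    have hcard : n = r * Nat.card f'.ker := by
      rw [← hn]
      refine Nat.eq_of_mul_eq_mul_right (Nat.card_pos (α := A)) ?_
      rw [hc1, hc3, ← hc2, hPcard]; ring
    have hpos : 0 < Nat.card f'.ker := Nat.card_pos
    have h2 := ih (Nat.card f'.ker) (by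
      rw [hcard]; exact lt_mul_of_one_lt_left hpos hr.one_lt) f' rfl hf' hcyc'
    rw [hcard, ArithmeticFunction.cardFactors_mul hr.ne_zero hpos.ne',
      ArithmeticFunction.cardFactors_apply_prime hr]
    omega

theorem cardFactors_card_le_depth {G : Type*} [Group G] [Finite G] [IsCyclic G] :
    Ω (Nat.card G) ≤ depth G := by
  have hk : (1 : G →* Unit).ker = ⊤ := MonoidHom.ker_one
  have := depth_add_cardFactors_ker_le (Nat.card G) (1 : G →* Unit)
    (by rw [hk, Subgroup.card_top]) (fun _ => ⟨1, Subsingleton.elim _ _⟩)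
    (by rw [hk]; exact isCyclic_of_surjective _ Subgroup.topEquiv.symm.surjective)
  omega

theorem cardFactors_add_one_le_depth {G : Type*} [Group G] [Finite G] {C : Subgroup G} [C.Normal]
    [IsCyclic C] (hC : C ≠ ⊤) : Ω (Nat.card C) + 1 ≤ depth G := by
  have : Nontrivial (G ⧸ C) := by
    rw [← not_subsingleton_iff_nontrivial, QuotientGroup.subsingleton_iff]
    exact hC
  have h1 := one_le_depth (G := G ⧸ C)
  have hk := QuotientGroup.ker_mk' C
  have := depth_add_cardFactors_ker_le (Nat.card C) (QuotientGroup.mk' C) (by rw [hk])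
    (QuotientGroup.mk'_surjective C) (by rw [hk]; infer_instance)
  omega

theorem IsCoatom.prime_index_of_normal {G : Type*} [Group G] [Finite G] {K : Subgroup G}
    (hK : IsCoatom K) [K.Normal] : K.index.Prime := by
  have h1 : K.index ≠ 1 := fun h => hK.1 (Subgroup.index_eq_one.1 h)
  by_contra hp
  have hc : 1 < Nat.card (G ⧸ K) :=
    lt_of_le_of_ne Nat.card_pos (Ne.symm h1)
  obtain ⟨r, hr, hrd⟩ := Nat.exists_prime_and_dvd (n := Nat.card (G ⧸ K)) hc.ne'
  have := Fact.mk hr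
  obtain ⟨x, hx⟩ := exists_prime_orderOf_dvd_card' r hrd
  have hlt : K < (Subgroup.zpowers x).comap (QuotientGroup.mk' K) := by
    refine lt_of_le_of_ne ?_ fun h => ?_
    · intro y hy
      have : QuotientGroup.mk' K y = 1 := (QuotientGroup.eq_one_iff y).2 hy
      rw [Subgroup.mem_comap, this]
      exact one_mem _
    · obtain ⟨y, rfl⟩ := QuotientGroup.mk'_surjective K x
      have hy : y ∈ K := by
        rw [h]
        exact Subgroup.mem_zpowers _
      have : QuotientGroup.mk' K y = 1 := (QuotientGroup.eq_one_iff y).2 hy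
      rw [this, orderOf_one] at hx
      exact hr.one_lt.ne hx
  have htop := hK.2 _ hlt
  have hz : Subgroup.zpowers x = ⊤ := by
    rw [← Subgroup.map_comap_eq_self_of_surjective (QuotientGroup.mk'_surjective K)
      (Subgroup.zpowers x), htop, Subgroup.map_top_of_surjective _ (QuotientGroup.mk'_surjective K)]
  apply hp
  rw [Subgroup.index, ← Subgroup.card_top, ← hz, Nat.card_zpowers, hx]
  exact hr

/-- A maximal subgroup that is not normal is its own normalizer, and for an `r`-subgroup the index
in the group is congruent modulo `r` to the index in the normalizer. -/
theorem IsCoatom.index_modEq_one {G : Type*} [Group G] [Finite G] {K : Subgroup G}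
    (hK : IsCoatom K) {r : ℕ} (hr : r.Prime) (hc : Nat.card K = r) :
    K.index.Prime ∨ K.index ≡ 1 [MOD r] := by
  have := Fact.mk hr
  by_cases hn : K.Normal
  · exact Or.inl hK.prime_index_of_normal
  · right
    have hN : Subgroup.normalizer (K : Set G) = K := by
      by_contra h
      exact hn (Subgroup.normalizer_eq_top_iff.1
        (hK.2 _ (lt_of_le_of_ne Subgroup.le_normalizer (Ne.symm h))))
    have h := Sylow.card_quotient_normalizer_modEq_card_quotient (p := r) (n := 1) (H := K)
      (by rw [hc, pow_one])
    have h1 : K.comap (Subgroup.normalizer (K : Set G)).subtype = ⊤ := by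
      rw [Subgroup.comap_subtype, Subgroup.subgroupOf_eq_top, hN]
    have h2 : Nat.card (Subgroup.normalizer (K : Set G) ⧸
        K.comap (Subgroup.normalizer (K : Set G)).subtype) = 1 := by
      change (K.comap (Subgroup.normalizer (K : Set G)).subtype).index = 1
      rw [h1, Subgroup.index_top]
    rw [h2] at h
    exact h.symm

theorem exists_isCoatom_prime_card {G : Type*} [Group G] [Finite G] (h1 : 1 < Nat.card G)
    (hp : ¬ (Nat.card G).Prime) (hd : depth G ≤ 2) :
    ∃ K : Subgroup G, IsCoatom K ∧ (Nat.card K).Prime := by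
  have : Nontrivial G := Finite.one_lt_card_iff_nontrivial.1 h1
  obtain ⟨K, hK, h⟩ := exists_isCoatom_depth_eq (G := G)
  refine ⟨K, hK, ?_⟩
  by_contra hKp
  by_cases hK1 : 1 < Nat.card K
  · have := two_le_depth hK1 hKp
    omega
  · have hpos : 0 < Nat.card K := Nat.card_pos
    have hb : K = ⊥ := Subgroup.card_eq_one.1 (by omega)
    have : K.Normal := by rw [hb]; infer_instance
    have := hK.prime_index_of_normal
    rw [hb, Subgroup.index_bot] at this
    exact hp this

/-- In depth two a maximal subgroup would have prime order 2, 3 or 5; the resulting indices 12, 8,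
30, 20, 12 are neither prime nor congruent to 1 modulo that prime. -/
theorem three_le_depth_of_card {G : Type*} [Group G] [Finite G]
    (h : Nat.card G = 24 ∨ Nat.card G = 60) : 3 ≤ depth G := by
  by_contra hlt
  obtain ⟨K, hK, hr⟩ := exists_isCoatom_prime_card (G := G) (by omega)
    (by rcases h with h | h <;> rw [h] <;> norm_num) (by omega)
  have hidx := hK.index_modEq_one hr rfl
  have hmul := K.card_mul_index
  generalize K.index = m at *
  generalize Nat.card K = r at *
  -- The number 120 is a common multiple of 24 and 60, and its only prime factors are 2, 3 and 5.
  have hdvd : r ∣ 60 * 2 := by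
    rcases h with h | h
    · exact (Dvd.intro _ (hmul.trans h)).trans (by norm_num)
    · exact (Dvd.intro _ (hmul.trans h)).trans (by norm_num)
  have hr235 : r = 2 ∨ r = 3 ∨ r = 5 := by
    have : r ∣ 2 ^ 3 * (3 * 5) := hdvd
    rcases hr.dvd_mul.1 this with h | h
    · left; exact (Nat.prime_dvd_prime_iff_eq hr Nat.prime_two).1 (hr.dvd_of_dvd_pow h)
    · right
      rcases hr.dvd_mul.1 h with h | h
      · left; exact (Nat.prime_dvd_prime_iff_eq hr Nat.prime_three).1 h
      · right; exact (Nat.prime_dvd_prime_iff_eq hr Nat.prime_five).1 h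
  rcases hr235 with rfl | rfl | rfl <;> rcases h with h | h
  · obtain rfl : m = 12 := by omega
    revert hidx; decide
  · obtain rfl : m = 30 := by omega
    revert hidx; decide
  · obtain rfl : m = 8 := by omega
    revert hidx; decide
  · obtain rfl : m = 20 := by omega
    revert hidx; decide
  · omega
  · obtain rfl : m = 12 := by omega
    revert hidx; decide

/-! ### Numbers of prime factors of `xⁿ - 1` and `xⁿ + 1` -/

/-- Multiplying the exponent by a prime replaces `x ^ d - 1` by a proper multiple, which has at
least one more prime factor. This keeps Borel subgroups and tori of large fields from shortening
chains. -/
theorem cardFactors_pow_sub_one {x n : ℕ} (hx : 2 ≤ x) (hn : n ≠ 0) :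
    Ω (x - 1) + Ω n ≤ Ω (x ^ n - 1) := by
  induction n using Nat.strong_induction_on with
  | _ n ih =>
    by_cases h1 : n = 1
    · simp [h1]
    obtain ⟨r, hr, d, rfl⟩ := Nat.exists_prime_and_dvd h1
    have hd : d ≠ 0 := right_ne_zero_of_mul hn
    have hlt : d < r * d := lt_mul_of_one_lt_left (Nat.pos_of_ne_zero hd) hr.one_lt
    have h2 := ih d hlt hd
    have hpow : x ^ d < x ^ (r * d) := Nat.pow_lt_pow_right hx hlt
    have hxd : 1 < x ^ d := Nat.one_lt_pow hd hx
    have h3 : Ω (x ^ d - 1) + 1 ≤ Ω (x ^ (r * d) - 1) :=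
      Nat.cardFactors_add_one_le_of_dvd_of_lt
        (Nat.pow_sub_one_dvd_pow_sub_one x (Dvd.intro_left r rfl)) (by omega) (by omega)
    rw [ArithmeticFunction.cardFactors_mul hr.ne_zero hd,
      ArithmeticFunction.cardFactors_apply_prime hr]
    omega

theorem cardFactors_pow_add_one {x n : ℕ} (hx : 2 ≤ x) (hn : Odd n) :
    Ω (x + 1) + Ω n ≤ Ω (x ^ n + 1) := by
  induction n using Nat.strong_induction_on with
  | _ n ih =>
    by_cases h1 : n = 1
    · simp [h1]
    obtain ⟨r, hr, d, rfl⟩ := Nat.exists_prime_and_dvd h1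
    obtain ⟨hro, hdo⟩ := Nat.odd_mul.1 hn
    have hd : d ≠ 0 := hdo.pos.ne'
    have hlt : d < r * d := lt_mul_of_one_lt_left hdo.pos hr.one_lt
    have h2 := ih d hlt hdo
    have hpow : x ^ d < x ^ (r * d) := Nat.pow_lt_pow_right hx hlt
    have h3 : Ω (x ^ d + 1) + 1 ≤ Ω (x ^ (r * d) + 1) := by
      refine Nat.cardFactors_add_one_le_of_dvd_of_lt ?_ (by omega) (by omega)
      have := hro.nat_add_dvd_pow_add_pow (x ^ d) 1
      rwa [one_pow, ← pow_mul, mul_comm d r] at this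
    rw [ArithmeticFunction.cardFactors_mul hr.ne_zero hd,
      ArithmeticFunction.cardFactors_apply_prime hr]
    omega

theorem cardFactors_half {n : ℕ} (h2 : 2 ∣ n) (hn : n ≠ 0) : Ω n = Ω (n / 2) + 1 := by
  obtain ⟨c, rfl⟩ := h2
  rw [Nat.mul_div_cancel_left c two_pos, ArithmeticFunction.cardFactors_mul two_ne_zero (by omega),
    ArithmeticFunction.cardFactors_apply_prime Nat.prime_two, add_comm]

theorem two_le_cardFactors {n : ℕ} (h1 : 1 < n) (hp : ¬ n.Prime) : 2 ≤ Ω n := by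
  have := Nat.one_le_cardFactors h1
  have h : Ω n ≠ 1 := fun h => hp (ArithmeticFunction.cardFactors_eq_one_iff_prime.1 h)
  omega

/-! ### Orbit counting for actions whose nontrivial elements fix one or two points -/

theorem MulAction.card_dvd_mul_card_of_card_stabilizer {A Y : Type*} [Group A] [Finite A]
    [MulAction A Y] [Finite Y] {s : ℕ} (h : ∀ y : Y, Nat.card (MulAction.stabilizer A y) = s) :
    Nat.card A ∣ s * Nat.card Y := by
  classical
  have := Fintype.ofFinite (Quotient (MulAction.orbitRel A Y))
  rw [Nat.card_congr (MulAction.selfEquivSigmaOrbitsQuotientStabilizer A Y), Nat.card_sigma,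
    Finset.mul_sum]
  refine Finset.dvd_sum fun ω _ => ?_
  rw [← h ω.out]
  exact (Subgroup.card_mul_index _).symm.dvd

/-- An action in which every nontrivial element fixes one point or two points, the first case
being that of the elements of the "unipotent radicals" `U x` of the point stabilizers. -/
structure IsPolarAction (H X : Type*) [Group H] [MulAction H X] (U : X → Subgroup H) : Prop where
  le_stabilizer : ∀ x, U x ≤ MulAction.stabilizer H x
  conj_mem : ∀ (g : H) (x : X), ∀ u ∈ U x, g * u * g⁻¹ ∈ U (g • x)
  card_fixedBy_one : ∀ h : H, h ≠ 1 → ∀ x, h ∈ U x → Nat.card (MulAction.fixedBy X h) = 1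
  card_fixedBy_two : ∀ h : H, h ≠ 1 → (∀ x, h ∉ U x) → Nat.card (MulAction.fixedBy X h) = 2
  comm_iff : ∀ (x : X) (u h : H), u ∈ U x → u ≠ 1 → h • x = x → (h * u = u * h ↔ h ∈ U x)

namespace IsPolarAction

open MulAction

variable {H X : Type*} [Group H] [MulAction H X] {U : X → Subgroup H}

theorem restrict (hU : IsPolarAction H X U) (K : Subgroup H) :
    IsPolarAction K X (fun x => (U x).subgroupOf K) where
  le_stabilizer x k hk := hU.le_stabilizer x hk
  conj_mem g x u hu := hU.conj_mem g x u hu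
  card_fixedBy_one h h1 x hx := hU.card_fixedBy_one h (fun e => h1 (Subtype.ext e)) x hx
  card_fixedBy_two h h1 hx := hU.card_fixedBy_two h (fun e => h1 (Subtype.ext e)) hx
  comm_iff x u h hu h1 hx := by
    have := hU.comm_iff x u h hu (fun e => h1 (Subtype.ext e)) hx
    rw [Subgroup.mem_subgroupOf, ← this, Subtype.ext_iff]
    rfl

theorem eq_of_smul_eq (hU : IsPolarAction H X U) {x y : X} {u : H} (hu : u ∈ U x) (h1 : u ≠ 1)
    (hy : u • y = y) : y = x := by
  have h := hU.card_fixedBy_one u h1 x hu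
  have : Subsingleton (fixedBy X u) := (Nat.card_eq_one_iff_unique.1 h).1
  exact congrArg Subtype.val
    (Subsingleton.elim (⟨y, hy⟩ : fixedBy X u) ⟨x, hU.le_stabilizer x hu⟩)

theorem card_eq_of_smul (hU : IsPolarAction H X U) [Finite H] (g : H) (x : X) :
    Nat.card (U (g • x)) = Nat.card (U x) := by
  refine le_antisymm ?_ ?_
  · refine Nat.card_le_card_of_injective
      (fun u : U (g • x) => (⟨g⁻¹ * u * g, by
        have := hU.conj_mem g⁻¹ (g • x) u u.2
        rwa [inv_smul_smul, inv_inv] at this⟩ : U x)) fun u v huv => ?_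
    have := congrArg Subtype.val huv
    exact Subtype.ext (by simpa using this)
  · refine Nat.card_le_card_of_injective
      (fun u : U x => (⟨g * u * g⁻¹, hU.conj_mem g x u u.2⟩ : U (g • x))) fun u v huv => ?_
    have := congrArg Subtype.val huv
    exact Subtype.ext (by simpa using this)

theorem card_dvd_stabilizer (hU : IsPolarAction H X U) (x : X) :
    Nat.card (U x) ∣ Nat.card (stabilizer H x) := Subgroup.card_dvd_of_le (hU.le_stabilizer x)

/-- The stabilizer of `x` acts by conjugation on the nontrivial elements of `U x`, and the
centralizer condition says that every stabilizer of this action is `U x` itself. -/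
theorem card_stabilizer_dvd [Finite H] (hU : IsPolarAction H X U) (x : X) :
    Nat.card (stabilizer H x) ∣ Nat.card (U x) * (Nat.card (U x) - 1) := by
  let Y := {u : H // u ∈ U x ∧ u ≠ 1}
  let act : MulAction (stabilizer H x) Y :=
    { smul := fun h u => ⟨h * u * (h : H)⁻¹, by
        have := hU.conj_mem h x u u.2.1
        rwa [show (h : H) • x = x from h.2] at this, by
        intro e
        apply u.2.2
        rwa [mul_inv_eq_one, mul_eq_left] at e⟩
      one_smul := fun u => Subtype.ext (by change (1 : H) * u * (1 : H)⁻¹ = u; simp)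
      mul_smul := fun a b u => Subtype.ext (by
        change ((a * b : H)) * u * ((a * b : H))⁻¹ = a * (b * u * (b : H)⁻¹) * (a : H)⁻¹
        group) }
  have hs : ∀ y : Y, Nat.card (stabilizer (stabilizer H x) y) = Nat.card (U x) := by
    intro y
    have : stabilizer (stabilizer H x) y = (U x).subgroupOf (stabilizer H x) := by
      ext h
      rw [Subgroup.mem_subgroupOf, ← hU.comm_iff x y h y.2.1 y.2.2 h.2, mem_stabilizer_iff,
        Subtype.ext_iff]
      change (h : H) * y * (h : H)⁻¹ = y ↔ _
      rw [mul_inv_eq_iff_eq_mul]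
    rw [this]
    exact Nat.card_congr (Subgroup.subgroupOfEquivOfLe (hU.le_stabilizer x)).toEquiv
  have hY : Nat.card Y = Nat.card (U x) - 1 := by
    have e : Y ≃ {u : U x // u ≠ 1} :=
      { toFun := fun u => ⟨⟨u, u.2.1⟩, fun e => u.2.2 (congrArg Subtype.val e)⟩
        invFun := fun u => ⟨u.1, u.1.2, fun e => u.2 (Subtype.ext e)⟩
        left_inv := fun u => rfl
        right_inv := fun u => rfl }
    classical
    have := Fintype.ofFinite (U x)
    rw [Nat.card_congr e, Nat.card_eq_fintype_card, Nat.card_eq_fintype_card,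
      Fintype.card_subtype_compl, Fintype.card_subtype_eq]
  rw [← hY]
  -- All orbits on the `|U x| - 1` nontrivial elements have the same size `|H_x| / |U x|`.
  exact card_dvd_mul_card_of_card_stabilizer hs

theorem smul_injective (hU : IsPolarAction H X U) {x y : X} (hy : y ≠ x) :
    Function.Injective fun u : U x => (u : H) • y := by
  intro u v huv
  by_contra hne
  refine hy (hU.eq_of_smul_eq (x := x) (u := (v : H)⁻¹ * u) ((U x).mul_mem ((U x).inv_mem v.2) u.2)
    (fun e => hne (Subtype.ext ?_)) ?_)
  · rw [inv_mul_eq_one] at e; exact e.symm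
  · rw [mul_smul]
    exact inv_smul_eq_iff.2 huv

/-- A nontrivial element of `U x` fixes only `x`, so `U x` acts freely on the rest of the orbit. -/
theorem card_dvd_orbit_sub_one [Finite H] [Finite X] (hU : IsPolarAction H X U) (x : X) :
    Nat.card (U x) ∣ Nat.card (orbit H x) - 1 := by
  let Y := {y : X // y ∈ orbit H x ∧ y ≠ x}
  let act : MulAction (U x) Y :=
    { smul := fun h y => ⟨(h : H) • (y : X), mem_orbit_of_mem_orbit _ y.2.1, fun e => y.2.2
        (MulAction.injective (h : H) (e.trans (hU.le_stabilizer x h.2 : (h : H) • x = x).symm))⟩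
      one_smul := fun y => Subtype.ext (one_smul H (y : X))
      mul_smul := fun a b y => Subtype.ext (mul_smul (a : H) (b : H) (y : X)) }
  have hs : ∀ y : Y, Nat.card (stabilizer (U x) y) = 1 := by
    intro y
    rw [Subgroup.card_eq_one, eq_bot_iff]
    intro u hu
    have h1 : (u : H) • (y : X) = y := congrArg Subtype.val hu
    exact hU.smul_injective y.2.2 (a₁ := u) (a₂ := 1) (by simpa using h1)
  have hY : Nat.card Y = Nat.card (orbit H x) - 1 := by
    have e : Y ≃ {u : orbit H x // u ≠ ⟨x, mem_orbit_self x⟩} :=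
      { toFun := fun u => ⟨⟨u, u.2.1⟩, fun e => u.2.2 (congrArg Subtype.val e)⟩
        invFun := fun u => ⟨u.1, u.1.2, fun e => u.2 (Subtype.ext e)⟩
        left_inv := fun u => rfl
        right_inv := fun u => rfl }
    classical
    have := Fintype.ofFinite (orbit H x)
    rw [Nat.card_congr e, Nat.card_eq_fintype_card, Nat.card_eq_fintype_card,
      Fintype.card_subtype_compl, Fintype.card_subtype_eq]
  rw [← hY]
  have := card_dvd_mul_card_of_card_stabilizer hs
  rwa [one_mul] at this

/-- A free action of `U x` on a set of `|U x|` points is regular; this later identifies the orbit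
with infinity together with an additive group. -/
theorem exists_smul_eq_of_card_orbit [Finite H] [Finite X] (hU : IsPolarAction H X U) {x y : X}
    (ho : Nat.card (orbit H x) = Nat.card (U x) + 1) (hy : y ∈ orbit H x) (hyx : y ≠ x) {z : X}
    (hz : z ∈ orbit H x) (hzx : z ≠ x) : ∃ u ∈ U x, u • y = z := by
  let Y := {y : X // y ∈ orbit H x ∧ y ≠ x}
  have hY : Nat.card Y = Nat.card (U x) := by
    have e : Y ≃ {u : orbit H x // u ≠ ⟨x, mem_orbit_self x⟩} :=
      { toFun := fun u => ⟨⟨u, u.2.1⟩, fun e => u.2.2 (congrArg Subtype.val e)⟩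
        invFun := fun u => ⟨u.1, u.1.2, fun e => u.2 (Subtype.ext e)⟩
        left_inv := fun u => rfl
        right_inv := fun u => rfl }
    classical
    have := Fintype.ofFinite (orbit H x)
    have h1 : Nat.card Y = Nat.card (orbit H x) - 1 := by
      rw [Nat.card_congr e, Nat.card_eq_fintype_card, Nat.card_eq_fintype_card,
        Fintype.card_subtype_compl, Fintype.card_subtype_eq]
    omega
  let f : U x → Y := fun u => ⟨(u : H) • y, mem_orbit_of_mem_orbit _ hy, fun e => hyx
    (MulAction.injective (u : H) (e.trans (hU.le_stabilizer x u.2 : (u : H) • x = x).symm))⟩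
  have hf : Function.Injective f := fun u v huv =>
    hU.smul_injective hyx (congrArg Subtype.val huv)
  have hb := hf.bijective_of_nat_card_le hY.le
  obtain ⟨u, hu⟩ := hb.2 ⟨z, hz, hzx⟩
  exact ⟨u, u.2, congrArg Subtype.val hu⟩

/-- Double counting of pairs `(h, x)` with `h ≠ 1`, where a pair with `h` in `U x` counts twice:
every nontrivial `h` then has total weight 2, from two fixed points or from a doubled single one.
The `-2` removes the identity from both groups. -/
theorem sum_card [Fintype H] [Fintype X] (hU : IsPolarAction H X U) :
    ∑ x : X, ((Nat.card (stabilizer H x) : ℤ) + Nat.card (U x) - 2) = 2 * (Nat.card H - 1) := by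
  classical
  have h1 : ∀ x : X, ((Nat.card (stabilizer H x) : ℤ) + Nat.card (U x) - 2) =
      ∑ h ∈ Finset.univ.erase (1 : H), ((if h • x = x then 1 else 0) + if h ∈ U x then 1 else 0) := by
    intro x
    have ha : (Nat.card (stabilizer H x) : ℤ) = ∑ h : H, if h • x = x then 1 else 0 := by
      rw [Finset.sum_boole, ← Fintype.card_subtype, ← Nat.card_eq_fintype_card]
      rfl
    have hb : (Nat.card (U x) : ℤ) = ∑ h : H, if h ∈ U x then 1 else 0 := by
      rw [Finset.sum_boole, ← Fintype.card_subtype, ← Nat.card_eq_fintype_card]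
    rw [ha, hb, ← Finset.sum_add_distrib, ← Finset.add_sum_erase _ _ (Finset.mem_univ (1 : H))]
    simp [(U x).one_mem]
  have h2 : ∀ h ∈ Finset.univ.erase (1 : H),
      ∑ x : X, (((if h • x = x then 1 else 0) + if h ∈ U x then 1 else 0) : ℤ) = 2 := by
    intro h hh
    have hne : h ≠ 1 := Finset.ne_of_mem_erase hh
    have ha : ∑ x : X, (if h • x = x then 1 else 0 : ℤ) = Nat.card (fixedBy X h) := by
      rw [Finset.sum_boole, ← Fintype.card_subtype, ← Nat.card_eq_fintype_card]
      rfl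
    rw [Finset.sum_add_distrib, ha]
    by_cases hx : ∃ x, h ∈ U x
    · obtain ⟨x, hx⟩ := hx
      rw [hU.card_fixedBy_one h hne x hx, Finset.sum_eq_single x]
      · simp [hx]
      · intro y _ hy
        refine if_neg fun hhy => hy (hU.eq_of_smul_eq hx hne (hU.le_stabilizer y hhy))
      · simp
    · push Not at hx
      rw [hU.card_fixedBy_two h hne hx]
      simp [hx]
  rw [Finset.sum_congr rfl fun x _ => h1 x, Finset.sum_comm, Finset.sum_congr rfl h2,
    Finset.sum_const, Finset.card_erase_of_mem (Finset.mem_univ _), Finset.card_univ,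
    Nat.card_eq_fintype_card, nsmul_eq_mul, Nat.cast_sub Fintype.card_pos]
  push_cast
  ring

theorem card_orbit_mul_card_stabilizer [Finite H] (x : X) :
    Nat.card (orbit H x) * Nat.card (stabilizer H x) = Nat.card H := by
  rw [Nat.card_congr (orbitEquivQuotientStabilizer H x)]
  exact (Subgroup.card_eq_card_quotient_mul_card_subgroup _).symm

theorem sum_orbits [Finite H] [Finite X] (hU : IsPolarAction H X U)
    [Fintype (Quotient (orbitRel H X))] :
    ∑ ω : Quotient (orbitRel H X), (Nat.card (orbit H ω.out) : ℤ) *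
      ((Nat.card (stabilizer H ω.out) : ℤ) + Nat.card (U ω.out) - 2) = 2 * (Nat.card H - 1) := by
  classical
  have := Fintype.ofFinite H
  have := Fintype.ofFinite X
  rw [← hU.sum_card]
  symm
  rw [← (selfEquivSigmaOrbits H X).symm.sum_comp, Fintype.sum_sigma]
  refine Finset.sum_congr rfl fun ω _ => ?_
  rw [Nat.card_eq_fintype_card, ← Finset.card_univ, ← nsmul_eq_mul]
  refine Finset.sum_eq_card_nsmul ?_
  rintro ⟨y, hy⟩ -
  obtain ⟨g, rfl⟩ := hy
  have h1 : (selfEquivSigmaOrbits H X).symm ⟨ω, ⟨g • ω.out, ⟨g, rfl⟩⟩⟩ = g • ω.out := rfl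
  dsimp only
  rw [h1, hU.card_eq_of_smul, stabilizer_smul_eq_stabilizer_map_conj,
    Subgroup.card_map_of_injective (MulEquiv.injective _)]

end IsPolarAction

/-! ### Numerical solutions of the class equation -/

/-- Two exceptional orbits, only the first with unipotents. There `|U x| = a + 2`, the stabilizer
has order `(a + 2) * t`, and the length `f` is 1 modulo `a + 2`; `n'` is the order of the other
stabilizers. The outcomes are a fixed point, a dihedral group, an orbit of `PGL₂` or `PSL₂` type,
and the order 60 occurring in characteristic 3. -/
theorem orbit_numerics_of_unipotent {f a t j m n' : ℤ} (ha : 0 ≤ a) (ht : 1 ≤ t) (hm : 0 ≤ m)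
    (hn' : 1 ≤ n') (htj : t * j = a + 1) (hf : f = 1 + (a + 2) * m)
    (h : (f * a + 2) * n' = f * (a + 2) * t) :
    m = 0 ∨ (a = 0 ∧ t = 1 ∧ n' = f) ∨ (0 < a ∧ f = a + 3 ∧ (t = a + 1 ∨ 2 * t = a + 1)) ∨
      (a = 1 ∧ t = 2 ∧ f = 10) := by
  rcases hm.eq_or_lt with hm | hm
  · exact Or.inl hm.symm
  right
  have hj : 1 ≤ j := by
    by_contra hj
    nlinarith
  rcases ha.eq_or_lt with ha | ha
  · left
    subst ha
    have ht1 : t = 1 := by nlinarith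
    subst ht1
    exact ⟨rfl, rfl, by linarith⟩
  right
  have hf1 : a + 3 ≤ f := by nlinarith
  -- With this `c` the equation reads `f * c = 2 * n'`, and eliminating `n'` gives `c * (2 + f * a)
  -- = 2 * (a + 2) * t`. The size of the right side forces `c` to be 1 or 2.
  set c : ℤ := (a + 2) * t - a * n' with hc
  have hfc : f * c = 2 * n' := by rw [hc]; linarith
  have hc2 : c * (2 + f * a) = 2 * (a + 2) * t := by
    have : c * (2 + f * a) = 2 * c + a * (f * c) := by ring
    rw [this, hfc, hc]; ring
  have hc0 : 1 ≤ c := by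
    by_contra hc0
    nlinarith
  have hta : t ≤ a + 1 := by nlinarith
  have hlow : (a + 1) * (a + 2) ≤ 2 + f * a := by nlinarith
  have hup : (a + 2) * t ≤ 2 + f * a := by nlinarith
  have hcle : c ≤ 2 := by
    by_contra hcle
    have h3 : 3 ≤ c := by omega
    have h5 : 0 < (a + 2) * t := by positivity
    have h4 : 3 * (2 + f * a) ≤ c * (2 + f * a) := mul_le_mul_of_nonneg_right h3 (by linarith)
    linarith
  have hc12 : c = 1 ∨ c = 2 := by omega
  rcases hc12 with h1 | h2
  · rw [h1] at hc2
    have h3 : 1 + m * a = 2 * t := by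
      have : (a + 2) * (1 + m * a) = (a + 2) * (2 * t) := by
        rw [hf] at hc2; linarith
      exact mul_left_cancel₀ (by omega) this
    have hj2 : j ≤ 2 := by
      by_contra hj2
      have : 3 ≤ j := by omega
      have h4 : t * 3 ≤ a + 1 := by nlinarith
      nlinarith
    have hj12 : j = 1 ∨ j = 2 := by omega
    rcases hj12 with rfl | rfl
    · right
      have h5 : a * (m - 2) = 1 := by linarith
      have ha1 : a = 1 := by
        rcases Int.mul_eq_one_iff_eq_one_or_neg_one.1 h5 with h | h <;> omega
      subst ha1
      have : m = 3 := by omega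
      subst this
      exact ⟨rfl, by omega, by omega⟩
    · left
      have h5 : a * m = a * 1 := by linarith
      have hm1 : m = 1 := mul_left_cancel₀ ha.ne' h5
      subst hm1
      exact ⟨ha, by omega, Or.inr (by omega)⟩
  · left
    rw [h2] at hc2
    have h3 : 2 + f * a = (a + 2) * t := by linarith
    have h4 : (a + 2) * t ≤ (a + 2) * (a + 1) := by nlinarith
    have h5 : 2 + f * a = (a + 2) * (a + 1) := by linarith
    have h6 : a * f = a * (a + 3) := by linarith
    have hf3 : f = a + 3 := mul_left_cancel₀ ha.ne' h6
    refine ⟨ha, hf3, Or.inl ?_⟩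
    have : (a + 2) * t = (a + 2) * (a + 1) := by linarith
    exact mul_left_cancel₀ (by omega) this

/-- This is the equation `1/n₁ + 1/n₂ + 1/n₃ = 1 + 2/g` of the finite rotation groups: dihedral, or
`(2, 3, 3)`, `(2, 3, 4)`, `(2, 3, 5)`. -/
theorem orbit_numerics_three_of_le {f₁ f₂ f₃ n₁ n₂ n₃ g : ℤ} (h₁ : f₁ * n₁ = g) (h₂ : f₂ * n₂ = g)
    (h₃ : f₃ * n₃ = g) (hf₁ : 1 ≤ f₁) (hf₂ : 1 ≤ f₂) (hf₃ : 1 ≤ f₃) (hn₁ : 2 ≤ n₁) (hn₂ : 2 ≤ n₂)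
    (hn₃ : 2 ≤ n₃) (hs : f₁ + f₂ + f₃ = g + 2) (h12 : f₂ ≤ f₁) (h23 : f₃ ≤ f₂) :
    (2 * n₃ = g) ∨
    (n₁ = 2 ∧ n₂ = 3 ∧ ((g = 12 ∧ n₃ = 3) ∨ (g = 24 ∧ n₃ = 4) ∨ (g = 60 ∧ n₃ = 5))) := by
  have hn1 : n₁ = 2 := by
    by_contra h
    have : 3 ≤ n₁ := by omega
    nlinarith
  subst hn1
  have hn2 : n₂ ≤ 3 := by
    by_contra h
    have : 4 ≤ n₂ := by omega
    nlinarith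
  have hn2' : n₂ = 2 ∨ n₂ = 3 := by omega
  rcases hn2' with rfl | rfl
  · left
    have : f₃ = 2 := by omega
    subst this
    exact h₃
  · right
    have hn3 : n₃ ≤ 5 := by
      by_contra h
      have : 6 ≤ n₃ := by omega
      nlinarith
    have hn3' : n₃ = 2 ∨ n₃ = 3 ∨ n₃ = 4 ∨ n₃ = 5 := by omega
    refine ⟨rfl, rfl, ?_⟩
    rcases hn3' with rfl | rfl | rfl | rfl <;> omega

/-! ### Classification of the finite groups with such an action -/

namespace IsPolarAction

open MulAction

variable {H X : Type*} [Group H] [MulAction H X] {U : X → Subgroup H}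

/-- Only the order and the orders of the point stabilizers of the rotation groups of the regular
polyhedra. -/
def IsPolyhedral (H X : Type*) [Group H] [MulAction H X] : Prop :=
  (Nat.card H = 12 ∧ ∀ x : X, Nat.card (stabilizer H x) ≤ 3) ∨
  (Nat.card H = 24 ∧ ∀ x : X, Nat.card (stabilizer H x) ≤ 4) ∨
  (Nat.card H = 60 ∧ ∀ x : X, Nat.card (stabilizer H x) ≤ 5 ∧ Nat.card (stabilizer H x) ≠ 4)

theorem card_stabilizer_out [Finite H] (x : X) :
    Nat.card (stabilizer H (Quotient.out (⟦x⟧ : Quotient (orbitRel H X)))) =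
      Nat.card (stabilizer H x) := by
  obtain ⟨g, hg⟩ := (orbitRel_apply.1 (Quotient.mk_out (s := orbitRel H X) x))
  rw [← hg]
  dsimp only
  rw [stabilizer_smul_eq_stabilizer_map_conj,
    Subgroup.card_map_of_injective (MulEquiv.injective _)]

theorem card_out (hU : IsPolarAction H X U) [Finite H] (x : X) :
    Nat.card (U (Quotient.out (⟦x⟧ : Quotient (orbitRel H X)))) = Nat.card (U x) := by
  obtain ⟨g, hg⟩ := (orbitRel_apply.1 (Quotient.mk_out (s := orbitRel H X) x))
  rw [← hg]
  exact hU.card_eq_of_smul g x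

/-- The contributions of the orbits to the class equation add up to `2 * (|H| - 1)`. An orbit with
nontrivial stabilizers contributes at least `|H| / 2`, and at least `|H|` if it carries unipotents,
so at most three such orbits occur and at most one of them has unipotents. The remaining cases are
numerical. -/
theorem classification [Finite H] [Finite X] (hU : IsPolarAction H X U) (hH : 1 < Nat.card H) :
    (∃ x : X, ∀ h : H, h • x = x) ∨
    (∃ x : X, 2 * Nat.card (stabilizer H x) = Nat.card H ∧ 2 ≤ Nat.card (stabilizer H x) ∧
      U x = ⊥) ∨
    ((∀ x, U x = ⊥) ∧ IsPolyhedral H X) ∨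
    (∃ x : X, 3 ≤ Nat.card (U x) ∧ Nat.card (orbit H x) = Nat.card (U x) + 1 ∧
      (Nat.card (stabilizer H x) = Nat.card (U x) * (Nat.card (U x) - 1) ∨
        2 * Nat.card (stabilizer H x) = Nat.card (U x) * (Nat.card (U x) - 1))) ∨
    (∃ x : X, Nat.card (U x) = 3 ∧ Nat.card H = 60) := by
  classical
  have := Fintype.ofFinite (Quotient (orbitRel H X))
  set g := Nat.card H with hg
  let n : Quotient (orbitRel H X) → ℕ := fun ω => Nat.card (stabilizer H ω.out)
  let Q : Quotient (orbitRel H X) → ℕ := fun ω => Nat.card (U ω.out)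
  let f : Quotient (orbitRel H X) → ℕ := fun ω => Nat.card (orbit H ω.out)
  have hfn : ∀ ω, f ω * n ω = g := fun ω => card_orbit_mul_card_stabilizer _
  have hn0 : ∀ ω, 1 ≤ n ω := fun ω => Nat.card_pos
  have hQ0 : ∀ ω, 1 ≤ Q ω := fun ω => Nat.card_pos
  have hf0 : ∀ ω, 1 ≤ f ω := fun ω =>
    Nat.pos_of_ne_zero fun h => by have := hfn ω; rw [h, zero_mul] at this; omega
  have hQn : ∀ ω, Q ω ∣ n ω := fun ω => hU.card_dvd_stabilizer _
  have hfix : ∀ ω, f ω = 1 → ∃ x : X, ∀ h : H, h • x = x := by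
    intro ω h
    refine ⟨ω.out, fun a => ?_⟩
    have h1 : n ω = g := by have := hfn ω; rwa [h, one_mul] at this
    have h2 : stabilizer H ω.out = ⊤ := Subgroup.eq_top_of_card_eq _ h1
    exact (h2 ▸ Subgroup.mem_top a : a ∈ stabilizer H ω.out)
  -- The contribution of an orbit: it is `g - f` without unipotents and `g + f * (Q - 2)` in
  -- general.
  let T : Quotient (orbitRel H X) → ℤ := fun ω => (f ω : ℤ) * ((n ω : ℤ) + Q ω - 2)
  have hsum : ∑ ω, T ω = 2 * ((g : ℤ) - 1) := hU.sum_orbits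
  have hfnZ : ∀ ω, (f ω : ℤ) * n ω = g := fun ω => by exact_mod_cast hfn ω
  have hT1 : ∀ ω, Q ω = 1 → T ω = g - f ω := fun ω h => by
    simp only [T, h]; rw [← hfnZ ω]; push_cast; ring
  have hT2 : ∀ ω, T ω = g + f ω * ((Q ω : ℤ) - 2) := fun ω => by
    simp only [T]; rw [← hfnZ ω]; ring
  have hTg : ∀ ω, 2 ≤ Q ω → (g : ℤ) ≤ T ω := fun ω h => by
    rw [hT2]
    have : (0 : ℤ) ≤ f ω * ((Q ω : ℤ) - 2) := mul_nonneg (by positivity) (by omega)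
    linarith
  have hTh : ∀ ω, n ω ≠ 1 → (g : ℤ) ≤ 2 * T ω := fun ω h => by
    by_cases hq : Q ω = 1
    · rw [hT1 ω hq]
      have h1 : (2 : ℤ) ≤ n ω := by have := hn0 ω; omega
      have h2 := hfnZ ω
      nlinarith [hf0 ω]
    · have := hTg ω (by have := hQ0 ω; omega)
      omega
  set S := Finset.univ.filter fun ω => n ω ≠ 1 with hS
  have hmem : ∀ ω, ω ∈ S ↔ n ω ≠ 1 := fun ω => by simp [hS]
  have hsumS : ∑ ω ∈ S, T ω = 2 * ((g : ℤ) - 1) := by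
    rw [← hsum]
    refine Finset.sum_subset (Finset.subset_univ _) fun ω _ hω => ?_
    have h1 : n ω = 1 := by by_contra h; exact hω ((hmem ω).2 h)
    have h2 : Q ω = 1 := Nat.dvd_one.1 (h1 ▸ hQn ω)
    simp [T, h1, h2]
  have hScard : S.card ≤ 3 := by
    by_contra h
    have h1 : ∑ ω ∈ S, (g : ℤ) ≤ ∑ ω ∈ S, 2 * T ω :=
      Finset.sum_le_sum fun ω hω => hTh ω ((hmem ω).1 hω)
    rw [← Finset.mul_sum, hsumS, Finset.sum_const, nsmul_eq_mul] at h1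
    have h2 : (4 : ℤ) ≤ S.card := by omega
    nlinarith
  -- The equation with one unipotent and one semisimple orbit. Here `a = Q - 2`, `t` is the index of
  -- `U` in the stabilizer, and `m` counts the free orbits of `U` off its fixed point.
  have hlie : ∀ ω₁ ω₂, 2 ≤ Q ω₁ → Q ω₂ = 1 → 2 ≤ n ω₂ → T ω₁ + T ω₂ = 2 * ((g : ℤ) - 1) →
      (f ω₁ = 1) ∨ (2 * n ω₂ = g ∧ Q ω₂ = 1) ∨ (3 ≤ Q ω₁ ∧ f ω₁ = Q ω₁ + 1 ∧
        (n ω₁ = Q ω₁ * (Q ω₁ - 1) ∨ 2 * n ω₁ = Q ω₁ * (Q ω₁ - 1))) ∨ (Q ω₁ = 3 ∧ g = 60) := by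
    intro ω₁ ω₂ hq1 hq2 hn2 hT
    obtain ⟨a, ha⟩ : ∃ a, Q ω₁ = a + 2 := ⟨Q ω₁ - 2, by omega⟩
    obtain ⟨t, ht⟩ := hQn ω₁
    have htpos : 1 ≤ t := Nat.pos_of_ne_zero fun h => by
      have := hn0 ω₁; rw [ht, h, mul_zero] at this; omega
    obtain ⟨j, hj⟩ : t ∣ a + 1 := by
      have h1 : n ω₁ ∣ Q ω₁ * (Q ω₁ - 1) := hU.card_stabilizer_dvd _
      rw [ht] at h1
      have h2 := Nat.dvd_of_mul_dvd_mul_left (hQ0 ω₁) h1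
      rwa [ha] at h2
    obtain ⟨m, hm⟩ : Q ω₁ ∣ f ω₁ - 1 := hU.card_dvd_orbit_sub_one _
    have hm' : f ω₁ = 1 + (a + 2) * m := by
      have := hf0 ω₁
      rw [← ha, ← hm]; omega
    rw [hT1 ω₂ hq2, hT2 ω₁, ha] at hT
    have hf2 : (f ω₂ : ℤ) = f ω₁ * a + 2 := by push_cast at hT; linarith
    have hg2 : (g : ℤ) = f ω₁ * (a + 2) * t := by
      rw [← hfnZ ω₁, ht, ha]; push_cast; ring
    have key := orbit_numerics_of_unipotent (f := f ω₁) (a := a) (t := t) (j := j) (m := m)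
      (n' := n ω₂) (by positivity) (by exact_mod_cast htpos) (by positivity)
      (by have := hn0 ω₂; exact_mod_cast this) (by exact_mod_cast hj.symm)
      (by exact_mod_cast hm') (by rw [← hf2, ← hg2, hfnZ ω₂])
    rcases key with h | ⟨h1, h2, h3⟩ | ⟨h0, h1, h2⟩ | ⟨h1, h2, h3⟩
    · left
      have : m = 0 := by exact_mod_cast h
      rw [hm', this, mul_zero, add_zero]
    · right; left
      refine ⟨?_, hq2⟩
      have : (2 * n ω₂ : ℤ) = g := by rw [hg2, h1, h2, h3]; ring
      exact_mod_cast this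
    · right; right
      left
      refine ⟨by omega, by omega, ?_⟩
      have hQ1 : Q ω₁ - 1 = a + 1 := by omega
      rw [hQ1, ht]
      rcases h2 with h2 | h2
      · left
        have : t = a + 1 := by exact_mod_cast h2
        rw [this]
      · right
        have : 2 * t = a + 1 := by exact_mod_cast h2
        rw [← this]; ring
    · right; right; right
      have h1' : a = 1 := by exact_mod_cast h1
      refine ⟨by omega, ?_⟩
      have : (g : ℤ) = 60 := by rw [hg2, h1, h2, h3]; norm_num
      exact_mod_cast this
  have hUbot : ∀ ω, Q ω = 1 → U ω.out = ⊥ := fun ω h => Subgroup.card_eq_one.1 h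
  have hcase : ∀ ω₁ ω₂, 2 ≤ Q ω₁ → Q ω₂ = 1 → 2 ≤ n ω₂ → T ω₁ + T ω₂ = 2 * ((g : ℤ) - 1) →
      ((∃ x : X, ∀ h : H, h • x = x) ∨
      (∃ x : X, 2 * Nat.card (stabilizer H x) = g ∧ 2 ≤ Nat.card (stabilizer H x) ∧ U x = ⊥) ∨
      ((∀ x, U x = ⊥) ∧ IsPolyhedral H X) ∨
      (∃ x : X, 3 ≤ Nat.card (U x) ∧ Nat.card (orbit H x) = Nat.card (U x) + 1 ∧
        (Nat.card (stabilizer H x) = Nat.card (U x) * (Nat.card (U x) - 1) ∨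
          2 * Nat.card (stabilizer H x) = Nat.card (U x) * (Nat.card (U x) - 1))) ∨
      (∃ x : X, Nat.card (U x) = 3 ∧ g = 60)) :=
    fun ω₁ ω₂ a b c d => by
      rcases hlie ω₁ ω₂ a b c d with h | ⟨h1, h2⟩ | h | h
      · exact Or.inl (hfix ω₁ h)
      · exact Or.inr (Or.inl ⟨ω₂.out, h1, c, hUbot ω₂ h2⟩)
      · exact Or.inr (Or.inr (Or.inr (Or.inl ⟨ω₁.out, h⟩)))
      · exact Or.inr (Or.inr (Or.inr (Or.inr ⟨ω₁.out, h⟩)))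
  have hgZ : (2 : ℤ) ≤ g := by exact_mod_cast hH
  have hn2 : ∀ ω ∈ S, 2 ≤ n ω := fun ω h => by
    have h1 := hn0 ω
    have h2 := (hmem ω).1 h
    omega
  have hScases : S.card = 0 ∨ S.card = 1 ∨ S.card = 2 ∨ S.card = 3 := by omega
  rcases hScases with h | h | h | h
  · rw [Finset.card_eq_zero.1 h, Finset.sum_empty] at hsumS
    omega
  · obtain ⟨ω, hω⟩ := Finset.card_eq_one.1 h
    rw [hω, Finset.sum_singleton] at hsumS
    by_cases hq : Q ω = 1
    · rw [hT1 ω hq] at hsumS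
      have := hf0 ω
      omega
    · left
      apply hfix ω
      have hq2 : 2 ≤ Q ω := by have := hQ0 ω; omega
      rw [hT2] at hsumS
      obtain ⟨t, ht⟩ := hQn ω
      have htpos : 1 ≤ t := Nat.pos_of_ne_zero fun h => by
        have := hn0 ω; rw [ht, h, mul_zero] at this; omega
      have h1 := hfnZ ω
      rw [ht] at h1
      push_cast at h1
      have h2 := hf0 ω
      by_contra hne
      have h3 : (2 : ℤ) ≤ f ω := by omega
      have h4 : (2 : ℤ) ≤ Q ω := by omega
      have h5 : (1 : ℤ) ≤ t := by omega
      nlinarith [mul_nonneg (mul_nonneg (by linarith : (0:ℤ) ≤ f ω) (by linarith : (0:ℤ) ≤ Q ω))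
        (by linarith : (0:ℤ) ≤ (t : ℤ) - 1)]
  · obtain ⟨ω₁, ω₂, hne, hω⟩ := Finset.card_eq_two.1 h
    rw [hω, Finset.sum_pair hne] at hsumS
    have hn1 := hn2 ω₁ (by rw [hω]; simp)
    have hn2 := hn2 ω₂ (by rw [hω]; simp)
    by_cases hq1 : Q ω₁ = 1
    · by_cases hq2 : Q ω₂ = 1
      · left
        apply hfix ω₁
        rw [hT1 _ hq1, hT1 _ hq2] at hsumS
        have := hf0 ω₁
        have := hf0 ω₂
        omega
      · exact hcase ω₂ ω₁ (by have := hQ0 ω₂; omega) hq1 hn1 (by rw [add_comm]; exact hsumS)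
    · by_cases hq2 : Q ω₂ = 1
      · exact hcase ω₁ ω₂ (by have := hQ0 ω₁; omega) hq2 hn2 hsumS
      · exfalso
        have := hTg ω₁ (by have := hQ0 ω₁; omega)
        have := hTg ω₂ (by have := hQ0 ω₂; omega)
        omega
  · obtain ⟨ω₁, ω₂, ω₃, h12, h13, h23, hω⟩ := Finset.card_eq_three.1 h
    have hsum3 : T ω₁ + T ω₂ + T ω₃ = 2 * ((g : ℤ) - 1) := by
      rw [← hsumS, hω, Finset.sum_insert (by simp [h12, h13]), Finset.sum_pair h23]; ring
    have hn1' := hn2 ω₁ (by rw [hω]; simp)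
    have hn2' := hn2 ω₂ (by rw [hω]; simp)
    have hn3' := hn2 ω₃ (by rw [hω]; simp)
    have hle1 := hTh ω₁ (by omega)
    have hle2 := hTh ω₂ (by omega)
    have hle3 := hTh ω₃ (by omega)
    have hq1 : Q ω₁ = 1 := by
      by_contra hq
      have := hTg ω₁ (by have := hQ0 ω₁; omega)
      omega
    have hq2 : Q ω₂ = 1 := by
      by_contra hq
      have := hTg ω₂ (by have := hQ0 ω₂; omega)
      omega
    have hq3 : Q ω₃ = 1 := by
      by_contra hq
      have := hTg ω₃ (by have := hQ0 ω₃; omega)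
      omega
    have hfs : (f ω₁ : ℤ) + f ω₂ + f ω₃ = g + 2 := by
      rw [hT1 _ hq1, hT1 _ hq2, hT1 _ hq3] at hsum3; omega
    have hnS : ∀ x : X, n ⟦x⟧ = 1 ∨ n ⟦x⟧ = n ω₁ ∨ n ⟦x⟧ = n ω₂ ∨ n ⟦x⟧ = n ω₃ := by
      intro x
      by_cases hx : n ⟦x⟧ = 1
      · exact Or.inl hx
      · have : (⟦x⟧ : Quotient (orbitRel H X)) ∈ S := (hmem _).2 hx
        rw [hω] at this
        simp only [Finset.mem_insert, Finset.mem_singleton] at this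
        rcases this with h | h | h <;> simp [h]
    have hUall : ∀ x : X, U x = ⊥ := by
      intro x
      rw [← Subgroup.card_eq_one, ← hU.card_out x]
      change Q ⟦x⟧ = 1
      by_cases hx : n ⟦x⟧ = 1
      · exact Nat.dvd_one.1 (hx ▸ hQn _)
      · have : (⟦x⟧ : Quotient (orbitRel H X)) ∈ S := (hmem _).2 hx
        rw [hω] at this
        simp only [Finset.mem_insert, Finset.mem_singleton] at this
        rcases this with h | h | h <;> rw [h] <;> assumption
    have main : ∀ α β γ : Quotient (orbitRel H X), 2 ≤ n α → 2 ≤ n β → 2 ≤ n γ → Q γ = 1 →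
        (f α : ℤ) + f β + f γ = g + 2 → f β ≤ f α → f γ ≤ f β →
        (∀ x : X, n ⟦x⟧ = 1 ∨ n ⟦x⟧ = n α ∨ n ⟦x⟧ = n β ∨ n ⟦x⟧ = n γ) →
        (∃ x : X, 2 * Nat.card (stabilizer H x) = g ∧ 2 ≤ Nat.card (stabilizer H x) ∧
          U x = ⊥) ∨ ((∀ x, U x = ⊥) ∧ IsPolyhedral H X) := by
      intro α β γ hα hβ hγ hq hs hαβ hβγ hall
      have hf0 : ∀ ω, (1 : ℤ) ≤ f ω := fun ω => by exact_mod_cast hf0 ω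
      have := orbit_numerics_three_of_le (hfnZ α) (hfnZ β) (hfnZ γ) (hf0 _) (hf0 _) (hf0 _)
        (by exact_mod_cast hα) (by exact_mod_cast hβ) (by exact_mod_cast hγ) hs
        (by exact_mod_cast hαβ) (by exact_mod_cast hβγ)
      rcases this with h | ⟨h1, h2, h⟩
      · left
        exact ⟨γ.out, by exact_mod_cast h, hγ, hUbot _ hq⟩
      · right
        have h1' : n α = 2 := by exact_mod_cast h1
        have h2' : n β = 3 := by exact_mod_cast h2
        have hst : ∀ x : X, n ⟦x⟧ = Nat.card (stabilizer H x) := fun x => card_stabilizer_out x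
        refine ⟨hUall, ?_⟩
        rcases h with ⟨h3, h4⟩ | ⟨h3, h4⟩ | ⟨h3, h4⟩
        · refine Or.inl ⟨by exact_mod_cast h3, fun x => ?_⟩
          rw [← hst]
          have := hall x
          omega
        · refine Or.inr (Or.inl ⟨by exact_mod_cast h3, fun x => ?_⟩)
          rw [← hst]
          have := hall x
          omega
        · refine Or.inr (Or.inr ⟨by exact_mod_cast h3, fun x => ?_⟩)
          rw [← hst]
          have := hall x
          omega
    -- The numerical lemma wants the three orbits in decreasing order of length.
    have fin : (∃ x : X, 2 * Nat.card (stabilizer H x) = g ∧ 2 ≤ Nat.card (stabilizer H x) ∧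
          U x = ⊥) ∨ ((∀ x, U x = ⊥) ∧ IsPolyhedral H X) := by
      rcases le_total (f ω₁) (f ω₂) with a | a <;> rcases le_total (f ω₂) (f ω₃) with b | b <;>
        rcases le_total (f ω₁) (f ω₃) with c | c
      · exact main ω₃ ω₂ ω₁ hn3' hn2' hn1' hq1 (by omega) b a fun x => by have := hnS x; tauto
      · exact main ω₃ ω₂ ω₁ hn3' hn2' hn1' hq1 (by omega) b a fun x => by have := hnS x; tauto
      · exact main ω₂ ω₃ ω₁ hn2' hn3' hn1' hq1 (by omega) b c fun x => by have := hnS x; tauto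
      · exact main ω₂ ω₁ ω₃ hn2' hn1' hn3' hq3 (by omega) a c fun x => by have := hnS x; tauto
      · exact main ω₃ ω₁ ω₂ hn3' hn1' hn2' hq2 (by omega) c a fun x => by have := hnS x; tauto
      · exact main ω₁ ω₃ ω₂ hn1' hn3' hn2' hq2 (by omega) c b fun x => by have := hnS x; tauto
      · exact main ω₁ ω₂ ω₃ hn1' hn2' hn3' hq3 (by omega) a b fun x => by have := hnS x; tauto
      · exact main ω₁ ω₂ ω₃ hn1' hn2' hn3' hq3 (by omega) a b fun x => by have := hnS x; tauto
    rcases fin with h | h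
    · exact Or.inr (Or.inl h)
    · exact Or.inr (Or.inr (Or.inl h))

end IsPolarAction

-- Two-by-two matrices and their eigenvectors

universe u

open Matrix in
theorem exists_mulVec_eq_smul_of_root {K : Type*} [Field K] {A : Matrix (Fin 2) (Fin 2) K} {c : K}
    (hc : c ^ 2 - A.trace * c + A.det = 0) : ∃ v : Fin 2 → K, v ≠ 0 ∧ A *ᵥ v = c • v := by
  have hdet : (A - c • (1 : Matrix (Fin 2) (Fin 2) K)).det = 0 := by
    rw [← hc, det_fin_two, det_fin_two, trace_fin_two]
    simp
    ring
  obtain ⟨v, hv, h⟩ := exists_mulVec_eq_zero_iff.2 hdet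
  refine ⟨v, hv, ?_⟩
  rwa [sub_mulVec, smul_mulVec, one_mulVec, sub_eq_zero] at h

section TwoByTwo

open Matrix

variable {K : Type*} [Field K]

/-- The determinant of a pair of vectors in the plane. -/
def wedge (v w : Fin 2 → K) : K := v 0 * w 1 - v 1 * w 0

theorem vec_two_ne_zero {v : Fin 2 → K} (h : v ≠ 0) : v 0 ≠ 0 ∨ v 1 ≠ 0 := by
  by_contra hc
  push Not at hc
  exact h (by ext i; fin_cases i <;> simp [hc.1, hc.2])

theorem exists_eq_smul_of_wedge_eq_zero {v w : Fin 2 → K} (hv : v ≠ 0) (h : wedge v w = 0) :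
    ∃ c : K, w = c • v := by
  unfold wedge at h
  rcases vec_two_ne_zero hv with h0 | h0
  · refine ⟨w 0 / v 0, ?_⟩
    ext i
    fin_cases i
    · simp [h0]
    · simp only [Fin.mk_one, Pi.smul_apply, smul_eq_mul]
      field_simp
      linear_combination h
  · refine ⟨w 1 / v 1, ?_⟩
    ext i
    fin_cases i
    · simp only [Fin.zero_eta, Pi.smul_apply, smul_eq_mul]
      field_simp
      linear_combination -h
    · simp [h0]

theorem wedge_smul_right (v w : Fin 2 → K) (c : K) : wedge v (c • w) = c * wedge v w := by
  simp [wedge]; ring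

theorem wedge_self (v : Fin 2 → K) : wedge v v = 0 := by
  simp [wedge]; ring

theorem wedge_mulVec (A : Matrix (Fin 2) (Fin 2) K) (v w : Fin 2 → K) :
    wedge (A *ᵥ v) (A *ᵥ w) = A.det * wedge v w := by
  simp [wedge, mulVec, dotProduct, det_fin_two, Fin.sum_univ_two]; ring

theorem eq_zero_of_mulVec_eq_zero {A : Matrix (Fin 2) (Fin 2) K} {v w : Fin 2 → K}
    (h : wedge v w ≠ 0) (hv : A *ᵥ v = 0) (hw : A *ᵥ w = 0) : A = 0 := by
  have hv0 := congrFun hv 0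
  have hv1 := congrFun hv 1
  have hw0 := congrFun hw 0
  have hw1 := congrFun hw 1
  simp only [mulVec, dotProduct, Fin.sum_univ_two, Pi.zero_apply] at hv0 hv1 hw0 hw1
  unfold wedge at h
  ext i j
  refine mul_left_cancel₀ h ?_
  fin_cases i <;> fin_cases j <;> simp only [Fin.zero_eta, Fin.mk_one, Matrix.zero_apply, mul_zero]
  · linear_combination w 1 * hv0 - v 1 * hw0
  · linear_combination v 0 * hw0 - w 0 * hv0
  · linear_combination w 1 * hv1 - v 1 * hw1
  · linear_combination v 0 * hw1 - w 0 * hv1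

theorem eigenvalue_eq {A : Matrix (Fin 2) (Fin 2) K} {v : Fin 2 → K} {c : K} (hv : v ≠ 0)
    (h : A *ᵥ v = c • v) : c ^ 2 - A.trace * c + A.det = 0 := by
  have h0 := congrFun h 0
  have h1 := congrFun h 1
  simp only [mulVec, dotProduct, Fin.sum_univ_two, Pi.smul_apply, smul_eq_mul] at h0 h1
  rw [trace_fin_two, det_fin_two]
  rcases vec_two_ne_zero hv with hx | hx <;> refine mul_left_cancel₀ hx ?_
  · linear_combination (A 1 1 - c) * h0 - A 0 1 * h1
  · linear_combination (A 0 0 - c) * h1 - A 1 0 * h0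

theorem det_eq_mul_of_eigenvectors {A : Matrix (Fin 2) (Fin 2) K} {v w : Fin 2 → K} {a b : K}
    (h : wedge v w ≠ 0) (hv : A *ᵥ v = a • v) (hw : A *ᵥ w = b • w) : A.det = a * b := by
  have := wedge_mulVec A v w
  rw [hv, hw] at this
  refine mul_right_cancel₀ h (this.symm.trans ?_)
  simp [wedge]; ring

/-- A matrix commuting with a nonscalar matrix `A` is a polynomial in `A`. -/
theorem exists_eq_of_commute {A B : Matrix (Fin 2) (Fin 2) K} (hA : ∀ c : K, A ≠ c • 1)
    (h : A * B = B * A) : ∃ a b : K, B = a • 1 + b • A := by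
  have h00 := congrFun (congrFun h 0) 0
  have h01 := congrFun (congrFun h 0) 1
  have h10 := congrFun (congrFun h 1) 0
  simp only [mul_apply, Fin.sum_univ_two] at h00 h01 h10
  by_cases h1 : A 0 1 = 0
  · by_cases h2 : A 1 0 = 0
    · have h3 : A 0 0 - A 1 1 ≠ 0 := fun h3 => hA (A 0 0) (by
        ext i j; fin_cases i <;> fin_cases j <;> simp [h1, h2]
        linear_combination -h3)
      refine ⟨B 0 0 - (B 0 0 - B 1 1) / (A 0 0 - A 1 1) * A 0 0,
        (B 0 0 - B 1 1) / (A 0 0 - A 1 1), ?_⟩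
      rw [h1] at h00 h01
      rw [h2] at h10 h00
      ext i j; fin_cases i <;> fin_cases j <;> simp [h1, h2]
      · refine mul_left_cancel₀ h3 ?_; linear_combination h01
      · refine mul_left_cancel₀ h3 ?_; linear_combination -h10
      · field_simp; ring
    · refine ⟨B 0 0 - B 1 0 / A 1 0 * A 0 0, B 1 0 / A 1 0, ?_⟩
      ext i j; fin_cases i <;> fin_cases j <;> simp [h2]
      · field_simp; linear_combination -h00
      · field_simp; linear_combination -h10
  · refine ⟨B 0 0 - B 0 1 / A 0 1 * A 0 0, B 0 1 / A 0 1, ?_⟩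
    ext i j; fin_cases i <;> fin_cases j <;> simp [h1]
    · field_simp; linear_combination h00
    · field_simp; linear_combination h01

/-- The displayed matrix is the map `x ↦ wedge v x • v`, which spans the matrices of trace zero that
kill `v`. -/
theorem exists_nilpotent_eq {N : Matrix (Fin 2) (Fin 2) K} {v : Fin 2 → K} (hv : v ≠ 0)
    (h : N *ᵥ v = 0) (ht : N.trace = 0) :
    ∃ s : K, N = s • !![-(v 0 * v 1), v 0 ^ 2; -v 1 ^ 2, v 0 * v 1] := by
  have h0 := congrFun h 0
  have h1 := congrFun h 1
  simp only [mulVec, dotProduct, Fin.sum_univ_two, Pi.zero_apply] at h0 h1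
  rw [trace_fin_two] at ht
  rcases vec_two_ne_zero hv with hx | hx
  · refine ⟨N 0 1 / v 0 ^ 2, ?_⟩
    ext i j; fin_cases i <;> fin_cases j <;> simp
    · field_simp; linear_combination h0
    · field_simp
    · field_simp; linear_combination v 0 * h1 + v 1 * h0 - v 0 * v 1 * ht
    · field_simp; linear_combination v 0 * ht - h0
  · refine ⟨-N 1 0 / v 1 ^ 2, ?_⟩
    ext i j; fin_cases i <;> fin_cases j <;> simp
    · field_simp; linear_combination v 1 * ht - h1
    · field_simp; linear_combination v 0 * h1 + v 1 * h0 - v 0 * v 1 * ht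
    · field_simp
    · field_simp; linear_combination h1

theorem commute_of_mulVec_eq_self {A B : Matrix (Fin 2) (Fin 2) K} {v : Fin 2 → K} (hv : v ≠ 0)
    (hA : A *ᵥ v = v) (hB : B *ᵥ v = v) (hdA : A.det = 1) (hdB : B.det = 1) : A * B = B * A := by
  have key : ∀ C : Matrix (Fin 2) (Fin 2) K, C *ᵥ v = v → C.det = 1 →
      ∃ s : K, C = 1 + s • !![-(v 0 * v 1), v 0 ^ 2; -v 1 ^ 2, v 0 * v 1] := by
    intro C hC hd
    have ht := eigenvalue_eq hv (c := 1) (by rw [hC, one_smul])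
    rw [hd] at ht
    obtain ⟨s, hs⟩ := exists_nilpotent_eq (N := C - 1) hv (by rw [sub_mulVec, hC, one_mulVec,
      sub_self]) (by rw [trace_sub, trace_one]; simp; linear_combination -ht)
    exact ⟨s, by rw [← hs]; abel⟩
  obtain ⟨s, rfl⟩ := key A hA hdA
  obtain ⟨t, rfl⟩ := key B hB hdB
  ext i j; fin_cases i <;> fin_cases j <;> simp [mul_apply, Fin.sum_univ_two] <;> ring

end TwoByTwo

/-- The splitting field of the product of all polynomials `X² - τX + 1` over the finite field: over
it every element of `SL₂(F)` has an eigenvector, while the projective line stays finite. -/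
theorem exists_splitting_extension (F : Type u) [Field F] [Finite F] :
    ∃ (K : Type u) (_ : Field K) (_ : Algebra F K), Finite K ∧
      ∀ τ : F, ∃ c : K, c ^ 2 - algebraMap F K τ * c + 1 = 0 := by
  classical
  have := Fintype.ofFinite F
  let f : Polynomial F := ∏ τ : F, (Polynomial.X ^ 2 - Polynomial.C τ * Polynomial.X + 1)
  have hdeg : ∀ τ : F,
      (Polynomial.X ^ 2 - Polynomial.C τ * Polynomial.X + 1 : Polynomial F).degree = 2 := by
    intro τ; compute_degree!
  refine ⟨f.SplittingField, inferInstance, inferInstance,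
    Module.finite_of_finite F, fun τ => ?_⟩
  have hs := Polynomial.SplittingField.splits f
  have hf0 : f ≠ 0 := Finset.prod_ne_zero_iff.2 fun τ _ h => by
    have := hdeg τ
    rw [h] at this
    simp at this
  have h1 := Polynomial.Splits.of_dvd hs ((Polynomial.map_ne_zero_iff
    (algebraMap F f.SplittingField).injective).2 hf0)
    (Polynomial.map_dvd (algebraMap F f.SplittingField)
      (Finset.dvd_prod_of_mem _ (Finset.mem_univ τ)))
  obtain ⟨c, hc⟩ := h1.exists_eval_eq_zero (by rw [Polynomial.degree_map, hdeg]; norm_num)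
  refine ⟨c, ?_⟩
  simpa [Polynomial.eval_map] using hc

/-! ### The action of `L₂(F)` on the projective line over an extension -/

open scoped LinearAlgebra.Projectivization Matrix

/-- The group `SL₂(F)`. -/
abbrev SL2 (F : Type*) [Field F] : Type _ := Matrix.SpecialLinearGroup (Fin 2) F

/-- The projection from `SL₂(F)` to `L₂(F)`. -/
abbrev L2.mk {F : Type*} [Field F] : SL2 F →* L2 F := QuotientGroup.mk' _

section

variable {F : Type*} [Field F]

theorem SL2.mem_center_iff {a : SL2 F} : a ∈ Subgroup.center (SL2 F) ↔ a = 1 ∨ a = -1 := by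
  rw [Matrix.SpecialLinearGroup.mem_center_iff]
  constructor
  · rintro ⟨r, hr, h⟩
    rw [Fintype.card_fin, sq_eq_one_iff] at hr
    rcases hr with rfl | rfl
    · left; ext i j; rw [← h]; simp
    · right; ext i j; rw [← h]; fin_cases i <;> fin_cases j <;> simp
  · rintro (rfl | rfl)
    · exact ⟨1, by simp, by simp⟩
    · exact ⟨-1, by simp, by ext i j; fin_cases i <;> fin_cases j <;> simp⟩

theorem L2.mk_surjective : Function.Surjective (L2.mk (F := F)) := QuotientGroup.mk'_surjective _

theorem L2.mk_eq_one_iff {a : SL2 F} : L2.mk a = 1 ↔ a = 1 ∨ a = -1 := by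
  rw [← SL2.mem_center_iff]
  exact QuotientGroup.eq_one_iff a

theorem L2.mk_eq_mk_iff {a b : SL2 F} : L2.mk a = L2.mk b ↔ a = b ∨ a = -b := by
  rw [← inv_mul_eq_one, ← map_inv, ← map_mul, L2.mk_eq_one_iff, inv_mul_eq_one, inv_mul_eq_iff_eq_mul]
  constructor
  · rintro (h | h)
    · exact Or.inl h
    · right; rw [h]; simp
  · rintro (h | h)
    · exact Or.inl h
    · right; rw [h]; simp

theorem L2.mk_neg (a : SL2 F) : L2.mk (-a) = L2.mk a := L2.mk_eq_mk_iff.2 (Or.inr rfl)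

/-- An element of `SL₂(F)` as a matrix over an extension field. -/
def SL2.toMat (K : Type*) [Field K] [Algebra F K] (g : SL2 F) : Matrix (Fin 2) (Fin 2) K :=
  (Matrix.SpecialLinearGroup.map (algebraMap F K) g).1

variable {K : Type*} [Field K] [Algebra F K]

namespace SL2

theorem toMat_apply (g : SL2 F) (i j : Fin 2) : g.toMat K i j = algebraMap F K (g.1 i j) := rfl

theorem toMat_mul (g h : SL2 F) : (g * h).toMat K = g.toMat K * h.toMat K := by
  simp [toMat]

theorem toMat_one : (1 : SL2 F).toMat K = 1 := by simp [toMat]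

theorem toMat_neg (g : SL2 F) : (-g).toMat K = -g.toMat K := by
  ext i j; simp [toMat_apply]

theorem det_toMat (g : SL2 F) : (g.toMat K).det = 1 :=
  (Matrix.SpecialLinearGroup.map (algebraMap F K) g).2

theorem trace_toMat (g : SL2 F) : (g.toMat K).trace = algebraMap F K g.1.trace := by
  simp [Matrix.trace_fin_two, toMat_apply]

theorem toMat_injective : Function.Injective (toMat K : SL2 F → _) := by
  intro g h hgh
  ext i j
  exact (algebraMap F K).injective (congrFun (congrFun hgh i) j)

theorem toMat_inv_mulVec {g : SL2 F} {v : Fin 2 → K} {c : K} (hc : c ≠ 0)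
    (h : g.toMat K *ᵥ v = c • v) : g⁻¹.toMat K *ᵥ v = c⁻¹ • v := by
  have h1 : v = c⁻¹ • (g.toMat K *ᵥ v) := by rw [h, smul_smul, inv_mul_cancel₀ hc, one_smul]
  conv_lhs => rw [h1]
  rw [Matrix.mulVec_smul, Matrix.mulVec_mulVec, ← toMat_mul, inv_mul_cancel, toMat_one,
    Matrix.one_mulVec]

theorem toMat_mulVec_ne_zero (g : SL2 F) {v : Fin 2 → K} (hv : v ≠ 0) : g.toMat K *ᵥ v ≠ 0 := by
  intro h
  apply hv
  rw [← Matrix.one_mulVec v, ← toMat_one (F := F), ← inv_mul_cancel g, toMat_mul,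
    ← Matrix.mulVec_mulVec, h, Matrix.mulVec_zero]

theorem eigenvalue_ne_zero {g : SL2 F} {v : Fin 2 → K} {c : K} (hv : v ≠ 0)
    (h : g.toMat K *ᵥ v = c • v) : c ≠ 0 := by
  rintro rfl
  exact toMat_mulVec_ne_zero g hv (by rw [h, zero_smul])

theorem eigenvalue_eq {g : SL2 F} {v : Fin 2 → K} {c : K} (hv : v ≠ 0)
    (h : g.toMat K *ᵥ v = c • v) : c ^ 2 - algebraMap F K g.1.trace * c + 1 = 0 := by
  have := _root_.eigenvalue_eq hv h
  rwa [trace_toMat, det_toMat] at this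

theorem exists_eigenvector {g : SL2 F} {c : K} (hc : c ^ 2 - algebraMap F K g.1.trace * c + 1 = 0) :
    ∃ v : Fin 2 → K, v ≠ 0 ∧ g.toMat K *ᵥ v = c • v :=
  exists_mulVec_eq_smul_of_root (by rw [trace_toMat, det_toMat]; exact hc)

theorem ne_smul_one {g : SL2 F} (h1 : L2.mk g ≠ 1) (c : K) : g.toMat K ≠ c • 1 := by
  intro h
  apply h1
  rw [L2.mk_eq_one_iff]
  have hd := det_toMat (K := K) g
  rw [h] at hd
  simp only [Matrix.det_smul, Fintype.card_fin, Matrix.det_one, mul_one] at hd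
  rcases sq_eq_one_iff.1 hd with rfl | rfl
  · left; apply toMat_injective (K := K); rw [h, toMat_one, one_smul]
  · right; apply toMat_injective (K := K); rw [h, toMat_neg, toMat_one, neg_one_smul]

theorem ne_smul_one' {g : SL2 F} (h1 : L2.mk g ≠ 1) (c : F) : g.1 ≠ c • 1 := by
  intro h
  apply h1
  rw [L2.mk_eq_one_iff]
  have hd := g.2
  rw [h] at hd
  simp only [Matrix.det_smul, Fintype.card_fin, Matrix.det_one, mul_one] at hd
  rcases sq_eq_one_iff.1 hd with rfl | rfl
  · left; ext i j; rw [h, one_smul]; rfl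
  · right; ext i j; rw [h, neg_one_smul]; simp

end SL2

/-- The action of `L₂(F)` on the projective line over an extension field. -/
noncomputable def L2.permHom (F K : Type*) [Field F] [Field K] [Algebra F K] :
    L2 F →* Equiv.Perm (ℙ K (Fin 2 → K)) :=
  QuotientGroup.lift _ ((MulAction.toPermHom (SL2 K) (ℙ K (Fin 2 → K))).comp
    (Matrix.SpecialLinearGroup.map (algebraMap F K))) (by
      intro a ha
      rw [SL2.mem_center_iff] at ha
      ext x
      induction x using Projectivization.ind with
      | h v hv =>
        rcases ha with rfl | rfl
        · simp
        · simp only [MonoidHom.coe_comp, Function.comp_apply, MulAction.toPermHom_apply,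
            MulAction.toPerm_apply, Projectivization.smul_mk, Equiv.Perm.coe_one, id_eq]
          rw [Projectivization.mk_eq_mk_iff']
          refine ⟨-1, ?_⟩
          change _ = (SL2.toMat K (-1)) *ᵥ v
          rw [SL2.toMat_neg, SL2.toMat_one, Matrix.neg_mulVec, Matrix.one_mulVec, neg_one_smul])

noncomputable instance L2.instMulActionProj : MulAction (L2 F) (ℙ K (Fin 2 → K)) :=
  MulAction.compHom _ (L2.permHom F K)

theorem L2.mk_smul_mk (g : SL2 F) (v : Fin 2 → K) (hv : v ≠ 0) :
    L2.mk g • Projectivization.mk K v hv =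
      Projectivization.mk K (g.toMat K *ᵥ v) (SL2.toMat_mulVec_ne_zero g hv) := rfl

theorem L2.smul_eq_iff (g : SL2 F) (v : Fin 2 → K) (hv : v ≠ 0) :
    L2.mk g • Projectivization.mk K v hv = Projectivization.mk K v hv ↔
      ∃ c : K, g.toMat K *ᵥ v = c • v := by
  rw [L2.mk_smul_mk, Projectivization.mk_eq_mk_iff']
  exact exists_congr fun c => eq_comm

theorem mk_eq_mk_iff_wedge {v w : Fin 2 → K} (hv : v ≠ 0) (hw : w ≠ 0) :
    Projectivization.mk K v hv = Projectivization.mk K w hw ↔ wedge v w = 0 := by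
  rw [Projectivization.mk_eq_mk_iff']
  constructor
  · rintro ⟨c, rfl⟩
    simp [wedge]; ring
  · intro h
    have h' : wedge w v = 0 := by simp [wedge] at h ⊢; linear_combination -h
    obtain ⟨c, hc⟩ := exists_eq_smul_of_wedge_eq_zero hw h'
    exact ⟨c, hc.symm⟩

/-- The elements of `SL₂(F)` fixing a vector over an extension field. -/
def SL2.fixer (F : Type*) {K : Type*} [Field F] [Field K] [Algebra F K] (v : Fin 2 → K) :
    Subgroup (SL2 F) where
  carrier := {g | g.toMat K *ᵥ v = v}
  one_mem' := by
    change (1 : SL2 F).toMat K *ᵥ v = v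
    rw [SL2.toMat_one, Matrix.one_mulVec]
  mul_mem' {a b} ha hb := by
    simp only [Set.mem_ofPred_eq] at *
    rw [SL2.toMat_mul, ← Matrix.mulVec_mulVec, hb, ha]
  inv_mem' {a} ha := by
    simp only [Set.mem_ofPred_eq] at *
    have := SL2.toMat_inv_mulVec (one_ne_zero) (ha.trans (one_smul K v).symm)
    rwa [inv_one, one_smul] at this

theorem SL2.mem_fixer {v : Fin 2 → K} {g : SL2 F} :
    g ∈ SL2.fixer F v ↔ g.toMat K *ᵥ v = v := Iff.rfl

/-- The group of unipotent elements fixing a point of the projective line. -/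
noncomputable def L2.unip (F : Type*) {K : Type*} [Field F] [Field K] [Algebra F K]
    (x : ℙ K (Fin 2 → K)) : Subgroup (L2 F) := (SL2.fixer F x.rep).map L2.mk

theorem L2.mem_unip_iff {h : L2 F} {v : Fin 2 → K} (hv : v ≠ 0) :
    h ∈ L2.unip F (Projectivization.mk K v hv) ↔
      ∃ g : SL2 F, g.toMat K *ᵥ v = v ∧ L2.mk g = h := by
  obtain ⟨a, ha⟩ := Projectivization.exists_smul_eq_mk_rep K v hv
  unfold L2.unip
  rw [Subgroup.mem_map, ← ha]
  refine exists_congr fun g => and_congr_left fun _ => ?_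
  rw [SL2.mem_fixer, Units.smul_def, Matrix.mulVec_smul]
  constructor
  · intro h
    have := congrArg (fun w => (a : K)⁻¹ • w) h
    simpa [smul_smul] using this
  · intro h; rw [h]

/-- The eigenvalues of a lift are `c` and `c⁻¹`. If they differ there are exactly two eigenlines; if
they agree then `c = ±1`, so the element is unipotent up to sign and, being nonscalar, has only one
eigenline. -/
theorem L2.isPolarAction (hK : ∀ τ : F, ∃ c : K, c ^ 2 - algebraMap F K τ * c + 1 = 0) :
    IsPolarAction (L2 F) (ℙ K (Fin 2 → K)) (L2.unip F) where
  le_stabilizer x h hh := by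
    induction x using Projectivization.ind with
    | h v hv =>
      obtain ⟨g, hg, rfl⟩ := (L2.mem_unip_iff hv).1 hh
      rw [MulAction.mem_stabilizer_iff, L2.smul_eq_iff]
      exact ⟨1, by rw [hg, one_smul]⟩
  conj_mem a x h hh := by
    induction x using Projectivization.ind with
    | h v hv =>
      obtain ⟨g, hg, rfl⟩ := (L2.mem_unip_iff hv).1 hh
      obtain ⟨b, rfl⟩ := L2.mk_surjective a
      rw [L2.mk_smul_mk, L2.mem_unip_iff]
      refine ⟨b * g * b⁻¹, ?_, by simp⟩
      rw [Matrix.mulVec_mulVec, ← SL2.toMat_mul, inv_mul_cancel_right, SL2.toMat_mul,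
        ← Matrix.mulVec_mulVec, hg]
  card_fixedBy_one h h1 x hh := by
    induction x using Projectivization.ind with
    | h v hv =>
      obtain ⟨g, hg, rfl⟩ := (L2.mem_unip_iff hv).1 hh
      have hset : MulAction.fixedBy (ℙ K (Fin 2 → K)) (L2.mk g) =
          {Projectivization.mk K v hv} := by
        ext y
        rw [MulAction.mem_fixedBy, Set.mem_singleton_iff]
        constructor
        · intro hy
          induction y using Projectivization.ind with
          | h w hw =>
            obtain ⟨c, hc⟩ := (L2.smul_eq_iff g w hw).1 hy
            have e1 := SL2.eigenvalue_eq hv (c := 1) (hg.trans (one_smul K v).symm)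
            have e2 := SL2.eigenvalue_eq hw hc
            have e3 : (c - 1) ^ 2 = 0 := by linear_combination e2 - c * e1
            have e4 : c = 1 := sub_eq_zero.1 (pow_eq_zero_iff two_ne_zero |>.1 e3)
            rw [eq_comm, mk_eq_mk_iff_wedge]
            by_contra hne
            have := eq_zero_of_mulVec_eq_zero (A := g.toMat K - 1) hne
              (by rw [Matrix.sub_mulVec, hg, Matrix.one_mulVec, sub_self])
              (by rw [Matrix.sub_mulVec, hc, e4, one_smul, Matrix.one_mulVec, sub_self])
            exact SL2.ne_smul_one h1 (1 : K) (by rw [one_smul]; exact sub_eq_zero.1 this)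
        · rintro rfl
          rw [L2.smul_eq_iff]
          exact ⟨1, by rw [hg, one_smul]⟩
      rw [hset, Nat.card_unique]
  card_fixedBy_two h h1 hh := by
    obtain ⟨g, rfl⟩ := L2.mk_surjective h
    obtain ⟨c, hc⟩ := hK g.1.trace
    obtain ⟨v, hv, hgv⟩ := SL2.exists_eigenvector hc
    have hc0 : c ≠ 0 := SL2.eigenvalue_ne_zero hv hgv
    have hc' : c⁻¹ ^ 2 - algebraMap F K g.1.trace * c⁻¹ + 1 = 0 := by
      field_simp
      linear_combination hc
    obtain ⟨w, hw, hgw⟩ := SL2.exists_eigenvector hc'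
    have hcc : c ≠ c⁻¹ := by
      intro hcc
      have hsq : c ^ 2 = 1 := by
        field_simp at hcc
        exact hcc
      have := hh (Projectivization.mk K v hv)
      rw [L2.mem_unip_iff] at this
      rcases sq_eq_one_iff.1 hsq with rfl | rfl
      · exact this ⟨g, by rw [hgv, one_smul], rfl⟩
      · exact this ⟨-g, by rw [SL2.toMat_neg, Matrix.neg_mulVec, hgv, neg_one_smul, neg_neg],
          L2.mk_neg g⟩
    have hvw : wedge v w ≠ 0 := by
      intro h0
      obtain ⟨a, rfl⟩ := exists_eq_smul_of_wedge_eq_zero hv h0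
      rw [Matrix.mulVec_smul, hgv, smul_comm] at hgw
      have := sub_eq_zero.2 hgw
      rw [← sub_smul] at this
      rcases smul_eq_zero.1 this with h | h
      · exact hcc (sub_eq_zero.1 h)
      · exact hw h
    have hset : MulAction.fixedBy (ℙ K (Fin 2 → K)) (L2.mk g) =
        {Projectivization.mk K v hv, Projectivization.mk K w hw} := by
      ext y
      rw [MulAction.mem_fixedBy, Set.mem_insert_iff, Set.mem_singleton_iff]
      constructor
      · intro hy
        induction y using Projectivization.ind with
        | h z hz =>
          obtain ⟨d, hd⟩ := (L2.smul_eq_iff g z hz).1 hy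
          have e := SL2.eigenvalue_eq hz hd
          have e2 : (d - c) * (d - c⁻¹) = 0 := by
            field_simp
            linear_combination c * e - d * hc
          rw [eq_comm, mk_eq_mk_iff_wedge, eq_comm, mk_eq_mk_iff_wedge]
          by_contra hne
          push Not at hne
          rcases mul_eq_zero.1 e2 with h | h
          · have := eq_zero_of_mulVec_eq_zero (A := g.toMat K - d • 1) (Ne.symm hne.1)
              (by rw [Matrix.sub_mulVec, hgv, Matrix.smul_mulVec, Matrix.one_mulVec,
                    sub_eq_zero.1 h, sub_self])
              (by rw [Matrix.sub_mulVec, hd, Matrix.smul_mulVec, Matrix.one_mulVec, sub_self])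
            exact SL2.ne_smul_one h1 d (sub_eq_zero.1 this)
          · have := eq_zero_of_mulVec_eq_zero (A := g.toMat K - d • 1) (v := z) (w := w)
              (by intro h0; apply hne.2; simp only [wedge] at h0 ⊢; linear_combination h0)
              (by rw [Matrix.sub_mulVec, hd, Matrix.smul_mulVec, Matrix.one_mulVec, sub_self])
              (by rw [Matrix.sub_mulVec, hgw, Matrix.smul_mulVec, Matrix.one_mulVec,
                    sub_eq_zero.1 h, sub_self])
            exact SL2.ne_smul_one h1 d (sub_eq_zero.1 this)
      · rintro (rfl | rfl)
        · exact (L2.smul_eq_iff _ _ _).2 ⟨_, hgv⟩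
        · exact (L2.smul_eq_iff _ _ _).2 ⟨_, hgw⟩
    rw [hset, Nat.card_coe_set_eq, Set.ncard_pair]
    rwa [Ne, mk_eq_mk_iff_wedge]
  comm_iff x u h hu hu1 hx := by
    induction x using Projectivization.ind with
    | h v hv =>
      obtain ⟨g, hg, rfl⟩ := (L2.mem_unip_iff hv).1 hu
      obtain ⟨k, rfl⟩ := L2.mk_surjective h
      obtain ⟨c, hc⟩ := (L2.smul_eq_iff k v hv).1 hx
      have hc0 := SL2.eigenvalue_ne_zero hv hc
      rw [L2.mem_unip_iff]
      constructor
      · intro hcomm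
        rw [← map_mul, ← map_mul, L2.mk_eq_mk_iff] at hcomm
        -- Commuting in `L₂` means commuting up to sign in `SL₂`. Evaluated at the common
        -- eigenvector `v`, the minus sign gives `2 * c = 0`, so it can only occur in characteristic
        -- two, where it is no sign at all.
        have hkg : k.toMat K * g.toMat K = g.toMat K * k.toMat K := by
          rcases hcomm with h | h
          · rw [← SL2.toMat_mul, h, SL2.toMat_mul]
          · have h2 := congrArg (fun a => SL2.toMat K a *ᵥ v) h
            simp only [SL2.toMat_mul, SL2.toMat_neg, Matrix.neg_mulVec,
              ← Matrix.mulVec_mulVec, hg, hc, Matrix.mulVec_smul] at h2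
            rw [← sub_eq_zero, sub_neg_eq_add, ← add_smul, smul_eq_zero] at h2
            have h3 : c + c = 0 := h2.resolve_right hv
            have h4 : (-1 : K) = 1 := by
              have : c * (1 + 1) = 0 := by linear_combination h3
              have := (mul_eq_zero.1 this).resolve_left hc0
              linear_combination -this
            rw [← SL2.toMat_mul, h, SL2.toMat_neg, SL2.toMat_mul, ← neg_one_smul K, h4, one_smul]
        obtain ⟨a, b, hab⟩ := exists_eq_of_commute (SL2.ne_smul_one hu1) hkg.symm
        have hv2 : k.toMat K *ᵥ v = (a + b) • v := by
          rw [hab, Matrix.add_mulVec, Matrix.smul_mulVec, Matrix.smul_mulVec, Matrix.one_mulVec,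
            hg, add_smul]
        have e1 := SL2.eigenvalue_eq hv (c := 1) (hg.trans (one_smul K v).symm)
        have htr : (g.toMat K).trace = 2 := by rw [SL2.trace_toMat]; linear_combination -e1
        have hdg := SL2.det_toMat (K := K) g
        have hdk := SL2.det_toMat (K := K) k
        rw [hab] at hdk
        rw [Matrix.det_fin_two] at hdk hdg
        rw [Matrix.trace_fin_two] at htr
        simp at hdk
        -- Since `g` has trace 2 and determinant 1, the determinant of `a + b g` is `(a + b)²`, and
        -- `a + b` is the eigenvalue of `k` at `v`.
        have hsq : (a + b) ^ 2 = 1 := by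
          linear_combination hdk - b ^ 2 * hdg - a * b * htr
        rcases sq_eq_one_iff.1 hsq with h | h
        · exact ⟨k, by rw [hv2, h, one_smul], rfl⟩
        · exact ⟨-k, by rw [SL2.toMat_neg, Matrix.neg_mulVec, hv2, h, neg_one_smul, neg_neg],
            L2.mk_neg k⟩
      · rintro ⟨k', hk', e⟩
        rw [← e, ← map_mul, ← map_mul]
        congr 1
        apply SL2.toMat_injective (K := K)
        rw [SL2.toMat_mul, SL2.toMat_mul]
        exact commute_of_mulVec_eq_self hv hk' hg (SL2.det_toMat _) (SL2.det_toMat _)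

end

/-! ### Subgroups with a fixed point or a stabilizer of index two -/

section

variable {F : Type*} [Field F]

/-- The stabilizer in `SL₂(F)` of the line spanned by a vector. -/
def SL2.lineStab (v : Fin 2 → F) (hv : v ≠ 0) : Subgroup (SL2 F) where
  carrier := {g | ∃ c : F, g.1 *ᵥ v = c • v}
  one_mem' := ⟨1, by simp⟩
  mul_mem' {a b} := by
    rintro ⟨c, hc⟩ ⟨d, hd⟩
    refine ⟨d * c, ?_⟩
    rw [Matrix.SpecialLinearGroup.coe_mul, ← Matrix.mulVec_mulVec, hd, Matrix.mulVec_smul, hc,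
      smul_smul]
  inv_mem' {a} := by
    rintro ⟨c, hc⟩
    have e : ∀ g : SL2 F, g.1 = g.toMat F := fun g => by ext i j; rfl
    rw [e] at hc
    exact ⟨c⁻¹, by rw [e]; exact SL2.toMat_inv_mulVec (SL2.eigenvalue_ne_zero hv hc) hc⟩

theorem SL2.mem_lineStab {v : Fin 2 → F} {hv : v ≠ 0} {g : SL2 F} :
    g ∈ SL2.lineStab v hv ↔ ∃ c : F, g.1 *ᵥ v = c • v := Iff.rfl

/-- The elements conjugating `X` to `X` or to its inverse. -/
def SL2.invStab (X : SL2 F) : Subgroup (SL2 F) where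
  carrier := {g | g * X * g⁻¹ = X ∨ g * X * g⁻¹ = X⁻¹}
  one_mem' := by left; simp
  mul_mem' {a b} := by
    have e : a * b * X * (a * b)⁻¹ = a * (b * X * b⁻¹) * a⁻¹ := by group
    have e' : a * X⁻¹ * a⁻¹ = (a * X * a⁻¹)⁻¹ := by group
    simp only [Set.mem_ofPred_eq]
    rw [e]
    rintro (h1 | h1) (h2 | h2) <;> rw [h2]
    · exact Or.inl h1
    · right; rw [e', h1]
    · exact Or.inr h1
    · left; rw [e', h1, inv_inv]
  inv_mem' {a} := by
    simp only [Set.mem_ofPred_eq, inv_inv]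
    rintro (h | h)
    · left; conv_lhs => rw [← h]
      group
    · right
      calc a⁻¹ * X * a = a⁻¹ * (X⁻¹)⁻¹ * a := by rw [inv_inv]
        _ = a⁻¹ * (a * X * a⁻¹)⁻¹ * a := by rw [h]
        _ = X⁻¹ := by group

theorem SL2.mem_invStab {X g : SL2 F} :
    g ∈ SL2.invStab X ↔ g * X * g⁻¹ = X ∨ g * X * g⁻¹ = X⁻¹ := Iff.rfl

variable {K : Type*} [Field K] [Algebra F K]

/-- The two coordinates of `v` are either linearly dependent over `F`, which makes the line of `v`
rational, or independent, and then no nonzero matrix over `F` kills `v`. -/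
theorem rational_or_eq_zero {v : Fin 2 → K} (hv : v ≠ 0) :
    (∃ v₀ : Fin 2 → F, v₀ ≠ 0 ∧ ∃ c : K, c ≠ 0 ∧ v = c • fun i => algebraMap F K (v₀ i)) ∨
      ∀ A : Matrix (Fin 2) (Fin 2) F, A.map (algebraMap F K) *ᵥ v = 0 → A = 0 := by
  by_cases h : ∀ A : Matrix (Fin 2) (Fin 2) F, A.map (algebraMap F K) *ᵥ v = 0 → A = 0
  · exact Or.inr h
  left
  push Not at h
  obtain ⟨A, hA, hne⟩ := h
  obtain ⟨i, hi⟩ : ∃ i, A i ≠ 0 := by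
    by_contra hc
    push Not at hc
    exact hne (by ext i j; rw [hc i]; rfl)
  have h0 : algebraMap F K (A i 0) * v 0 + algebraMap F K (A i 1) * v 1 = 0 := by
    have := congrFun hA i
    simpa [Matrix.mulVec, dotProduct, Fin.sum_univ_two] using this
  have hne0 : (![-A i 1, A i 0] : Fin 2 → F) ≠ 0 := by
    intro hz
    apply hi
    have a0 := congrFun hz 0
    have a1 := congrFun hz 1
    simp at a0 a1
    ext j
    fin_cases j
    · exact a1
    · exact a0
  have hw : (fun j => algebraMap F K ((![-A i 1, A i 0] : Fin 2 → F) j)) ≠ 0 := by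
    intro hz
    apply hne0
    ext j
    exact (algebraMap F K).injective (by rw [congrFun hz j]; simp)
  obtain ⟨c, hc⟩ := exists_eq_smul_of_wedge_eq_zero (w := v) hw (by
    simp [wedge]; linear_combination -h0)
  refine ⟨_, hne0, c, ?_, hc⟩
  rintro rfl
  exact hv (by rw [hc, zero_smul])

theorem SL2.toMat_mulVec_rational (g : SL2 F) (v₀ : Fin 2 → F) :
    g.toMat K *ᵥ (fun i => algebraMap F K (v₀ i)) = fun i => algebraMap F K ((g.1 *ᵥ v₀) i) := by
  ext i
  simp [Matrix.mulVec, dotProduct, Fin.sum_univ_two, SL2.toMat_apply]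

theorem SL2.mem_lineStab_of_toMat {g : SL2 F} {v₀ : Fin 2 → F} (hv₀ : v₀ ≠ 0) {c d : K}
    (hd : d ≠ 0)
    (h : g.toMat K *ᵥ (d • fun i => algebraMap F K (v₀ i)) =
      c • (d • fun i => algebraMap F K (v₀ i))) : g ∈ SL2.lineStab v₀ hv₀ := by
  rw [Matrix.mulVec_smul, smul_comm, SL2.toMat_mulVec_rational] at h
  have h' := smul_right_injective _ hd h
  have hw : wedge v₀ (g.1 *ᵥ v₀) = 0 := by
    apply (algebraMap F K).injective
    have h0 := congrFun h' 0
    have h1 := congrFun h' 1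
    simp only [Pi.smul_apply, smul_eq_mul] at h0 h1
    simp only [wedge, map_sub, map_mul, h0, h1, map_zero]
    ring
  exact exists_eq_smul_of_wedge_eq_zero hv₀ hw

theorem SL2.trace_sq_ne_four {X : SL2 F} {v : Fin 2 → K} {c : K} (hv : v ≠ 0)
    (h : X.toMat K *ᵥ v = c • v) (hc : c ^ 2 ≠ 1) : X.1.trace ^ 2 ≠ 4 := by
  intro ht
  have e := SL2.eigenvalue_eq hv h
  have ht' : algebraMap F K X.1.trace ^ 2 = 4 := by
    rw [← map_pow, ht, map_ofNat]
  apply hc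
  have h1 : (c ^ 2 - 1) ^ 2 = 0 := by
    linear_combination (c ^ 2 + algebraMap F K X.1.trace * c + 1) * e + c ^ 2 * ht'
  exact sub_eq_zero.1 (pow_eq_zero_iff two_ne_zero |>.1 h1)

/-- A rational fixed point puts the group into a Borel subgroup. At an irrational one the commutator
`gX - Xg` kills the common eigenvector, so it vanishes and the group centralizes any of its
elements. -/
theorem L2.le_of_fixed (H : Subgroup (L2 F)) (x : ℙ K (Fin 2 → K)) (hx : ∀ h ∈ H, h • x = x) :
    (∃ v₀ : Fin 2 → F, ∃ hv : v₀ ≠ 0, H.comap L2.mk ≤ SL2.lineStab v₀ hv) ∨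
    (∃ X : SL2 F, X.1.trace ^ 2 ≠ 4 ∧ H.comap L2.mk ≤ SL2.invStab X) := by
  induction x using Projectivization.ind with
  | h v hv =>
    have hev : ∀ g : SL2 F, g ∈ H.comap L2.mk → ∃ c : K, g.toMat K *ᵥ v = c • v :=
      fun g hg => (L2.smul_eq_iff g v hv).1 (hx _ hg)
    rcases rational_or_eq_zero (F := F) hv with ⟨v₀, hv₀, d, hd, rfl⟩ | hirr
    · left
      refine ⟨v₀, hv₀, fun g hg => ?_⟩
      obtain ⟨c, hc⟩ := hev g hg
      exact SL2.mem_lineStab_of_toMat hv₀ hd hc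
    · by_cases hH : H = ⊥
      · left
        refine ⟨![1, 0], by intro h; simpa using congrFun h 0, fun g hg => ?_⟩
        rw [hH, Subgroup.mem_comap, Subgroup.mem_bot, L2.mk_eq_one_iff] at hg
        rcases hg with rfl | rfl
        · exact one_mem _
        · exact ⟨-1, by simp [Matrix.neg_mulVec]⟩
      · right
        obtain ⟨⟨h, hh⟩, h1⟩ := Subgroup.ne_bot_iff_exists_ne_one.1 hH
        obtain ⟨X, rfl⟩ := L2.mk_surjective h
        have hX1 : L2.mk X ≠ 1 := fun e => h1 (Subtype.ext e)
        obtain ⟨c, hc⟩ := hev X hh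
        refine ⟨X, SL2.trace_sq_ne_four hv hc fun hsq => ?_, fun g hg => ?_⟩
        -- An eigenvalue lying in `F` would make the matrix `X - e` over `F` kill the irrational
        -- vector, so `X` would be scalar.
        · have key : ∀ e : F, algebraMap F K e = c → False := by
            rintro e rfl
            refine SL2.ne_smul_one' hX1 e (sub_eq_zero.1 (hirr (X.1 - e • 1) ?_))
            have : (X.1 - e • (1 : Matrix (Fin 2) (Fin 2) F)).map (algebraMap F K) =
                X.toMat K - algebraMap F K e • 1 := by
              ext i j; fin_cases i <;> fin_cases j <;>
                simp [SL2.toMat_apply] <;> exact Algebra.algebraMap_eq_smul_one e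
            rw [this, Matrix.sub_mulVec, hc, Matrix.smul_mulVec, Matrix.one_mulVec, sub_self]
          rcases sq_eq_one_iff.1 hsq with h | h
          · exact key 1 (by rw [h, map_one])
          · exact key (-1) (by rw [h, map_neg, map_one])
        · left
          obtain ⟨d, hd⟩ := hev g hg
          rw [mul_inv_eq_iff_eq_mul]
          apply Subtype.ext
          refine sub_eq_zero.1 (hirr ((g * X).1 - (X * g).1) ?_)
          have : ((g * X).1 - (X * g).1).map (algebraMap F K) =
              g.toMat K * X.toMat K - X.toMat K * g.toMat K := by
            rw [← SL2.toMat_mul, ← SL2.toMat_mul]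
            ext i j; simp only [Matrix.map_apply, Matrix.sub_apply, map_sub]; rfl
          rw [this, Matrix.sub_mulVec, ← Matrix.mulVec_mulVec, ← Matrix.mulVec_mulVec, hc, hd,
            Matrix.mulVec_smul, Matrix.mulVec_smul, hc, hd, smul_comm, sub_self]

/-- The stabilizer is normal, so it fixes both points of the orbit of `x` and is diagonal in the
corresponding basis. A conjugate of a nontrivial stabilizer element `X` is again diagonal with the
same trace, hence equal to `X` or its inverse. -/
theorem L2.le_invStab_of_index_two (H : Subgroup (L2 F)) [Finite H] (x : ℙ K (Fin 2 → K))
    (h2 : 2 * Nat.card (MulAction.stabilizer H x) = Nat.card H)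
    (h1 : 2 ≤ Nat.card (MulAction.stabilizer H x)) (hU : (L2.unip F x).subgroupOf H = ⊥) :
    ∃ X : SL2 F, X.1.trace ^ 2 ≠ 4 ∧ H.comap L2.mk ≤ SL2.invStab X := by
  have hidx : (MulAction.stabilizer H x).index = 2 := by
    have := (MulAction.stabilizer H x).card_mul_index
    rw [← h2, mul_comm] at this
    exact Nat.eq_of_mul_eq_mul_right (by omega) this
  have hnorm := Subgroup.normal_of_index_eq_two hidx
  have hnt : Nontrivial (MulAction.stabilizer H x) :=
    Finite.one_lt_card_iff_nontrivial.1 (by omega)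
  obtain ⟨⟨⟨c, hcH⟩, hcs⟩, hc1⟩ := exists_ne (1 : MulAction.stabilizer H x)
  have hc1' : c ≠ 1 := fun e => hc1 (Subtype.ext (Subtype.ext e))
  have htop : MulAction.stabilizer H x ≠ ⊤ := fun e => by
    rw [e, Subgroup.index_top] at hidx; omega
  obtain ⟨⟨y, hyH⟩, hys⟩ : ∃ y : H, y ∉ MulAction.stabilizer H x := by
    by_contra hcon
    push Not at hcon
    exact htop (eq_top_iff.2 fun y _ => hcon y)
  have hconj : ∀ a b : L2 F, a ∈ H → b ∈ H → b • x = x → (a * b * a⁻¹) • x = x :=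
    fun a b ha hb hbx => hnorm.conj_mem ⟨b, hb⟩ hbx ⟨a, ha⟩
  have hcs' : c • x = x := hcs
  have hys' : y • x ≠ x := hys
  clear hc1 hcs hys
  induction x using Projectivization.ind with
  | h v hv =>
    obtain ⟨X, rfl⟩ := L2.mk_surjective c
    obtain ⟨y, rfl⟩ := L2.mk_surjective y
    obtain ⟨l, hl⟩ := (L2.smul_eq_iff X v hv).1 hcs'
    have hl2 : l ^ 2 ≠ 1 := by
      intro hsq
      have : L2.mk X ∈ L2.unip F (Projectivization.mk K v hv) := by
        rw [L2.mem_unip_iff]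
        rcases sq_eq_one_iff.1 hsq with rfl | rfl
        · exact ⟨X, by rw [hl, one_smul], rfl⟩
        · exact ⟨-X, by rw [SL2.toMat_neg, Matrix.neg_mulVec, hl, neg_one_smul, neg_neg],
            L2.mk_neg X⟩
      have hm : (⟨L2.mk X, hcH⟩ : H) ∈ (L2.unip F (Projectivization.mk K v hv)).subgroupOf H := this
      rw [hU, Subgroup.mem_bot] at hm
      exact hc1' (congrArg Subtype.val hm)
    have hw : wedge v (y.toMat K *ᵥ v) ≠ 0 := by
      rw [L2.mk_smul_mk, Ne, eq_comm, mk_eq_mk_iff_wedge] at hys'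
      exact hys'
    -- Stabilizer elements have eigenvectors `v` and `y v`, with mutually inverse eigenvalues
    -- because the determinant is 1.
    have hfix2 : ∀ Y : SL2 F, L2.mk Y ∈ H → L2.mk Y • Projectivization.mk K v hv =
        Projectivization.mk K v hv → ∃ a : K, Y.toMat K *ᵥ v = a • v ∧
          Y.toMat K *ᵥ (y.toMat K *ᵥ v) = a⁻¹ • (y.toMat K *ᵥ v) := by
      intro Y hYH hY
      obtain ⟨a, ha⟩ := (L2.smul_eq_iff Y v hv).1 hY
      have h3 := hconj (L2.mk y)⁻¹ (L2.mk Y) (H.inv_mem hyH) hYH hY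
      rw [inv_inv, ← map_inv, ← map_mul, ← map_mul] at h3
      obtain ⟨b, hb⟩ := (L2.smul_eq_iff _ v hv).1 h3
      have hb' : Y.toMat K *ᵥ (y.toMat K *ᵥ v) = b • (y.toMat K *ᵥ v) := by
        have h4 : Y * y = y * (y⁻¹ * Y * y) := by group
        rw [Matrix.mulVec_mulVec, ← SL2.toMat_mul, h4, SL2.toMat_mul, ← Matrix.mulVec_mulVec, hb,
          Matrix.mulVec_smul]
      have hab := det_eq_mul_of_eigenvectors hw ha hb'
      rw [SL2.det_toMat] at hab
      exact ⟨a, ha, by rw [hb', eq_inv_of_mul_eq_one_right hab.symm]⟩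
    obtain ⟨l', hl', hly⟩ := hfix2 X hcH hcs'
    have hll : l' = l := by
      have := hl'.symm.trans hl
      rw [← sub_eq_zero, ← sub_smul, smul_eq_zero] at this
      exact sub_eq_zero.1 (this.resolve_right hv)
    rw [hll] at hly
    have hl0 := SL2.eigenvalue_ne_zero hv hl
    refine ⟨X, SL2.trace_sq_ne_four hv hl hl2, fun g hg => ?_⟩
    have hYs := hconj (L2.mk g) (L2.mk X) hg hcH hcs'
    have hYH : L2.mk g * L2.mk X * (L2.mk g)⁻¹ ∈ H := H.mul_mem (H.mul_mem hg hcH) (H.inv_mem hg)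
    rw [← map_inv, ← map_mul, ← map_mul] at hYs hYH
    obtain ⟨a, ha, hay⟩ := hfix2 _ hYH hYs
    have htr : (g * X * g⁻¹).1.trace = X.1.trace := by
      rw [Matrix.SpecialLinearGroup.coe_mul, Matrix.trace_mul_comm,
        ← Matrix.SpecialLinearGroup.coe_mul, ← mul_assoc, inv_mul_cancel, one_mul]
    have e1 := SL2.eigenvalue_eq hv hl
    have e2 := SL2.eigenvalue_eq hv ha
    rw [htr] at e2
    have e3 : (a - l) * (a * l - 1) = 0 := by linear_combination l * e2 - a * e1
    rw [SL2.mem_invStab]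
    rcases mul_eq_zero.1 e3 with h | h
    · left
      rw [sub_eq_zero.1 h] at ha hay
      apply SL2.toMat_injective (K := K)
      refine sub_eq_zero.1 (eq_zero_of_mulVec_eq_zero hw ?_ ?_)
      · rw [Matrix.sub_mulVec, ha, hl, sub_self]
      · rw [Matrix.sub_mulVec, hay, hly, sub_self]
    · right
      have hal : a = l⁻¹ := eq_inv_of_mul_eq_one_left (sub_eq_zero.1 h)
      rw [hal] at ha hay
      apply SL2.toMat_injective (K := K)
      refine sub_eq_zero.1 (eq_zero_of_mulVec_eq_zero hw ?_ ?_)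
      · rw [Matrix.sub_mulVec, ha, SL2.toMat_inv_mulVec hl0 hl, sub_self]
      · rw [Matrix.sub_mulVec, hay, SL2.toMat_inv_mulVec (inv_ne_zero hl0) hly, sub_self]

end

/-! ### Orders of `SL₂`, its center and the tori -/

section

variable {F : Type u} [Field F]

theorem SL2.card_center_of_two_eq_zero (h : (2 : F) = 0) :
    Nat.card (Subgroup.center (SL2 F)) = 1 := by
  rw [Subgroup.card_eq_one, eq_bot_iff]
  intro a ha
  rw [SL2.mem_center_iff] at ha
  rcases ha with rfl | rfl
  · exact one_mem _
  · rw [Subgroup.mem_bot]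
    have h1 : (-1 : F) = 1 := by linear_combination -h
    ext i j
    fin_cases i <;> fin_cases j <;> simp [h1]

theorem SL2.neg_one_ne_one (h : (2 : F) ≠ 0) : (-1 : SL2 F) ≠ 1 := by
  intro e
  have := congrArg (fun g : SL2 F => g.1 0 0) e
  simp at this
  apply h
  linear_combination -this

theorem SL2.card_center_of_two_ne_zero (h : (2 : F) ≠ 0) :
    Nat.card (Subgroup.center (SL2 F)) = 2 := by
  have : ((Subgroup.center (SL2 F) : Subgroup (SL2 F)) : Set (SL2 F)) = {1, -1} := by
    ext a
    rw [SetLike.mem_coe, SL2.mem_center_iff]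
    rfl
  rw [← SetLike.coe_sort_coe, this, Nat.card_coe_set_eq, Set.ncard_pair (SL2.neg_one_ne_one h).symm]

variable [Finite F]

theorem SL2.card_eq : Nat.card (SL2 F) = Nat.card F * (Nat.card F ^ 2 - 1) := by
  classical
  have := Fintype.ofFinite F
  have h1 : Nat.card (GL (Fin 2) F) = Nat.card (SL2 F) * Nat.card Fˣ := by
    have hs : Function.Surjective (Matrix.GeneralLinearGroup.det (n := Fin 2) (R := F)) := by
      intro u
      refine ⟨Matrix.GeneralLinearGroup.mkOfDetNeZero !![(u : F), 0; 0, 1] (by simp), ?_⟩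
      ext
      simp [Matrix.GeneralLinearGroup.mkOfDetNeZero]
    have hk := (Matrix.GeneralLinearGroup.det (n := Fin 2) (R := F)).ker.card_mul_index
    rw [Subgroup.index_ker, MonoidHom.range_eq_top.2 hs, Subgroup.card_top] at hk
    rw [← hk]
    congr 1
    refine (Nat.card_congr (Equiv.ofBijective (fun g : SL2 F =>
      (⟨Matrix.SpecialLinearGroup.toGL g, by
        rw [MonoidHom.mem_ker]; ext; exact g.2⟩ :
        (Matrix.GeneralLinearGroup.det (n := Fin 2) (R := F)).ker)) ⟨?_, ?_⟩)).symm
    · intro a b hab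
      exact Matrix.SpecialLinearGroup.toGL_injective (congrArg Subtype.val hab)
    · rintro ⟨g, hg⟩
      refine ⟨⟨g.1, congrArg Units.val (MonoidHom.mem_ker.1 hg)⟩, ?_⟩
      ext; rfl
  rw [Matrix.card_GL_field, Fin.prod_univ_two, Nat.card_units, ← Nat.card_eq_fintype_card] at h1
  simp only [Fin.val_zero, pow_zero, Fin.val_one, pow_one] at h1
  have hq : 1 < Nat.card F := Finite.one_lt_card
  generalize Nat.card F = q at *
  obtain ⟨r, rfl⟩ : ∃ r, q = r + 1 := ⟨q - 1, by omega⟩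
  refine Nat.eq_of_mul_eq_mul_right (show 0 < r by omega) ?_
  simp only [Nat.add_sub_cancel] at h1
  rw [← h1, mul_comm ((r + 1) ^ 2 - 1)]
  have e : (r + 1) ^ 2 - (r + 1) = (r + 1) * r := by
    rw [sq, ← Nat.mul_sub_one]; simp
  rw [e]
  ring

theorem L2.card_comap (H : Subgroup (L2 F)) :
    Nat.card (H.comap L2.mk) = Nat.card (Subgroup.center (SL2 F)) * Nat.card H := by
  have h1 := (H.comap L2.mk).card_mul_index
  rw [Subgroup.index_comap_of_surjective _ L2.mk_surjective] at h1
  have h2 := H.card_mul_index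
  have h3 := Subgroup.card_eq_card_quotient_mul_card_subgroup (Subgroup.center (SL2 F))
  refine Nat.eq_of_mul_eq_mul_right (Nat.pos_of_ne_zero H.index_ne_zero_of_finite) ?_
  rw [h1, h3, mul_assoc, h2, mul_comm]

theorem L2.card_mul_card_center :
    Nat.card (Subgroup.center (SL2 F)) * Nat.card (L2 F) = Nat.card F * (Nat.card F ^ 2 - 1) := by
  rw [← SL2.card_eq, Subgroup.card_eq_card_quotient_mul_card_subgroup (Subgroup.center (SL2 F)),
    mul_comm]

/-- In characteristic two every element is a square. Otherwise completing the square leaves a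
nondegenerate binary form, which represents every element of a finite field. -/
theorem exists_norm_form_eq {τ : F} (hτ : τ ^ 2 ≠ 4) (c : F) :
    ∃ a b : F, a ^ 2 + τ * a * b + b ^ 2 = c := by
  classical
  have := Fintype.ofFinite F
  by_cases h2 : (2 : F) = 0
  · obtain ⟨a, ha⟩ := FiniteField.isSquare_of_char_two (F := F) (by
      have : CharP F 2 := CharTwo.of_one_ne_zero_of_two_eq_zero one_ne_zero h2
      exact ringChar.eq F 2) c
    exact ⟨a, 0, by rw [ha]; ring⟩
  · have h4 : (4 : F) ≠ 0 := by
      have : (4 : F) = 2 * 2 := by norm_num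
      rw [this]; exact mul_ne_zero h2 h2
    have hne : 1 - τ ^ 2 / 4 ≠ 0 := by
      intro h
      apply hτ
      field_simp at h
      linear_combination -h
    obtain ⟨x, b, h⟩ := FiniteField.exists_root_sum_quadratic (R := F)
      (f := Polynomial.X ^ 2 - Polynomial.C c)
      (g := Polynomial.C (1 - τ ^ 2 / 4) * Polynomial.X ^ 2)
      (Polynomial.degree_X_pow_sub_C two_pos c) (Polynomial.degree_C_mul_X_pow 2 hne)
      (FiniteField.odd_card_of_char_ne_two fun h => h2 (by
        have := ringChar.Nat.cast_ringChar (R := F)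
        rw [h] at this
        exact_mod_cast this))
    simp at h
    refine ⟨x - τ * b / 2, b, ?_⟩
    field_simp at h ⊢
    linear_combination h

/-- The centralizer of an element of `SL₂(F)`. -/
abbrev SL2.cent (X : SL2 F) : Subgroup (SL2 F) := Subgroup.centralizer {X}

omit [Finite F] in
theorem SL2.mem_cent {X g : SL2 F} : g ∈ SL2.cent X ↔ g * X = X * g := by
  rw [Subgroup.mem_centralizer_singleton_iff]

omit [Finite F] in
theorem SL2.inv_val (X : SL2 F) : (X⁻¹).1 = !![X.1 1 1, -X.1 0 1; -X.1 1 0, X.1 0 0] := by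
  rw [Matrix.SpecialLinearGroup.coe_inv, Matrix.adjugate_fin_two]

omit [Finite F] in
theorem SL2.det_val (X : SL2 F) : X.1 0 0 * X.1 1 1 - X.1 0 1 * X.1 1 0 = 1 := by
  have := X.2
  rwa [Matrix.det_fin_two] at this

omit [Finite F] in
theorem SL2.inv_ne_self {X : SL2 F} (hX : X.1.trace ^ 2 ≠ 4) : X⁻¹ ≠ X := by
  intro h
  have hv := SL2.inv_val X
  rw [h] at hv
  have h00 := congrFun (congrFun hv 0) 0
  have h01 := congrFun (congrFun hv 0) 1
  simp at h00 h01
  apply hX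
  rw [Matrix.trace_fin_two]
  have hd := SL2.det_val X
  linear_combination 4 * hd + 2 * X.1 1 0 * h01 + (X.1 0 0 - X.1 1 1) * h00

omit [Finite F] in
theorem SL2.nonscalar {X : SL2 F} (hX : X.1.trace ^ 2 ≠ 4) (c : F) : X.1 ≠ c • 1 := by
  intro h
  apply hX
  have hd := SL2.det_val X
  rw [h] at hd ⊢
  simp at hd ⊢
  linear_combination 4 * hd

/-- Every regular semisimple element is conjugate to its inverse. -/
theorem SL2.exists_conj_eq_inv {X : SL2 F} (hX : X.1.trace ^ 2 ≠ 4) :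
    ∃ y : SL2 F, y * X * y⁻¹ = X⁻¹ := by
  -- The element sought is a matrix `y` of trace zero and determinant 1 for which `y X` also has
  -- trace zero: then `y` and `y X` both have square `-1`, which says that `y` inverts `X`. Solving
  -- the linear condition reduces the quadratic one to the norm form of `X` taking the value `-1`.
  suffices h : ∃ s r w : F, s * (X.1 0 0 - X.1 1 1) + r * X.1 1 0 + w * X.1 0 1 = 0 ∧
      -s ^ 2 - r * w = 1 by
    obtain ⟨s, r, w, h1, h2⟩ := h
    refine ⟨⟨!![s, r; w, -s], by rw [Matrix.det_fin_two_of]; linear_combination h2⟩, ?_⟩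
    refine mul_inv_eq_iff_eq_mul.2 (Subtype.ext ?_)
    refine Eq.trans (Matrix.SpecialLinearGroup.coe_mul _ _)
      (Eq.trans ?_ (Matrix.SpecialLinearGroup.coe_mul _ _).symm)
    rw [SL2.inv_val]
    ext i j
    fin_cases i <;> fin_cases j <;> simp [Matrix.mul_apply, Fin.sum_univ_two]
    · linear_combination h1
    · ring
    · ring
    · linear_combination h1
  have hd := SL2.det_val X
  obtain ⟨S, w, hSw⟩ := exists_norm_form_eq hX (-1)
  rw [Matrix.trace_fin_two] at hSw
  by_cases h10 : X.1 1 0 = 0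
  · by_cases h01 : X.1 0 1 = 0
    · exact ⟨0, 1, -1, by rw [h10, h01]; ring, by ring⟩
    · refine ⟨S + X.1 0 0 * w, X.1 0 1 * w,
        -((S + X.1 0 0 * w) * (X.1 0 0 - X.1 1 1) / X.1 0 1 + w * X.1 1 0), ?_, ?_⟩
      · field_simp; ring
      · field_simp; linear_combination -w ^ 2 * hd - hSw
  · refine ⟨S + X.1 0 0 * w,
      -((S + X.1 0 0 * w) * (X.1 0 0 - X.1 1 1) / X.1 1 0 + w * X.1 0 1), X.1 1 0 * w, ?_, ?_⟩
    · field_simp; ring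
    · field_simp; linear_combination -w ^ 2 * hd - hSw

omit [Finite F] in
theorem SL2.det_linear (X : SL2 F) (a b : F) :
    (a • (1 : Matrix (Fin 2) (Fin 2) F) + b • X.1).det = a ^ 2 + X.1.trace * a * b + b ^ 2 := by
  have hd := SL2.det_val X
  rw [Matrix.det_fin_two, Matrix.trace_fin_two]
  simp
  linear_combination b ^ 2 * hd

omit [Finite F] in
theorem linear_eq_linear {A : Matrix (Fin 2) (Fin 2) F} (hA : ∀ c : F, A ≠ c • 1) {a b a' b' : F}
    (h : a • (1 : Matrix (Fin 2) (Fin 2) F) + b • A = a' • 1 + b' • A) : a = a' ∧ b = b' := by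
  have h1 : (b - b') • A = (a' - a) • (1 : Matrix (Fin 2) (Fin 2) F) := by
    rw [sub_smul, sub_smul, sub_eq_sub_iff_add_eq_add, add_comm, h, add_comm]
  have hb : b = b' := by
    by_contra hb
    apply hA ((b - b')⁻¹ * (a' - a))
    rw [mul_smul, ← h1, smul_smul, inv_mul_cancel₀ (sub_ne_zero.2 hb), one_smul]
  refine ⟨?_, hb⟩
  rw [hb, sub_self, zero_smul] at h1
  have := congrFun (congrFun h1 0) 0
  simp at this
  linear_combination this

/-- The centralizer of `X` in `GL₂` consists of the nonzero elements of the quadratic field `F[X]`,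
of which there are `q² - 1`; the determinant is the norm, which is onto `Fˣ`, so its kernel has `q +
1` elements. -/
theorem SL2.card_cent_of_irreducible {X : SL2 F} (hX : X.1.trace ^ 2 ≠ 4)
    (hirr : ∀ l : F, l ^ 2 - X.1.trace * l + 1 ≠ 0) :
    Nat.card (SL2.cent X) = Nat.card F + 1 := by
  classical
  have hns := SL2.nonscalar hX
  have hN : ∀ p : F × F, p ≠ 0 → (p.1 • (1 : Matrix (Fin 2) (Fin 2) F) + p.2 • X.1).det ≠ 0 := by
    rintro ⟨a, b⟩ hp
    rw [SL2.det_linear]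
    intro h
    by_cases hb : b = 0
    · subst hb
      apply hp
      have : a ^ 2 = 0 := by simpa using h
      simp [pow_eq_zero_iff two_ne_zero |>.1 this]
    · apply hirr (-a / b)
      dsimp only at h
      field_simp
      linear_combination h
  let Z : Subgroup (GL (Fin 2) F) :=
    Subgroup.centralizer {Matrix.SpecialLinearGroup.toGL X}
  have hZ : ∀ g : GL (Fin 2) F, g ∈ Z ↔ X.1 * g.1 = g.1 * X.1 := fun g => by
    rw [Subgroup.mem_centralizer_singleton_iff, Units.ext_iff, eq_comm]; rfl
  have hcomm : ∀ a b : F, X.1 * (a • (1 : Matrix (Fin 2) (Fin 2) F) + b • X.1) =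
      (a • (1 : Matrix (Fin 2) (Fin 2) F) + b • X.1) * X.1 := fun a b => by
    simp [mul_add, add_mul]
  have hcardZ : Nat.card Z = Nat.card F ^ 2 - 1 := by
    have e : {p : F × F // p ≠ 0} ≃ Z := Equiv.ofBijective
      (fun p => ⟨Matrix.GeneralLinearGroup.mkOfDetNeZero _ (hN p.1 p.2), by
        rw [hZ]; exact hcomm _ _⟩) ⟨by
        rintro ⟨⟨a, b⟩, hp⟩ ⟨⟨a', b'⟩, hp'⟩ h
        have h1 := congrArg (fun z : Z => z.1.1) h
        obtain ⟨h2, h3⟩ := linear_eq_linear hns h1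
        simp_all, by
        rintro ⟨g, hg⟩
        obtain ⟨a, b, hab⟩ := exists_eq_of_commute hns ((hZ g).1 hg)
        refine ⟨⟨(a, b), fun h => ?_⟩, ?_⟩
        · have ha : a = 0 := congrArg Prod.fst h
          have hb : b = 0 := congrArg Prod.snd h
          have := Matrix.GeneralLinearGroup.det_ne_zero g
          rw [hab, ha, hb] at this
          simp at this
        · apply Subtype.ext
          apply Units.ext
          exact hab.symm⟩
    rw [← Nat.card_congr e]
    have := Fintype.ofFinite F
    rw [Nat.card_eq_fintype_card, Fintype.card_subtype_compl, Fintype.card_subtype_eq,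
      Fintype.card_prod, Nat.card_eq_fintype_card, sq]
  let φ : Z →* Fˣ := Matrix.GeneralLinearGroup.det.comp Z.subtype
  have hφ : Function.Surjective φ := by
    intro u
    obtain ⟨a, b, hab⟩ := exists_norm_form_eq hX (u : F)
    have hdet := SL2.det_linear X a b
    rw [hab] at hdet
    refine ⟨⟨Matrix.GeneralLinearGroup.mkOfDetNeZero
      (a • (1 : Matrix (Fin 2) (Fin 2) F) + b • X.1) (by rw [hdet]; exact u.ne_zero), by
        rw [hZ]; exact hcomm _ _⟩, ?_⟩
    ext
    exact hdet
  have hk := φ.ker.card_mul_index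
  rw [Subgroup.index_ker, MonoidHom.range_eq_top.2 hφ, Subgroup.card_top, hcardZ, Nat.card_units]
    at hk
  have hker : Nat.card φ.ker = Nat.card (SL2.cent X) := by
    refine (Nat.card_congr (Equiv.ofBijective (fun g : SL2.cent X =>
      (⟨⟨Matrix.SpecialLinearGroup.toGL g.1, by
        rw [hZ]; exact (congrArg Subtype.val (SL2.mem_cent.1 g.2)).symm⟩, by
        rw [MonoidHom.mem_ker]; ext; exact g.1.2⟩ : φ.ker)) ⟨?_, ?_⟩)).symm
    · intro a b hab
      apply Subtype.ext
      exact Matrix.SpecialLinearGroup.toGL_injective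
        (congrArg (fun z : φ.ker => z.1.1) hab)
    · rintro ⟨⟨g, hgZ⟩, hg⟩
      refine ⟨⟨⟨g.1, congrArg Units.val (MonoidHom.mem_ker.1 hg)⟩, ?_⟩, ?_⟩
      · exact SL2.mem_cent.2 (Subtype.ext ((hZ g).1 hgZ).symm)
      · apply Subtype.ext; apply Subtype.ext; apply Units.ext; rfl
  rw [hker] at hk
  have hq : 1 < Nat.card F := Finite.one_lt_card
  generalize Nat.card F = q at *
  obtain ⟨r, rfl⟩ : ∃ r, q = r + 1 := ⟨q - 1, by omega⟩
  refine Nat.eq_of_mul_eq_mul_right (show 0 < r by omega) ?_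
  simp only [Nat.add_sub_cancel] at hk
  rw [hk]
  have : (r + 1) ^ 2 = (r + 1 + 1) * r + 1 := by ring
  rw [this, Nat.add_sub_cancel]

omit [Finite F] in
theorem SL2.card_cent_of_root {X : SL2 F} (hX : X.1.trace ^ 2 ≠ 4) {l : F}
    (hl : l ^ 2 - X.1.trace * l + 1 = 0) : Nat.card (SL2.cent X) = Nat.card F - 1 := by
  classical
  have hns := SL2.nonscalar hX
  have hl0 : l ≠ 0 := by rintro rfl; simp at hl
  have hll : l ^ 2 - 1 ≠ 0 := by
    intro h
    apply hX
    refine mul_left_cancel₀ (pow_ne_zero 2 hl0) ?_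
    linear_combination (-X.1.trace * l - l ^ 2 - 1) * hl + (l ^ 2 - 1) * h
  have htr : X.1.trace = l + l⁻¹ := by field_simp; linear_combination -hl
  rw [← Nat.card_units]
  -- The coefficients `a`, `b` interpolate: they solve `a + b * l = u` and `a + b * l⁻¹ = u⁻¹`, so
  -- `a + b X` has eigenvalues `u` and `u⁻¹`.
  have hdet : ∀ u : Fˣ, ((((u : F)⁻¹ * l ^ 2 - u) / (l ^ 2 - 1)) •
      (1 : Matrix (Fin 2) (Fin 2) F) + ((u - (u : F)⁻¹) * l / (l ^ 2 - 1)) • X.1).det = 1 := by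
    intro u
    rw [SL2.det_linear, htr]
    have := u.ne_zero
    field_simp
    ring
  refine (Nat.card_congr (Equiv.ofBijective (fun u : Fˣ => (⟨⟨_, hdet u⟩, by
    refine SL2.mem_cent.2 (Subtype.ext ?_)
    refine Eq.trans (Matrix.SpecialLinearGroup.coe_mul _ _)
      (Eq.trans ?_ (Matrix.SpecialLinearGroup.coe_mul _ _).symm)
    simp [mul_add, add_mul]⟩ : SL2.cent X)) ⟨?_, ?_⟩)).symm
  · intro u v huv
    obtain ⟨h1, h2⟩ := linear_eq_linear hns (congrArg (fun z : SL2.cent X => z.1.1) huv)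
    have e : ∀ u : Fˣ, ((u : F)⁻¹ * l ^ 2 - u) / (l ^ 2 - 1) +
        l * (((u : F) - (u : F)⁻¹) * l / (l ^ 2 - 1)) = u := fun u => by
      field_simp; ring
    ext
    rw [← e u, ← e v, h1, h2]
  · rintro ⟨g, hg⟩
    obtain ⟨a, b, hab⟩ := exists_eq_of_commute hns
      (congrArg Subtype.val (SL2.mem_cent.1 hg).symm)
    have hd := SL2.det_linear X a b
    rw [← hab, g.2, htr] at hd
    have hd' : (a + l * b) * (a + l⁻¹ * b) = 1 := by
      rw [hd]; field_simp; ring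
    refine ⟨Units.mk (a + l * b) (a + l⁻¹ * b) hd' (by rw [mul_comm]; exact hd'), ?_⟩
    apply Subtype.ext; apply Subtype.ext
    dsimp only
    rw [hab]
    have hinv : (a + l * b)⁻¹ = a + l⁻¹ * b := inv_eq_of_mul_eq_one_right hd'
    congr 2
    · rw [hinv]; field_simp; ring
    · rw [hinv]; field_simp; ring

end

/-! ### Torus normalizers and Borel subgroups: structure and depth -/

section

variable {F : Type u} [Field F]

theorem SL2.cent_le_invStab (X : SL2 F) : SL2.cent X ≤ SL2.invStab X := by
  intro g hg
  left
  exact mul_inv_eq_iff_eq_mul.2 (SL2.mem_cent.1 hg)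

theorem SL2.normal_cent (X : SL2 F) : ((SL2.cent X).subgroupOf (SL2.invStab X)).Normal := by
  refine ⟨?_⟩
  rintro ⟨n, hn⟩ hc ⟨g, hg⟩
  change g * n * g⁻¹ ∈ SL2.cent X
  have hn' : n * X = X * n := SL2.mem_cent.1 hc
  have hn'' : n * X⁻¹ = X⁻¹ * n := by
    rw [mul_inv_eq_iff_eq_mul, mul_assoc, hn', inv_mul_cancel_left]
  rw [SL2.mem_cent]
  rcases ((SL2.invStab X).inv_mem hg : g⁻¹ * X * g⁻¹⁻¹ = X ∨ g⁻¹ * X * g⁻¹⁻¹ = X⁻¹) with h | h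
  · rw [mul_inv_eq_iff_eq_mul] at h
    have h2 : g * X = X * g :=
      calc g * X = g * (X * g⁻¹) * g := by group
        _ = X * g := by rw [← h]; group
    rw [mul_assoc, h, ← mul_assoc, mul_assoc g, hn', ← mul_assoc, h2]; group
  · rw [mul_inv_eq_iff_eq_mul] at h
    have h2 : g * X⁻¹ = X * g :=
      calc g * X⁻¹ = g * (X⁻¹ * g⁻¹) * g := by group
        _ = X * g := by rw [← h]; group
    rw [mul_assoc, h, ← mul_assoc, mul_assoc g, hn'', ← mul_assoc, h2]; group

theorem SL2.card_invStab [Finite F] {X : SL2 F} (hX : X.1.trace ^ 2 ≠ 4) :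
    Nat.card (SL2.invStab X) = 2 * Nat.card (SL2.cent X) := by
  obtain ⟨y, hy⟩ := SL2.exists_conj_eq_inv hX
  have hy' : y ∈ SL2.invStab X := Or.inr hy
  have hidx : ((SL2.cent X).subgroupOf (SL2.invStab X)).index = 2 := by
    rw [Subgroup.index_eq_two_iff]
    refine ⟨⟨y, hy'⟩, ?_⟩
    rintro ⟨g, hg⟩
    rw [Subgroup.mem_subgroupOf, Subgroup.mem_subgroupOf]
    have e : ∀ b : SL2 F, b ∈ SL2.cent X ↔ b * X * b⁻¹ = X := fun b => by
      rw [SL2.mem_cent, mul_inv_eq_iff_eq_mul]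
    change Xor (g * y ∈ SL2.cent X) (g ∈ SL2.cent X)
    rw [e, e]
    have h1 : g * y * X * (g * y)⁻¹ = (g * X * g⁻¹)⁻¹ := by
      have : g * y * X * (g * y)⁻¹ = g * (y * X * y⁻¹) * g⁻¹ := by group
      rw [this, hy]; group
    rw [h1]
    have hne := SL2.inv_ne_self hX
    rcases hg with h | h <;> rw [h]
    · exact Or.inr ⟨rfl, hne⟩
    · exact Or.inl ⟨inv_inv X, hne⟩
  have h1 := ((SL2.cent X).subgroupOf (SL2.invStab X)).card_mul_index
  rw [hidx, Nat.card_congr (Subgroup.subgroupOfEquivOfLe (SL2.cent_le_invStab X)).toEquiv] at h1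
  omega

/-- The centralizer consists of polynomials in `X`, so an eigenvector of `X` over a splitting field
is a common eigenvector. The eigenvalue is a character into a field, and it is injective because `X`
is not unipotent up to sign. -/
theorem SL2.isCyclic_cent [Finite F] {X : SL2 F} (hX : X.1.trace ^ 2 ≠ 4) :
    IsCyclic (SL2.cent X) := by
  obtain ⟨K, _, _, _, hK⟩ := exists_splitting_extension F
  obtain ⟨c, hc⟩ := hK X.1.trace
  obtain ⟨v, hv, hXv⟩ := SL2.exists_eigenvector hc
  have hlin : ∀ g : SL2.cent X, ∃ a b : F, g.1.1 = a • 1 + b • X.1 := fun g =>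
    exists_eq_of_commute (SL2.nonscalar hX) (congrArg Subtype.val (SL2.mem_cent.1 g.2)).symm
  have hK' : ∀ (g : SL2.cent X) (a b : F), g.1.1 = a • 1 + b • X.1 →
      g.1.toMat K = algebraMap F K a • 1 + algebraMap F K b • X.toMat K := fun g a b h => by
    ext i j
    rw [SL2.toMat_apply, h]
    fin_cases i <;> fin_cases j <;>
      simp [SL2.toMat_apply] <;> simp [Algebra.smul_def]
  have hev : ∀ g : SL2.cent X, ∃ d : K, g.1.toMat K *ᵥ v = d • v := fun g => by
    obtain ⟨a, b, hab⟩ := hlin g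
    refine ⟨algebraMap F K a + algebraMap F K b * c, ?_⟩
    rw [hK' g a b hab, Matrix.add_mulVec, Matrix.smul_mulVec, Matrix.smul_mulVec,
      Matrix.one_mulVec, hXv, smul_smul, add_smul]
  choose χ hχ using hev
  have huniq : ∀ a b : K, a • v = b • v → a = b := fun a b h => by
    rw [← sub_eq_zero, ← sub_smul, smul_eq_zero] at h
    exact sub_eq_zero.1 (h.resolve_right hv)
  let f : SL2.cent X →* K :=
    { toFun := χ
      map_one' := by
        refine huniq _ _ ((hχ 1).symm.trans ?_)
        change (1 : SL2 F).toMat K *ᵥ v = _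
        rw [SL2.toMat_one, Matrix.one_mulVec, one_smul]
      map_mul' := fun g h => by
        refine huniq _ _ ((hχ (g * h)).symm.trans ?_)
        change (g.1 * h.1).toMat K *ᵥ v = _
        rw [SL2.toMat_mul, ← Matrix.mulVec_mulVec, hχ h, Matrix.mulVec_smul, hχ g, smul_smul,
          mul_comm] }
  refine isCyclic_of_injective_ringHom f ?_
  rw [injective_iff_map_eq_one]
  intro g hg
  have hg1 : g.1.toMat K *ᵥ v = v := by
    rw [hχ g, show χ g = 1 from hg, one_smul]
  obtain ⟨a, b, hab⟩ := hlin g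
  have hac : algebraMap F K a + algebraMap F K b * c = 1 := by
    apply huniq
    rw [one_smul, add_smul, mul_smul, ← hXv]
    rw [hK' g a b hab, Matrix.add_mulVec, Matrix.smul_mulVec, Matrix.smul_mulVec,
      Matrix.one_mulVec] at hg1
    exact hg1
  have hd := SL2.det_linear X a b
  rw [← hab, g.1.2] at hd
  have hd' := congrArg (algebraMap F K) hd
  simp only [map_one, map_add, map_mul, map_pow] at hd'
  have hX' : algebraMap F K X.1.trace ^ 2 ≠ 4 := fun h => hX
    ((algebraMap F K).injective (by rw [map_pow, h, map_ofNat]))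
  have hb : b = 0 := by
    by_contra hb
    have hb' : algebraMap F K b ≠ 0 := fun h => hb ((map_eq_zero _).1 h)
    set T := algebraMap F K X.1.trace
    set A := algebraMap F K a
    set B := algebraMap F K b
    have hA : A = 1 - B * c := by linear_combination hac
    -- Eliminating `A` from the determinant equation: an element with eigenvalue 1 has `b = 0`
    -- unless `c` is a double eigenvalue of `X`.
    have h3 : B * (T - 2 * c) = 0 := by
      rw [hA] at hd'
      linear_combination -hd' - B ^ 2 * hc
    have h4 : T = 2 * c := sub_eq_zero.1 ((mul_eq_zero.1 h3).resolve_left hb')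
    apply hX'
    rw [h4] at hc ⊢
    linear_combination -4 * hc
  apply Subtype.ext
  apply Subtype.ext
  rw [hab, hb]
  rw [hb, map_zero, zero_mul, add_zero, ← map_one (algebraMap F K)] at hac
  rw [(algebraMap F K).injective hac]
  simp

theorem L2.ker_mk : (L2.mk (F := F)).ker = Subgroup.center (SL2 F) := QuotientGroup.ker_mk' _

theorem L2.comap_map_mk {N : Subgroup (SL2 F)} (h : Subgroup.center (SL2 F) ≤ N) :
    (N.map L2.mk).comap L2.mk = N := by
  rw [Subgroup.comap_map_eq_self]
  rw [L2.ker_mk]; exact h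

theorem L2.comap_eq_of_isCoatom {M : Subgroup (L2 F)} (hM : IsCoatom M) {N : Subgroup (SL2 F)}
    (h : M.comap L2.mk ≤ N) (hN : N ≠ ⊤) : M.comap L2.mk = N :=
  ((Subgroup.isCoatom_comap_of_surjective L2.mk_surjective hM).le_iff_eq hN).1 h |>.symm

variable [Finite F]

/-- The image `C` of the torus is cyclic and normal of index two in `M`, so the bound for proper
cyclic normal subgroups applies. -/
theorem L2.card_and_depth_of_comap_eq_invStab {M : Subgroup (L2 F)} {X : SL2 F}
    (hX : X.1.trace ^ 2 ≠ 4) (hM : M.comap L2.mk = SL2.invStab X) :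
    Nat.card (Subgroup.center (SL2 F)) * Nat.card M = 2 * Nat.card (SL2.cent X) ∧
    ∃ c, Nat.card (Subgroup.center (SL2 F)) * c = Nat.card (SL2.cent X) ∧ Ω c + 1 ≤ depth M := by
  have hcard := L2.card_comap M
  rw [hM, SL2.card_invStab hX] at hcard
  refine ⟨hcard.symm, ?_⟩
  have hcen : Subgroup.center (SL2 F) ≤ SL2.cent X := Subgroup.center_le_centralizer _
  let C := (SL2.cent X).map L2.mk
  have hC : C.comap L2.mk = SL2.cent X := L2.comap_map_mk hcen
  have hCM : C ≤ M := by
    rw [← Subgroup.comap_le_comap_of_surjective L2.mk_surjective, hC, hM]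
    exact SL2.cent_le_invStab X
  have hCc := L2.card_comap C
  rw [hC] at hCc
  refine ⟨Nat.card C, hCc.symm, ?_⟩
  have hcyc := SL2.isCyclic_cent hX
  have hCcyc : IsCyclic C :=
    isCyclic_of_surjective (L2.mk.subgroupMap (SL2.cent X)) (L2.mk.subgroupMap_surjective _)
  have hC' : IsCyclic (C.subgroupOf M) :=
    isCyclic_of_injective (Subgroup.subgroupOfEquivOfLe hCM).toMonoidHom
      (Subgroup.subgroupOfEquivOfLe hCM).injective
  have hnorm : (C.subgroupOf M).Normal := by
    refine ⟨?_⟩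
    rintro ⟨n, hn⟩ hc ⟨g, hg⟩
    change g * n * g⁻¹ ∈ C
    obtain ⟨n, rfl⟩ := L2.mk_surjective n
    obtain ⟨g, rfl⟩ := L2.mk_surjective g
    have hn1 : n ∈ SL2.cent X := by rw [← hC]; exact hc
    have hg1 : g ∈ SL2.invStab X := by rw [← hM]; exact hg
    exact ⟨g * n * g⁻¹, (SL2.normal_cent X).conj_mem ⟨n, SL2.cent_le_invStab X hn1⟩ hn1 ⟨g, hg1⟩,
      by simp⟩
  have hcc : Nat.card (C.subgroupOf M) = Nat.card C :=
    Nat.card_congr (Subgroup.subgroupOfEquivOfLe hCM).toEquiv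
  rw [← hcc]
  refine cardFactors_add_one_le_depth fun htop => ?_
  rw [htop, Subgroup.card_top] at hcc
  rw [hcc] at hcard
  have := Nat.card_pos (α := SL2.cent X)
  omega

/-- The upper triangular matrices in `SL₂(F)`. -/
def SL2.borel (F : Type u) [Field F] : Subgroup (SL2 F) where
  carrier := {g | g.1 1 0 = 0}
  one_mem' := by simp
  mul_mem' {a b} := by
    intro ha hb
    simp only [Set.mem_ofPred_eq] at *
    rw [Matrix.SpecialLinearGroup.coe_mul, Matrix.mul_apply, Fin.sum_univ_two, ha, hb]
    ring
  inv_mem' {a} := by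
    intro ha
    simp only [Set.mem_ofPred_eq] at *
    rw [SL2.inv_val]
    simp [ha]

omit [Finite F] in
theorem SL2.mem_borel {g : SL2 F} : g ∈ SL2.borel F ↔ g.1 1 0 = 0 := Iff.rfl

/-- The upper triangular matrix with diagonal `a, a⁻¹` and upper right entry `b`. -/
def SL2.upper (a : Fˣ) (b : F) : SL2 F :=
  ⟨!![(a : F), b; 0, (a⁻¹ : Fˣ)], by rw [Matrix.det_fin_two_of]; simp⟩

omit [Finite F] in
theorem SL2.upper_mem (a : Fˣ) (b : F) : SL2.upper a b ∈ SL2.borel F := rfl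

/-- The diagonal character of the upper triangular group. -/
def SL2.diagChar (F : Type u) [Field F] : SL2.borel F →* Fˣ :=
  MonoidHom.toHomUnits
    { toFun := fun g => g.1.1 0 0
      map_one' := by simp
      map_mul' := fun a b => by
        have hb : b.1.1 1 0 = 0 := b.2
        rw [Subgroup.coe_mul, Matrix.SpecialLinearGroup.coe_mul, Matrix.mul_apply,
          Fin.sum_univ_two, hb]
        ring }

omit [Finite F] in
theorem SL2.diagChar_surjective : Function.Surjective (SL2.diagChar F) := fun a =>
  ⟨⟨SL2.upper a 0, SL2.upper_mem a 0⟩, by ext; rfl⟩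

omit [Finite F] in
theorem SL2.exists_upper_eq {g : SL2 F} (hg : g ∈ SL2.borel F) : ∃ a b, g = SL2.upper a b := by
  have hd := SL2.det_val g
  have h0 : g.1 1 0 = 0 := hg
  rw [h0, mul_zero, sub_zero] at hd
  refine ⟨Units.mk _ _ hd (by rw [mul_comm]; exact hd), g.1 0 1, ?_⟩
  ext i j
  fin_cases i <;> fin_cases j <;> first | rfl | exact h0

omit [Finite F] in
theorem SL2.card_ker_diagChar : Nat.card (SL2.diagChar F).ker = Nat.card F := by
  refine (Nat.card_congr (Equiv.ofBijective (fun b : F =>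
    (⟨⟨SL2.upper 1 b, SL2.upper_mem 1 b⟩, by rw [MonoidHom.mem_ker]; ext; rfl⟩ :
      (SL2.diagChar F).ker)) ⟨?_, ?_⟩)).symm
  · intro b c h
    exact congrArg (fun g : (SL2.diagChar F).ker => g.1.1.1 0 1) h
  · rintro ⟨⟨g, hg⟩, hk⟩
    obtain ⟨a, b, rfl⟩ := SL2.exists_upper_eq hg
    have h1 := congrArg Units.val (MonoidHom.mem_ker.1 hk)
    have ha : a = 1 := Units.ext h1
    subst ha
    exact ⟨b, rfl⟩

omit [Finite F] in
theorem SL2.card_borel : Nat.card (SL2.borel F) = Nat.card F * (Nat.card F - 1) := by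
  rw [← (SL2.diagChar F).ker.card_mul_index, Subgroup.index_ker,
    MonoidHom.range_eq_top.2 SL2.diagChar_surjective, Subgroup.card_top, SL2.card_ker_diagChar,
    Nat.card_units]

/-- The group maps onto the cyclic group of squares in `Fˣ`, of order `(q - 1) / gcd(q - 1, 2)`, and
the kernel contains a transvection, hence adds one. -/
theorem L2.depth_of_comap_eq_borel {M : Subgroup (L2 F)} (hM : M.comap L2.mk = SL2.borel F) :
    Ω ((Nat.card F - 1) / (Nat.card F - 1).gcd 2) + 1 ≤ depth M := by
  have hmem : ∀ g : SL2.borel F, L2.mk g.1 ∈ M := fun g => hM.ge g.2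
  let f : SL2.borel F →* M := (L2.mk.comp (SL2.borel F).subtype).codRestrict M hmem
  have hf : Function.Surjective f := by
    rintro ⟨m, hm⟩
    obtain ⟨g, rfl⟩ := L2.mk_surjective m
    exact ⟨⟨g, by rw [← hM]; exact hm⟩, rfl⟩
  -- Squaring the diagonal character makes it trivial on `-1`, so that it factors through `L₂`.
  let g : SL2.borel F →* Fˣ := (powMonoidHom 2).comp (SL2.diagChar F)
  have hker : f.ker ≤ g.ker := by
    rintro ⟨x, hx⟩ hk
    have h1 : L2.mk x = 1 := congrArg Subtype.val (MonoidHom.mem_ker.1 hk)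
    rw [MonoidHom.mem_ker]
    ext
    change x.1 0 0 ^ 2 = 1
    rcases L2.mk_eq_one_iff.1 h1 with rfl | rfl <;> simp
  let φ : M →* Fˣ := MonoidHom.liftOfSurjective f hf ⟨g, hker⟩
  have hφ : ∀ x, φ (f x) = g x := fun x =>
    MonoidHom.liftOfRightInverse_comp_apply _ _ _ _ _
  have hrange : φ.range = (powMonoidHom 2 : Fˣ →* Fˣ).range := by
    ext u
    constructor
    · rintro ⟨m, rfl⟩
      obtain ⟨x, rfl⟩ := hf m
      exact ⟨SL2.diagChar F x, (hφ x).symm⟩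
    · rintro ⟨w, rfl⟩
      obtain ⟨x, rfl⟩ := SL2.diagChar_surjective w
      exact ⟨f x, hφ x⟩
  have hcard : Nat.card φ.range = (Nat.card F - 1) / (Nat.card F - 1).gcd 2 := by
    rw [hrange, IsCyclic.card_powMonoidHom_range, Nat.card_units]
  have hd := cardFactors_card_le_depth (G := φ.range)
  have hs := depth_add_one_le_of_surjective _ φ.rangeRestrict rfl φ.rangeRestrict_surjective (by
    rw [MonoidHom.ker_rangeRestrict]
    intro hbot
    have hx : f ⟨SL2.upper 1 1, SL2.upper_mem 1 1⟩ ∈ φ.ker := by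
      rw [MonoidHom.mem_ker, hφ]
      ext
      change (1 : F) ^ 2 = 1
      simp
    rw [hbot, Subgroup.mem_bot] at hx
    have h1 : L2.mk (SL2.upper (1 : Fˣ) (1 : F)) = 1 := congrArg Subtype.val hx
    rcases L2.mk_eq_one_iff.1 h1 with h | h <;>
      · have := congrArg (fun g : SL2 F => g.1 0 1) h
        simp [SL2.upper] at this)
  rw [hcard] at hd
  omega

omit [Finite F] in
theorem SL2.exists_conj_lineStab (v : Fin 2 → F) (hv : v ≠ 0) :
    ∃ P : SL2 F, ∀ g, P * g * P⁻¹ ∈ SL2.lineStab v hv ↔ g ∈ SL2.borel F := by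
  obtain ⟨P, hP⟩ : ∃ P : SL2 F, P.1 *ᵥ ![1, 0] = v := by
    rcases vec_two_ne_zero hv with h | h
    · refine ⟨⟨!![v 0, 0; v 1, (v 0)⁻¹], by rw [Matrix.det_fin_two_of]; field_simp; ring⟩, ?_⟩
      ext i; fin_cases i <;> simp [Matrix.mulVec, dotProduct, Fin.sum_univ_two]
    · refine ⟨⟨!![v 0, -(v 1)⁻¹; v 1, 0], by rw [Matrix.det_fin_two_of]; field_simp; ring⟩, ?_⟩
      ext i; fin_cases i <;> simp [Matrix.mulVec, dotProduct, Fin.sum_univ_two]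
  refine ⟨P, fun g => ?_⟩
  rw [SL2.mem_lineStab, SL2.mem_borel]
  have h1 : (P * g * P⁻¹).1 *ᵥ v = P.1 *ᵥ (g.1 *ᵥ ![1, 0]) := by
    rw [← hP, Matrix.mulVec_mulVec, Matrix.mulVec_mulVec, ← Matrix.SpecialLinearGroup.coe_mul,
      ← Matrix.SpecialLinearGroup.coe_mul]
    rw [inv_mul_cancel_right]
  have hinj : ∀ a b : Fin 2 → F, P.1 *ᵥ a = P.1 *ᵥ b ↔ a = b := fun a b =>
    ⟨fun h => by
      have e : ∀ w, (P⁻¹).1 *ᵥ (P.1 *ᵥ w) = w := fun w => by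
        rw [Matrix.mulVec_mulVec, ← Matrix.SpecialLinearGroup.coe_mul, inv_mul_cancel,
          Matrix.SpecialLinearGroup.coe_one, Matrix.one_mulVec]
      rw [← e a, h, e], fun h => by rw [h]⟩
  constructor
  · rintro ⟨c, hc⟩
    rw [h1, ← hP, ← Matrix.mulVec_smul, hinj] at hc
    have := congrFun hc 1
    simpa [Matrix.mulVec, dotProduct, Fin.sum_univ_two] using this
  · intro hg
    refine ⟨g.1 0 0, ?_⟩
    rw [h1, ← hP, ← Matrix.mulVec_smul, hinj]
    ext i; fin_cases i <;> simp [Matrix.mulVec, dotProduct, Fin.sum_univ_two, hg]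

omit [Finite F] in
theorem SL2.card_lineStab (v : Fin 2 → F) (hv : v ≠ 0) :
    Nat.card (SL2.lineStab v hv) = Nat.card F * (Nat.card F - 1) := by
  obtain ⟨P, hP⟩ := SL2.exists_conj_lineStab v hv
  rw [← SL2.card_borel]
  refine (Nat.card_congr ((MulAut.conj P).toEquiv.subtypeEquiv fun g => ?_)).symm
  exact (hP g).symm

theorem L2.card_and_depth_of_comap_eq_lineStab {M : Subgroup (L2 F)} {v : Fin 2 → F} {hv : v ≠ 0}
    (hM : M.comap L2.mk = SL2.lineStab v hv) :
    Nat.card (Subgroup.center (SL2 F)) * Nat.card M = Nat.card F * (Nat.card F - 1) ∧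
    Ω ((Nat.card F - 1) / (Nat.card F - 1).gcd 2) + 1 ≤ depth M := by
  refine ⟨by rw [← L2.card_comap, hM, SL2.card_lineStab], ?_⟩
  obtain ⟨P, hP⟩ := SL2.exists_conj_lineStab v hv
  let e := MulAut.conj (L2.mk P)
  have h := L2.depth_of_comap_eq_borel (M := M.comap e.toMonoidHom) (by
    ext g
    rw [← hP, ← hM]
    simp [e])
  refine h.trans (le_of_eq ((depth_congr (e.subgroupMap _)).trans ?_))
  have hmap : (M.comap e.toMonoidHom).map e.toMonoidHom = M :=
    Subgroup.map_comap_eq_self_of_surjective e.surjective M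
  exact congrArg (fun N : Subgroup (L2 F) => depth N) hmap

theorem SL2.invStab_ne_top (hq : 3 ≤ Nat.card F) {X : SL2 F} (hX : X.1.trace ^ 2 ≠ 4) :
    SL2.invStab X ≠ ⊤ := by
  intro h
  have h1 := SL2.card_invStab hX
  rw [h, Subgroup.card_top, SL2.card_eq] at h1
  have h2 : Nat.card (SL2.cent X) ≤ Nat.card F + 1 := by
    by_cases hr : ∃ l : F, l ^ 2 - X.1.trace * l + 1 = 0
    · obtain ⟨l, hl⟩ := hr
      rw [SL2.card_cent_of_root hX hl]; omega
    · push Not at hr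
      exact (SL2.card_cent_of_irreducible hX hr).le
  generalize Nat.card F = q at *
  obtain ⟨r, rfl⟩ : ∃ r, q = r + 1 := ⟨q - 1, by omega⟩
  have e : (r + 1) ^ 2 - 1 = r * (r + 2) := by
    have : (r + 1) ^ 2 = r * (r + 2) + 1 := by ring
    omega
  rw [e] at h1
  nlinarith

theorem SL2.lineStab_ne_top (v : Fin 2 → F) (hv : v ≠ 0) : SL2.lineStab v hv ≠ ⊤ := by
  intro h
  have h1 := SL2.card_lineStab v hv
  rw [h, Subgroup.card_top, SL2.card_eq] at h1
  have hq : 1 < Nat.card F := Finite.one_lt_card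
  have h2 := Nat.eq_of_mul_eq_mul_left (by omega) h1
  generalize Nat.card F = q at *
  have : q * 1 < q * q := by apply Nat.mul_lt_mul_of_pos_left <;> omega
  rw [sq] at h2
  omega

end

/-! ### Additive groups of unipotents, multiplier fields, descent of square roots -/

section

variable {F : Type u} [Field F]

theorem SL2.upper_one_mul (a b : F) :
    SL2.upper 1 a * SL2.upper 1 b = SL2.upper 1 (a + b) := by
  apply Subtype.ext
  rw [Matrix.SpecialLinearGroup.coe_mul]
  ext i j
  fin_cases i <;> fin_cases j <;> simp [SL2.upper, Matrix.mul_apply, Fin.sum_univ_two, add_comm]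

theorem SL2.upper_one_zero : SL2.upper (1 : Fˣ) (0 : F) = 1 := by
  ext i j
  fin_cases i <;> fin_cases j <;> simp [SL2.upper]

theorem SL2.upper_one_inv (a : F) : (SL2.upper 1 a)⁻¹ = SL2.upper 1 (-a) := by
  rw [inv_eq_iff_mul_eq_one, SL2.upper_one_mul, add_neg_cancel, SL2.upper_one_zero]

/-- The parameters of the upper unitriangular matrices in a subgroup. -/
def SL2.unipParam (S : Subgroup (SL2 F)) : AddSubgroup F where
  carrier := {b | SL2.upper 1 b ∈ S}
  zero_mem' := by
    change SL2.upper 1 0 ∈ S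
    rw [SL2.upper_one_zero]
    exact S.one_mem
  add_mem' {a b} ha hb := by
    change SL2.upper 1 (a + b) ∈ S
    rw [← SL2.upper_one_mul]
    exact S.mul_mem ha hb
  neg_mem' {a} ha := by
    change SL2.upper 1 (-a) ∈ S
    rw [← SL2.upper_one_inv]
    exact S.inv_mem ha

theorem SL2.mem_unipParam {S : Subgroup (SL2 F)} {b : F} :
    b ∈ SL2.unipParam S ↔ SL2.upper 1 b ∈ S := Iff.rfl

/-- The multipliers of a finite additive subgroup of a field form a subfield. -/
def AddSubgroup.multipliers [Finite F] (B : AddSubgroup F) : Subfield F where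
  carrier := {x | ∀ b ∈ B, x * b ∈ B}
  mul_mem' {x y} hx hy b hb := by
    rw [mul_assoc]
    exact hx _ (hy b hb)
  one_mem' b hb := by rwa [one_mul]
  add_mem' {x y} hx hy b hb := by
    rw [add_mul]
    exact B.add_mem (hx b hb) (hy b hb)
  zero_mem' b hb := by
    rw [zero_mul]
    exact B.zero_mem
  neg_mem' {x} hx b hb := by
    rw [neg_mul]
    exact B.neg_mem (hx b hb)
  inv_mem' x hx b hb := by
    by_cases h0 : x = 0
    · rw [h0, inv_zero, zero_mul]
      exact B.zero_mem
    -- Multiplication by a nonzero multiplier is injective on a finite group, hence bijective, so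
    -- its inverse is a multiplier too.
    · have hinj : Function.Injective (fun c : B => (⟨x * c.1, hx c.1 c.2⟩ : B)) := by
        intro c d h
        exact Subtype.ext (mul_left_cancel₀ h0 (congrArg Subtype.val h))
      obtain ⟨c, hc⟩ := (Finite.injective_iff_surjective.1 hinj) ⟨b, hb⟩
      have hc' : x * c.1 = b := congrArg Subtype.val hc
      rw [← hc', inv_mul_cancel_left₀ h0]
      exact c.2

/-- In an extension of finite fields of odd degree, square roots descend. -/
theorem Subfield.mem_of_sq_mem {p k : ℕ} [Fact p.Prime] [Finite F] (hk : Odd k)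
    (hF : Nat.card F = p ^ k) (L : Subfield F) {a : F} (ha : a ^ 2 ∈ L) : a ∈ L := by
  classical
  have := Fintype.ofFinite F
  have := Fintype.ofFinite L
  have hpow : Nat.card F = Nat.card L ^ Module.finrank L F := Module.natCard_eq_pow_finrank
  set Q := Nat.card L with hQ
  set d := Module.finrank L F with hd
  -- The polynomial `X ^ Q - X` has at most `Q` roots and the elements of `L` already supply `Q`, so
  -- its roots are exactly `L`.
  have hLF : ∀ b : F, b ^ Q = b → b ∈ L := by
    intro b hb
    have h1 : 1 < Q := Finite.one_lt_card
    by_contra hbL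
    have hne : (Polynomial.X ^ Q - Polynomial.X : Polynomial F) ≠ 0 :=
      FiniteField.X_pow_card_sub_X_ne_zero F h1
    let s : Finset F := insert b ((Finset.univ : Finset L).image Subtype.val)
    have hs : s ⊆ (Polynomial.X ^ Q - Polynomial.X : Polynomial F).roots.toFinset := by
      intro c hc
      rw [Multiset.mem_toFinset, Polynomial.mem_roots hne, Polynomial.IsRoot.def]
      simp only [Polynomial.eval_sub, Polynomial.eval_pow, Polynomial.eval_X]
      rw [Finset.mem_insert] at hc
      rcases hc with rfl | hc
      · rw [hb, sub_self]
      · obtain ⟨c, -, rfl⟩ := Finset.mem_image.1 hc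
        have := FiniteField.pow_card c
        rw [← Nat.card_eq_fintype_card] at this
        rw [sub_eq_zero]
        exact_mod_cast congrArg Subtype.val this
    have hc := Finset.card_le_card hs
    have hroots : (Polynomial.X ^ Q - Polynomial.X : Polynomial F).roots.toFinset.card ≤ Q :=
      (Multiset.toFinset_card_le _).trans ((Polynomial.card_roots' _).trans
        (FiniteField.X_pow_card_sub_X_natDegree_eq F h1).le)
    rw [Finset.card_insert_of_notMem (by simpa using hbL),
      Finset.card_image_of_injective _ Subtype.val_injective, Finset.card_univ,
      ← Nat.card_eq_fintype_card] at hc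
    omega
  obtain ⟨m, hm⟩ : ∃ m, Q = p ^ m := by
    have hcp : Q ∣ p ^ k := by rw [← hF, hpow]; exact dvd_pow_self _ (by
      intro h0; rw [h0, pow_zero] at hpow; have : 1 < Nat.card F := Finite.one_lt_card; omega)
    obtain ⟨m, -, hm⟩ := (Nat.dvd_prime_pow Fact.out).1 hcp
    exact ⟨m, hm⟩
  have hodd : Odd d := by
    have hpow := hpow
    rw [hm, hF, ← pow_mul] at hpow
    have := Nat.pow_right_injective (Fact.out : p.Prime).two_le hpow
    rw [this] at hk
    exact (Nat.odd_mul.1 hk).2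
  have h2 : (a ^ Q) ^ 2 = a ^ 2 := by
    have := FiniteField.pow_card (⟨a ^ 2, ha⟩ : L)
    rw [← Nat.card_eq_fintype_card] at this
    have := congrArg Subtype.val this
    rw [← pow_mul, mul_comm, pow_mul]
    exact this
  rcases sq_eq_sq_iff_eq_or_eq_neg.1 h2 with h | h
  · exact hLF a h
  · apply hLF
    rw [h]
    -- If Frobenius negates `a`, its iterate of odd order `d` negates `a` as well; but that iterate
    -- is the identity of `F`, so `a = -a`.
    have hiter : ∀ n : ℕ, a ^ Q ^ n = (-1) ^ n * a := by
      intro n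
      induction n with
      | zero => simp
      | succ n ih =>
        rw [pow_succ Q, pow_mul, ih, mul_pow, h, ← pow_mul, mul_comm n Q, pow_mul]
        have hQ1 : (-1 : F) ^ Q = -1 := by
          rcases Nat.even_or_odd Q with he | ho
          · have h20 : (2 : F) = 0 := by
              have hp0 : (p : F) = 0 := by
                have h0 : ((Nat.card F : ℕ) : F) = 0 := by
                  rw [Nat.card_eq_fintype_card]
                  exact Nat.cast_card_eq_zero F
                rw [hF, Nat.cast_pow] at h0
                exact (pow_eq_zero_iff hk.pos.ne').1 h0
              have h2p : p = 2 := by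
                rw [hm, Nat.even_pow] at he
                exact (Fact.out : p.Prime).even_iff.1 he.1
              rw [h2p] at hp0
              exact_mod_cast hp0
            rw [he.neg_one_pow]
            linear_combination h20
          · exact ho.neg_one_pow
        rw [hQ1]; ring
    have h3 := hiter d
    rw [← hpow, Nat.card_eq_fintype_card, FiniteField.pow_card, hodd.neg_one_pow] at h3
    linear_combination -h3

end

/-! ### Groups defined over a subfield -/

section

variable {F : Type u} [Field F]

theorem SL2.upper_one_apply (b : F) : (SL2.upper 1 b).1 = !![1, b; 0, 1] := by
  simp [SL2.upper]

/-- A subgroup of `SL₂(F)` containing sufficiently many upper triangular matrices, acting on the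
orbit of infinity as a doubly transitive group, is defined over a subfield. -/
theorem SL2.exists_subfield {p k : ℕ} [Fact p.Prime] [Finite F] (hk : Odd k)
    (hF : Nat.card F = p ^ k) (S : Subgroup (SL2 F)) (h1 : SL2.upper 1 1 ∈ S)
    (h0 : ∀ s ∈ S, s.1 1 1 ≠ 0 → s.1 0 1 / s.1 1 1 ∈ SL2.unipParam S)
    (hinf : ∀ s ∈ S, s.1 1 0 ≠ 0 → s.1 0 0 / s.1 1 0 ∈ SL2.unipParam S)
    (hcard : Nat.card (SL2.unipParam S) ≤
      2 * Nat.card {c : F // ∃ s ∈ S, s.1 1 0 = 0 ∧ s.1 0 0 ^ 2 = c} + 1) :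
    ∃ L : Subfield F, Nat.card L = Nat.card (SL2.unipParam S) ∧ ∀ s ∈ S, ∀ i j, s.1 i j ∈ L := by
  classical
  set B := SL2.unipParam S with hB
  set L := B.multipliers with hL
  have hsq : ∀ s ∈ S, s.1 1 0 = 0 → s.1 0 0 ^ 2 ∈ L := by
    intro s hs hs0 b hb
    have hd := SL2.det_val s
    rw [hs0, mul_zero, sub_zero] at hd
    have e : SL2.upper 1 (s.1 0 0 ^ 2 * b) = s * SL2.upper 1 b * s⁻¹ := by
      rw [eq_mul_inv_iff_mul_eq]
      apply Subtype.ext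
      rw [Matrix.SpecialLinearGroup.coe_mul, Matrix.SpecialLinearGroup.coe_mul,
        SL2.upper_one_apply, SL2.upper_one_apply]
      ext i j
      fin_cases i <;> fin_cases j <;> simp [Matrix.mul_apply, Fin.sum_univ_two, hs0]
      linear_combination s.1 0 0 * b * hd
    rw [hB, SL2.mem_unipParam, e]
    exact S.mul_mem (S.mul_mem hs hb) (S.inv_mem hs)
  have hLB : L.toAddSubgroup ≤ B := by
    intro x hx
    have := hx 1 h1
    rwa [mul_one] at this
  -- The squares of the diagonal entries multiply `B` into itself and are nonzero, so together with
  -- 0 they give enough elements of the multiplier field.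
  have hlow : Nat.card {c : F // ∃ s ∈ S, s.1 1 0 = 0 ∧ s.1 0 0 ^ 2 = c} + 1 ≤ Nat.card L := by
    have hinj : Function.Injective (fun o : Option {c : F // ∃ s ∈ S, s.1 1 0 = 0 ∧
        s.1 0 0 ^ 2 = c} => (o.elim (0 : L) fun c => ⟨c.1, by
          obtain ⟨s, hs, hs0, hc⟩ := c.2
          rw [← hc]; exact hsq s hs hs0⟩)) := by
      have hne : ∀ c : {c : F // ∃ s ∈ S, s.1 1 0 = 0 ∧ s.1 0 0 ^ 2 = c}, c.1 ≠ 0 := by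
        rintro ⟨c, s, hs, hs0, rfl⟩ h
        have hd := SL2.det_val s
        rw [(pow_eq_zero_iff two_ne_zero).1 h, hs0] at hd
        simp at hd
      rintro (_ | c) (_ | d) h
      · rfl
      · exact absurd (congrArg Subtype.val h).symm (hne d)
      · exact absurd (congrArg Subtype.val h) (hne c)
      · exact congrArg some (Subtype.ext (congrArg (fun z : L => z.1) h))
    have := Nat.card_le_card_of_injective _ hinj
    rwa [Finite.card_option] at this
  have hLc : Nat.card L.toAddSubgroup = Nat.card L := rfl
  -- The order of `L` divides that of `B`, and the counting hypothesis makes `B` smaller than twice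
  -- `L`, so they coincide.
  have hcardeq : Nat.card L = Nat.card B := by
    obtain ⟨m, hm⟩ := AddSubgroup.card_dvd_of_le hLB
    rw [hLc] at hm
    have hpos : 0 < Nat.card B := Nat.card_pos
    have : m = 1 := by
      have hm2 : m < 2 := by
        by_contra hge
        have : Nat.card L * 2 ≤ Nat.card L * m := Nat.mul_le_mul_left _ (by omega)
        omega
      interval_cases m
      · omega
      · rfl
    rw [hm, this, mul_one]
  have hBL : ∀ b ∈ B, b ∈ L := by
    have : L.toAddSubgroup = B := AddSubgroup.eq_of_le_of_card_ge hLB (by rw [hLc, hcardeq])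
    intro b hb
    rw [← this] at hb
    exact hb
  refine ⟨L, hcardeq, fun s hs => ?_⟩
  have hd := SL2.det_val s
  suffices h : s.1 0 0 ∈ L ∧ s.1 0 1 ∈ L ∧ s.1 1 0 ∈ L ∧ s.1 1 1 ∈ L by
    intro i j
    fin_cases i <;> fin_cases j
    exacts [h.1, h.2.1, h.2.2.1, h.2.2.2]
  by_cases hc : s.1 1 0 = 0
  · rw [hc, mul_zero, sub_zero] at hd
    have ha := L.mem_of_sq_mem hk hF (hsq s hs hc)
    have hd1 : s.1 1 1 = (s.1 0 0)⁻¹ := eq_inv_of_mul_eq_one_right hd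
    have hd0 : s.1 1 1 ≠ 0 := right_ne_zero_of_mul_eq_one hd
    have hd2 : s.1 1 1 ∈ L := by rw [hd1]; exact L.inv_mem ha
    refine ⟨ha, ?_, by rw [hc]; exact L.zero_mem, hd2⟩
    rw [← div_mul_cancel₀ (s.1 0 1) hd0]
    exact L.mul_mem (hBL _ (h0 s hs hd0)) hd2
  · have he1 := hinf s hs hc
    have he2 : s.1 1 1 / s.1 1 0 ∈ B := by
      have := hinf s⁻¹ (S.inv_mem hs) (by rw [SL2.inv_val]; simpa using hc)
      rw [SL2.inv_val] at this
      have h2 := B.neg_mem this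
      simpa [div_neg] using h2
    -- Translations on both sides, chosen to make the lower right entry equal to the lower left
    -- entry `c`. The upper right entry becomes `-c⁻¹`, so the image of the point 0 is `-c⁻²`; it
    -- lies in `L`, and the square root descends.
    have hr : SL2.upper 1 (-(s.1 0 0 / s.1 1 0)) * s * SL2.upper 1 (1 - s.1 1 1 / s.1 1 0) ∈ S := by
      refine S.mul_mem (S.mul_mem (B.neg_mem he1) hs) ?_
      exact B.sub_mem h1 he2
    have hr0 := h0 _ hr
    rw [Matrix.SpecialLinearGroup.coe_mul, Matrix.SpecialLinearGroup.coe_mul,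
        SL2.upper_one_apply, SL2.upper_one_apply] at hr0
    have e11 : ((!![1, -(s.1 0 0 / s.1 1 0); 0, 1] * s.1 *
        !![1, 1 - s.1 1 1 / s.1 1 0; 0, 1] : Matrix (Fin 2) (Fin 2) F) 1 1) = s.1 1 0 := by
      simp [Matrix.mul_apply, Fin.sum_univ_two, Matrix.vecMul, dotProduct]
      field_simp
      ring
    have e01 : ((!![1, -(s.1 0 0 / s.1 1 0); 0, 1] * s.1 *
        !![1, 1 - s.1 1 1 / s.1 1 0; 0, 1] : Matrix (Fin 2) (Fin 2) F) 0 1) = -(s.1 1 0)⁻¹ := by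
      simp [Matrix.mul_apply, Fin.sum_univ_two, Matrix.vecMul, dotProduct]
      field_simp
      linear_combination -hd
    rw [e11, e01] at hr0
    have hc1 : s.1 1 0 ∈ L := by
      have h3 := L.neg_mem (hBL _ (hr0 hc))
      have h4 : -(-(s.1 1 0)⁻¹ / s.1 1 0) = (s.1 1 0)⁻¹ ^ 2 := by field_simp
      rw [h4] at h3
      have := L.inv_mem (L.mem_of_sq_mem hk hF h3)
      rwa [inv_inv] at this
    have ha : s.1 0 0 ∈ L := by
      rw [← div_mul_cancel₀ (s.1 0 0) hc]
      exact L.mul_mem (hBL _ he1) hc1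
    have hd' : s.1 1 1 ∈ L := by
      rw [← div_mul_cancel₀ (s.1 1 1) hc]
      exact L.mul_mem (hBL _ he2) hc1
    have hb : s.1 0 1 = (s.1 0 0 * s.1 1 1 - 1) / s.1 1 0 := by
      field_simp
      linear_combination -hd
    refine ⟨ha, ?_, hc1, hd'⟩
    rw [hb]
    exact L.div_mem (L.sub_mem (L.mul_mem ha hd') L.one_mem) hc1

/-- Conjugation by an invertible matrix. -/
def SL2.conjGL (P : GL (Fin 2) F) : SL2 F ≃* SL2 F where
  toFun s := ⟨P.1 * s.1 * P⁻¹.1, by rw [Matrix.det_units_conj]; exact s.2⟩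
  invFun s := ⟨P⁻¹.1 * s.1 * P.1, by rw [Matrix.det_units_conj']; exact s.2⟩
  left_inv s := by
    apply Subtype.ext
    change P⁻¹.1 * (P.1 * s.1 * P⁻¹.1) * P.1 = s.1
    rw [mul_assoc P.1, Units.inv_mul_cancel_left, mul_assoc, Units.inv_mul, mul_one]
  right_inv s := by
    apply Subtype.ext
    change P.1 * (P⁻¹.1 * s.1 * P.1) * P⁻¹.1 = s.1
    rw [mul_assoc P⁻¹.1, Units.mul_inv_cancel_left, mul_assoc, Units.mul_inv, mul_one]
  map_mul' a b := by
    apply Subtype.ext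
    change P.1 * (a * b).1 * P⁻¹.1 = (P.1 * a.1 * P⁻¹.1) * (P.1 * b.1 * P⁻¹.1)
    rw [Matrix.SpecialLinearGroup.coe_mul]
    simp only [mul_assoc, Units.inv_mul_cancel_left]

theorem SL2.conjGL_val (P : GL (Fin 2) F) (s : SL2 F) :
    (SL2.conjGL P s).1 = P.1 * s.1 * P⁻¹.1 := rfl

theorem SL2.conjGL_mulVec (P : GL (Fin 2) F) (s : SL2 F) (w : Fin 2 → F) :
    (SL2.conjGL P s).1 *ᵥ (P.1 *ᵥ w) = P.1 *ᵥ (s.1 *ᵥ w) := by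
  rw [SL2.conjGL_val, Matrix.mulVec_mulVec, Matrix.mulVec_mulVec, mul_assoc, mul_assoc,
    Units.inv_mul, mul_one]

theorem SL2.conjGL_neg (P : GL (Fin 2) F) (s : SL2 F) :
    SL2.conjGL P (-s) = -SL2.conjGL P s := by
  apply Subtype.ext
  change P.1 * (-s.1) * P⁻¹.1 = -(P.1 * s.1 * P⁻¹.1)
  rw [mul_neg, neg_mul]

theorem GL2.mulVec_ne_zero (P : GL (Fin 2) F) {w : Fin 2 → F} (hw : w ≠ 0) : P.1 *ᵥ w ≠ 0 := by
  intro h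
  apply hw
  rw [← Matrix.one_mulVec w, ← P.inv_mul, ← Matrix.mulVec_mulVec, h, Matrix.mulVec_zero]

theorem GL2.mulVec_injective (P : GL (Fin 2) F) {v w : Fin 2 → F} (h : P.1 *ᵥ v = P.1 *ᵥ w) :
    v = w := by
  rw [← Matrix.one_mulVec v, ← Matrix.one_mulVec w, ← P.inv_mul, ← Matrix.mulVec_mulVec, h,
    Matrix.mulVec_mulVec]

variable (K : Type*) [Field K] [Algebra F K]

theorem algebraMap_vec_ne_zero {v : Fin 2 → F} (hv : v ≠ 0) :
    (fun i => algebraMap F K (v i)) ≠ 0 := by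
  intro h
  apply hv
  ext i
  have := congrFun h i
  simpa using this

/-- The point of the projective line over `K` spanned by a vector over `F`. -/
def ratPt (v : Fin 2 → F) (hv : v ≠ 0) : ℙ K (Fin 2 → K) :=
  Projectivization.mk K (fun i => algebraMap F K (v i)) (algebraMap_vec_ne_zero K hv)

variable {K}

theorem ratPt_eq_iff {v w : Fin 2 → F} (hv : v ≠ 0) (hw : w ≠ 0) :
    ratPt K v hv = ratPt K w hw ↔ wedge v w = 0 := by
  rw [ratPt, ratPt, mk_eq_mk_iff_wedge]
  unfold wedge
  rw [← map_mul, ← map_mul, ← map_sub, map_eq_zero]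

theorem SL2.mulVec_ne_zero (g : SL2 F) {v : Fin 2 → F} (hv : v ≠ 0) : g.1 *ᵥ v ≠ 0 :=
  SL2.toMat_mulVec_ne_zero (K := F) g hv

theorem L2.mk_smul_ratPt (g : SL2 F) {v : Fin 2 → F} (hv : v ≠ 0) :
    L2.mk g • ratPt K v hv = ratPt K (g.1 *ᵥ v) (SL2.mulVec_ne_zero g hv) := by
  unfold ratPt
  rw [L2.mk_smul_mk]
  congr 1
  exact SL2.toMat_mulVec_rational g v

theorem L2.mem_unip_ratPt {h : L2 F} {v : Fin 2 → F} (hv : v ≠ 0) :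
    h ∈ L2.unip F (ratPt K v hv) ↔ ∃ g : SL2 F, g.1 *ᵥ v = v ∧ L2.mk g = h := by
  unfold ratPt
  rw [L2.mem_unip_iff]
  refine exists_congr fun g => and_congr_left fun _ => ?_
  rw [SL2.toMat_mulVec_rational]
  constructor
  · intro h
    ext i
    exact (algebraMap F K).injective (congrFun h i)
  · intro h
    rw [h]

end

/-! ### From an orbit of length `Q + 1` to a subfield of order `Q` -/

section

variable {F : Type u} [Field F]

/-- The conjugate by `P` of the special linear group over a subfield. -/
def SL2.subfieldSL (P : GL (Fin 2) F) (L : Subfield F) : Subgroup (SL2 F) :=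
  (Matrix.SpecialLinearGroup.map (n := Fin 2) L.subtype).range.map (SL2.conjGL P).toMonoidHom

theorem SL2.conjGL_mem_subfieldSL {P : GL (Fin 2) F} {L : Subfield F} {s : SL2 F}
    (hs : ∀ i j, s.1 i j ∈ L) : SL2.conjGL P s ∈ SL2.subfieldSL P L := by
  refine ⟨s, ⟨⟨Matrix.of fun i j => ⟨s.1 i j, hs i j⟩, ?_⟩, ?_⟩, rfl⟩
  · apply Subtype.ext
    have := SL2.det_val s
    rw [Matrix.det_fin_two]
    exact this
  · ext i j
    rfl

theorem SL2.eq_upper_one {s : SL2 F} (h : s.1 *ᵥ ![1, 0] = ![1, 0]) :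
    s = SL2.upper 1 (s.1 0 1) := by
  have h0 := congrFun h 0
  have h1 := congrFun h 1
  simp [Matrix.mulVec, dotProduct, Fin.sum_univ_two] at h0 h1
  have hd := SL2.det_val s
  rw [h0, h1] at hd
  apply Subtype.ext
  rw [SL2.upper_one_apply]
  ext i j
  fin_cases i <;> fin_cases j <;> simp [h0, h1]
  linear_combination hd

/-- If `g` fixes an irrational vector then the matrix `g - 1` over `F` kills it and is zero. -/
theorem exists_rational_of_mem_unip {K : Type*} [Field K] [Algebra F K] {x : ℙ K (Fin 2 → K)}
    {h : L2 F} (hh : h ∈ L2.unip F x) (h1 : h ≠ 1) :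
    ∃ (v : Fin 2 → F) (hv : v ≠ 0), x = ratPt K v hv := by
  induction x using Projectivization.ind with
  | h v hv =>
    obtain ⟨g, hg, rfl⟩ := (L2.mem_unip_iff hv).1 hh
    rcases rational_or_eq_zero (F := F) hv with ⟨v₀, hv₀, c, hc, rfl⟩ | hz
    · refine ⟨v₀, hv₀, ?_⟩
      unfold ratPt
      rw [Projectivization.mk_eq_mk_iff']
      exact ⟨c, rfl⟩
    · exfalso
      apply h1
      have : g.1 - 1 = 0 := hz _ (by
        have e : (g.1 - 1).map (algebraMap F K) = g.toMat K - 1 := by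
          ext i j
          fin_cases i <;> fin_cases j <;> simp [SL2.toMat_apply]
        rw [e, Matrix.sub_mulVec, hg, Matrix.one_mulVec, sub_self])
      rw [show g = 1 from Subtype.ext (sub_eq_zero.1 this), map_one]

theorem exists_GL2_frame {v w : Fin 2 → F} (h : wedge v w ≠ 0) :
    ∃ P : GL (Fin 2) F, P.1 *ᵥ ![1, 0] = v ∧ P.1 *ᵥ ![0, 1] = w := by
  refine ⟨Matrix.GeneralLinearGroup.mkOfDetNeZero !![v 0, w 0; v 1, w 1] ?_, ?_, ?_⟩
  · rw [Matrix.det_fin_two_of]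
    intro e
    apply h
    unfold wedge
    linear_combination e
  · ext i; fin_cases i <;>
      simp [Matrix.GeneralLinearGroup.mkOfDetNeZero, Matrix.mulVec, dotProduct, Fin.sum_univ_two]
  · ext i; fin_cases i <;>
      simp [Matrix.GeneralLinearGroup.mkOfDetNeZero, Matrix.mulVec, dotProduct, Fin.sum_univ_two]

theorem GL2.wedge_ne_zero (P : GL (Fin 2) F) : wedge (P.1 *ᵥ ![1, 0]) (P.1 *ᵥ ![0, 1]) ≠ 0 := by
  rw [wedge_mulVec]
  refine mul_ne_zero (Matrix.GeneralLinearGroup.det_ne_zero P) ?_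
  simp [wedge]

theorem GL2.wedge_eq_zero_iff (P : GL (Fin 2) F) (v w : Fin 2 → F) :
    wedge (P.1 *ᵥ v) (P.1 *ᵥ w) = 0 ↔ wedge v w = 0 := by
  rw [wedge_mulVec, mul_eq_zero, or_iff_right (Matrix.GeneralLinearGroup.det_ne_zero P)]

/-- The frame in which a group with unipotent elements contains the standard transvection. -/
theorem L2.exists_frame {K : Type*} [Field K] [Algebra F K] (H : Subgroup (L2 F))
    (x : ℙ K (Fin 2 → K)) {h g : L2 F} (hh : h ∈ L2.unip F x) (hhH : h ∈ H) (h1 : h ≠ 1)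
    (hgH : g ∈ H) (hg : g • x ≠ x) :
    ∃ P : GL (Fin 2) F, L2.mk (SL2.conjGL P (SL2.upper 1 1)) ∈ H ∧
      ∃ h0 h1, x = ratPt K (P.1 *ᵥ ![1, 0]) h0 ∧
        g • x = ratPt K (P.1 *ᵥ ![0, 1]) h1 := by
  obtain ⟨v, hv, rfl⟩ := exists_rational_of_mem_unip hh h1
  obtain ⟨g, rfl⟩ := L2.mk_surjective g
  obtain ⟨r, hr, rfl⟩ := (L2.mem_unip_ratPt hv).1 hh
  rw [L2.mk_smul_ratPt, Ne, eq_comm, ratPt_eq_iff] at hg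
  set w := g.1 *ᵥ v with hw
  have hrw : wedge v (r.1 *ᵥ w) = wedge v w := by
    conv_lhs => rw [← hr]
    rw [wedge_mulVec, r.2, one_mul]
  -- The unipotent `r` moves `w` by a multiple `c v` of the fixed vector, so in the basis `c v`, `w`
  -- it becomes the standard transvection.
  obtain ⟨c, hc⟩ := exists_eq_smul_of_wedge_eq_zero (w := r.1 *ᵥ w - w) hv (by
    unfold wedge at hrw ⊢
    simp only [Pi.sub_apply]
    linear_combination hrw)
  have hc0 : c ≠ 0 := by
    rintro rfl
    rw [zero_smul] at hc
    apply h1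
    have : r.1 - 1 = 0 := eq_zero_of_mulVec_eq_zero hg
      (by rw [Matrix.sub_mulVec, hr, Matrix.one_mulVec, sub_self])
      (by rw [Matrix.sub_mulVec, Matrix.one_mulVec, hc])
    rw [show r = 1 from Subtype.ext (sub_eq_zero.1 this), map_one]
  have hcw : wedge (c • v) w ≠ 0 := by
    have : wedge (c • v) w = c * wedge v w := by simp [wedge]; ring
    rw [this]
    exact mul_ne_zero hc0 hg
  obtain ⟨P, hP0, hP1⟩ := exists_GL2_frame hcw
  have hPr : SL2.conjGL P (SL2.upper 1 1) = r := by
    apply Subtype.ext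
    refine sub_eq_zero.1 (eq_zero_of_mulVec_eq_zero (GL2.wedge_ne_zero P) ?_ ?_)
    · rw [Matrix.sub_mulVec, SL2.conjGL_mulVec, SL2.upper_one_apply]
      have : (!![1, 1; 0, 1] : Matrix (Fin 2) (Fin 2) F) *ᵥ ![1, 0] = ![1, 0] := by
        ext i; fin_cases i <;> simp [Matrix.mulVec, dotProduct, Fin.sum_univ_two]
      rw [this, hP0, Matrix.mulVec_smul, hr, sub_self]
    · rw [Matrix.sub_mulVec, SL2.conjGL_mulVec, SL2.upper_one_apply]
      have : (!![1, 1; 0, 1] : Matrix (Fin 2) (Fin 2) F) *ᵥ ![0, 1] = ![1, 0] + ![0, 1] := by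
        ext i; fin_cases i <;> simp [Matrix.mulVec, dotProduct, Fin.sum_univ_two]
      rw [this, Matrix.mulVec_add, hP0, hP1, ← hc]
      abel
  refine ⟨P, by rw [hPr]; exact hhH, GL2.mulVec_ne_zero P (by intro h; simpa using congrFun h 0),
    GL2.mulVec_ne_zero P (by intro h; simpa using congrFun h 1), ?_, ?_⟩
  · rw [ratPt_eq_iff, hP0, wedge_smul_right, wedge_self, mul_zero]
  · rw [L2.mk_smul_ratPt, ratPt_eq_iff, hP1, wedge_self]

open MulAction

/-- In a suitable frame the orbit of `x` is infinity together with the additive group of unipotent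
parameters, because `U x` is regular on the rest. The stabilizer bound supplies enough diagonal
entries for the multiplier field to fill that group. -/
theorem L2.exists_subfield_of_orbit {p k : ℕ} [Fact p.Prime] [Finite F] (hk : Odd k)
    (hF : Nat.card F = p ^ k) {K : Type*} [Field K] [Algebra F K] [Finite K] (H : Subgroup (L2 F))
    (hU : IsPolarAction H (ℙ K (Fin 2 → K)) fun x => (L2.unip F x).subgroupOf H)
    (x : ℙ K (Fin 2 → K)) (hQ : 3 ≤ Nat.card ((L2.unip F x).subgroupOf H))
    (ho : Nat.card (orbit H x) = Nat.card ((L2.unip F x).subgroupOf H) + 1)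
    (hs : Nat.card ((L2.unip F x).subgroupOf H) * (Nat.card ((L2.unip F x).subgroupOf H) - 1) ≤
      2 * Nat.card (stabilizer H x)) :
    ∃ (P : GL (Fin 2) F) (L : Subfield F), Nat.card L = Nat.card ((L2.unip F x).subgroupOf H) ∧
      H.comap L2.mk ≤ SL2.subfieldSL P L := by
  classical
  have hfin : Finite (ℙ K (Fin 2 → K)) := Quotient.finite _
  obtain ⟨⟨⟨h, hhH⟩, hh⟩, h1⟩ : ∃ u : (L2.unip F x).subgroupOf H, u ≠ 1 :=
    have : Nontrivial ((L2.unip F x).subgroupOf H) :=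
      Finite.one_lt_card_iff_nontrivial.1 (by omega)
    exists_ne 1
  have h1' : h ≠ 1 := fun e => h1 (Subtype.ext (Subtype.ext e))
  have hh' : h ∈ L2.unip F x := hh
  obtain ⟨g, hgH, hg⟩ : ∃ g ∈ H, g • x ≠ x := by
    have : Nontrivial (orbit H x) := Finite.one_lt_card_iff_nontrivial.1 (by omega)
    obtain ⟨⟨y, ⟨g, hg, rfl⟩⟩, hne⟩ := exists_ne (⟨x, mem_orbit_self x⟩ : orbit H x)
    exact ⟨g, g.2, fun e => hne (Subtype.ext e)⟩
  obtain ⟨P, hP, hv0, hv1, hx, hy⟩ := L2.exists_frame H x hh' hhH h1' hgH hg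
  have he0 : (![1, 0] : Fin 2 → F) ≠ 0 := by intro h; simpa using congrFun h 0
  have he1 : (![0, 1] : Fin 2 → F) ≠ 0 := by intro h; simpa using congrFun h 1
  let S : Subgroup (SL2 F) := (H.comap L2.mk).comap (SL2.conjGL P).toMonoidHom
  have hS : ∀ s, s ∈ S ↔ L2.mk (SL2.conjGL P s) ∈ H := fun s => Iff.rfl
  have hsurj : ∀ g : SL2 F, ∃ s, SL2.conjGL P s = g := (SL2.conjGL P).surjective
  have hact : ∀ (s : SL2 F) (w : Fin 2 → F) (hw : w ≠ 0),
      L2.mk (SL2.conjGL P s) • ratPt K (P.1 *ᵥ w) (GL2.mulVec_ne_zero P hw) =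
        ratPt K (P.1 *ᵥ (s.1 *ᵥ w)) (GL2.mulVec_ne_zero P (SL2.mulVec_ne_zero s hw)) := by
    intro s w hw
    rw [L2.mk_smul_ratPt]
    congr 1
    exact SL2.conjGL_mulVec P s w
  have hpt : ∀ (v w : Fin 2 → F) (hv : v ≠ 0) (hw : w ≠ 0),
      ratPt K (P.1 *ᵥ v) (GL2.mulVec_ne_zero P hv) = ratPt K (P.1 *ᵥ w) (GL2.mulVec_ne_zero P hw) ↔
        wedge v w = 0 := by
    intro v w hv hw
    rw [ratPt_eq_iff, GL2.wedge_eq_zero_iff]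
  have hunip : ∀ s : SL2 F, s.1 *ᵥ ![1, 0] = ![1, 0] → L2.mk (SL2.conjGL P s) ∈ L2.unip F x := by
    intro s hs
    rw [hx, L2.mem_unip_ratPt]
    exact ⟨_, by rw [SL2.conjGL_mulVec, hs], rfl⟩
  have hunip' : ∀ k ∈ L2.unip F x, ∃ b : F, L2.mk (SL2.conjGL P (SL2.upper 1 b)) = k := by
    intro k hk
    rw [hx, L2.mem_unip_ratPt] at hk
    obtain ⟨g, hg, rfl⟩ := hk
    obtain ⟨s, rfl⟩ := hsurj g
    rw [SL2.conjGL_mulVec] at hg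
    rw [SL2.eq_upper_one (GL2.mulVec_injective P hg)]
    exact ⟨_, rfl⟩
  have hupe : ∀ b : F, (SL2.upper 1 b).1 *ᵥ ![1, 0] = ![1, 0] := by
    intro b
    rw [SL2.upper_one_apply]
    ext i; fin_cases i <;> simp [Matrix.mulVec, dotProduct, Fin.sum_univ_two]
  have horb : ∀ (z : Fin 2 → F) (hz : z ≠ 0),
      ratPt K (P.1 *ᵥ z) (GL2.mulVec_ne_zero P hz) ∈ orbit H x → z 1 ≠ 0 →
      z 0 / z 1 ∈ SL2.unipParam S := by
    intro z hz hzo hz1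
    obtain ⟨u, hu, huy⟩ := hU.exists_smul_eq_of_card_orbit ho (y := g • x)
      ⟨⟨g, hgH⟩, rfl⟩ hg hzo (by
        conv_rhs => rw [hx]
        rw [Ne, hpt _ _ hz he0]
        simpa [wedge] using hz1)
    obtain ⟨b, hb⟩ := hunip' u.1 hu
    have huy' : u.1 • (g • x) = ratPt K (P.1 *ᵥ z) (GL2.mulVec_ne_zero P hz) := huy
    rw [hy, ← hb, hact _ _ he1, hpt _ _ (SL2.mulVec_ne_zero _ he1) hz, SL2.upper_one_apply] at huy'
    have hbz : z 0 / z 1 = b := by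
      rw [div_eq_iff hz1]
      simp [wedge, Matrix.mulVec, dotProduct, Fin.sum_univ_two] at huy'
      linear_combination -huy'
    rw [hbz, SL2.mem_unipParam, hS, hb]
    exact u.2
  have horbx : ∀ s ∈ S, ∀ (w : Fin 2 → F) (hw : w ≠ 0),
      ratPt K (P.1 *ᵥ w) (GL2.mulVec_ne_zero P hw) ∈ orbit H x →
      ratPt K (P.1 *ᵥ (s.1 *ᵥ w)) (GL2.mulVec_ne_zero P (SL2.mulVec_ne_zero s hw)) ∈ orbit H x := by
    intro s hs w hw hwo
    rw [← hact s w hw]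
    obtain ⟨c, hc⟩ := hwo
    exact ⟨⟨_, hs⟩ * c, (mul_smul _ _ _).trans (congrArg _ hc)⟩
  have hcardU : Nat.card (SL2.unipParam S) = Nat.card ((L2.unip F x).subgroupOf H) := by
    refine Nat.card_congr (Equiv.ofBijective (fun b : SL2.unipParam S =>
      (⟨⟨L2.mk (SL2.conjGL P (SL2.upper 1 b.1)), b.2⟩, hunip _ (hupe _)⟩ :
        (L2.unip F x).subgroupOf H)) ⟨?_, ?_⟩)
    · rintro ⟨b, hb⟩ ⟨c, hc⟩ hbc
      have h2 : L2.mk (SL2.conjGL P (SL2.upper 1 b)) = L2.mk (SL2.conjGL P (SL2.upper 1 c)) :=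
        congrArg (fun u : (L2.unip F x).subgroupOf H => u.1.1) hbc
      apply Subtype.ext
      rw [L2.mk_eq_mk_iff, ← SL2.conjGL_neg] at h2
      rcases h2 with h2 | h2
      · exact congrArg (fun s : SL2 F => s.1 0 1) ((SL2.conjGL P).injective h2)
      · have h3 := (SL2.conjGL P).injective h2
        have h4 : (SL2.upper 1 b).1 = -(SL2.upper 1 c).1 := congrArg Subtype.val h3
        rw [SL2.upper_one_apply, SL2.upper_one_apply] at h4
        have h5 := congrFun (congrFun h4 0) 1
        replace h4 := congrFun (congrFun h4 0) 0
        simp at h4 h5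
        change b = c
        rw [h5, ← neg_one_mul, ← h4, one_mul]
    · rintro ⟨⟨u, huH⟩, hu⟩
      obtain ⟨b, rfl⟩ := hunip' u hu
      exact ⟨⟨b, huH⟩, rfl⟩
  let T := {c : F // ∃ s ∈ S, s.1 1 0 = 0 ∧ s.1 0 0 ^ 2 = c}
  -- A stabilizer element is determined modulo `U x` by the square of its diagonal entry, the square
  -- taking care of the sign of the lift.
  have hstab : Nat.card (stabilizer H x) ≤ Nat.card T * Nat.card ((L2.unip F x).subgroupOf H) := by
    have hex : ∀ k : stabilizer H x, ∃ s ∈ S, s.1 1 0 = 0 ∧ L2.mk (SL2.conjGL P s) = k.1.1 := by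
      rintro ⟨⟨k, hkH⟩, hkx⟩
      obtain ⟨g, rfl⟩ := L2.mk_surjective k
      obtain ⟨s, rfl⟩ := hsurj g
      refine ⟨s, hkH, ?_, rfl⟩
      have hkx' : L2.mk (SL2.conjGL P s) • x = x := hkx
      rw [hx, hact _ _ he0, hpt _ _ (SL2.mulVec_ne_zero _ he0) he0] at hkx'
      simpa [wedge, Matrix.mulVec, dotProduct, Fin.sum_univ_two] using hkx'
    choose sec hsecS hsec0 hsec using hex
    let t : stabilizer H x → T := fun k => ⟨(sec k).1 0 0 ^ 2, sec k, hsecS k, hsec0 k, rfl⟩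
    have hdiff : ∀ k l : stabilizer H x, t k = t l → k⁻¹.1 * l.1 ∈ (L2.unip F x).subgroupOf H := by
      intro k l hkl
      have hkl' : (sec k).1 0 0 ^ 2 = (sec l).1 0 0 ^ 2 := congrArg Subtype.val hkl
      have e : (k.1⁻¹ * l.1).1 = L2.mk (SL2.conjGL P ((sec k)⁻¹ * sec l)) := by
        rw [map_mul, map_inv, map_mul, map_inv, hsec, hsec]
        rfl
      change (k.1⁻¹ * l.1).1 ∈ L2.unip F x
      rw [e]
      have hdk := SL2.det_val (sec k)
      rw [hsec0, mul_zero, sub_zero] at hdk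
      have hv : ((sec k)⁻¹ * sec l).1 *ᵥ ![1, 0] = ![(sec k).1 1 1 * (sec l).1 0 0, 0] := by
        rw [Matrix.SpecialLinearGroup.coe_mul, SL2.inv_val]
        ext i; fin_cases i <;>
          simp [Matrix.mulVec, dotProduct, Fin.sum_univ_two, Matrix.mul_apply, hsec0]
      rcases sq_eq_sq_iff_eq_or_eq_neg.1 hkl' with h | h
      · refine hunip _ ?_
        rw [hv, ← h, mul_comm, hdk]
      · rw [← L2.mk_neg, ← SL2.conjGL_neg]
        refine hunip _ ?_
        have : (-((sec k)⁻¹ * sec l)).1 = -((sec k)⁻¹ * sec l).1 := rfl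
        rw [this, Matrix.neg_mulVec, hv]
        rw [h] at hdk
        ext i; fin_cases i <;> simp
        linear_combination hdk
    have hne : Nonempty (stabilizer H x) := ⟨1⟩
    have hti : ∀ k, t (Function.invFun t (t k)) = t k := fun k => Function.invFun_eq ⟨k, rfl⟩
    rw [← Nat.card_prod]
    refine Nat.card_le_card_of_injective (fun k =>
      ((t k, ⟨_, hdiff _ _ (hti k)⟩) : T × (L2.unip F x).subgroupOf H)) ?_
    intro k l hkl
    have h2 : t k = t l := congrArg Prod.fst hkl
    have h3 := congrArg (fun z : T × (L2.unip F x).subgroupOf H => z.2.1) hkl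
    dsimp only at h3
    rw [h2] at h3
    exact Subtype.ext (mul_left_cancel h3)
  obtain ⟨L, hL, hLS⟩ := SL2.exists_subfield hk hF S hP
    (fun s hs hs1 => by
      have h2 := horbx s hs _ he1 (by rw [← hy]; exact ⟨⟨g, hgH⟩, rfl⟩)
      have e : s.1 *ᵥ ![0, 1] = ![s.1 0 1, s.1 1 1] := by
        ext i; fin_cases i <;> simp [Matrix.mulVec, dotProduct, Fin.sum_univ_two]
      have h3 := horb _ (SL2.mulVec_ne_zero s he1) h2 (by rw [e]; exact hs1)
      rw [e] at h3
      exact h3)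
    (fun s hs hs1 => by
      have h2 := horbx s hs _ he0 (by rw [← hx]; exact mem_orbit_self x)
      have e : s.1 *ᵥ ![1, 0] = ![s.1 0 0, s.1 1 0] := by
        ext i; fin_cases i <;> simp [Matrix.mulVec, dotProduct, Fin.sum_univ_two]
      have h3 := horb _ (SL2.mulVec_ne_zero s he0) h2 (by rw [e]; exact hs1)
      rw [e] at h3
      exact h3)
    (by
      rw [hcardU]
      change _ ≤ 2 * Nat.card T + 1
      set Q := Nat.card ((L2.unip F x).subgroupOf H)
      have h2 : Q * (Q - 1) ≤ Q * (2 * Nat.card T) := by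
        calc Q * (Q - 1) ≤ 2 * Nat.card (stabilizer H x) := hs
          _ ≤ 2 * (Nat.card T * Q) := by omega
          _ = Q * (2 * Nat.card T) := by ring
      have h3 := Nat.le_of_mul_le_mul_left h2 (by omega)
      omega)
  refine ⟨P, L, hL.trans hcardU, fun g hg => ?_⟩
  obtain ⟨s, rfl⟩ := hsurj g
  exact SL2.conjGL_mem_subfieldSL (hLS s hg)

end

/-! ### Subfield subgroups, and subfields of finite fields -/

section

variable {F : Type u} [Field F]

theorem SL2.subfieldSL_mono (P : GL (Fin 2) F) {L L' : Subfield F} (h : L ≤ L') :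
    SL2.subfieldSL P L ≤ SL2.subfieldSL P L' := by
  rintro _ ⟨_, ⟨s, rfl⟩, rfl⟩
  exact SL2.conjGL_mem_subfieldSL fun i j => h (s.1 i j).2

theorem SL2.center_le_subfieldSL (P : GL (Fin 2) F) (L : Subfield F) :
    Subgroup.center (SL2 F) ≤ SL2.subfieldSL P L := by
  intro a ha
  rcases SL2.mem_center_iff.1 ha with rfl | rfl
  · exact one_mem _
  · refine ⟨-1, ⟨-1, ?_⟩, ?_⟩
    · ext i j; fin_cases i <;> fin_cases j <;> simp
    · change SL2.conjGL P (-1) = -1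
      rw [SL2.conjGL_neg, map_one]

/-- The embedding of the projective special linear group of a subfield. -/
theorem L2.subfield_equiv (P : GL (Fin 2) F) (L : Subfield F) :
    Nonempty (L2 L ≃* (SL2.subfieldSL P L).map L2.mk) := by
  let φ : SL2 L →* L2 F := (L2.mk.comp (SL2.conjGL P).toMonoidHom).comp
    (Matrix.SpecialLinearGroup.map (n := Fin 2) L.subtype)
  have hinj : Function.Injective (Matrix.SpecialLinearGroup.map (n := Fin 2) L.subtype) := by
    intro a b h
    ext i j
    exact congrArg (fun s : SL2 F => s.1 i j) h
  have hker : φ.ker = Subgroup.center (SL2 L) := by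
    ext s
    rw [MonoidHom.mem_ker, SL2.mem_center_iff]
    change L2.mk (SL2.conjGL P (Matrix.SpecialLinearGroup.map (n := Fin 2) L.subtype s)) = 1 ↔ _
    rw [L2.mk_eq_one_iff]
    have h1 : (-1 : SL2 F) = SL2.conjGL P (Matrix.SpecialLinearGroup.map (n := Fin 2) L.subtype
        (-1)) := by
      have : Matrix.SpecialLinearGroup.map (n := Fin 2) L.subtype (-1) = (-1 : SL2 F) := by
        ext i j; fin_cases i <;> fin_cases j <;> simp
      rw [this, SL2.conjGL_neg, map_one]
    rw [h1, (SL2.conjGL P).injective.eq_iff, hinj.eq_iff, ← map_one (SL2.conjGL P),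
      (SL2.conjGL P).injective.eq_iff, ← map_one (Matrix.SpecialLinearGroup.map (n := Fin 2)
      L.subtype), hinj.eq_iff]
  have hrange : φ.range = (SL2.subfieldSL P L).map L2.mk := by
    rw [MonoidHom.range_comp, SL2.subfieldSL, Subgroup.map_map]
  exact ⟨(QuotientGroup.quotientMulEquivOfEq hker.symm).trans
    ((QuotientGroup.quotientKerEquivRange φ).trans (MulEquiv.subgroupCongr hrange))⟩

theorem SL2.subfieldSL_eq_top {P : GL (Fin 2) F} {L : Subfield F} (h : SL2.subfieldSL P L = ⊤) :
    L = ⊤ := by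
  rw [eq_top_iff]
  intro b _
  obtain ⟨_, ⟨s, rfl⟩, hs⟩ : SL2.conjGL P (SL2.upper 1 b) ∈ SL2.subfieldSL P L := by
    rw [h]; exact Subgroup.mem_top _
  have h1 := congrArg (fun s : SL2 F => s.1 0 1) ((SL2.conjGL P).injective hs)
  have h2 : ((s.1 0 1 : L) : F) = b := h1
  rw [← h2]
  exact (s.1 0 1).2

/-- The subfield group is proper, so maximality turns the inclusion into an equality. -/
theorem L2.nonempty_equiv_of_isCoatom {M : Subgroup (L2 F)} (hM : IsCoatom M)
    {P : GL (Fin 2) F} {L : Subfield F} (hL : L ≠ ⊤) (hle : M.comap L2.mk ≤ SL2.subfieldSL P L) :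
    Nonempty (L2 L ≃* M) := by
  have heq := L2.comap_eq_of_isCoatom hM hle fun h => hL (SL2.subfieldSL_eq_top h)
  obtain ⟨e⟩ := L2.subfield_equiv P L
  have hmap : (SL2.subfieldSL P L).map L2.mk = M := by
    rw [← heq, Subgroup.map_comap_eq_self_of_surjective L2.mk_surjective]
  exact ⟨e.trans (MulEquiv.subgroupCongr hmap)⟩

theorem L2.equiv_of_ringEquiv {F' : Type*} [Field F'] (e : F ≃+* F') :
    Nonempty (L2 F ≃* L2 F') := by
  let φ : SL2 F →* L2 F' := L2.mk.comp (Matrix.SpecialLinearGroup.map (n := Fin 2) e.toRingHom)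
  have hker : φ.ker = Subgroup.center (SL2 F) := by
    ext s
    rw [MonoidHom.mem_ker, SL2.mem_center_iff]
    change L2.mk (Matrix.SpecialLinearGroup.map (n := Fin 2) e.toRingHom s) = 1 ↔ _
    rw [L2.mk_eq_one_iff]
    have hinj : Function.Injective (Matrix.SpecialLinearGroup.map (n := Fin 2) e.toRingHom) := by
      intro a b h
      ext i j
      exact e.injective (congrArg (fun s : SL2 F' => s.1 i j) h)
    have : Matrix.SpecialLinearGroup.map (n := Fin 2) e.toRingHom (-1) = (-1 : SL2 F') := by
      ext i j; fin_cases i <;> fin_cases j <;> simp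
    rw [← this, hinj.eq_iff, ← map_one (Matrix.SpecialLinearGroup.map (n := Fin 2) e.toRingHom),
      hinj.eq_iff]
  have hsurj : Function.Surjective φ := by
    intro y
    obtain ⟨s, rfl⟩ := L2.mk_surjective y
    refine ⟨Matrix.SpecialLinearGroup.map (n := Fin 2) e.symm.toRingHom s, ?_⟩
    change L2.mk _ = L2.mk s
    congr 1
    ext i j
    exact e.apply_symm_apply _
  exact ⟨(QuotientGroup.quotientMulEquivOfEq hker.symm).trans
    (QuotientGroup.quotientKerEquivOfSurjective φ hsurj)⟩

variable [Finite F]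

theorem depth_L2_congr {F' : Type*} [Field F'] [Finite F'] (h : Nat.card F = Nat.card F') :
    depth (L2 F) = depth (L2 F') := by
  have := Fintype.ofFinite F
  have := Fintype.ofFinite F'
  obtain ⟨e⟩ := L2.equiv_of_ringEquiv (FiniteField.ringEquivOfCardEq (K := F) (K' := F')
    (by rw [← Nat.card_eq_fintype_card, h, Nat.card_eq_fintype_card]))
  exact depth_congr e

theorem charP_of_natCard {p k : ℕ} [hp : Fact p.Prime] (hF : Nat.card F = p ^ k) : CharP F p := by
  rw [CharP.charP_iff_prime_eq_zero hp.out]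
  have := Fintype.ofFinite F
  have h0 : ((Nat.card F : ℕ) : F) = 0 := by
    rw [Nat.card_eq_fintype_card]
    exact Nat.cast_card_eq_zero F
  rw [hF, Nat.cast_pow] at h0
  exact by_contra fun h => pow_ne_zero k h h0

theorem Subfield.card_eq_prime_pow {p k : ℕ} [hp : Fact p.Prime] (hF : Nat.card F = p ^ k)
    (L : Subfield F) : ∃ m, m ∣ k ∧ Nat.card L = p ^ m := by
  have hpow : Nat.card F = Nat.card L ^ Module.finrank L F := Module.natCard_eq_pow_finrank
  have h1 : 1 < Nat.card F := Finite.one_lt_card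
  have hcp : Nat.card L ∣ p ^ k := by
    rw [← hF, hpow]; exact dvd_pow_self _ fun h0 => by rw [h0, pow_zero] at hpow; omega
  obtain ⟨m, -, hm⟩ := (Nat.dvd_prime_pow hp.out).1 hcp
  rw [hm, hF, ← pow_mul] at hpow
  exact ⟨m, ⟨_, Nat.pow_right_injective hp.out.two_le hpow⟩, hm⟩

/-- The subfield of elements fixed by a power of the Frobenius endomorphism. -/
theorem Subfield.exists_card_eq {p k m : ℕ} [hp : Fact p.Prime] (hF : Nat.card F = p ^ k)
    (hm : m ∣ k) (hm0 : m ≠ 0) :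
    ∃ L : Subfield F, Nat.card L = p ^ m ∧ ∀ x : F, x ^ p ^ m = x → x ∈ L := by
  have := charP_of_natCard hF
  have hmp : 1 < p ^ m := Nat.one_lt_pow hm0 hp.out.one_lt
  refine ⟨(iterateFrobenius F p m).eqLocusField (RingHom.id F), ?_, fun x hx => ?_⟩
  · have hmem : ∀ x : F, x ∈ (iterateFrobenius F p m).eqLocusField (RingHom.id F) ↔
        x ^ p ^ m = x := fun x => by
      rw [RingHom.mem_eqLocusField, iterateFrobenius_def]; rfl
    -- The nonzero fixed elements are the `(p ^ m - 1)`-torsion of a cyclic group whose order is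
    -- divisible by `p ^ m - 1`.
    have hcard := IsCyclic.card_powMonoidHom_ker (G := Fˣ) (p ^ m - 1)
    have hdvd : p ^ m - 1 ∣ p ^ k - 1 := by
      obtain ⟨c, rfl⟩ := hm
      rw [pow_mul]
      simpa using Nat.sub_dvd_pow_sub_pow (p ^ m) 1 c
    rw [Nat.card_units, hF, Nat.gcd_eq_right hdvd] at hcard
    have e : (iterateFrobenius F p m).eqLocusField (RingHom.id F) ≃
        Option (powMonoidHom (p ^ m - 1) : Fˣ →* Fˣ).ker := by
      classical
      refine Equiv.symm (Equiv.ofBijective (fun o => o.elim 0 fun u => ⟨u.1.1, ?_⟩) ⟨?_, ?_⟩)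
      · rw [hmem]
        have h1 : u.1 ^ (p ^ m - 1) = 1 := MonoidHom.mem_ker.1 u.2
        have h2 : u.1 ^ (p ^ m) = u.1 := by
          obtain ⟨v, hv⟩ := u
          change v ^ (p ^ m) = v
          change v ^ (p ^ m - 1) = 1 at h1
          rw [← Nat.sub_add_cancel hmp.le, pow_succ, h1, one_mul]
        exact_mod_cast congrArg Units.val h2
      · rintro (_ | u) (_ | v) h
        · rfl
        · exact absurd (congrArg Subtype.val h).symm v.1.ne_zero
        · exact absurd (congrArg Subtype.val h) u.1.ne_zero
        · exact congrArg some (Subtype.ext (Units.ext (congrArg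
            (fun z : (iterateFrobenius F p m).eqLocusField (RingHom.id F) => z.1) h)))
      · rintro ⟨x, hx⟩
        by_cases h0 : x = 0
        · exact ⟨none, Subtype.ext h0.symm⟩
        · refine ⟨some ⟨Units.mk0 x h0, ?_⟩, rfl⟩
          rw [MonoidHom.mem_ker]
          ext
          have h1 := (hmem x).1 hx
          rw [← Nat.sub_add_cancel hmp.le, pow_succ] at h1
          exact mul_right_cancel₀ h0 (h1.trans (one_mul x).symm)
    rw [Nat.card_congr e, Finite.card_option, hcard]
    omega
  · rw [RingHom.mem_eqLocusField, iterateFrobenius_def]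
    exact hx

/-- With `|L| = p ^ m` and `k / m` divisible by a prime `r`, the field of `p ^ (k / r)` elements is
the fixed field of a power of the Frobenius that already fixes `L`. -/
theorem Subfield.exists_maximal_of_ne_top {p k : ℕ} [hp : Fact p.Prime]
    (hF : Nat.card F = p ^ k) (hk : k ≠ 0) {L : Subfield F} (hL : L ≠ ⊤) :
    ∃ r : ℕ, r.Prime ∧ r ∣ k ∧ ∃ L' : Subfield F, L ≤ L' ∧ Nat.card L' = p ^ (k / r) := by
  obtain ⟨m, ⟨c, hc⟩, hm⟩ := L.card_eq_prime_pow hF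
  have hc1 : c ≠ 1 := by
    rintro rfl
    apply hL
    rw [mul_one] at hc
    have h1 : Function.Surjective (Subtype.val : L → F) := by
      refine (Function.Injective.bijective_of_nat_card_le Subtype.val_injective ?_).2
      rw [hm, hF, hc]
    rw [eq_top_iff]
    intro x _
    obtain ⟨y, rfl⟩ := h1 x
    exact y.2
  obtain ⟨r, hr, d, rfl⟩ := Nat.exists_prime_and_dvd hc1
  have hr0 := hr.pos
  have hkr : k / r = m * d := by
    rw [hc, show m * (r * d) = m * d * r by ring, Nat.mul_div_cancel _ hr0]
  refine ⟨r, hr, ⟨m * d, by rw [hc]; ring⟩, ?_⟩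
  obtain ⟨L', hL', h⟩ := Subfield.exists_card_eq (p := p) (m := k / r) hF
    ⟨r, by rw [hkr, hc]; ring⟩ (by rw [hkr]; rintro h0; apply hk; rw [hc, show m * (r * d) =
      r * (m * d) by ring, h0, mul_zero])
  refine ⟨L', fun x hx => h x ?_, hL'⟩
  have := Fintype.ofFinite L
  have h1 := FiniteField.pow_card_pow d (⟨x, hx⟩ : L)
  rw [← Nat.card_eq_fintype_card, hm, ← pow_mul, ← hkr] at h1
  exact congrArg Subtype.val h1

end

/-! ### Maximal subgroups of `L₂(q)` -/

section

variable {F : Type u} [Field F] {K : Type*} [Field K] [Algebra F K]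

theorem L2.pow_eq_one_of_mem_unip {p : ℕ} [CharP F p] {x : ℙ K (Fin 2 → K)} {h : L2 F}
    (hh : h ∈ L2.unip F x) : h ^ p = 1 := by
  induction x using Projectivization.ind with
  | h v hv =>
    obtain ⟨g, hg, rfl⟩ := (L2.mem_unip_iff hv).1 hh
    have ht := SL2.eigenvalue_eq hv (c := 1) (by rw [hg, one_smul])
    have ht' : g.1.trace = 2 := by
      apply (algebraMap F K).injective
      rw [map_ofNat]
      linear_combination -ht
    have hpow : ∀ n : ℕ, (g ^ n).1 = 1 + (n : F) • (g.1 - 1) := by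
      intro n
      induction n with
      | zero => simp
      | succ n ih =>
        have hd := SL2.det_val g
        rw [Matrix.trace_fin_two] at ht'
        have hsq : (g.1 - 1) * (g.1 - 1) = 0 := by
          ext i j
          fin_cases i <;> fin_cases j <;> simp [Matrix.mul_apply, Fin.sum_univ_two]
          · linear_combination g.1 0 0 * ht' - hd
          · linear_combination g.1 0 1 * ht'
          · linear_combination g.1 1 0 * ht'
          · linear_combination g.1 1 1 * ht' - hd
        have hg1 : g.1 = 1 + (g.1 - 1) := by abel
        rw [pow_succ, Matrix.SpecialLinearGroup.coe_mul, ih]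
        conv_lhs => rw [hg1]
        rw [add_sub_cancel_left, add_mul, one_mul, Matrix.smul_mul, mul_add, mul_one, hsq, add_zero,
          add_assoc, Nat.cast_succ, add_smul, one_smul, add_comm (g.1 - 1)]
    rw [← map_pow, L2.mk_eq_one_iff]
    left
    apply Subtype.ext
    rw [hpow, CharP.cast_eq_zero, zero_smul, add_zero]
    rfl

/-- An eigenvalue `c` satisfies `c ^ (2 * p) = 1`, and Frobenius is injective, so `c² = 1`: elements
of order `p` are unipotent up to sign. -/
theorem L2.exists_mem_unip_of_pow_eq_one {p : ℕ} [hp : Fact p.Prime] [CharP F p]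
    (hK : ∀ τ : F, ∃ c : K, c ^ 2 - algebraMap F K τ * c + 1 = 0) {h : L2 F} (hh : h ^ p = 1) :
    ∃ x : ℙ K (Fin 2 → K), h ∈ L2.unip F x := by
  have : CharP K p := charP_of_injective_algebraMap (algebraMap F K).injective p
  obtain ⟨g, rfl⟩ := L2.mk_surjective h
  obtain ⟨c, hc⟩ := hK g.1.trace
  obtain ⟨v, hv, hgv⟩ := SL2.exists_eigenvector hc
  have hpow : ∀ n : ℕ, (g ^ n).toMat K *ᵥ v = c ^ n • v := by
    intro n
    induction n with
    | zero => simp [SL2.toMat_one]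
    | succ n ih =>
      rw [pow_succ, SL2.toMat_mul, ← Matrix.mulVec_mulVec, hgv, Matrix.mulVec_smul, ih, smul_smul,
        pow_succ']
  have hcp : (c ^ p) ^ 2 = 1 := by
    rw [← map_pow, L2.mk_eq_one_iff] at hh
    have h1 := hpow p
    have huniq : ∀ a b : K, a • v = b • v → a = b := fun a b h => by
      rw [← sub_eq_zero, ← sub_smul, smul_eq_zero] at h
      exact sub_eq_zero.1 (h.resolve_right hv)
    rcases hh with h | h
    · rw [h, SL2.toMat_one, Matrix.one_mulVec] at h1
      rw [← huniq 1 (c ^ p) (by rw [one_smul]; exact h1), one_pow]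
    · rw [h, SL2.toMat_neg, SL2.toMat_one, Matrix.neg_mulVec, Matrix.one_mulVec] at h1
      rw [← huniq (-1) (c ^ p) (by rw [neg_one_smul]; exact h1)]
      ring
  have hc2 : c ^ 2 = 1 := by
    rw [← pow_mul, mul_comm, pow_mul] at hcp
    have h2 : frobenius K p (c ^ 2) = frobenius K p 1 := by rw [frobenius_def, map_one, hcp]
    exact frobenius_inj K p h2
  refine ⟨Projectivization.mk K v hv, ?_⟩
  rw [L2.mem_unip_iff]
  rcases sq_eq_one_iff.1 hc2 with rfl | rfl
  · exact ⟨g, by rw [hgv, one_smul], rfl⟩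
  · exact ⟨-g, by rw [SL2.toMat_neg, Matrix.neg_mulVec, hgv, neg_one_smul, neg_neg], L2.mk_neg g⟩

theorem L2.not_dvd_card_of_unip_eq_bot [Finite F] {p : ℕ} [hp : Fact p.Prime] [CharP F p]
    (hK : ∀ τ : F, ∃ c : K, c ^ 2 - algebraMap F K τ * c + 1 = 0) {M : Subgroup (L2 F)}
    (hM : ∀ x : ℙ K (Fin 2 → K), (L2.unip F x).subgroupOf M = ⊥) : ¬ p ∣ Nat.card M := by
  intro h
  obtain ⟨u, hu⟩ := exists_prime_orderOf_dvd_card' p h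
  have h1 : u ≠ 1 := by
    rintro rfl
    rw [orderOf_one] at hu
    exact hp.out.one_lt.ne hu
  obtain ⟨x, hx⟩ := L2.exists_mem_unip_of_pow_eq_one hK (h := u.1) (p := p) (by
    have := pow_orderOf_eq_one u
    rw [hu] at this
    exact congrArg Subtype.val this)
  have hx' : u ∈ (L2.unip F x).subgroupOf M := hx
  rw [hM x, Subgroup.mem_bot] at hx'
  exact h1 hx'

/-- For odd `k` the square of `3 ^ k` is `-1` modulo 5. So 5 does not divide the order of `L₂(3 ^
k)`, which excludes subgroups of order 60. -/
theorem three_pow_not_five_dvd {k : ℕ} (hk : Odd k) : ¬ 5 ∣ 3 ^ k * ((3 ^ k) ^ 2 - 1) := by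
  obtain ⟨m, rfl⟩ := hk
  intro h
  rw [Nat.Prime.dvd_mul (by norm_num)] at h
  rcases h with h | h
  · have := Nat.Prime.dvd_of_dvd_pow (by norm_num : Nat.Prime 5) h
    omega
  · have h1 : 1 ≤ (3 ^ (2 * m + 1)) ^ 2 := Nat.one_le_pow _ _ (by positivity)
    rw [← (Nat.modEq_iff_dvd' h1)] at h
    have h2 : (3 ^ (2 * m + 1)) ^ 2 = 81 ^ m * 9 := by
      rw [← pow_mul, show (2 * m + 1) * 2 = 4 * m + 2 by ring, pow_add, pow_mul]; norm_num
    rw [h2] at h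
    have h3 : 81 ^ m * 9 ≡ 1 ^ m * 4 [MOD 5] :=
      Nat.ModEq.mul ((by decide : 81 ≡ 1 [MOD 5]).pow m) (by decide)
    rw [one_pow, one_mul] at h3
    have := h.trans h3
    revert this
    decide

open MulAction

/-- The maximal subgroups of `L₂(q)`. -/
theorem L2.isCoatom_cases [Finite F] [Finite K] {p k : ℕ} [hp : Fact p.Prime] (hk : Odd k)
    (hF : Nat.card F = p ^ k) (hq : 3 ≤ Nat.card F)
    (hK : ∀ τ : F, ∃ c : K, c ^ 2 - algebraMap F K τ * c + 1 = 0)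
    {M : Subgroup (L2 F)} (hM : IsCoatom M) :
    (∃ v hv, M.comap L2.mk = SL2.lineStab v hv) ∨
    (∃ X : SL2 F, X.1.trace ^ 2 ≠ 4 ∧ M.comap L2.mk = SL2.invStab X) ∨
    (5 ≤ p ∧ ¬ p ∣ Nat.card M ∧ (∀ x : ℙ K (Fin 2 → K), (L2.unip F x).subgroupOf M = ⊥) ∧
      IsPolarAction.IsPolyhedral M (ℙ K (Fin 2 → K))) ∨
    (∃ r : ℕ, r.Prime ∧ r ∣ k ∧ 3 ≤ p ^ (k / r) ∧ ∃ L : Subfield F, Nat.card L = p ^ (k / r) ∧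
      Nonempty (L2 L ≃* M)) := by
  have hfin : Finite (ℙ K (Fin 2 → K)) := Quotient.finite _
  have := charP_of_natCard hF
  have hline : (∃ v hv, M.comap L2.mk ≤ SL2.lineStab v hv) →
      ∃ v hv, M.comap L2.mk = SL2.lineStab v hv := fun ⟨v, hv, h⟩ =>
    ⟨v, hv, L2.comap_eq_of_isCoatom hM h (SL2.lineStab_ne_top v hv)⟩
  have hinv : (∃ X : SL2 F, X.1.trace ^ 2 ≠ 4 ∧ M.comap L2.mk ≤ SL2.invStab X) →
      ∃ X : SL2 F, X.1.trace ^ 2 ≠ 4 ∧ M.comap L2.mk = SL2.invStab X := fun ⟨X, hX, h⟩ =>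
    ⟨X, hX, L2.comap_eq_of_isCoatom hM h (SL2.invStab_ne_top hq hX)⟩
  have hfixed : (∃ x : ℙ K (Fin 2 → K), ∀ h : M, h • x = x) → _ := fun ⟨x, hx⟩ =>
    (L2.le_of_fixed M x fun h hh => hx ⟨h, hh⟩).imp hline hinv
  have hU := (L2.isPolarAction hK).restrict M
  by_cases hM1 : 1 < Nat.card M
  swap
  · have : Subsingleton M := by
      rw [← not_nontrivial_iff_subsingleton, ← Finite.one_lt_card_iff_nontrivial]
      exact hM1
    rcases hfixed ⟨Projectivization.mk K ![1, 0] (by intro h; simpa using congrFun h 0),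
      fun h => by rw [Subsingleton.elim h 1, one_smul]⟩ with h | h
    · exact Or.inl h
    · exact Or.inr (Or.inl h)
  have hcardG := L2.card_mul_card_center (F := F)
  rcases hU.classification hM1 with h | ⟨x, h2, h1, hx⟩ | ⟨h, hpoly⟩ | ⟨x, hQ, ho, hst⟩ |
    ⟨x, hx3, h60⟩
  · rcases hfixed h with h | h
    · exact Or.inl h
    · exact Or.inr (Or.inl h)
  · exact Or.inr (Or.inl (hinv (L2.le_invStab_of_index_two M x h2 h1 hx)))
  · refine Or.inr (Or.inr (Or.inl ⟨?_, L2.not_dvd_card_of_unip_eq_bot hK h, h, hpoly⟩))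
    have hnd := L2.not_dvd_card_of_unip_eq_bot (p := p) hK h
    have hp2 := hp.out.two_le
    by_contra hlt
    -- For `p = 2` or `p = 3` the prime `p` would divide 12, giving an element of order `p` in a
    -- group without unipotents.
    have h12 : 12 ∣ Nat.card M := by
      rcases hpoly with h | h | h <;> rw [h.1]
      · exact ⟨2, rfl⟩
      · exact ⟨5, rfl⟩
    have hp4 : p ≠ 4 := by rintro rfl; exact absurd hp.out (by norm_num)
    apply hnd
    refine dvd_trans ?_ h12
    interval_cases p <;> omega
  · right; right; right
    set Q := Nat.card ((L2.unip F x).subgroupOf M) with hQdef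
    set n := Nat.card (stabilizer M x) with hn
    obtain ⟨P, L, hL, hle⟩ := L2.exists_subfield_of_orbit hk hF M hU x hQ ho (by
      rcases hst with h | h
      · rw [← h]; omega
      · rw [← h])
    -- If `Q = q`, the orbit and stabilizer orders give `M` the order of `L₂(F)` or more, unless the
    -- center is trivial and the stabilizer has order `Q (Q - 1) / 2`. In that case `Q` is even, and
    -- since `Q` divides the stabilizer order, `Q - 1` would be even too.
    have hLtop : L ≠ ⊤ := by
      rintro rfl
      have hQq : Q = Nat.card F := by
        exact hL.symm.trans (Nat.card_congr Subfield.topEquiv.toEquiv)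
      have hcardM : (Q + 1) * n = Nat.card M := by
        rw [← ho]
        exact IsPolarAction.card_orbit_mul_card_stabilizer _
      have hsq : Nat.card F ^ 2 - 1 = (Q - 1) * (Q + 1) := by
        rw [← hQq, mul_comm]
        exact Nat.sq_sub_sq Q 1
      have hlt : Nat.card M < Nat.card (L2 F) := by
        refine lt_of_le_of_ne (Subgroup.card_le_card_group M) fun h => hM.1 ?_
        exact Subgroup.eq_top_of_card_eq M h
      have hcpos : 0 < Nat.card (Subgroup.center (SL2 F)) := Nat.card_pos
      rw [hsq, ← hQq] at hcardG
      have hmul : Nat.card (Subgroup.center (SL2 F)) * ((Q + 1) * n) <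
          Q * ((Q - 1) * (Q + 1)) := by
        rw [← hcardG, hcardM]
        exact Nat.mul_lt_mul_of_pos_left hlt hcpos
      have hmul' : Nat.card (Subgroup.center (SL2 F)) * n < Q * (Q - 1) := by
        refine Nat.lt_of_mul_lt_mul_right (a := Q + 1) ?_
        calc Nat.card (Subgroup.center (SL2 F)) * n * (Q + 1) =
            Nat.card (Subgroup.center (SL2 F)) * ((Q + 1) * n) := by ring
          _ < Q * ((Q - 1) * (Q + 1)) := hmul
          _ = _ := by ring
      rcases hst with h | h
      · rw [← h] at hmul'
        nlinarith
      · rw [← h] at hmul'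
        have hc1 : Nat.card (Subgroup.center (SL2 F)) < 2 := lt_of_mul_lt_mul_right' hmul'
        by_cases h20 : (2 : F) = 0
        · have hp2 : p = 2 := by
            have h2 : ((2 : ℕ) : F) = 0 := by exact_mod_cast h20
            rw [CharP.cast_eq_zero_iff F p] at h2
            exact (Nat.prime_dvd_prime_iff_eq hp.out Nat.prime_two).1 h2
          obtain ⟨t, ht⟩ := hU.card_dvd_stabilizer x
          have ht' : n = Q * t := ht
          rw [ht'] at h
          have h3 : Q * (2 * t) = Q * (Q - 1) := by rw [← h]; ring
          have h4 := Nat.eq_of_mul_eq_mul_left (by omega) h3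
          have h5 : 2 ∣ Q := by
            rw [hQq, hF, hp2]
            exact dvd_pow_self 2 hk.pos.ne'
          omega
        · rw [SL2.card_center_of_two_ne_zero h20] at hc1
          omega
    obtain ⟨r, hr, hrk, L', hLL', hL'⟩ := Subfield.exists_maximal_of_ne_top hF hk.pos.ne' hLtop
    have hcard : Nat.card L ≤ Nat.card L' :=
      Nat.card_le_card_of_injective _ (Subfield.inclusion hLL').injective
    refine ⟨r, hr, hrk, by omega, L', hL', ?_⟩
    have hne : L' ≠ ⊤ := by
      intro htop
      rw [htop, Nat.card_congr Subfield.topEquiv.toEquiv, hF] at hL'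
      have h1 := Nat.pow_right_injective hp.out.two_le hL'
      have h2 := Nat.div_lt_self hk.pos hr.one_lt
      omega
    exact L2.nonempty_equiv_of_isCoatom hM hne (hle.trans (SL2.subfieldSL_mono P hLL'))
  -- A unipotent group of order 3 forces `p = 3`, where order 60 contradicts divisibility by 5.
  · exfalso
    have hp3 : p = 3 := by
      have hnt : Nontrivial ((L2.unip F x).subgroupOf M) :=
        Finite.one_lt_card_iff_nontrivial.1 (by omega)
      obtain ⟨u, hu⟩ := exists_ne (1 : (L2.unip F x).subgroupOf M)
      have h3 : orderOf u ∣ 3 := by rw [← hx3]; exact orderOf_dvd_natCard u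
      have h4 : orderOf u ∣ p := by
        rw [orderOf_dvd_iff_pow_eq_one]
        apply Subtype.ext
        apply Subtype.ext
        exact L2.pow_eq_one_of_mem_unip (p := p) (show u.1.1 ∈ L2.unip F x from u.2)
      have h5 : orderOf u ≠ 1 := fun h => hu (orderOf_eq_one_iff.1 h)
      have h6 := (Nat.dvd_prime (by norm_num : Nat.Prime 3)).1 h3 |>.resolve_left h5
      have h7 := (Nat.dvd_prime hp.out).1 h4 |>.resolve_left h5
      omega
    have h5 : 5 ∣ Nat.card (L2 F) :=
      dvd_trans (by rw [h60]; exact ⟨12, rfl⟩) (Subgroup.card_subgroup_dvd_card M)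
    have h6 : 5 ∣ Nat.card F * (Nat.card F ^ 2 - 1) := by
      rw [← hcardG]; exact Dvd.dvd.mul_left h5 _
    rw [hF, hp3] at h6
    exact three_pow_not_five_dvd hk h6

end

/-! ### Quaternion pairs and conjugation into a subfield group -/

section

variable {F : Type u} [Field F]

theorem SL2.mul_self_eq_neg_one {g : SL2 F} (h : g.1.trace = 0) : g * g = -1 := by
  have hd := SL2.det_val g
  rw [Matrix.trace_fin_two] at h
  apply Subtype.ext
  rw [Matrix.SpecialLinearGroup.coe_mul]
  ext i j
  fin_cases i <;> fin_cases j <;> simp [Matrix.mul_apply, Fin.sum_univ_two]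
  · linear_combination g.1 0 0 * h - hd
  · linear_combination g.1 0 1 * h
  · linear_combination g.1 1 0 * h
  · linear_combination g.1 1 1 * h - hd

theorem SL2.trace_eq_zero_of_mul_self {g : SL2 F} (h : g * g = -1) :
    g.1.trace = 0 := by
  have h' : g.1 * g.1 = -1 := congrArg Subtype.val h
  have hd := SL2.det_val g
  have h00 := congrFun (congrFun h' 0) 0
  have h01 := congrFun (congrFun h' 0) 1
  have h10 := congrFun (congrFun h' 1) 0
  have h11 := congrFun (congrFun h' 1) 1
  simp [Matrix.mul_apply, Fin.sum_univ_two] at h00 h01 h10 h11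
  rw [Matrix.trace_fin_two]
  by_contra hne
  have e00 : g.1 0 0 = 0 := by
    have : (g.1 0 0 + g.1 1 1) * g.1 0 0 = 0 := by linear_combination h00 + hd
    exact (mul_eq_zero.1 this).resolve_left hne
  have e11 : g.1 1 1 = 0 := by
    have : (g.1 0 0 + g.1 1 1) * g.1 1 1 = 0 := by linear_combination h11 + hd
    exact (mul_eq_zero.1 this).resolve_left hne
  exact hne (by rw [e00, e11, add_zero])

/-- The matrices of the standard quaternion generators. -/
def SL2.stdI (F : Type u) [Field F] : SL2 F := ⟨!![0, -1; 1, 0], by rw [Matrix.det_fin_two_of]; ring⟩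

/-- The matrices of the standard quaternion generators. -/
def SL2.stdJ (s t : F) (h : s ^ 2 + t ^ 2 = -1) : SL2 F :=
  ⟨!![t, s; s, -t], by rw [Matrix.det_fin_two_of]; linear_combination -h⟩

/-- A vector `v` with `j v = t v + s (i v)` makes `i` and `j` standard in the basis `v`, `i v`. Such
a vector is found in the image of a suitable element of the quaternion algebra. -/
theorem SL2.exists_conj_quaternion {i j : SL2 F} (h2 : (2 : F) ≠ 0) (hi : i * i = -1)
    (hij : i * j = -(j * i)) (hj : j * j = -1) {s t : F} (hst : s ^ 2 + t ^ 2 = -1) :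
    ∃ P : GL (Fin 2) F, SL2.conjGL P (SL2.stdI F) = i ∧ SL2.conjGL P (SL2.stdJ s t hst) = j := by
  have hi' : i.1 * i.1 = -1 := congrArg Subtype.val hi
  have hj' : j.1 * j.1 = -1 := congrArg Subtype.val hj
  have hij' : i.1 * j.1 = -(j.1 * i.1) := congrArg Subtype.val hij
  -- Because `s² + t² = -1`, this element satisfies `j N = t N + s i N`. It is nonzero since `i N +
  -- N i = -2`.
  set N : Matrix (Fin 2) (Fin 2) F := i.1 + s • j.1 + t • (i.1 * j.1) with hN
  have hjN : j.1 * N = t • N + s • (i.1 * N) := by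
    have e1 : j.1 * (i.1 * j.1) = i.1 := by
      rw [hij', mul_neg, ← mul_assoc, hj', neg_mul, one_mul, neg_neg]
    have e2 : i.1 * (i.1 * j.1) = -j.1 := by rw [← mul_assoc, hi', neg_mul, one_mul]
    have e3 : j.1 * i.1 = -(i.1 * j.1) := by rw [hij', neg_neg]
    simp only [hN, mul_add, Matrix.mul_smul, e1, e2, e3, hi', hj', smul_add, smul_smul, smul_neg]
    have e5 : -(i.1 * j.1) = (s * s + t * t) • (i.1 * j.1) := by
      rw [show s * s + t * t = -1 by linear_combination hst, neg_one_smul]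
    rw [e5, add_smul, mul_comm s t]
    abel
  have hN0 : N ≠ 0 := by
    intro h0
    have e1 : i.1 * j.1 * i.1 = j.1 := by
      rw [hij', neg_mul, mul_assoc, hi', mul_neg, mul_one, neg_neg]
    have e2 : i.1 * N + N * i.1 = -(2 : F) • 1 := by
      have e3 : i.1 * (i.1 * j.1) = -j.1 := by rw [← mul_assoc, hi', neg_mul, one_mul]
      have e4 : i.1 * N + N * i.1 = (i.1 * i.1 + i.1 * i.1) + s • (i.1 * j.1 + j.1 * i.1) +
          t • (i.1 * (i.1 * j.1) + i.1 * j.1 * i.1) := by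
        simp only [hN, mul_add, add_mul, Matrix.mul_smul, Matrix.smul_mul, smul_add]
        abel
      rw [e4, e3, e1, hi', hij', neg_add_cancel, neg_add_cancel, smul_zero, smul_zero, add_zero,
        add_zero, neg_smul, two_smul]
      abel
    rw [h0] at e2
    have := congrFun (congrFun e2 0) 0
    simp at this
    exact h2 this
  obtain ⟨u, hu⟩ : ∃ u, N *ᵥ u ≠ 0 := by
    by_contra hc
    push Not at hc
    apply hN0
    ext a b
    have := congrFun (hc (Pi.single b 1)) a
    simpa using this
  have hjv : j.1 *ᵥ (N *ᵥ u) = t • (N *ᵥ u) + s • (i.1 *ᵥ (N *ᵥ u)) := by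
    rw [Matrix.mulVec_mulVec, hjN, Matrix.add_mulVec, Matrix.smul_mulVec, Matrix.smul_mulVec,
      Matrix.mulVec_mulVec]
  set v := N *ᵥ u with hv
  have hw : wedge v (i.1 *ᵥ v) ≠ 0 := by
    intro h
    obtain ⟨c, hc⟩ := exists_eq_smul_of_wedge_eq_zero hu h
    have hc2 : c * c = -1 := by
      have h3 : (i.1 * i.1) *ᵥ v = (c * c) • v := by
        rw [← Matrix.mulVec_mulVec, hc, Matrix.mulVec_smul, hc, smul_smul]
      rw [hi', Matrix.neg_mulVec, Matrix.one_mulVec, ← neg_one_smul F v] at h3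
      rw [← sub_eq_zero, ← sub_smul, smul_eq_zero] at h3
      have := h3.resolve_right hu
      linear_combination -this
    rw [hc, smul_smul, ← add_smul] at hjv
    have hd0 : ((2 : F) * c * (t + s * c)) • v = 0 := by
      have h3 : (i.1 * j.1) *ᵥ v = -((j.1 * i.1) *ᵥ v) := by rw [hij', Matrix.neg_mulVec]
      rw [← Matrix.mulVec_mulVec, ← Matrix.mulVec_mulVec, hjv, hc, Matrix.mulVec_smul,
        Matrix.mulVec_smul, hjv, hc, smul_smul, smul_smul, ← sub_eq_zero, sub_neg_eq_add,
        ← add_smul] at h3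
      rw [← h3]; congr 1; ring
    have hd1 := (smul_eq_zero.1 hd0).resolve_right hu
    have hc0 : c ≠ 0 := by rintro rfl; simp at hc2
    have hd2 := (mul_eq_zero.1 hd1).resolve_left (mul_ne_zero h2 hc0)
    rw [hd2, zero_smul] at hjv
    exact SL2.mulVec_ne_zero j hu hjv
  obtain ⟨P, hP0, hP1⟩ := exists_GL2_frame hw
  have hiiv : i.1 *ᵥ (i.1 *ᵥ v) = -v := by
    rw [Matrix.mulVec_mulVec, hi', Matrix.neg_mulVec, Matrix.one_mulVec]
  have hjiv : j.1 *ᵥ (i.1 *ᵥ v) = s • v - t • (i.1 *ᵥ v) := by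
    have e3 : j.1 * i.1 = -(i.1 * j.1) := by rw [hij', neg_neg]
    rw [Matrix.mulVec_mulVec, e3, Matrix.neg_mulVec, ← Matrix.mulVec_mulVec, hjv,
      Matrix.mulVec_add, Matrix.mulVec_smul, Matrix.mulVec_smul, hiiv, smul_neg]
    abel
  have key : ∀ a g : SL2 F, P.1 *ᵥ (a.1 *ᵥ ![1, 0]) = g.1 *ᵥ v →
      P.1 *ᵥ (a.1 *ᵥ ![0, 1]) = g.1 *ᵥ (i.1 *ᵥ v) → SL2.conjGL P a = g := by
    intro a g h0 h1
    apply Subtype.ext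
    refine sub_eq_zero.1 (eq_zero_of_mulVec_eq_zero (GL2.wedge_ne_zero P) ?_ ?_)
    · rw [Matrix.sub_mulVec, SL2.conjGL_mulVec, h0, hP0, sub_self]
    · rw [Matrix.sub_mulVec, SL2.conjGL_mulVec, h1, hP1, sub_self]
  have hcol : ∀ a b c d : F, (!![a, b; c, d] : Matrix (Fin 2) (Fin 2) F) *ᵥ ![1, 0] =
      a • ![1, 0] + c • ![0, 1] := by
    intro a b c d
    ext i; fin_cases i <;> simp [Matrix.mulVec, dotProduct, Fin.sum_univ_two]
  have hcol' : ∀ a b c d : F, (!![a, b; c, d] : Matrix (Fin 2) (Fin 2) F) *ᵥ ![0, 1] =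
      b • ![1, 0] + d • ![0, 1] := by
    intro a b c d
    ext i; fin_cases i <;> simp [Matrix.mulVec, dotProduct, Fin.sum_univ_two]
  refine ⟨P, key _ _ ?_ ?_, key _ _ ?_ ?_⟩
  · change P.1 *ᵥ ((!![0, -1; 1, 0] : Matrix (Fin 2) (Fin 2) F) *ᵥ ![1, 0]) = _
    rw [hcol, Matrix.mulVec_add, Matrix.mulVec_smul, Matrix.mulVec_smul, hP0, hP1]
    simp
  · change P.1 *ᵥ ((!![0, -1; 1, 0] : Matrix (Fin 2) (Fin 2) F) *ᵥ ![0, 1]) = _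
    rw [hcol', Matrix.mulVec_add, Matrix.mulVec_smul, Matrix.mulVec_smul, hP0, hP1, hiiv]
    simp
  · change P.1 *ᵥ ((!![t, s; s, -t] : Matrix (Fin 2) (Fin 2) F) *ᵥ ![1, 0]) = _
    rw [hcol, Matrix.mulVec_add, Matrix.mulVec_smul, Matrix.mulVec_smul, hP0, hP1, hjv]
  · change P.1 *ᵥ ((!![t, s; s, -t] : Matrix (Fin 2) (Fin 2) F) *ᵥ ![0, 1]) = _
    rw [hcol', Matrix.mulVec_add, Matrix.mulVec_smul, Matrix.mulVec_smul, hP0, hP1, hjiv, neg_smul]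
    abel

theorem SL2.trace_conjGL (P : GL (Fin 2) F) (s : SL2 F) :
    (SL2.conjGL P s).1.trace = s.1.trace := by
  rw [SL2.conjGL_val, Matrix.trace_mul_comm, ← mul_assoc, Units.inv_mul, one_mul]

/-- A group containing anticommuting elements of square `-1` is defined over any finite subfield
containing its traces. -/
theorem SL2.exists_le_subfieldSL [Finite F] (h2 : (2 : F) ≠ 0) {S : Subgroup (SL2 F)} {i j : SL2 F}
    (hiS : i ∈ S) (hjS : j ∈ S) (hi : i * i = -1) (hj : j * j = -1) (hij : i * j = -(j * i))
    {L : Subfield F} (hL : ∀ s ∈ S, s.1.trace ∈ L) :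
    ∃ P : GL (Fin 2) F, S ≤ SL2.subfieldSL P L := by
  obtain ⟨⟨s, hs⟩, ⟨t, ht⟩, hst'⟩ := exists_norm_form_eq (F := L) (τ := 0) (by
    intro h
    have h4 : (4 : F) = 0 := by
      have h4' : ((4 : ℕ) : L) = 0 := by rw [Nat.cast_ofNat]; simpa using h.symm
      have h5 := congrArg L.subtype h4'
      rw [map_natCast, map_zero] at h5
      exact_mod_cast h5
    have : (2 : F) * 2 = 0 := by linear_combination h4
    exact h2 (mul_self_eq_zero.1 this)) (-1)
  have hst : s ^ 2 + t ^ 2 = -1 := by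
    have := congrArg Subtype.val hst'
    simpa using this
  obtain ⟨P, hPi, hPj⟩ := SL2.exists_conj_quaternion h2 hi hij hj hst
  refine ⟨P, fun g hg => ?_⟩
  obtain ⟨h, rfl⟩ := (SL2.conjGL P).surjective g
  apply SL2.conjGL_mem_subfieldSL
  -- The traces of `h` against `1`, `i`, `j`, `i j` lie in `L`. These four matrices form a basis and
  -- the trace form is nondegenerate over `L` (as `s² + t² = -1`), so the entries of `h` can be
  -- solved for.
  have hT : ∀ m : SL2 F, SL2.conjGL P m ∈ S → (h * m).1.trace ∈ L := by
    intro m hm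
    rw [← SL2.trace_conjGL P, map_mul]
    exact hL _ (S.mul_mem hg hm)
  have t0 := hT 1 (by rw [map_one]; exact S.one_mem)
  have t1 := hT (SL2.stdI F) (by rw [hPi]; exact hiS)
  have t2 := hT (SL2.stdJ s t hst) (by rw [hPj]; exact hjS)
  have t3 := hT (SL2.stdI F * SL2.stdJ s t hst) (by
    rw [map_mul, hPi, hPj]; exact S.mul_mem hiS hjS)
  rw [mul_one, Matrix.trace_fin_two] at t0
  have e1 : (h * SL2.stdI F).1.trace = h.1 0 1 - h.1 1 0 := by
    rw [Matrix.SpecialLinearGroup.coe_mul, SL2.stdI, Matrix.trace_fin_two]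
    simp [Matrix.mul_apply, Fin.sum_univ_two]
    ring
  have e2 : (h * SL2.stdJ s t hst).1.trace =
      t * (h.1 0 0 - h.1 1 1) + s * (h.1 0 1 + h.1 1 0) := by
    rw [Matrix.SpecialLinearGroup.coe_mul, SL2.stdJ, Matrix.trace_fin_two]
    simp [Matrix.mul_apply, Fin.sum_univ_two]
    ring
  have e3 : (h * (SL2.stdI F * SL2.stdJ s t hst)).1.trace =
      -s * (h.1 0 0 - h.1 1 1) + t * (h.1 0 1 + h.1 1 0) := by
    rw [Matrix.SpecialLinearGroup.coe_mul, Matrix.SpecialLinearGroup.coe_mul, SL2.stdI, SL2.stdJ,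
      Matrix.trace_fin_two]
    simp [Matrix.mul_apply, Fin.sum_univ_two]
    ring
  rw [e1] at t1
  rw [e2] at t2
  rw [e3] at t3
  have d0 : h.1 0 0 - h.1 1 1 ∈ L := by
    have := L.sub_mem (L.mul_mem hs t3) (L.mul_mem ht t2)
    have e : s * (-s * (h.1 0 0 - h.1 1 1) + t * (h.1 0 1 + h.1 1 0)) -
        t * (t * (h.1 0 0 - h.1 1 1) + s * (h.1 0 1 + h.1 1 0)) = h.1 0 0 - h.1 1 1 := by
      linear_combination -(h.1 0 0 - h.1 1 1) * hst
    rwa [e] at this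
  have d1 : h.1 0 1 + h.1 1 0 ∈ L := by
    have := L.neg_mem (L.add_mem (L.mul_mem hs t2) (L.mul_mem ht t3))
    have e : -(s * (t * (h.1 0 0 - h.1 1 1) + s * (h.1 0 1 + h.1 1 0)) +
        t * (-s * (h.1 0 0 - h.1 1 1) + t * (h.1 0 1 + h.1 1 0))) = h.1 0 1 + h.1 1 0 := by
      linear_combination -(h.1 0 1 + h.1 1 0) * hst
    rwa [e] at this
  have hhalf : ∀ x : F, 2 * x ∈ L → x ∈ L := by
    intro x hx
    have := L.div_mem hx (L.add_mem L.one_mem L.one_mem)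
    rwa [one_add_one_eq_two, mul_div_cancel_left₀ _ h2] at this
  have f00 : h.1 0 0 ∈ L := hhalf _ (by
    have := L.add_mem t0 d0
    rwa [show h.1 0 0 + h.1 1 1 + (h.1 0 0 - h.1 1 1) = 2 * h.1 0 0 by ring] at this)
  have f11 : h.1 1 1 ∈ L := hhalf _ (by
    have := L.sub_mem t0 d0
    rwa [show h.1 0 0 + h.1 1 1 - (h.1 0 0 - h.1 1 1) = 2 * h.1 1 1 by ring] at this)
  have f01 : h.1 0 1 ∈ L := hhalf _ (by
    have := L.add_mem d1 t1
    rwa [show h.1 0 1 + h.1 1 0 + (h.1 0 1 - h.1 1 0) = 2 * h.1 0 1 by ring] at this)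
  have f10 : h.1 1 0 ∈ L := hhalf _ (by
    have := L.sub_mem d1 t1
    rwa [show h.1 0 1 + h.1 1 0 - (h.1 0 1 - h.1 1 0) = 2 * h.1 1 0 by ring] at this)
  intro a b
  fin_cases a <;> fin_cases b
  exacts [f00, f01, f10, f11]

end

/-! ### Polyhedral subgroups are defined over the prime field -/

section

variable {F : Type u} [Field F]

/-- An element of `SL₂` whose square, fourth, third or fifth power is scalar has its trace in every
subfield closed under square roots. -/
theorem SL2.trace_mem_of_pow {g : SL2 F} {m : ℕ} (h2 : (2 : F) ≠ 0) (hm0 : 1 ≤ m) (hm : m ≤ 5)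
    (h : g ^ m = 1 ∨ g ^ m = -1) (L : Subfield F) (hL : ∀ a : F, a ^ 2 ∈ L → a ∈ L) :
    g.1.trace ∈ L := by
  set τ := g.1.trace with hτ
  have htwo : (2 : F) ∈ L := by
    rw [← one_add_one_eq_two]; exact L.add_mem L.one_mem L.one_mem
  have hsq : g.1 * g.1 = τ • g.1 - 1 := by
    have hd := SL2.det_val g
    rw [hτ, Matrix.trace_fin_two]
    ext i j
    fin_cases i <;> fin_cases j <;> simp [Matrix.mul_apply, Fin.sum_univ_two]
    · linear_combination -hd
    · ring
    · ring
    · linear_combination -hd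
  have hscal : ∀ a b c : F, a ≠ 0 → a • g.1 - b • (1 : Matrix (Fin 2) (Fin 2) F) = c • 1 →
      τ ∈ L := by
    intro a b c ha hab
    have hg : g.1 = (a⁻¹ * (c + b)) • 1 := by
      rw [mul_smul, add_smul, ← hab, sub_add_cancel, smul_smul, inv_mul_cancel₀ ha, one_smul]
    set e := a⁻¹ * (c + b)
    have hd := g.2
    rw [hg] at hd
    simp at hd
    have he : e = 1 ∨ e = -1 := hd
    rw [hτ, hg, Matrix.trace_fin_two]
    simp
    have : e + e = 2 * e := by ring
    rw [this]
    rcases he with h | h <;> rw [h]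
    · exact L.mul_mem htwo L.one_mem
    · exact L.mul_mem htwo (L.neg_mem L.one_mem)
  have hpow : ∃ c : F, g.1 ^ m = c • 1 := by
    rcases h with h | h
    · exact ⟨1, by rw [← Matrix.SpecialLinearGroup.coe_pow, h]; simp⟩
    · exact ⟨-1, by rw [← Matrix.SpecialLinearGroup.coe_pow, h]; simp⟩
  obtain ⟨c, hc⟩ := hpow
  -- Powers of `g` reduced by `g² = τ g - 1`. If `g ^ m` is scalar then either `g` is scalar, or the
  -- coefficient of `g` in `g ^ m`, a Chebyshev-type polynomial in `τ`, vanishes.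
  have hstep : ∀ a b : F, (a • g.1 - b • (1 : Matrix (Fin 2) (Fin 2) F)) * g.1 =
      (a * τ - b) • g.1 - a • 1 := by
    intro a b
    rw [sub_mul, Matrix.smul_mul, Matrix.smul_mul, one_mul, hsq, smul_sub, smul_smul, sub_smul]
    abel
  have p1 : g.1 ^ 1 = (1 : F) • g.1 - (0 : F) • 1 := by simp
  have p2 : g.1 ^ 2 = (1 * τ - 0) • g.1 - (1 : F) • 1 := by rw [pow_succ, p1, hstep]
  have p3 : g.1 ^ 3 = ((1 * τ - 0) * τ - 1) • g.1 - (1 * τ - 0) • 1 := by rw [pow_succ, p2, hstep]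
  have p4 : g.1 ^ 4 = (((1 * τ - 0) * τ - 1) * τ - (1 * τ - 0)) • g.1 -
      ((1 * τ - 0) * τ - 1) • 1 := by rw [pow_succ, p3, hstep]
  have p5 : g.1 ^ 5 = ((((1 * τ - 0) * τ - 1) * τ - (1 * τ - 0)) * τ - ((1 * τ - 0) * τ - 1)) • g.1 -
      (((1 * τ - 0) * τ - 1) * τ - (1 * τ - 0)) • 1 := by rw [pow_succ, p4, hstep]
  have key : ∀ a b : F, g.1 ^ m = a • g.1 - b • 1 → (a = 0 → τ ∈ L) → τ ∈ L := by
    intro a b hab hz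
    by_cases ha : a = 0
    · exact hz ha
    · exact hscal a b c ha (hab.symm.trans hc)
  interval_cases m
  · exact key _ _ p1 fun h => absurd h one_ne_zero
  · refine key _ _ p2 fun h => ?_
    have : τ = 0 := by linear_combination h
    rw [this]; exact L.zero_mem
  · refine key _ _ p3 fun h => hL _ ?_
    rw [show τ ^ 2 = 1 by linear_combination h]; exact L.one_mem
  · refine key _ _ p4 fun h => ?_
    have h3 : τ * (τ ^ 2 - 2) = 0 := by linear_combination h
    rcases mul_eq_zero.1 h3 with h4 | h4
    · rw [h4]; exact L.zero_mem
    · apply hL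
      rw [sub_eq_zero.1 h4]; exact htwo
  · refine key _ _ p5 fun h => ?_
    -- The condition `τ⁴ - 3τ² + 1 = 0` factors, and each factor gives `(2τ ± 1)² = 5`.
    have h3 : (τ ^ 2 - τ - 1) * (τ ^ 2 + τ - 1) = 0 := by linear_combination h
    have h5 : (5 : F) ∈ L := by
      have : (5 : F) = 2 * 2 + 1 := by norm_num
      rw [this]; exact L.add_mem (L.mul_mem htwo htwo) L.one_mem
    have hhalf : ∀ x : F, 2 * x ∈ L → x ∈ L := by
      intro x hx
      have := L.div_mem hx htwo
      rwa [mul_div_cancel_left₀ _ h2] at this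
    rcases mul_eq_zero.1 h3 with h4 | h4
    · have h6 : 2 * τ - 1 ∈ L := hL _ (by
        rw [show (2 * τ - 1) ^ 2 = 5 by linear_combination 4 * h4]; exact h5)
      have := L.add_mem h6 L.one_mem
      rw [sub_add_cancel] at this
      exact hhalf _ this
    · have h6 : 2 * τ + 1 ∈ L := hL _ (by
        rw [show (2 * τ + 1) ^ 2 = 5 by linear_combination 4 * h4]; exact h5)
      have := L.sub_mem h6 L.one_mem
      rw [add_sub_cancel_right] at this
      exact hhalf _ this

variable {K : Type*} [Field K] [Algebra F K]

open MulAction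

theorem IsPolarAction.IsPolyhedral.card_stabilizer_le {H X : Type*} [Group H] [MulAction H X]
    (h : IsPolarAction.IsPolyhedral H X) (x : X) : Nat.card (stabilizer H x) ≤ 5 := by
  rcases h with h | h | h
  · exact (h.2 x).trans (by norm_num)
  · exact (h.2 x).trans (by norm_num)
  · exact (h.2 x).1

/-- Every nontrivial element fixes a point, so its order divides the order of a stabilizer, which is
at most 5. -/
theorem IsPolarAction.exists_pow_eq_one_of_isPolyhedral {H X : Type*} [Group H] [Finite H]
    [MulAction H X] {U : X → Subgroup H} (hU : IsPolarAction H X U) (hbot : ∀ x, U x = ⊥)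
    (h : IsPolarAction.IsPolyhedral H X) (g : H) : ∃ m, 1 ≤ m ∧ m ≤ 5 ∧ g ^ m = 1 := by
  by_cases h1 : g = 1
  · exact ⟨1, le_rfl, by norm_num, by rw [h1, one_pow]⟩
  have hfix := hU.card_fixedBy_two g h1 fun x => by rw [hbot]; exact h1
  have hne : Nonempty (fixedBy X g) := by
    by_contra hc
    rw [not_nonempty_iff] at hc
    rw [Nat.card_of_isEmpty] at hfix
    omega
  obtain ⟨x, hx⟩ := hne
  refine ⟨Nat.card (stabilizer H x), Nat.card_pos, h.card_stabilizer_le x, ?_⟩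
  exact congrArg Subtype.val (pow_card_eq_one' (x := (⟨g, hx⟩ : stabilizer H x)))

/-- A polyhedral group contains commuting elements `z`, `s` with `z` an involution and `s` not
fixing a given fixed point of `z`. -/
theorem IsPolarAction.exists_involution_of_isPolyhedral {H X : Type*} [Group H] [Finite H]
    [MulAction H X] {U : X → Subgroup H} (hU : IsPolarAction H X U) (hbot : ∀ x, U x = ⊥)
    (h : IsPolarAction.IsPolyhedral H X) :
    ∃ (z s : H) (x : X), z ≠ 1 ∧ z * z = 1 ∧ s * z = z * s ∧ z • x = x ∧ s • x ≠ x := by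
  classical
  obtain ⟨S⟩ : Nonempty (Sylow 2 H) := inferInstance
  have hScard := S.card_eq_multiplicity
  have hS4 : Nat.card S = 4 ∨ Nat.card S = 8 := by
    rcases h with h | h | h
    · left
      rw [hScard, h.1, show (12 : ℕ) = 2 ^ 2 * 3 by norm_num,
        Nat.factorization_mul (by norm_num) (by norm_num), Nat.Prime.factorization_pow Nat.prime_two,
        Nat.Prime.factorization (by norm_num : Nat.Prime 3)]
      simp
    · right
      rw [hScard, h.1, show (24 : ℕ) = 2 ^ 3 * 3 by norm_num,
        Nat.factorization_mul (by norm_num) (by norm_num), Nat.Prime.factorization_pow Nat.prime_two,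
        Nat.Prime.factorization (by norm_num : Nat.Prime 3)]
      simp
    · left
      rw [hScard, h.1, show (60 : ℕ) = 2 ^ 2 * (3 * 5) by norm_num,
        Nat.factorization_mul (by norm_num) (by norm_num), Nat.Prime.factorization_pow Nat.prime_two,
        Nat.factorization_mul (by norm_num) (by norm_num),
        Nat.Prime.factorization (by norm_num : Nat.Prime 3),
        Nat.Prime.factorization (by norm_num : Nat.Prime 5)]
      simp
  -- A Sylow 2-subgroup has order 4 or 8 and does not fit into a stabilizer. This is why stabilizers
  -- of order 4 are excluded for order 60. A central involution of it then serves as `z`.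
  have hlt : ∀ x : X, ∃ s ∈ S, s • x ≠ x := by
    intro x
    by_contra hc
    push Not at hc
    have hle : (S : Subgroup H) ≤ stabilizer H x := hc
    have hdvd := Subgroup.card_dvd_of_le hle
    have hpos : 0 < Nat.card (stabilizer H x) := Nat.card_pos
    change Nat.card S ∣ _ at hdvd
    have h5 := h.card_stabilizer_le x
    rcases hS4 with h4 | h8
    · rw [h4] at hdvd
      have h44 : Nat.card (stabilizer H x) = 4 := by omega
      rcases h with h | h | h
      · have := h.2 x; omega
      · have h3 : Nat.card S = 8 := by
          rw [hScard, h.1, show (24 : ℕ) = 2 ^ 3 * 3 by norm_num,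
            Nat.factorization_mul (by norm_num) (by norm_num),
            Nat.Prime.factorization_pow Nat.prime_two,
            Nat.Prime.factorization (by norm_num : Nat.Prime 3)]
          simp
        omega
      · exact (h.2 x).2 h44
    · rw [h8] at hdvd
      have := Nat.le_of_dvd hpos hdvd
      omega
  have hnt : Nontrivial S := Finite.one_lt_card_iff_nontrivial.1 (by rcases hS4 with h | h <;> omega)
  have hcen : Nontrivial (Subgroup.center S) := S.isPGroup'.center_nontrivial
  have h2dvd : 2 ∣ Nat.card (Subgroup.center S) := by
    obtain ⟨n, hn⟩ := IsPGroup.iff_card.1 (S.isPGroup'.to_subgroup (Subgroup.center S))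
    rw [hn]
    refine dvd_pow_self 2 ?_
    rintro rfl
    have := Finite.one_lt_card_iff_nontrivial.2 hcen
    omega
  obtain ⟨z, hz⟩ := exists_prime_orderOf_dvd_card' (G := Subgroup.center S) 2 h2dvd
  have hz1 : z.1.1 ≠ 1 := by
    intro e
    have : z = 1 := Subtype.ext (Subtype.ext e)
    rw [this, orderOf_one] at hz
    omega
  have hz2 : z.1.1 * z.1.1 = 1 := by
    have h3 := pow_orderOf_eq_one z
    rw [hz, sq] at h3
    exact congrArg (fun w : Subgroup.center S => w.1.1) h3
  have hfix := hU.card_fixedBy_two z.1.1 hz1 fun x => by rw [hbot]; exact hz1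
  have hne : Nonempty (fixedBy X z.1.1) := by
    by_contra hc
    rw [not_nonempty_iff] at hc
    rw [Nat.card_of_isEmpty] at hfix
    omega
  obtain ⟨x, hx⟩ := hne
  obtain ⟨s, hs, hsx⟩ := hlt x
  exact ⟨z.1.1, s, x, hz1, hz2, congrArg Subtype.val (Subgroup.mem_center_iff.1 z.2 ⟨s, hs⟩), hx, hsx⟩

/-- The lift of an involution has square `-1` in odd characteristic. If the lifts commuted, `v` and
`j v` would be independent eigenvectors of `i` with the same eigenvalue `c`; then `c² = 1` from the
determinant and `c² = -1` from the trace. Anticommuting makes `j` conjugate to `-j`, so its trace is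
zero. -/
theorem L2.exists_anticommuting (h2 : (2 : F) ≠ 0) {M : Subgroup (L2 F)} {z s : M}
    {x : ℙ K (Fin 2 → K)} (hz : z ≠ 1) (hz2 : z * z = 1) (hzs : s * z = z * s) (hx : z • x = x)
    (hs : s • x ≠ x) :
    ∃ i ∈ M.comap L2.mk, ∃ j ∈ M.comap L2.mk, i * i = -1 ∧ j * j = -1 ∧ i * j = -(j * i) ∧
      L2.mk i = z ∧ L2.mk j = s := by
  obtain ⟨z, hzM⟩ := z
  obtain ⟨s, hsM⟩ := s
  obtain ⟨i, rfl⟩ := L2.mk_surjective z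
  obtain ⟨j, rfl⟩ := L2.mk_surjective s
  have hz' : L2.mk i ≠ 1 := fun e => hz (Subtype.ext e)
  have hz2' : L2.mk (i * i) = 1 := by rw [map_mul]; exact congrArg Subtype.val hz2
  have hzs' : L2.mk (i * j) = L2.mk (j * i) := by
    rw [map_mul, map_mul]; exact (congrArg Subtype.val hzs).symm
  have hx' : L2.mk i • x = x := hx
  have hs' : L2.mk j • x ≠ x := hs
  have hi : i * i = -1 := by
    rcases L2.mk_eq_one_iff.1 hz2' with h | h
    · exfalso
      have h1 : i.1 * i.1 = 1 := congrArg Subtype.val h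
      have hd := SL2.det_val i
      have e00 := congrFun (congrFun h1 0) 0
      have e01 := congrFun (congrFun h1 0) 1
      have e10 := congrFun (congrFun h1 1) 0
      have e11 := congrFun (congrFun h1 1) 1
      simp [Matrix.mul_apply, Fin.sum_univ_two] at e00 e01 e10 e11
      have hinv : i⁻¹ = i := inv_eq_of_mul_eq_one_right h
      have hv := SL2.inv_val i
      rw [hinv] at hv
      have f00 := congrFun (congrFun hv 0) 0
      have f01 := congrFun (congrFun hv 0) 1
      have f10 := congrFun (congrFun hv 1) 0
      simp at f00 f01 f10
      have hb : i.1 0 1 = 0 := by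
        have : 2 * i.1 0 1 = 0 := by linear_combination f01
        exact (mul_eq_zero.1 this).resolve_left h2
      have hc : i.1 1 0 = 0 := by
        have : 2 * i.1 1 0 = 0 := by linear_combination f10
        exact (mul_eq_zero.1 this).resolve_left h2
      apply SL2.ne_smul_one' hz' (i.1 0 0)
      ext a b
      fin_cases a <;> fin_cases b <;> simp [hb, hc, f00]
    · exact h
  have hij : i * j = -(j * i) := by
    rcases L2.mk_eq_mk_iff.1 hzs' with h | h
    · exfalso
      induction x using Projectivization.ind with
      | h v hv =>
        obtain ⟨c, hc⟩ := (L2.smul_eq_iff i v hv).1 hx'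
        rw [L2.mk_smul_mk, Ne, eq_comm, mk_eq_mk_iff_wedge] at hs'
        have h3 : i.toMat K *ᵥ (j.toMat K *ᵥ v) = c • (j.toMat K *ᵥ v) := by
          rw [Matrix.mulVec_mulVec, ← SL2.toMat_mul, h, SL2.toMat_mul, ← Matrix.mulVec_mulVec, hc,
            Matrix.mulVec_smul]
        have h4 := det_eq_mul_of_eigenvectors hs' hc h3
        rw [SL2.det_toMat] at h4
        have h5 := SL2.eigenvalue_eq hv hc
        rw [SL2.trace_eq_zero_of_mul_self hi, map_zero, zero_mul, sub_zero] at h5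
        have h6 : (2 : K) = 0 := by linear_combination h5 + h4
        apply h2
        apply (algebraMap F K).injective
        rw [map_ofNat, h6, map_zero]
    · exact h
  refine ⟨i, hzM, j, hsM, hi, ?_, hij, rfl, rfl⟩
  apply SL2.mul_self_eq_neg_one
  have h3 : i * j * i⁻¹ = -j := by
    rw [hij, mul_inv_eq_iff_eq_mul, neg_mul]
  have h4 : (i * j * i⁻¹).1.trace = j.1.trace := by
    rw [Matrix.SpecialLinearGroup.coe_mul, Matrix.trace_mul_comm,
      ← Matrix.SpecialLinearGroup.coe_mul, ← mul_assoc, inv_mul_cancel, one_mul]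
  rw [h3] at h4
  have h5 : (-j).1.trace = -j.1.trace := Matrix.trace_neg _
  rw [h5] at h4
  have : 2 * j.1.trace = 0 := by linear_combination -h4
  exact (mul_eq_zero.1 this).resolve_left h2

/-- A polyhedral subgroup of `L₂(q)` with `q` an odd power of `p` is conjugate to a subgroup of
`L₂(p)`. -/
theorem L2.exists_le_subfieldSL_of_isPolyhedral [Finite F] {p k : ℕ} [hp : Fact p.Prime]
    (hk : Odd k) (hF : Nat.card F = p ^ k) (hp5 : 5 ≤ p)
    {M : Subgroup (L2 F)}
    (hU : IsPolarAction M (ℙ K (Fin 2 → K)) fun x => (L2.unip F x).subgroupOf M)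
    (hbot : ∀ x : ℙ K (Fin 2 → K), (L2.unip F x).subgroupOf M = ⊥)
    (hpoly : IsPolarAction.IsPolyhedral M (ℙ K (Fin 2 → K))) (L : Subfield F) :
    ∃ P : GL (Fin 2) F, M.comap L2.mk ≤ SL2.subfieldSL P L := by
  have := charP_of_natCard hF
  have h2 : (2 : F) ≠ 0 := by
    intro h
    have h2 : ((2 : ℕ) : F) = 0 := by exact_mod_cast h
    rw [CharP.cast_eq_zero_iff F p] at h2
    have := Nat.le_of_dvd two_pos h2
    omega
  obtain ⟨z, s, x, hz, hz2, hzs, hx, hs⟩ := IsPolarAction.exists_involution_of_isPolyhedral hU hbot hpoly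
  obtain ⟨i, hiM, j, hjM, hi, hj, hij, -, -⟩ := L2.exists_anticommuting h2 hz hz2 hzs hx hs
  refine SL2.exists_le_subfieldSL h2 hiM hjM hi hj hij fun g hg => ?_
  obtain ⟨m, hm1, hm5, hm⟩ := IsPolarAction.exists_pow_eq_one_of_isPolyhedral hU hbot hpoly ⟨L2.mk g, hg⟩
  refine SL2.trace_mem_of_pow h2 hm1 hm5 ?_ L fun a ha => L.mem_of_sq_mem hk hF ha
  rw [← L2.mk_eq_one_iff, map_pow]
  exact congrArg Subtype.val hm

end

/-! ### Maximal subgroups when the degree is odd -/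

section

variable {F : Type u} [Field F]

open MulAction

theorem L2.card_dvd_card [Finite F] : Nat.card F ∣ 2 * Nat.card (L2 F) := by
  have h := L2.card_mul_card_center (F := F)
  by_cases h2 : (2 : F) = 0
  · rw [SL2.card_center_of_two_eq_zero h2, one_mul] at h
    exact Dvd.dvd.mul_left ⟨_, h⟩ 2
  · rw [SL2.card_center_of_two_ne_zero h2] at h
    exact ⟨_, h⟩

/-- The maximal subgroups of `L₂(q)`, where `q` is an odd power of `p`. -/
theorem L2.isCoatom_cases_of_odd [Finite F] {K : Type*} [Field K] [Algebra F K] [Finite K] {p k : ℕ}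
    [hp : Fact p.Prime] (hk : Odd k) (hF : Nat.card F = p ^ k) (hq : 3 ≤ Nat.card F)
    (hK : ∀ τ : F, ∃ c : K, c ^ 2 - algebraMap F K τ * c + 1 = 0)
    {M : Subgroup (L2 F)} (hM : IsCoatom M) :
    (∃ v hv, M.comap L2.mk = SL2.lineStab v hv) ∨
    (∃ X : SL2 F, X.1.trace ^ 2 ≠ 4 ∧ M.comap L2.mk = SL2.invStab X) ∨
    (k = 1 ∧ 5 ≤ p ∧ ¬ p ∣ Nat.card M ∧ (∀ x : ℙ K (Fin 2 → K), (L2.unip F x).subgroupOf M = ⊥) ∧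
      IsPolarAction.IsPolyhedral M (ℙ K (Fin 2 → K))) ∨
    (∃ r : ℕ, r.Prime ∧ r ∣ k ∧ 3 ≤ p ^ (k / r) ∧ ∃ L : Subfield F, Nat.card L = p ^ (k / r) ∧
      Nonempty (L2 L ≃* M)) := by
  rcases L2.isCoatom_cases hk hF hq hK hM with h | h | ⟨h5, hnd, hbot, hpoly⟩ | h
  · exact Or.inl h
  · exact Or.inr (Or.inl h)
  · refine Or.inr (Or.inr (Or.inl ⟨?_, h5, hnd, hbot, hpoly⟩))
    by_contra hk1
    obtain ⟨L, hL, -⟩ := Subfield.exists_card_eq (p := p) (m := 1) hF (one_dvd k) one_ne_zero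
    obtain ⟨P, hP⟩ := L2.exists_le_subfieldSL_of_isPolyhedral hk hF h5
      ((L2.isPolarAction hK).restrict M) hbot hpoly L
    have hLtop : L ≠ ⊤ := by
      rintro rfl
      rw [Nat.card_congr Subfield.topEquiv.toEquiv, hF] at hL
      exact hk1 (Nat.pow_right_injective hp.out.two_le hL)
    obtain ⟨e⟩ := L2.nonempty_equiv_of_isCoatom hM hLtop hP
    -- A maximal polyhedral subgroup would coincide with a conjugate of `L₂(p)`, whose order is
    -- divisible by `p`.
    have hd := L2.card_dvd_card (F := L)
    rw [hL, pow_one, Nat.card_congr e.toEquiv, hp.out.dvd_mul] at hd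
    rcases hd with hd | hd
    · have := Nat.le_of_dvd two_pos hd
      omega
    · exact hnd hd
  · exact Or.inr (Or.inr (Or.inr h))

end

/-! ### Normalizers of small sets, and quaternion coordinates -/

theorem Subgroup.mem_normalizer_of_finite {G : Type*} [Group G] {T : Set G} (hT : T.Finite) {g : G}
    (h : ∀ t ∈ T, g * t * g⁻¹ ∈ T) : g ∈ Subgroup.normalizer T := by
  rw [Subgroup.mem_normalizer_iff_conj_image_eq]
  refine Set.eq_of_subset_of_ncard_le ?_ ?_ hT
  · rintro _ ⟨t, ht, rfl⟩
    exact h t ht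
  · rw [Set.ncard_image_of_injective _ (MulAut.conj g).injective]

section

variable {F : Type u} [Field F]

/-- A small set of matrices which are not scalar plus nilpotent is not invariant under
conjugation. -/
theorem SL2.normalizer_ne_top {p : ℕ} [CharP F p] {T : Set (SL2 F)} (hT : T.Finite)
    (hp : T.ncard < p) {a : SL2 F} (ha : a ∈ T) (htr : a.1.trace ^ 2 ≠ 4) :
    Subgroup.normalizer T ≠ ⊤ := by
  intro htop
  have hinv : ∀ g : SL2 F, g * a * g⁻¹ ∈ T := by
    intro g
    have : g ∈ Subgroup.normalizer T := by rw [htop]; exact Subgroup.mem_top _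
    rw [Subgroup.mem_normalizer_iff_conj_image_eq] at this
    rw [← this]
    exact ⟨a, ha, rfl⟩
  have hval : ∀ x : F, SL2.upper 1 x * a * (SL2.upper 1 x)⁻¹ =
      (⟨!![a.1 0 0 + x * a.1 1 0, a.1 0 1 + x * (a.1 1 1 - a.1 0 0) - x ^ 2 * a.1 1 0;
        a.1 1 0, a.1 1 1 - x * a.1 1 0], by
        rw [Matrix.det_fin_two_of]
        linear_combination SL2.det_val a⟩ : SL2 F) := by
    intro x
    refine mul_inv_eq_iff_eq_mul.2 (Subtype.ext ?_)
    change (SL2.upper 1 x).1 * a.1 = !![a.1 0 0 + x * a.1 1 0,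
      a.1 0 1 + x * (a.1 1 1 - a.1 0 0) - x ^ 2 * a.1 1 0; a.1 1 0, a.1 1 1 - x * a.1 1 0] *
      (SL2.upper 1 x).1
    ext i j
    fin_cases i <;> fin_cases j <;>
      simp [SL2.upper, Matrix.mul_apply, Fin.sum_univ_two] <;> ring
  have hinj : Function.Injective fun x : F => SL2.upper 1 x * a * (SL2.upper 1 x)⁻¹ := by
    intro x y hxy
    dsimp only at hxy
    rw [hval, hval] at hxy
    have h00 := congrArg (fun s : SL2 F => s.1 0 0) hxy
    have h01 := congrArg (fun s : SL2 F => s.1 0 1) hxy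
    simp at h00 h01
    have hd := SL2.det_val a
    rw [Matrix.trace_fin_two] at htr
    rcases h00 with h | h
    · exact h
    · rw [h] at h01 hd
      have h3 : (x - y) * (a.1 1 1 - a.1 0 0) = 0 := by linear_combination h01
      rcases mul_eq_zero.1 h3 with h4 | h4
      · exact sub_eq_zero.1 h4
      · exact absurd (by linear_combination (a.1 1 1 - a.1 0 0) * h4 + 4 * hd) htr
  -- The integers below `p` give `p` different conjugates of `a` by transvections, more than `T` can
  -- hold.
  have hcast : Function.Injective fun n : Fin p => ((n : ℕ) : F) := by
    intro m n hmn
    exact Fin.ext (CharP.natCast_injOn_Iio F p m.2 n.2 hmn)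
  have := Set.ncard_le_ncard (s := Set.range fun n : Fin p =>
    SL2.upper 1 ((n : ℕ) : F) * a * (SL2.upper 1 ((n : ℕ) : F))⁻¹) (t := T)
    (by rintro _ ⟨n, rfl⟩; exact hinv _) hT
  have hinj' : Function.Injective fun n : Fin p =>
    SL2.upper 1 ((n : ℕ) : F) * a * (SL2.upper 1 ((n : ℕ) : F))⁻¹ := hinj.comp hcast
  rw [← Set.image_univ, Set.ncard_image_of_injective _ hinj', Set.ncard_univ,
    Nat.card_eq_fintype_card, Fintype.card_fin] at this
  omega

/-- Linear combinations of the basis of a quaternion algebra. -/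
def SL2.quat (i j : SL2 F) (a b c d : F) : Matrix (Fin 2) (Fin 2) F :=
  a • (1 : Matrix (Fin 2) (Fin 2) F) + b • i.1 + c • j.1 + d • (i.1 * j.1)

section

variable {i j : SL2 F} (hi : i * i = -1) (hj : j * j = -1) (hij : i * j = -(j * i))

include hi hj hij

theorem SL2.quat_mul (a b c d a' b' c' d' : F) :
    SL2.quat i j a b c d * SL2.quat i j a' b' c' d' =
      SL2.quat i j (a * a' - b * b' - c * c' - d * d') (a * b' + b * a' + c * d' - d * c')
        (a * c' - b * d' + c * a' + d * b') (a * d' + b * c' - c * b' + d * a') := by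
  have hi' : i.1 * i.1 = -1 := congrArg Subtype.val hi
  have hj' : j.1 * j.1 = -1 := congrArg Subtype.val hj
  have e1 : j.1 * i.1 = -(i.1 * j.1) := by
    have : i.1 * j.1 = -(j.1 * i.1) := congrArg Subtype.val hij
    rw [this, neg_neg]
  have e2 : i.1 * (i.1 * j.1) = -j.1 := by rw [← mul_assoc, hi', neg_mul, one_mul]
  have e3 : i.1 * j.1 * j.1 = -i.1 := by rw [mul_assoc, hj', mul_neg, mul_one]
  have e4 : j.1 * (i.1 * j.1) = i.1 := by rw [← mul_assoc, e1, neg_mul, e3, neg_neg]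
  have e5 : i.1 * j.1 * i.1 = j.1 := by rw [mul_assoc, e1, mul_neg, e2, neg_neg]
  have e6 : i.1 * j.1 * (i.1 * j.1) = -1 := by rw [mul_assoc, e4, hi']
  simp only [SL2.quat, mul_add, add_mul, Matrix.mul_smul, Matrix.smul_mul, mul_one, one_mul, hi',
    hj', e1, e2, e3, e4, e5, e6, smul_smul, smul_neg]
  module

theorem SL2.trace_quat (h2 : (2 : F) ≠ 0) (a b c d : F) : (SL2.quat i j a b c d).trace = 2 * a := by
  have h1 := SL2.trace_eq_zero_of_mul_self hi
  have h3 := SL2.trace_eq_zero_of_mul_self hj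
  have h4 : (i.1 * j.1).trace = 0 := by
    have h5 : (i.1 * j.1).trace = -(i.1 * j.1).trace := by
      conv_lhs => rw [show i.1 * j.1 = -(j.1 * i.1) from congrArg Subtype.val hij, Matrix.trace_neg,
        Matrix.trace_mul_comm]
    have : (2 : F) * (i.1 * j.1).trace = 0 := by linear_combination h5
    exact (mul_eq_zero.1 this).resolve_left h2
  simp only [SL2.quat, Matrix.trace_add, Matrix.trace_smul, h1, h3, h4, Matrix.trace_one]
  simp
  ring

theorem SL2.adjugate_quat (h2 : (2 : F) ≠ 0) (a b c d : F) :
    (SL2.quat i j a b c d).adjugate = SL2.quat i j a (-b) (-c) (-d) := by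
  have ht := SL2.trace_quat hi hj hij h2 a b c d
  have hadj : ∀ A : Matrix (Fin 2) (Fin 2) F, A.adjugate = A.trace • 1 - A := by
    intro A
    rw [Matrix.adjugate_fin_two, Matrix.trace_fin_two]
    ext r s
    fin_cases r <;> fin_cases s <;> simp
  rw [hadj, ht]
  simp only [SL2.quat]
  module

theorem SL2.det_quat (h2 : (2 : F) ≠ 0) (a b c d : F) :
    (SL2.quat i j a b c d).det = a ^ 2 + b ^ 2 + c ^ 2 + d ^ 2 := by
  have h3 := Matrix.mul_adjugate (SL2.quat i j a b c d)
  rw [SL2.adjugate_quat hi hj hij h2, SL2.quat_mul hi hj hij] at h3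
  have h4 := congrArg (fun A : Matrix (Fin 2) (Fin 2) F => A 0 0) h3
  have h5 : SL2.quat i j (a * a - b * -b - c * -c - d * -d) (a * -b + b * a + c * -d - d * -c)
      (a * -c - b * -d + c * a + d * -b) (a * -d + b * -c - c * -b + d * a) =
      (a ^ 2 + b ^ 2 + c ^ 2 + d ^ 2) • (1 : Matrix (Fin 2) (Fin 2) F) := by
    simp only [SL2.quat]
    module
  rw [h5] at h4
  simpa using h4.symm

theorem SL2.exists_quat (h2 : (2 : F) ≠ 0) {a b c d : F} (h : a ^ 2 + b ^ 2 + c ^ 2 + d ^ 2 = 1) :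
    ∃ g : SL2 F, g.1 = SL2.quat i j a b c d :=
  ⟨⟨_, (SL2.det_quat hi hj hij h2 a b c d).trans h⟩, rfl⟩

end

theorem SL2.val_left_eq_quat (i j : SL2 F) : i.1 = SL2.quat i j 0 1 0 0 := by simp [SL2.quat]

theorem SL2.val_right_eq_quat (i j : SL2 F) : j.1 = SL2.quat i j 0 0 1 0 := by simp [SL2.quat]

theorem SL2.val_neg_of_quat {i j g : SL2 F} {a b c d : F} (h : g.1 = SL2.quat i j a b c d) :
    (-g).1 = SL2.quat i j (-a) (-b) (-c) (-d) := by
  rw [Matrix.SpecialLinearGroup.coe_neg, h]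
  simp only [SL2.quat]
  module

theorem SL2.val_inv_of_quat {i j g : SL2 F} (h2 : (2 : F) ≠ 0) (hi : i * i = -1) (hj : j * j = -1)
    (hij : i * j = -(j * i)) {a b c d : F} (hg : g.1 = SL2.quat i j a b c d) :
    (g⁻¹).1 = SL2.quat i j a (-b) (-c) (-d) := by
  rw [Matrix.SpecialLinearGroup.coe_inv, hg, SL2.adjugate_quat hi hj hij h2]

theorem SL2.val_mul_of_quat {i j g h : SL2 F} (hi : i * i = -1) (hj : j * j = -1)
    (hij : i * j = -(j * i)) {a b c d a' b' c' d' : F} (hg : g.1 = SL2.quat i j a b c d)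
    (hh : h.1 = SL2.quat i j a' b' c' d') : (g * h).1 =
      SL2.quat i j (a * a' - b * b' - c * c' - d * d') (a * b' + b * a' + c * d' - d * c')
        (a * c' - b * d' + c * a' + d * b') (a * d' + b * c' - c * b' + d * a') := by
  rw [Matrix.SpecialLinearGroup.coe_mul, hg, hh, SL2.quat_mul hi hj hij]

end

/-! ### Axis sets and the icosahedral configuration -/

/-- The values of a function and their inverses. -/
def axisSet {G ι : Type*} [Group G] (A : ι → G) : Set G :=
  Set.range A ∪ Set.range fun n => (A n)⁻¹

section

variable {G ι : Type*} [Group G] [Finite ι] (A : ι → G)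

theorem finite_axisSet : (axisSet A).Finite := (Set.finite_range _).union (Set.finite_range _)

theorem ncard_axisSet_le : (axisSet A).ncard ≤ 2 * Nat.card ι := by
  have h : ∀ B : ι → G, (Set.range B).ncard ≤ Nat.card ι := fun B => by
    rw [← Set.image_univ, ← Set.ncard_univ]
    exact Set.ncard_image_le Set.finite_univ
  have := Set.ncard_union_le (Set.range A) (Set.range fun n => (A n)⁻¹)
  have h1 := h A
  have h2 := h fun n => (A n)⁻¹
  unfold axisSet
  omega

variable {A}

theorem mem_normalizer_axisSet {g : G}
    (h : ∀ n, ∃ m, g * A n = A m * g ∨ g * A n = (A m)⁻¹ * g) :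
    g ∈ Subgroup.normalizer (axisSet A) := by
  refine Subgroup.mem_normalizer_of_finite (finite_axisSet A) ?_
  have h1 : ∀ n, g * A n * g⁻¹ ∈ axisSet A ∧ (g * A n * g⁻¹)⁻¹ ∈ axisSet A := by
    intro n
    obtain ⟨m, hm | hm⟩ := h n
    · rw [hm, mul_inv_cancel_right]
      exact ⟨Or.inl ⟨m, rfl⟩, Or.inr ⟨m, rfl⟩⟩
    · rw [hm, mul_inv_cancel_right, inv_inv]
      exact ⟨Or.inr ⟨m, rfl⟩, Or.inl ⟨m, rfl⟩⟩
  rintro t (⟨n, rfl⟩ | ⟨n, rfl⟩)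
  · exact (h1 n).1
  · have := (h1 n).2
    rwa [mul_inv_rev, mul_inv_rev, inv_inv, ← mul_assoc] at this

end

section

variable {F : Type u} [Field F] {i j : SL2 F}

theorem SL2.inv_eq_neg {i : SL2 F} (hi : i * i = -1) : i⁻¹ = -i := by
  rw [inv_eq_iff_mul_eq_one, mul_neg, hi, neg_neg]

/-- The vectors along the fivefold axes of an icosahedron. -/
def icosahedralAxes (c f : F) : Fin 6 → F × F × F :=
  ![(c, c * f, 0), (c, -(c * f), 0), (0, c, c * f), (0, c, -(c * f)), (c * f, 0, c),
    (-(c * f), 0, c)]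

variable (h2 : (2 : F) ≠ 0) (hi : i * i = -1) (hj : j * j = -1) (hij : i * j = -(j * i))

include h2 hi hj hij

/-- With `f` the golden ratio, these quaternions of norm 1 are rotations of order five about the
axes of an icosahedron. -/
theorem SL2.exists_icosahedral {f : F} (hf : f ^ 2 = f + 1) :
    ∃ A : Fin 6 → SL2 F, (∀ n, (A n).1 = SL2.quat i j (2⁻¹ * (f - 1)) (icosahedralAxes 2⁻¹ f n).1
      (icosahedralAxes 2⁻¹ f n).2.1 (icosahedralAxes 2⁻¹ f n).2.2) := by
  have hc : (2 : F) * 2⁻¹ = 1 := mul_inv_cancel₀ h2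
  have : ∀ n, ∃ g : SL2 F, g.1 = SL2.quat i j (2⁻¹ * (f - 1)) (icosahedralAxes 2⁻¹ f n).1
      (icosahedralAxes 2⁻¹ f n).2.1 (icosahedralAxes 2⁻¹ f n).2.2 := by
    intro n
    refine SL2.exists_quat hi hj hij h2 ?_
    generalize (2 : F)⁻¹ = c at hc
    fin_cases n <;> simp only [icosahedralAxes] <;> simp <;>
      linear_combination 2 * c ^ 2 * hf + (1 + 2 * c) * hc
  choose A hA using this
  exact ⟨A, hA⟩

omit h2 in
theorem SL2.mul_eq_mul_of_quat {g x y : SL2 F} {a b c d a₁ b₁ c₁ d₁ a₂ b₂ c₂ d₂ : F}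
    (hg : g.1 = SL2.quat i j a b c d) (hx : x.1 = SL2.quat i j a₁ b₁ c₁ d₁)
    (hy : y.1 = SL2.quat i j a₂ b₂ c₂ d₂)
    (h0 : a * a₁ - b * b₁ - c * c₁ - d * d₁ = a₂ * a - b₂ * b - c₂ * c - d₂ * d)
    (h1 : a * b₁ + b * a₁ + c * d₁ - d * c₁ = a₂ * b + b₂ * a + c₂ * d - d₂ * c)
    (h3 : a * c₁ - b * d₁ + c * a₁ + d * b₁ = a₂ * c - b₂ * d + c₂ * a + d₂ * b)
    (h4 : a * d₁ + b * c₁ - c * b₁ + d * a₁ = a₂ * d + b₂ * c - c₂ * b + d₂ * a) :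
    g * x = y * g := by
  apply Subtype.ext
  rw [SL2.val_mul_of_quat hi hj hij hg hx, SL2.val_mul_of_quat hi hj hij hy hg, h0, h1, h3, h4]

variable {f : F} {A : Fin 6 → SL2 F}
  (hA : ∀ n, (A n).1 = SL2.quat i j (2⁻¹ * (f - 1)) (icosahedralAxes 2⁻¹ f n).1
      (icosahedralAxes 2⁻¹ f n).2.1 (icosahedralAxes 2⁻¹ f n).2.2)

include hA

theorem SL2.mem_normalizer_icosahedral_left : i ∈ Subgroup.normalizer (axisSet A) := by
  have hi' := SL2.val_left_eq_quat i j
  refine mem_normalizer_axisSet fun n => ?_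
  fin_cases n
  · refine ⟨1, Or.inl (SL2.mul_eq_mul_of_quat hi hj hij hi' (hA 0) (hA 1) ?_ ?_ ?_ ?_)⟩
    all_goals simp [icosahedralAxes]
  · refine ⟨0, Or.inl (SL2.mul_eq_mul_of_quat hi hj hij hi' (hA 1) (hA 0) ?_ ?_ ?_ ?_)⟩
    all_goals simp [icosahedralAxes]
  · refine ⟨2, Or.inr (SL2.mul_eq_mul_of_quat hi hj hij hi' (hA 2)
      (SL2.val_inv_of_quat h2 hi hj hij (hA 2)) ?_ ?_ ?_ ?_)⟩
    all_goals simp [icosahedralAxes]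
  · refine ⟨3, Or.inr (SL2.mul_eq_mul_of_quat hi hj hij hi' (hA 3)
      (SL2.val_inv_of_quat h2 hi hj hij (hA 3)) ?_ ?_ ?_ ?_)⟩
    all_goals simp [icosahedralAxes]
  · refine ⟨5, Or.inr (SL2.mul_eq_mul_of_quat hi hj hij hi' (hA 4)
      (SL2.val_inv_of_quat h2 hi hj hij (hA 5)) ?_ ?_ ?_ ?_)⟩
    all_goals simp [icosahedralAxes]
  · refine ⟨4, Or.inr (SL2.mul_eq_mul_of_quat hi hj hij hi' (hA 5)
      (SL2.val_inv_of_quat h2 hi hj hij (hA 4)) ?_ ?_ ?_ ?_)⟩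
    all_goals simp [icosahedralAxes]

theorem SL2.mem_normalizer_icosahedral_right : j ∈ Subgroup.normalizer (axisSet A) := by
  have hj' := SL2.val_right_eq_quat i j
  refine mem_normalizer_axisSet fun n => ?_
  fin_cases n
  · refine ⟨1, Or.inr (SL2.mul_eq_mul_of_quat hi hj hij hj' (hA 0)
      (SL2.val_inv_of_quat h2 hi hj hij (hA 1)) ?_ ?_ ?_ ?_)⟩
    all_goals simp [icosahedralAxes]
  · refine ⟨0, Or.inr (SL2.mul_eq_mul_of_quat hi hj hij hj' (hA 1)
      (SL2.val_inv_of_quat h2 hi hj hij (hA 0)) ?_ ?_ ?_ ?_)⟩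
    all_goals simp [icosahedralAxes]
  · refine ⟨3, Or.inl (SL2.mul_eq_mul_of_quat hi hj hij hj' (hA 2) (hA 3) ?_ ?_ ?_ ?_)⟩
    all_goals simp [icosahedralAxes]
  · refine ⟨2, Or.inl (SL2.mul_eq_mul_of_quat hi hj hij hj' (hA 3) (hA 2) ?_ ?_ ?_ ?_)⟩
    all_goals simp [icosahedralAxes]
  · refine ⟨4, Or.inr (SL2.mul_eq_mul_of_quat hi hj hij hj' (hA 4)
      (SL2.val_inv_of_quat h2 hi hj hij (hA 4)) ?_ ?_ ?_ ?_)⟩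
    all_goals simp [icosahedralAxes]
  · refine ⟨5, Or.inr (SL2.mul_eq_mul_of_quat hi hj hij hj' (hA 5)
      (SL2.val_inv_of_quat h2 hi hj hij (hA 5)) ?_ ?_ ?_ ?_)⟩
    all_goals simp [icosahedralAxes]

omit h2 in
-- Conjugation by `1 + i + j + ij`, up to scale, permutes the coordinates cyclically, and the axes
-- are invariant under that.
theorem SL2.mem_normalizer_icosahedral_rotation {ω : SL2 F} {c : F}
    (hω : ω.1 = SL2.quat i j c c c c) : ω ∈ Subgroup.normalizer (axisSet A) := by
  refine mem_normalizer_axisSet fun n => ⟨![2, 3, 4, 5, 0, 1] n, Or.inl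
    (SL2.mul_eq_mul_of_quat hi hj hij hω (hA n) (hA _) ?_ ?_ ?_ ?_)⟩
  all_goals fin_cases n <;> simp [icosahedralAxes] <;> ring

theorem SL2.mem_normalizer_icosahedral_axis (hf : f ^ 2 = f + 1) :
    A 0 ∈ Subgroup.normalizer (axisSet A) := by
  refine mem_normalizer_axisSet fun n => ?_
  fin_cases n
  · exact ⟨0, Or.inl rfl⟩
  · refine ⟨4, Or.inr (SL2.mul_eq_mul_of_quat hi hj hij (hA 0) (hA 1)
      (SL2.val_inv_of_quat h2 hi hj hij (hA 4)) ?_ ?_ ?_ ?_)⟩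
    all_goals
      simp only [icosahedralAxes]
      simp
      try grind
  · refine ⟨5, Or.inr (SL2.mul_eq_mul_of_quat hi hj hij (hA 0) (hA 2)
      (SL2.val_inv_of_quat h2 hi hj hij (hA 5)) ?_ ?_ ?_ ?_)⟩
    all_goals
      simp only [icosahedralAxes]
      simp
      try grind
  · refine ⟨2, Or.inl (SL2.mul_eq_mul_of_quat hi hj hij (hA 0) (hA 3) (hA 2) ?_ ?_ ?_ ?_)⟩
    all_goals
      simp only [icosahedralAxes]
      simp
      try grind
  · refine ⟨3, Or.inl (SL2.mul_eq_mul_of_quat hi hj hij (hA 0) (hA 4) (hA 3) ?_ ?_ ?_ ?_)⟩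
    all_goals
      simp only [icosahedralAxes]
      simp
      try grind
  · refine ⟨1, Or.inl (SL2.mul_eq_mul_of_quat hi hj hij (hA 0) (hA 5) (hA 1) ?_ ?_ ?_ ?_)⟩
    all_goals
      simp only [icosahedralAxes]
      simp
      try grind

theorem SL2.trace_icosahedral (n : Fin 6) : (A n).1.trace = f - 1 := by
  rw [hA, SL2.trace_quat hi hj hij h2, ← mul_assoc, mul_inv_cancel₀ h2, one_mul]

/-- The trace `a = f - 1` satisfies `a² + a - 1 = 0`, so `x² - a x + 1` is a factor of the fifth
cyclotomic polynomial. -/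
theorem SL2.icosahedral_pow_five (hf : f ^ 2 = f + 1) (n : Fin 6) : A n ^ 5 = 1 := by
  set a := f - 1 with ha
  have ha2 : a ^ 2 + a - 1 = 0 := by rw [ha]; linear_combination hf
  have h1 : (A n).1 ^ 2 = a • (A n).1 - 1 := by
    have ht := SL2.trace_icosahedral h2 hi hj hij hA n
    have hd := SL2.det_val (A n)
    rw [Matrix.trace_fin_two] at ht
    rw [sq]
    ext r s
    fin_cases r <;> fin_cases s <;>
      simp only [Matrix.mul_apply, Fin.sum_univ_two, Matrix.sub_apply, Matrix.smul_apply] <;> simp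
    · linear_combination (A n).1 0 0 * ht - hd
    · linear_combination (A n).1 0 1 * ht
    · linear_combination (A n).1 1 0 * ht
    · linear_combination (A n).1 1 1 * ht - hd
  apply Subtype.ext
  rw [Matrix.SpecialLinearGroup.coe_pow]
  generalize (A n).1 = M at h1
  have h4 : M ^ 4 = -M + a • 1 := by
    have : M ^ 4 = (a • M - 1) * (a • M - 1) := by rw [← h1]; noncomm_ring
    rw [this, sub_mul, mul_sub, mul_sub, Matrix.smul_mul, Matrix.mul_smul, ← sq M, h1]
    simp only [mul_one, one_mul, smul_sub, smul_smul]
    have e : a * (a * a) = 2 * a - 1 := by linear_combination (a - 1) * ha2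
    have e2 : a * a = 1 - a := by linear_combination ha2
    rw [e, e2]
    module
  rw [pow_succ, h4, add_mul, neg_mul, ← sq, h1]
  simp

end

/-! ### The quaternion frame and its normalizer -/

section

variable {F : Type u} [Field F] {i j : SL2 F}

/-- The elements of order four in a quaternion group, up to sign. -/
def SL2.quatAxes (i j : SL2 F) : Fin 3 → SL2 F := ![i, j, i * j]

variable (h2 : (2 : F) ≠ 0) (hi : i * i = -1) (hj : j * j = -1) (hij : i * j = -(j * i))

include hi hj hij

theorem SL2.mul_mul_self_eq_neg_one : i * j * (i * j) = -1 := by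
  calc i * j * (i * j) = i * (j * i) * j := by group
    _ = i * -(i * j) * j := by rw [hij, neg_neg]
    _ = -(i * i * (j * j)) := by rw [mul_neg, neg_mul, mul_assoc, mul_assoc, mul_assoc]
    _ = -1 := by rw [hi, hj]; simp

omit hi hj hij in
theorem SL2.val_mul_eq_quat : (i * j).1 = SL2.quat i j 0 0 0 1 := by
  rw [Matrix.SpecialLinearGroup.coe_mul]; simp [SL2.quat]

omit hi in
theorem SL2.mul_eq_neg_mul_mul : j * (i * j) = -(i * j * j) := by
  rw [mul_assoc, hj, mul_neg, mul_one, neg_neg, ← mul_assoc, show j * i = -(i * j) by rw [hij, neg_neg],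
    neg_mul, mul_assoc, hj]
  simp

theorem SL2.mem_normalizer_quatAxes_rotation {ω : SL2 F} {c : F}
    (hω : ω.1 = SL2.quat i j c c c c) : ω ∈ Subgroup.normalizer (axisSet (SL2.quatAxes i j)) := by
  have hi' := SL2.val_left_eq_quat i j
  have hj' := SL2.val_right_eq_quat i j
  have hk' := SL2.val_mul_eq_quat (i := i) (j := j)
  refine mem_normalizer_axisSet fun n => ?_
  fin_cases n
  · exact ⟨1, Or.inl (SL2.mul_eq_mul_of_quat hi hj hij hω hi' hj' (by simp) (by simp) (by simp)
      (by simp))⟩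
  · exact ⟨2, Or.inl (SL2.mul_eq_mul_of_quat hi hj hij hω hj' hk' (by simp) (by simp) (by simp)
      (by simp))⟩
  · exact ⟨0, Or.inl (SL2.mul_eq_mul_of_quat hi hj hij hω hk' hi' (by simp) (by simp) (by simp)
      (by simp))⟩

/-- A multiple of `1 + i` is a quarter turn about the first axis and exchanges the other two. In
`SL₂` it needs `2 r² = 1`, that is, a square root of 2. -/
theorem SL2.mem_normalizer_quatAxes_quarter {y : SL2 F} {r : F}
    (hy : y.1 = SL2.quat i j r r 0 0) : y ∈ Subgroup.normalizer (axisSet (SL2.quatAxes i j)) := by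
  have hi' := SL2.val_left_eq_quat i j
  have hj' := SL2.val_right_eq_quat i j
  have hk' := SL2.val_mul_eq_quat (i := i) (j := j)
  have hjinv := SL2.inv_eq_neg hj
  refine mem_normalizer_axisSet fun n => ?_
  fin_cases n
  · exact ⟨0, Or.inl (SL2.mul_eq_mul_of_quat hi hj hij hy hi' hi' (by simp) (by simp) (by simp)
      (by simp))⟩
  · exact ⟨2, Or.inl (SL2.mul_eq_mul_of_quat hi hj hij hy hj' hk' (by simp) (by simp) (by simp)
      (by simp))⟩
  · refine ⟨1, Or.inr ?_⟩
    change y * (i * j) = j⁻¹ * y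
    rw [hjinv]
    exact SL2.mul_eq_mul_of_quat hi hj hij hy hk' (SL2.val_neg_of_quat hj') (by simp) (by simp)
      (by simp) (by simp)

theorem SL2.left_mem_normalizer_quatAxes : i ∈ Subgroup.normalizer (axisSet (SL2.quatAxes i j)) := by
  refine mem_normalizer_axisSet fun n => ?_
  fin_cases n
  · exact ⟨0, Or.inl rfl⟩
  · refine ⟨1, Or.inr ?_⟩
    change i * j = j⁻¹ * i
    rw [SL2.inv_eq_neg hj, neg_mul, hij]
  · refine ⟨2, Or.inr ?_⟩
    change i * (i * j) = (i * j)⁻¹ * i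
    rw [SL2.inv_eq_neg (SL2.mul_mul_self_eq_neg_one hi hj hij), neg_mul, mul_assoc,
      show j * i = -(i * j) by rw [hij, neg_neg], mul_neg, neg_neg]

theorem SL2.right_mem_normalizer_quatAxes : j ∈ Subgroup.normalizer (axisSet (SL2.quatAxes i j)) := by
  refine mem_normalizer_axisSet fun n => ?_
  fin_cases n
  · refine ⟨0, Or.inr ?_⟩
    change j * i = i⁻¹ * j
    rw [SL2.inv_eq_neg hi, neg_mul, hij, neg_neg]
  · exact ⟨1, Or.inl rfl⟩
  · refine ⟨2, Or.inr ?_⟩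
    change j * (i * j) = (i * j)⁻¹ * j
    rw [SL2.inv_eq_neg (SL2.mul_mul_self_eq_neg_one hi hj hij), neg_mul,
      SL2.mul_eq_neg_mul_mul hj hij]

include h2

omit hj hij in
-- The axis set has at most six elements, fewer than `p`, and contains a matrix of trace zero.
theorem SL2.normalizer_quatAxes_ne_top {p : ℕ} [CharP F p] (hp : 7 ≤ p) :
    Subgroup.normalizer (axisSet (SL2.quatAxes i j)) ≠ ⊤ := by
  refine SL2.normalizer_ne_top (p := p) (a := i) (finite_axisSet _) ?_ (Or.inl ⟨0, rfl⟩) ?_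
  · have := ncard_axisSet_le (SL2.quatAxes i j)
    rw [Nat.card_eq_fintype_card, Fintype.card_fin] at this
    omega
  · rw [SL2.trace_eq_zero_of_mul_self hi]
    intro h
    have : (2 : F) * 2 = 0 := by linear_combination -h
    exact h2 (mul_self_eq_zero.1 this)

omit hi hj in
-- On a common eigenvector the two matrices would act by commuting nonzero scalars, while
-- anticommuting requires twice their product to vanish.
theorem SL2.not_le_lineStab {S : Subgroup (SL2 F)} (hiS : i ∈ S) (hjS : j ∈ S) {v : Fin 2 → F}
    (hv : v ≠ 0) : ¬ S ≤ SL2.lineStab v hv := by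
  intro h
  obtain ⟨c, hc⟩ := h hiS
  obtain ⟨d, hd⟩ := h hjS
  have h3 : (i.1 * j.1) *ᵥ v = -((j.1 * i.1) *ᵥ v) := by
    rw [← Matrix.neg_mulVec]
    exact congrArg (· *ᵥ v) (congrArg Subtype.val hij)
  rw [← Matrix.mulVec_mulVec, ← Matrix.mulVec_mulVec, hc, hd, Matrix.mulVec_smul,
    Matrix.mulVec_smul, hc, hd, smul_smul, smul_smul, ← sub_eq_zero, sub_neg_eq_add,
    ← add_smul] at h3
  have h4 := (smul_eq_zero.1 h3).resolve_right hv
  have h5 : (2 : F) * (c * d) = 0 := by linear_combination h4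
  rcases mul_eq_zero.1 ((mul_eq_zero.1 h5).resolve_left h2) with rfl | rfl
  · exact SL2.mulVec_ne_zero i hv (by rw [hc, zero_smul])
  · exact SL2.mulVec_ne_zero j hv (by rw [hd, zero_smul])

theorem SL2.quat_sub_eq_zero {a b c d a' b' c' d' : F}
    (h : SL2.quat i j a b c d = SL2.quat i j a' b' c' d') :
    (a - a') ^ 2 + (b - b') ^ 2 + (c - c') ^ 2 + (d - d') ^ 2 = 0 := by
  rw [← SL2.det_quat hi hj hij h2]
  have : SL2.quat i j (a - a') (b - b') (c - c') (d - d') =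
      SL2.quat i j a b c d - SL2.quat i j a' b' c' d' := by
    simp only [SL2.quat]
    module
  rw [this, h, sub_self, Matrix.det_zero]

omit h2 hi hj hij in
theorem SL2.mul_self_mem_cent {X g : SL2 F} (h : g ∈ SL2.invStab X) : g * g ∈ SL2.cent X := by
  rw [SL2.mem_cent, ← mul_inv_eq_iff_eq_mul]
  have h3 : g * g * X * (g * g)⁻¹ = g * (g * X * g⁻¹) * g⁻¹ := by group
  rw [h3]
  rcases h with h1 | h1
  · rw [h1, h1]
  · have h4 : g * X⁻¹ * g⁻¹ = (g * X * g⁻¹)⁻¹ := by group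
    rw [h1, h4, h1, inv_inv]

/-- Squares of elements of a torus normalizer lie in the torus and commute, whereas the squares of
`ω` and `i ω` do not. -/
theorem SL2.not_le_invStab [Finite F] {S : Subgroup (SL2 F)} (hiS : i ∈ S) {ω : SL2 F} {c : F}
    (hω : ω.1 = SL2.quat i j c c c c) (hc : 2 * c = 1) (hωS : ω ∈ S) {X : SL2 F}
    (hX : X.1.trace ^ 2 ≠ 4) : ¬ S ≤ SL2.invStab X := by
  intro h
  have := SL2.isCyclic_cent hX
  have hcomm : ∀ a ∈ SL2.cent X, ∀ b ∈ SL2.cent X, a * b = b * a := fun a ha b hb =>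
    congrArg Subtype.val (IsMulCommutative.is_comm.comm (⟨a, ha⟩ : SL2.cent X) ⟨b, hb⟩)
  have h1 := hcomm _ (SL2.mul_self_mem_cent (h hωS)) _
    (SL2.mul_self_mem_cent (h (S.mul_mem hiS hωS)))
  have e1 := SL2.val_mul_of_quat hi hj hij hω hω
  have e3 := SL2.val_mul_of_quat hi hj hij (SL2.val_left_eq_quat i j) hω
  have e4 := SL2.val_mul_of_quat hi hj hij e3 e3
  have e5 := congrArg Subtype.val h1
  rw [SL2.val_mul_of_quat hi hj hij e1 e4, SL2.val_mul_of_quat hi hj hij e4 e1] at e5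
  have e6 := SL2.quat_sub_eq_zero h2 hi hj hij e5
  apply h2
  have hc2 : c * c * 2 = c := by linear_combination c * hc
  grind

end

/-! ### Group structure and depth of the polyhedral groups -/

namespace IsPolarAction

open MulAction

variable {H X : Type*} [Group H] [Finite H] [MulAction H X] {U : X → Subgroup H}

/-- The normalizer of the group generated by `g` permutes the two fixed points of `g`. -/
theorem card_normalizer_zpowers_le (hU : IsPolarAction H X U) (hbot : ∀ x, U x = ⊥) {b : ℕ}
    (hb : ∀ x : X, Nat.card (stabilizer H x) ≤ b) {g : H} (hg : g ≠ 1) :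
    Nat.card (Subgroup.normalizer (Subgroup.zpowers g : Set H)) ≤ 2 * b := by
  have hfix := hU.card_fixedBy_two g hg fun x => by rw [hbot]; exact hg
  have hfin : Finite (fixedBy X g) := Nat.finite_of_card_ne_zero (by omega)
  obtain ⟨x, hx⟩ : Nonempty (fixedBy X g) := by
    by_contra hc
    rw [not_nonempty_iff] at hc
    rw [Nat.card_of_isEmpty] at hfix
    omega
  set N := Subgroup.normalizer (Subgroup.zpowers g : Set H)
  have hsub : orbit N x ⊆ fixedBy X g := by
    rintro _ ⟨n, rfl⟩
    have h1 : (n : H)⁻¹ * g * n ∈ Subgroup.zpowers g := by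
      have := (Subgroup.mem_normalizer_iff''.1 n.2 g).1 (Subgroup.mem_zpowers g)
      exact this
    have h2 : ((n : H)⁻¹ * g * n) • x = x := by
      have hle : Subgroup.zpowers g ≤ stabilizer H x := by
        rw [Subgroup.zpowers_le]; exact hx
      exact hle h1
    change g • (n : H) • x = (n : H) • x
    rw [mul_smul, mul_smul, inv_smul_eq_iff] at h2
    exact h2
  have horb : Nat.card (orbit N x) ≤ 2 := by
    rw [← hfix]
    exact Nat.card_mono (Set.toFinite _) hsub
  have hstab : Nat.card (stabilizer N x) ≤ b := by
    refine le_trans ?_ (hb x)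
    exact Nat.card_le_card_of_injective (fun n : stabilizer N x => (⟨n.1.1, n.2⟩ : stabilizer H x))
      fun a c h => Subtype.ext (Subtype.ext (congrArg (fun s : stabilizer H x => s.1) h))
  have hmul := Nat.card_congr (orbitProdStabilizerEquivGroup N x)
  rw [Nat.card_prod] at hmul
  rw [← hmul]
  exact Nat.mul_le_mul horb hstab

/-- The normalizer has order 3 or 6 by the fixed point bound. Order 6 would mean exactly two Sylow
3-subgroups, which is not 1 modulo 3. -/
theorem card_normalizer_sylow_three (hU : IsPolarAction H X U) (hbot : ∀ x, U x = ⊥)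
    (hH : Nat.card H = 12) (hb : ∀ x : X, Nat.card (stabilizer H x) ≤ 3) (P : Sylow 3 H) :
    Nat.card P = 3 ∧ Nat.card (Subgroup.normalizer (P : Set H)) = 3 := by
  have hP : Nat.card P = 3 := by
    rw [P.card_eq_multiplicity, hH, show (12 : ℕ) = 2 ^ 2 * 3 by norm_num,
      Nat.factorization_mul (by norm_num) (by norm_num), Nat.Prime.factorization_pow Nat.prime_two,
      Nat.Prime.factorization (by norm_num : Nat.Prime 3)]
    simp
  refine ⟨hP, ?_⟩
  have : Fact (Nat.Prime 3) := ⟨by norm_num⟩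
  have hcyc : IsCyclic P := isCyclic_of_prime_card hP
  obtain ⟨g, hg⟩ := (Subgroup.isCyclic_iff_exists_zpowers_eq_top (P : Subgroup H)).1 hcyc
  have hg1 : g ≠ 1 := by
    rintro rfl
    rw [Subgroup.zpowers_one_eq_bot] at hg
    have : Nat.card (P : Subgroup H) = 1 := by rw [← hg, Subgroup.card_bot]
    change Nat.card P = 1 at this
    omega
  have h6 := hU.card_normalizer_zpowers_le hbot hb hg1
  rw [hg] at h6
  have hle : (P : Subgroup H) ≤ Subgroup.normalizer (P : Set H) := Subgroup.le_normalizer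
  have h3 := Subgroup.card_dvd_of_le hle
  change Nat.card P ∣ _ at h3
  rw [hP] at h3
  have hmod := card_sylow_modEq_one 3 H
  rw [P.card_eq_index_normalizer] at hmod
  have hidx := (Subgroup.normalizer (P : Set H)).card_mul_index
  change _ ≤ 2 * 3 at h6
  change 3 ∣ Nat.card (Subgroup.normalizer (P : Set H)) at h3
  rw [hH] at hidx
  have hpos : 0 < Nat.card (Subgroup.normalizer (P : Set H)) := Nat.card_pos
  generalize Nat.card (Subgroup.normalizer (P : Set H)) = n at *
  have : n = 3 ∨ n = 6 := by omega
  rcases this with h | h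
  · exact h
  · subst h
    have : (Subgroup.normalizer (P : Set H)).index = 2 := by omega
    rw [this] at hmod
    exact absurd hmod (by decide)

/-- The group of order twelve is not dihedral: its elements of order three are not inverted. -/
theorem exists_normal_card_four (hU : IsPolarAction H X U) (hbot : ∀ x, U x = ⊥)
    (hH : Nat.card H = 12) (hb : ∀ x : X, Nat.card (stabilizer H x) ≤ 3) :
    ∃ W : Subgroup H, W.Normal ∧ Nat.card W = 4 ∧ W.index = 3 := by
  have : Fact (Nat.Prime 3) := ⟨by norm_num⟩
  obtain ⟨P⟩ : Nonempty (Sylow 3 H) := inferInstance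
  obtain ⟨hP, hN⟩ := hU.card_normalizer_sylow_three hbot hH hb P
  have hNP : Subgroup.normalizer (P : Set H) = P :=
    (Subgroup.eq_of_le_of_card_ge Subgroup.le_normalizer
      (hN.le.trans hP.symm.le)).symm
  have hcyc : IsCyclic P := isCyclic_of_prime_card hP
  -- Burnside's transfer theorem: a Sylow subgroup central in its normalizer has a normal
  -- complement, here of order 4.
  have hle : Subgroup.normalizer (P : Set H) ≤ Subgroup.centralizer (P : Set H) := by
    rw [hNP]
    exact Subgroup.le_centralizer _
  have hcompl := MonoidHom.ker_transferSylow_isComplement' P hle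
  have hcard := hcompl.card_mul_card
  change _ * Nat.card P = _ at hcard
  rw [hP, hH] at hcard
  have h4 : Nat.card (MonoidHom.transferSylow P hle).ker = 4 := by omega
  refine ⟨(MonoidHom.transferSylow P hle).ker, inferInstance, h4, ?_⟩
  have := (MonoidHom.transferSylow P hle).ker.card_mul_index
  rw [h4, hH] at this
  omega

/-- A maximal subgroup over a Sylow 3-subgroup has order 3 or 6, and order 6 would normalize it. So
the Sylow subgroup itself is maximal. -/
theorem depth_le_two_of_card_twelve (hU : IsPolarAction H X U) (hbot : ∀ x, U x = ⊥)
    (hH : Nat.card H = 12) (hb : ∀ x : X, Nat.card (stabilizer H x) ≤ 3) : depth H ≤ 2 := by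
  have : Fact (Nat.Prime 3) := ⟨by norm_num⟩
  obtain ⟨P⟩ : Nonempty (Sylow 3 H) := inferInstance
  obtain ⟨hP, hN⟩ := hU.card_normalizer_sylow_three hbot hH hb P
  have hPtop : (P : Subgroup H) ≠ ⊤ := by
    intro h
    have : Nat.card (P : Subgroup H) = 12 := by rw [h, Subgroup.card_top, hH]
    change Nat.card P = 12 at this
    omega
  obtain ⟨M, hM, hPM⟩ := (eq_top_or_exists_le_coatom (P : Subgroup H)).resolve_left hPtop
  have h3 := Subgroup.card_dvd_of_le hPM
  change Nat.card P ∣ _ at h3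
  rw [hP] at h3
  obtain ⟨c, hc⟩ := h3
  have hMi := M.card_mul_index
  rw [hH, hc] at hMi
  have hi1 : M.index ≠ 1 := fun h => hM.1 (Subgroup.index_eq_one.1 h)
  have h4 : c * M.index = 4 := by nlinarith
  have hcd : c ∣ 4 := ⟨_, h4.symm⟩
  have hcle : c ≤ 4 := Nat.le_of_dvd (by norm_num) hcd
  have hcases : c = 1 ∨ c = 2 := by interval_cases c <;> omega
  rcases hcases with rfl | rfl
  · have := depth_le_cardFactors 3 M (by omega)
    rw [ArithmeticFunction.cardFactors_apply_prime (by norm_num)] at this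
    have := depth_le_depth_add_one hM
    omega
  · exfalso
    have hidx : ((P : Subgroup H).subgroupOf M).index = 2 := by
      have h := ((P : Subgroup H).subgroupOf M).card_mul_index
      rw [Nat.card_congr (Subgroup.subgroupOfEquivOfLe hPM).toEquiv, hc] at h
      change Nat.card P * _ = _ at h
      rw [hP] at h
      omega
    have hnorm := Subgroup.normal_of_index_eq_two hidx
    have hle := (Subgroup.normal_subgroupOf_iff_le_normalizer hPM).1 hnorm
    have := Subgroup.card_le_of_le hle
    change _ ≤ Nat.card (Subgroup.normalizer (P : Set H)) at this
    omega

/-- For order 24 a maximal subgroup containing an element of order 3 has order 3, 6 or 12, and in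
the last case it is polyhedral again. For order 60 one containing an element of order 5 has order 5
or 10. All of these have depth at most two. -/
theorem IsPolyhedral.depth_le [Finite X] (hU : IsPolarAction H X U) (hbot : ∀ x, U x = ⊥)
    (h : IsPolyhedral H X) : depth H ≤ 3 := by
  have key : ∀ K : Subgroup H, 1 < Nat.card K →
      (∃ x : X, Nat.card K ≤ Nat.card (stabilizer H x)) ∨
      (∃ x : X, Nat.card K ≤ 2 * Nat.card (stabilizer H x)) ∨ IsPolyhedral K X := by
    intro K hK
    have hinj : ∀ x : X, Nat.card (stabilizer K x) ≤ Nat.card (stabilizer H x) := fun x =>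
      Nat.card_le_card_of_injective (fun n : stabilizer K x => (⟨n.1.1, n.2⟩ : stabilizer H x))
        fun a c h => Subtype.ext (Subtype.ext (congrArg (fun s : stabilizer H x => s.1) h))
    have hb' : ∀ x, Nat.card ((U x).subgroupOf K) = 1 := fun x => by
      rw [hbot, Subgroup.bot_subgroupOf, Subgroup.card_bot]
    rcases (hU.restrict K).classification hK with ⟨x, hx⟩ | ⟨x, hx, -⟩ | ⟨-, h⟩ | ⟨x, hx, -⟩ |
      ⟨x, hx, -⟩
    · left
      refine ⟨x, Subgroup.card_le_of_le fun k hk => hx ⟨k, hk⟩⟩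
    · right; left
      refine ⟨x, ?_⟩
      have := hinj x
      omega
    · exact Or.inr (Or.inr h)
    · have := hb' x; omega
    · have := hb' x; omega
  have hco : ∀ q : ℕ, q.Prime → q ∣ Nat.card H → Nat.card H ≠ q → ∃ M : Subgroup H, IsCoatom M ∧
      q ∣ Nat.card M := by
    intro q hq hd hne
    have : Fact q.Prime := ⟨hq⟩
    obtain ⟨g, hg⟩ := exists_prime_orderOf_dvd_card' (G := H) q hd
    have hgc : Nat.card (Subgroup.zpowers g) = q := by rw [Nat.card_zpowers, hg]
    have htop : Subgroup.zpowers g ≠ ⊤ := by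
      intro e
      apply hne
      rw [← hgc, e, Subgroup.card_top]
    obtain ⟨M, hM, hle⟩ := (eq_top_or_exists_le_coatom _).resolve_left htop
    exact ⟨M, hM, by rw [← hgc]; exact Subgroup.card_dvd_of_le hle⟩
  have hprime : ∀ q : ℕ, q.Prime → Ω q = 1 := fun q hq =>
    ArithmeticFunction.cardFactors_apply_prime hq
  have hdepth : ∀ (K : Subgroup H) (a b : ℕ), a.Prime → b.Prime → Nat.card K = a * b →
      depth K ≤ 2 := by
    intro K a b ha hb hK
    have := depth_le_cardFactors _ K hK
    rw [ArithmeticFunction.cardFactors_mul ha.ne_zero hb.ne_zero, hprime a ha, hprime b hb] at this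
    exact this
  rcases h with h | h | h
  · exact (hU.depth_le_two_of_card_twelve hbot h.1 h.2).trans (by norm_num)
  · obtain ⟨M, hM, hd⟩ := hco 3 (by norm_num) (by rw [h.1]; norm_num) (by rw [h.1]; norm_num)
    have hM2 : depth M ≤ 2 := by
      obtain ⟨c, hc⟩ := hd
      have hMi := M.card_mul_index
      rw [h.1, hc] at hMi
      have hi1 : M.index ≠ 1 := fun h => hM.1 (Subgroup.index_eq_one.1 h)
      have h8 : c * M.index = 8 := by nlinarith
      have hcle : c ≤ 8 := Nat.le_of_dvd (by norm_num) ⟨_, h8.symm⟩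
      have hcases : c = 1 ∨ c = 2 ∨ c = 4 := by interval_cases c <;> omega
      rcases hcases with rfl | rfl | rfl
      · have := depth_le_cardFactors 3 M (by omega)
        rw [hprime 3 (by norm_num)] at this
        omega
      · exact hdepth M 3 2 (by norm_num) (by norm_num) hc
      · rcases key M (by omega) with ⟨x, hx⟩ | ⟨x, hx⟩ | hp
        · have := h.2 x; omega
        · have := h.2 x; omega
        · rcases hp with hp | hp | hp
          · exact (hU.restrict M).depth_le_two_of_card_twelve
              (fun x => by rw [hbot, Subgroup.bot_subgroupOf]) hp.1 hp.2
          · have := hp.1; omega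
          · have := hp.1; omega
    have := depth_le_depth_add_one hM
    omega
  · obtain ⟨M, hM, hd⟩ := hco 5 (by norm_num) (by rw [h.1]; norm_num) (by rw [h.1]; norm_num)
    have hM2 : depth M ≤ 2 := by
      have hlt : Nat.card M ≠ 60 := by
        intro e
        exact hM.1 (Subgroup.eq_top_of_card_eq M (by rw [e, h.1]))
      have hpos : 0 < Nat.card M := Nat.card_pos
      have h10 : Nat.card M = 5 ∨ Nat.card M = 5 * 2 := by
        rcases key M (by omega) with ⟨x, hx⟩ | ⟨x, hx⟩ | hp
        · have := (h.2 x).1; omega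
        · have := (h.2 x).1; omega
        · rcases hp with hp | hp | hp
          · have := hp.1; omega
          · have := hp.1; omega
          · exact absurd hp.1 hlt
      rcases h10 with h10 | h10
      · have := depth_le_cardFactors 5 M h10
        rw [hprime 5 (by norm_num)] at this
        omega
      · exact hdepth M 5 2 (by norm_num) (by norm_num) h10
    have := depth_le_depth_add_one hM
    omega

end IsPolarAction

/-! ### Polyhedral maximal subgroups of `L₂(p)` -/

section

variable {F : Type u} [Field F]

theorem SL2.neg_one_mem_normalizer (T : Set (SL2 F)) : -1 ∈ Subgroup.normalizer T := by
  rw [Subgroup.mem_normalizer_iff_conj_image_eq]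
  convert Set.image_id T
  ext t
  simp

theorem SL2.center_le_normalizer (T : Set (SL2 F)) :
    Subgroup.center (SL2 F) ≤ Subgroup.normalizer T := by
  intro a ha
  rcases SL2.mem_center_iff.1 ha with rfl | rfl
  · exact one_mem _
  · exact SL2.neg_one_mem_normalizer T

variable [Finite F] {p : ℕ} [hp : Fact p.Prime]

theorem two_ne_zero_of_natCard (hF : Nat.card F = p) (hp3 : 3 ≤ p) : (2 : F) ≠ 0 := by
  have := charP_of_natCard (hF.trans (pow_one p).symm)
  intro h
  have h2 : ((2 : ℕ) : F) = 0 := by exact_mod_cast h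
  rw [CharP.cast_eq_zero_iff F p] at h2
  have := Nat.le_of_dvd two_pos h2
  omega

theorem exists_sq_add_sq_eq_neg_one (hF : Nat.card F = p) (hp3 : 3 ≤ p) :
    ∃ s t : F, s ^ 2 + t ^ 2 = -1 := by
  have h2 := two_ne_zero_of_natCard hF hp3
  obtain ⟨s, t, h⟩ := exists_norm_form_eq (F := F) (τ := 0) (by
    intro h
    have : (2 : F) * 2 = 0 := by linear_combination -h
    exact h2 (mul_self_eq_zero.1 this)) (-1)
  exact ⟨s, t, by simpa using h⟩

variable {K : Type*} [Field K] [Algebra F K] [Finite K]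

/-- The stabilizer of a frame is contained in a polyhedral maximal subgroup. -/
theorem L2.exists_isCoatom_isPolyhedral (hF : Nat.card F = p) (hp7 : 7 ≤ p)
    (hK : ∀ τ : F, ∃ c : K, c ^ 2 - algebraMap F K τ * c + 1 = 0) :
    ∃ M : Subgroup (L2 F), IsCoatom M ∧ ¬ p ∣ Nat.card M ∧
      (∀ x : ℙ K (Fin 2 → K), (L2.unip F x).subgroupOf M = ⊥) ∧
      IsPolarAction.IsPolyhedral M (ℙ K (Fin 2 → K)) := by
  have := charP_of_natCard (hF.trans (pow_one p).symm)
  have h2 := two_ne_zero_of_natCard hF (by omega)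
  obtain ⟨s, t, hst⟩ := exists_sq_add_sq_eq_neg_one hF (by omega)
  set i := SL2.stdI F
  set j := SL2.stdJ s t hst
  have hi : i * i = -1 := SL2.mul_self_eq_neg_one (by simp [i, SL2.stdI, Matrix.trace_fin_two])
  have hj : j * j = -1 := SL2.mul_self_eq_neg_one (by simp [j, SL2.stdJ, Matrix.trace_fin_two])
  have hij : i * j = -(j * i) := by
    apply Subtype.ext
    change !![0, -1; 1, 0] * !![t, s; s, -t] = -(!![t, s; s, -t] * !![0, -1; 1, 0])
    ext a b
    fin_cases a <;> fin_cases b <;> simp [Matrix.mul_apply, Fin.sum_univ_two]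
  have hc : (2 : F) * 2⁻¹ = 1 := mul_inv_cancel₀ h2
  obtain ⟨ω, hω⟩ := SL2.exists_quat hi hj hij h2 (a := 2⁻¹) (b := 2⁻¹) (c := 2⁻¹) (d := 2⁻¹)
    (by linear_combination (2 * (2 : F)⁻¹ + 1) * hc)
  set N := Subgroup.normalizer (axisSet (SL2.quatAxes i j)) with hN
  have hNtop : N ≠ ⊤ := SL2.normalizer_quatAxes_ne_top (p := p) h2 hi hp7
  have hmap : N.map L2.mk ≠ ⊤ := by
    intro h
    apply hNtop
    have h1 : (N.map L2.mk).comap L2.mk = N := L2.comap_map_mk (SL2.center_le_normalizer _)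
    rw [← h1, h, Subgroup.comap_top]
  obtain ⟨M, hM, hle⟩ := (eq_top_or_exists_le_coatom (N.map L2.mk)).resolve_left hmap
  have hNM : N ≤ M.comap L2.mk := Subgroup.map_le_iff_le_comap.1 hle
  refine ⟨M, hM, ?_⟩
  -- The frame normalizer contains `i`, `j` and `ω`, which fit neither into a Borel subgroup nor
  -- into a torus normalizer, and there are no proper subfields. Only the polyhedral type remains.
  rcases L2.isCoatom_cases_of_odd (p := p) (k := 1) odd_one (by rw [hF, pow_one]) (by omega) hK hM
    with ⟨v, hv, h⟩ | ⟨X, hX, h⟩ | ⟨-, -, h3, h4, h5⟩ | ⟨r, hr, hr1, -⟩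
  · exact absurd h.le (SL2.not_le_lineStab h2 hij
      (hNM (SL2.left_mem_normalizer_quatAxes hi hj hij))
      (hNM (SL2.right_mem_normalizer_quatAxes hi hj hij)) hv)
  · exact absurd h.le (SL2.not_le_invStab h2 hi hj hij
      (hNM (SL2.left_mem_normalizer_quatAxes hi hj hij)) hω hc
      (hNM (SL2.mem_normalizer_quatAxes_rotation hi hj hij hω)) hX)
  · exact ⟨h3, h4, h5⟩
  · exact absurd (Nat.dvd_one.1 hr1) hr.ne_one

omit [Finite K] in
-- A maximal subgroup of order 12 is the full stabilizer of its frame of three axes. A square root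
-- of 2 would add a quarter turn to that stabilizer, and a square root of 5 would put the group into
-- the stabilizer of an icosahedron. The bound on `p` makes the twelve elements of the icosahedral
-- axis set too few to be invariant.
theorem L2.not_isSquare_of_isCoatom_card_twelve (hF : Nat.card F = p) (hp13 : 13 ≤ p)
    (hK : ∀ τ : F, ∃ c : K, c ^ 2 - algebraMap F K τ * c + 1 = 0) {M : Subgroup (L2 F)}
    (hM : IsCoatom M) (hbot : ∀ x : ℙ K (Fin 2 → K), (L2.unip F x).subgroupOf M = ⊥)
    (hc : Nat.card M = 12)
    (hb : ∀ x : ℙ K (Fin 2 → K), Nat.card (MulAction.stabilizer M x) ≤ 3) :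
    ¬ IsSquare (2 : F) ∧ ¬ IsSquare (5 : F) := by
  have := charP_of_natCard (hF.trans (pow_one p).symm)
  have h2 := two_ne_zero_of_natCard hF (by omega)
  have hU := (L2.isPolarAction (F := F) hK).restrict M
  obtain ⟨W, hWn, hW4, hW3⟩ := hU.exists_normal_card_four hbot hc hb
  obtain ⟨z, s, x, hz1, hz2, hzs, hx, hs⟩ :=
    hU.exists_involution_of_isPolyhedral hbot (Or.inl ⟨hc, hb⟩)
  obtain ⟨i, hiM, j, hjM, hi, hj, hij, hzi, hsj⟩ := L2.exists_anticommuting h2 hz1 hz2 hzs hx hs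
  have hs2 : s * s = 1 := by
    apply Subtype.ext
    rw [Subgroup.coe_mul, ← hsj, ← map_mul, hj, L2.mk_neg, map_one, Subgroup.coe_one]
  have hinvW : ∀ y : M, y * y = 1 → y ∈ W := by
    intro y hy
    have := W.pow_index_mem y
    rwa [hW3, pow_succ, sq, hy, one_mul] at this
  have hzs2 : z * s * (z * s) = 1 := by
    rw [mul_assoc, ← mul_assoc s, hzs, mul_assoc z, hs2, mul_one, hz2]
  have hzs_ne : z ≠ s := by rintro rfl; exact hs hx
  have hs1 : s ≠ 1 := by rintro rfl; exact hs (one_smul _ _)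
  have hzs1 : z * s ≠ 1 := by
    intro h
    apply hzs_ne
    rw [mul_eq_one_iff_eq_inv] at h
    rw [h, inv_eq_iff_mul_eq_one, hs2]
  have hWeq : (W : Set M) = {1, z, s, z * s} := by
    symm
    refine Set.eq_of_subset_of_ncard_le ?_ ?_ (Set.toFinite _)
    · rintro y (rfl | rfl | rfl | rfl)
      · exact W.one_mem
      · exact hinvW _ hz2
      · exact hinvW _ hs2
      · exact hinvW _ hzs2
    · have h1 : (W : Set M).ncard = 4 := by rw [← hW4, ← Nat.card_coe_set_eq]; rfl
      rw [h1, Set.ncard_insert_of_notMem, Set.ncard_insert_of_notMem, Set.ncard_pair]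
      · intro h; exact hz1 (mul_eq_right.1 h.symm)
      · rintro (h | h)
        · exact hzs_ne h
        · exact hs1 (mul_eq_left.1 h.symm)
      · rintro (h | h | h)
        · exact hz1 h.symm
        · exact hs1 h.symm
        · exact hzs1 h.symm
  set N := Subgroup.normalizer (axisSet (SL2.quatAxes i j)) with hN
  have hNtop : N ≠ ⊤ := SL2.normalizer_quatAxes_ne_top (p := p) h2 hi (by omega)
  have hax : ∀ n, ∃ y : M, y ∈ W ∧ y ≠ 1 ∧ L2.mk (SL2.quatAxes i j n) = y := by
    intro n
    fin_cases n
    · exact ⟨z, hinvW _ hz2, hz1, hzi⟩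
    · exact ⟨s, hinvW _ hs2, hs1, hsj⟩
    · refine ⟨z * s, hinvW _ hzs2, hzs1, ?_⟩
      change L2.mk (i * j) = _
      rw [map_mul, hzi, hsj, Subgroup.coe_mul]
  have hax2 : ∀ n, (SL2.quatAxes i j n)⁻¹ = -SL2.quatAxes i j n := by
    intro n
    apply SL2.inv_eq_neg
    fin_cases n
    · exact hi
    · exact hj
    · exact SL2.mul_mul_self_eq_neg_one hi hj hij
  have hWax : ∀ y ∈ W, y ≠ 1 → ∃ n, L2.mk (SL2.quatAxes i j n) = y := by
    intro y hy hy1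
    have hy' : y ∈ (W : Set M) := hy
    rw [hWeq] at hy'
    rcases hy' with rfl | rfl | rfl | rfl
    · exact absurd rfl hy1
    · exact ⟨0, hzi⟩
    · exact ⟨1, hsj⟩
    · refine ⟨2, ?_⟩
      change L2.mk (i * j) = _
      rw [map_mul, hzi, hsj, Subgroup.coe_mul]
  -- The normal subgroup `W` of order 4 consists of the identity and the three axes, so `M` permutes
  -- the axes; maximality gives equality.
  have hMN : M.comap L2.mk = N := by
    refine L2.comap_eq_of_isCoatom hM ?_ hNtop
    intro g hg
    refine mem_normalizer_axisSet fun n => ?_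
    obtain ⟨y, hyW, hy1, hy⟩ := hax n
    obtain ⟨m, hm⟩ := hWax _ (hWn.conj_mem y hyW ⟨L2.mk g, hg⟩) (by
      intro h
      apply hy1
      rwa [mul_inv_eq_one, mul_eq_left] at h)
    refine ⟨m, ?_⟩
    have h1 : L2.mk (SL2.quatAxes i j m) = L2.mk (g * SL2.quatAxes i j n * g⁻¹) := by
      rw [hm, map_mul, map_mul, hy, map_inv]
      rfl
    rw [hax2]
    rcases L2.mk_eq_mk_iff.1 h1 with h | h
    · left; rw [h, inv_mul_cancel_right]
    · right; rw [h, neg_neg, inv_mul_cancel_right]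
  constructor
  · rintro ⟨w, hw⟩
    have hw0 : w ≠ 0 := by rintro rfl; exact h2 (by rw [hw, mul_zero])
    have hw2 : w⁻¹ * w = 1 := inv_mul_cancel₀ hw0
    obtain ⟨y, hy⟩ := SL2.exists_quat hi hj hij h2 (a := w⁻¹) (b := w⁻¹) (c := 0) (d := 0) (by
      have : w⁻¹ ^ 2 * 2 = 1 := by rw [hw]; linear_combination (w⁻¹ * w + 1) * hw2
      linear_combination this)
    have hyN : y ∈ M.comap L2.mk := by
      rw [hMN]
      exact SL2.mem_normalizer_quatAxes_quarter hi hj hij hy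
    have hyy : y * y = i := by
      apply Subtype.ext
      rw [SL2.val_mul_of_quat hi hj hij hy hy, SL2.val_left_eq_quat i j]
      have : w⁻¹ * w⁻¹ * 2 = 1 := by rw [hw]; linear_combination (w⁻¹ * w + 1) * hw2
      congr 1
      · ring
      · linear_combination this
      · ring
      · ring
    set Y : M := ⟨L2.mk y, hyN⟩ with hY
    have hYY : Y * Y = z := by
      apply Subtype.ext
      rw [Subgroup.coe_mul, hY, ← map_mul, hyy, hzi]
    -- The cube of `Y` is in `W` because the index is 3, and `Y² = z` is in `W`. But `W` has
    -- exponent two, so `z = Y²` would be trivial.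
    have hYW : Y ∈ W := by
      have h3 := W.pow_index_mem Y
      rw [hW3, pow_succ, sq, hYY] at h3
      exact (W.mul_mem_cancel_left (hinvW _ hz2)).1 h3
    have hYW' : Y ∈ (W : Set M) := hYW
    rw [hWeq] at hYW'
    apply hz1
    rw [← hYY]
    rcases hYW' with h | h | h | h
    · rw [h, one_mul]
    · rw [h, hz2]
    · rw [h, hs2]
    · rw [h, hzs2]
  · rintro ⟨w, hw⟩
    have hcc : (2 : F) * 2⁻¹ = 1 := mul_inv_cancel₀ h2
    -- The golden ratio built from the square root `w` of 5.
    set f : F := 2⁻¹ * (1 + w) with hf'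
    have hf : f ^ 2 = f + 1 := by
      rw [hf']
      linear_combination (-(2 : F)⁻¹ ^ 2) * hw + (w * 2⁻¹ + 2⁻¹ * 3 + 1) * hcc
    obtain ⟨A, hA⟩ := SL2.exists_icosahedral h2 hi hj hij hf
    obtain ⟨ω, hω⟩ := SL2.exists_quat hi hj hij h2 (a := 2⁻¹) (b := 2⁻¹) (c := 2⁻¹) (d := 2⁻¹)
      (by linear_combination (2 * (2 : F)⁻¹ + 1) * hcc)
    have htr : ((A 0).1.trace) ^ 2 ≠ 4 := by
      rw [SL2.trace_icosahedral h2 hi hj hij hA]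
      intro h
      have h5 : w * w = 0 := by
        have e1 : f = -2 := by linear_combination hf - h
        have e2 : (5 : F) = 0 := by rw [e1] at hf; linear_combination hf
        rw [← hw, e2]
      have h6 := mul_self_eq_zero.1 h5
      rw [h6, mul_zero] at hw
      have h7 : ((5 : ℕ) : F) = 0 := by exact_mod_cast hw
      rw [CharP.cast_eq_zero_iff F p] at h7
      have := Nat.le_of_dvd (by norm_num) h7
      omega
    have hTtop : Subgroup.normalizer (axisSet A) ≠ ⊤ := by
      refine SL2.normalizer_ne_top (p := p) (a := A 0) (finite_axisSet _) ?_ (Or.inl ⟨0, rfl⟩) htr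
      have := ncard_axisSet_le A
      rw [Nat.card_eq_fintype_card, Fintype.card_fin] at this
      omega
    set T := Subgroup.normalizer (axisSet A) with hT
    have hiT : i ∈ T := SL2.mem_normalizer_icosahedral_left h2 hi hj hij hA
    have hjT : j ∈ T := SL2.mem_normalizer_icosahedral_right h2 hi hj hij hA
    have hωT : ω ∈ T := SL2.mem_normalizer_icosahedral_rotation hi hj hij hA hω
    have hωM : ω ∈ M.comap L2.mk := by
      rw [hMN]; exact SL2.mem_normalizer_quatAxes_rotation hi hj hij hω
    -- The icosahedral stabilizer contains `W` and also `ω`, which is not in `W`; as `W` has prime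
    -- index 3 in `M`, together they generate `M`.
    have hMT : M ≤ T.map L2.mk := by
      set S : Subgroup M := (T.map L2.mk).subgroupOf M with hS
      have hWS : W ≤ S := by
        intro y hy
        have hzS : z ∈ S := ⟨i, hiT, hzi⟩
        have hsS : s ∈ S := ⟨j, hjT, hsj⟩
        have hy' : y ∈ (W : Set M) := hy
        rw [hWeq] at hy'
        rcases hy' with rfl | rfl | rfl | rfl
        · exact S.one_mem
        · exact hzS
        · exact hsS
        · exact S.mul_mem hzS hsS
      have hStop : S = ⊤ := by
        have h1 : S.index ∣ 3 := hW3 ▸ Subgroup.index_dvd_of_le hWS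
        rcases (Nat.dvd_prime (by norm_num)).1 h1 with h | h
        · exact Subgroup.index_eq_one.1 h
        · exfalso
          have hSW : W = S := by
            refine Subgroup.eq_of_le_of_card_ge hWS ?_
            have := S.card_mul_index
            rw [h, hc] at this
            omega
          have hωS : (⟨L2.mk ω, hωM⟩ : M) ∈ S := ⟨ω, hωT, rfl⟩
          rw [← hSW] at hωS
          have hω' : (⟨L2.mk ω, hωM⟩ : M) ∈ (W : Set M) := hωS
          rw [hWeq] at hω'
          have hsq : L2.mk (ω * ω) = 1 := by
            have h5 : (⟨L2.mk ω, hωM⟩ : M) * ⟨L2.mk ω, hωM⟩ = 1 := by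
              rcases hω' with h | h | h | h
              · rw [h, one_mul]
              · rw [h, hz2]
              · rw [h, hs2]
              · rw [h, hzs2]
            have h6 := congrArg Subtype.val h5
            rw [map_mul]
            exact h6
          have htr1 : (ω * ω).1.trace = -1 := by
            rw [SL2.val_mul_of_quat hi hj hij hω hω, SL2.trace_quat hi hj hij h2]
            linear_combination (-1 - 2 * (2 : F)⁻¹) * hcc
          have h3 : (3 : F) ≠ 0 := by
            intro h3
            have h7 : ((3 : ℕ) : F) = 0 := by exact_mod_cast h3
            rw [CharP.cast_eq_zero_iff F p] at h7
            have := Nat.le_of_dvd (by norm_num) h7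
            omega
          rcases L2.mk_eq_one_iff.1 hsq with h | h
          · rw [h] at htr1
            simp at htr1
            exact h3 (by linear_combination htr1)
          · rw [h] at htr1
            simp at htr1
            have h8 : (1 : F) = 0 := by linear_combination htr1
            exact one_ne_zero h8
      exact Subgroup.subgroupOf_eq_top.1 hStop
    have hMT2 : M.comap L2.mk = T := by
      refine L2.comap_eq_of_isCoatom hM ?_ hTtop
      have h1 : (T.map L2.mk).comap L2.mk = T := L2.comap_map_mk (SL2.center_le_normalizer _)
      exact (Subgroup.comap_mono hMT).trans h1.le
    have hA0 : A 0 ∈ M.comap L2.mk := by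
      rw [hMT2]; exact SL2.mem_normalizer_icosahedral_axis h2 hi hj hij hA hf
    set Y : M := ⟨L2.mk (A 0), hA0⟩ with hY
    have hY5 : Y ^ 5 = 1 := by
      apply Subtype.ext
      rw [Subgroup.coe_pow, hY, ← map_pow, SL2.icosahedral_pow_five h2 hi hj hij hA hf, map_one]
      rfl
    have hY12 : Y ^ 12 = 1 := by rw [← hc]; exact pow_card_eq_one'
    -- An element with fifth power 1 in a group of order 12 is trivial, but the fivefold rotation is
    -- not.
    have hY1 : Y = 1 := by
      have h1 : orderOf Y ∣ 5 := orderOf_dvd_of_pow_eq_one hY5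
      have h3 : orderOf Y ∣ 12 := orderOf_dvd_of_pow_eq_one hY12
      have : orderOf Y ∣ 1 := (Nat.dvd_gcd h1 h3)
      exact orderOf_eq_one_iff.1 (Nat.dvd_one.1 this)
    have hmk : L2.mk (A 0) = 1 := congrArg Subtype.val hY1
    apply htr
    rcases L2.mk_eq_one_iff.1 hmk with h | h <;> rw [h] <;> simp <;> norm_num

end

/-! ### Divisibility relations between the orders of the candidate subgroups -/

/-- Modulo `x + 1` the odd power `x ^ r` is `-1`, so the product is 2. Hence Borel subgroups cannot
contain groups of order divisible by `x + 1`. -/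
theorem Nat.not_add_one_dvd_pow_mul_pow_sub_one {x r : ℕ} (hx : 2 ≤ x) (hr : Odd r) :
    ¬ x + 1 ∣ x ^ r * (x ^ r - 1) := by
  intro h
  have h1 : x + 1 ∣ x ^ r + 1 := by simpa using hr.nat_add_dvd_pow_add_pow x 1
  have hx1 : 1 ≤ x ^ r := Nat.one_le_pow _ _ (by omega)
  have h2 : x + 1 ∣ 2 := by
    have h3 := Nat.dvd_add h (h1.mul_left 2)
    rw [show x ^ r * (x ^ r - 1) + 2 * (x ^ r + 1) = x ^ r * (x ^ r + 1) + 2 by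
      obtain ⟨n, hn⟩ := Nat.exists_eq_add_of_le hx1
      rw [hn, Nat.add_sub_cancel_left]; ring] at h3
    exact (Nat.dvd_add_right (h1.mul_left _)).1 h3
  have := Nat.le_of_dvd two_pos h2
  omega

theorem Nat.le_two_of_dvd_two_mul {x q n : ℕ} (hq : 1 ≤ q) (hxq : x ∣ q) (hn : n = q - 1 ∨ n = q + 1)
    (h : x ∣ 2 * n) : x ≤ 2 := by
  apply Nat.le_of_dvd two_pos
  rcases hn with rfl | rfl
  · have h4 : 2 * q = 2 * (q - 1) + 2 := by omega
    exact (Nat.dvd_add_right h).1 (h4 ▸ hxq.mul_left 2)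
  · rw [mul_add, mul_one] at h
    exact (Nat.dvd_add_right (hxq.mul_left 2)).1 h

/-- The factor `p ^ (2 * a) - 1` is prime to `p`, so it divides `p ^ (2 * b) - 1`, and `gcd(p ^ m -
1, p ^ n - 1) = p ^ gcd(m, n) - 1`. -/
theorem Nat.dvd_of_pow_mul_dvd {p a b : ℕ} (hp : 2 ≤ p)
    (h : p ^ a * ((p ^ a) ^ 2 - 1) ∣ p ^ b * ((p ^ b) ^ 2 - 1)) : a ∣ b := by
  by_cases ha : a = 0
  · subst ha
    simp at h
    rcases h with h | h
    · omega
    · have h1 : (p ^ b) ^ 2 ≤ 1 := by omega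
      by_contra hb
      have hb0 : b ≠ 0 := fun h => hb (by rw [h])
      have : 1 < p ^ b := Nat.one_lt_pow hb0 (by omega)
      nlinarith
  have h1 : p ^ (2 * a) - 1 ∣ p ^ (2 * b) - 1 := by
    rw [← pow_mul, ← pow_mul, mul_comm a, mul_comm b] at h
    refine Nat.Coprime.dvd_of_dvd_mul_left ?_ ((Dvd.intro_left _ rfl).trans h)
    apply Nat.Coprime.pow_right
    have h3 : 1 ≤ p ^ (2 * a) := Nat.one_le_pow _ _ (by omega)
    have h4 : p ∣ p ^ (2 * a) := dvd_pow_self _ (by omega)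
    have h5 : Nat.gcd (p ^ (2 * a) - 1) p ∣ 1 := by
      have h6 := (Nat.gcd_dvd_right (p ^ (2 * a) - 1) p).trans h4
      have h7 : p ^ (2 * a) = p ^ (2 * a) - 1 + 1 := by omega
      rw [h7] at h6
      exact (Nat.dvd_add_right (Nat.gcd_dvd_left _ _)).1 h6
    exact Nat.dvd_one.1 h5
  have h3 := Nat.gcd_eq_left h1
  rw [Nat.pow_sub_one_gcd_pow_sub_one] at h3
  have h4 : p ^ (Nat.gcd (2 * a) (2 * b)) = p ^ (2 * a) := by
    have h5 : 1 ≤ p ^ (2 * a) := Nat.one_le_pow _ _ (by omega)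
    have h6 : 1 ≤ p ^ (Nat.gcd (2 * a) (2 * b)) := Nat.one_le_pow _ _ (by omega)
    omega
  have h5 := Nat.pow_right_injective hp h4
  have h6 := Nat.gcd_eq_left_iff_dvd.1 h5
  exact (Nat.mul_dvd_mul_iff_left two_pos).1 h6

/-! ### Orders and depths of maximal subgroups; extensions of prime degree -/

section

variable {F : Type u} [Field F] [Finite F] {p k : ℕ} [hp : Fact p.Prime]

theorem two_eq_zero_iff_of_natCard (hF : Nat.card F = p ^ k) : (2 : F) = 0 ↔ p = 2 := by
  have := charP_of_natCard hF
  have h2 : (2 : F) = 0 ↔ ((2 : ℕ) : F) = 0 := by rw [Nat.cast_ofNat]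
  rw [h2, CharP.cast_eq_zero_iff F p]
  exact Nat.prime_dvd_prime_iff_eq hp.out Nat.prime_two

theorem SL2.card_center_of_natCard_even (hF : Nat.card F = p ^ k) (h : p = 2) :
    Nat.card (Subgroup.center (SL2 F)) = 1 :=
  SL2.card_center_of_two_eq_zero ((two_eq_zero_iff_of_natCard hF).2 h)

theorem SL2.card_center_of_natCard_odd (hF : Nat.card F = p ^ k) (h : p ≠ 2) :
    Nat.card (Subgroup.center (SL2 F)) = 2 :=
  SL2.card_center_of_two_ne_zero fun h2 => h ((two_eq_zero_iff_of_natCard hF).1 h2)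

/-- The orders of the maximal subgroups of `L₂(q)`, with bounds for their depths. -/
theorem L2.card_and_depth_of_isCoatom {K : Type*} [Field K] [Algebra F K] [Finite K]
    (hk : Odd k) (hF : Nat.card F = p ^ k) (hq : 3 ≤ Nat.card F)
    (hK : ∀ τ : F, ∃ c : K, c ^ 2 - algebraMap F K τ * c + 1 = 0)
    {M : Subgroup (L2 F)} (hM : IsCoatom M) :
    (Nat.card (Subgroup.center (SL2 F)) * Nat.card M = Nat.card F * (Nat.card F - 1) ∧
      Ω ((Nat.card F - 1) / (Nat.card F - 1).gcd 2) + 1 ≤ depth M) ∨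
    (∃ n c, (n = Nat.card F - 1 ∨ n = Nat.card F + 1) ∧
      Nat.card (Subgroup.center (SL2 F)) * Nat.card M = 2 * n ∧
      Nat.card (Subgroup.center (SL2 F)) * c = n ∧ Ω c + 1 ≤ depth M) ∨
    (k = 1 ∧ 5 ≤ p ∧ ¬ p ∣ Nat.card M ∧ (∀ x : ℙ K (Fin 2 → K), (L2.unip F x).subgroupOf M = ⊥) ∧
      IsPolarAction.IsPolyhedral M (ℙ K (Fin 2 → K))) ∨
    (∃ r : ℕ, r.Prime ∧ r ∣ k ∧ 3 ≤ p ^ (k / r) ∧ ∃ L : Subfield F, Nat.card L = p ^ (k / r) ∧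
      Nat.card M = Nat.card (L2 L) ∧ depth M = depth (L2 L)) := by
  rcases L2.isCoatom_cases_of_odd hk hF hq hK hM with ⟨v, hv, h⟩ | ⟨X, hX, h⟩ | h |
    ⟨r, hr, hrk, h3, L, hL, ⟨e⟩⟩
  · exact Or.inl (L2.card_and_depth_of_comap_eq_lineStab h)
  · right; left
    obtain ⟨h1, c, h3, h4⟩ := L2.card_and_depth_of_comap_eq_invStab hX h
    refine ⟨Nat.card (SL2.cent X), c, ?_, h1, h3, h4⟩
    by_cases hirr : ∀ l : F, l ^ 2 - X.1.trace * l + 1 ≠ 0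
    · exact Or.inr (SL2.card_cent_of_irreducible hX hirr)
    · push Not at hirr
      obtain ⟨l, hl⟩ := hirr
      exact Or.inl (SL2.card_cent_of_root hX hl)
  · exact Or.inr (Or.inr (Or.inl h))
  · exact Or.inr (Or.inr (Or.inr ⟨r, hr, hrk, h3, L, hL, (Nat.card_congr e.toEquiv).symm,
      (depth_congr e).symm⟩))

/-- The map `l ↦ l + l⁻¹` from `q - 1` elements to `q` elements is not onto; a missed value is the
trace of a matrix without eigenvalues in `F`. -/
theorem SL2.exists_irreducible (F : Type u) [Field F] [Finite F] :
    ∃ X : SL2 F, X.1.trace ^ 2 ≠ 4 ∧ ∀ l : F, l ^ 2 - X.1.trace * l + 1 ≠ 0 := by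
  obtain ⟨τ, hτ⟩ : ∃ τ : F, ∀ l : F, l ^ 2 - τ * l + 1 ≠ 0 := by
    by_contra hc
    push Not at hc
    have hsurj : Function.Surjective fun l : Fˣ => (l : F) + (l⁻¹ : Fˣ) := by
      intro τ
      obtain ⟨l, hl⟩ := hc τ
      have hl0 : l ≠ 0 := by rintro rfl; simp at hl
      refine ⟨Units.mk0 l hl0, ?_⟩
      have h1 : l * l⁻¹ = 1 := mul_inv_cancel₀ hl0
      simp only [Units.val_mk0, Units.val_inv_eq_inv_val]
      linear_combination l⁻¹ * hl + (τ - l) * h1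
    have h1 := Nat.card_le_card_of_surjective _ hsurj
    rw [Nat.card_units] at h1
    have : 0 < Nat.card F := Nat.card_pos
    omega
  let X : SL2 F := ⟨!![0, -1; 1, τ], by rw [Matrix.det_fin_two_of]; ring⟩
  have htr : X.1.trace = τ := by simp [X, Matrix.trace_fin_two]
  refine ⟨X, ?_, by rwa [htr]⟩
  rw [htr]
  intro h
  have h1 : (τ - 2) * (τ + 2) = 0 := by linear_combination h
  rcases mul_eq_zero.1 h1 with h | h
  · exact hτ 1 (by linear_combination -h)
  · exact hτ (-1) (by linear_combination h)

theorem L2.exists_isCoatom_of_le {N : Subgroup (SL2 F)} (hN : Subgroup.center (SL2 F) ≤ N)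
    (htop : N ≠ ⊤) : ∃ M : Subgroup (L2 F), IsCoatom M ∧
      Nat.card N ∣ Nat.card (Subgroup.center (SL2 F)) * Nat.card M ∧ N ≤ M.comap L2.mk := by
  have hmap : N.map L2.mk ≠ ⊤ := by
    intro h
    apply htop
    rw [← L2.comap_map_mk hN, h, Subgroup.comap_top]
  obtain ⟨M, hM, hle⟩ := (eq_top_or_exists_le_coatom (N.map L2.mk)).resolve_left hmap
  have hle' : N ≤ M.comap L2.mk := Subgroup.map_le_iff_le_comap.1 hle
  exact ⟨M, hM, by rw [← L2.card_comap]; exact Subgroup.card_dvd_of_le hle', hle'⟩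

omit [Finite F] in
theorem SL2.center_le_borel : Subgroup.center (SL2 F) ≤ SL2.borel F := by
  intro a ha
  rcases SL2.mem_center_iff.1 ha with rfl | rfl
  · exact one_mem _
  · simp [SL2.mem_borel]

omit [Finite F] in
theorem SL2.center_le_invStab (X : SL2 F) : Subgroup.center (SL2 F) ≤ SL2.invStab X :=
  (Subgroup.center_le_centralizer _).trans (SL2.cent_le_invStab X)

omit [Finite F] in
theorem SL2.borel_ne_top : SL2.borel F ≠ ⊤ := by
  intro h
  have : SL2.stdI F ∈ SL2.borel F := by rw [h]; exact Subgroup.mem_top _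
  rw [SL2.mem_borel] at this
  simp [SL2.stdI] at this

/-- The depth of `L₂` grows by at most one in an extension of prime degree. -/
theorem L2.depth_le_depth_add_one_of_prime (hk : Odd k) (hF : Nat.card F = p ^ k) {r : ℕ} (hr : r.Prime)
    (hrk : r ∣ k) (h3 : 3 ≤ p ^ (k / r)) {E : Type*} [Field E] [Finite E]
    (hE : Nat.card E = p ^ (k / r)) : depth (L2 F) ≤ depth (L2 E) + 1 := by
  have hk0 : k ≠ 0 := by rintro rfl; simp at hk
  have hkr : k / r * r = k := Nat.div_mul_cancel hrk
  have hkr0 : k / r ≠ 0 := by intro h; rw [h, zero_mul] at hkr; omega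
  have hrodd : Odd r := by
    rw [← hkr] at hk
    exact (Nat.odd_mul.1 hk).2
  obtain ⟨L, hL, -⟩ := Subfield.exists_card_eq hF (Nat.div_dvd_of_dvd hrk) hkr0
  have hpow : Nat.card F = (p ^ (k / r)) ^ r := by rw [hF, ← pow_mul, hkr]
  have hlt : k / r < k := Nat.div_lt_self (by omega) hr.one_lt
  have hltc : p ^ (k / r) < p ^ k := Nat.pow_lt_pow_right hp.out.one_lt hlt
  have hLtop : L ≠ ⊤ := by
    intro h
    have h1 : Nat.card L = Nat.card F := by
      rw [h]; exact Nat.card_congr Subfield.topEquiv.toEquiv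
    omega
  set Q := p ^ (k / r) with hQ
  have hcen : Nat.card (Subgroup.center (SL2 L)) = Nat.card (Subgroup.center (SL2 F)) := by
    by_cases h2 : p = 2
    · rw [SL2.card_center_of_natCard_even hL h2, SL2.card_center_of_natCard_even hF h2]
    · rw [SL2.card_center_of_natCard_odd hL h2, SL2.card_center_of_natCard_odd hF h2]
  have hcard : Nat.card (SL2.subfieldSL (1 : GL (Fin 2) F) L) = Q * (Q ^ 2 - 1) := by
    obtain ⟨e⟩ := L2.subfield_equiv (1 : GL (Fin 2) F) L
    rw [← hL, ← L2.card_mul_card_center, hcen, Nat.card_congr e.toEquiv, ← L2.card_comap,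
      L2.comap_map_mk (SL2.center_le_subfieldSL _ _)]
  obtain ⟨M, hM, hdvd, -⟩ := L2.exists_isCoatom_of_le (SL2.center_le_subfieldSL (1 : GL (Fin 2) F) L)
    fun h => hLtop (SL2.subfieldSL_eq_top h)
  rw [hcard] at hdvd
  refine (depth_le_depth_add_one hM).trans (Nat.add_le_add_right ?_ 1)
  have hfac : Q ^ 2 - 1 = (Q + 1) * (Q - 1) := by simpa using Nat.sq_sub_sq Q 1
  obtain ⟨K, _, _, hKf, hK⟩ := exists_splitting_extension F
  rcases L2.card_and_depth_of_isCoatom hk hF (by omega) hK hM with ⟨h1, -⟩ | ⟨n, c, hn, h1, -⟩ |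
    ⟨h1, -⟩ | ⟨r', hr', hrk', -, L', hL', h1, h5⟩
  · rw [h1, hpow] at hdvd
    have h5 : Q + 1 ∣ Q * (Q ^ 2 - 1) := ⟨Q * (Q - 1), by rw [hfac]; ring⟩
    exact absurd (h5.trans hdvd)
      (Nat.not_add_one_dvd_pow_mul_pow_sub_one (by omega : 2 ≤ Q) hrodd)
  · rw [h1] at hdvd
    have := Nat.le_two_of_dvd_two_mul (by omega) (x := Q) (q := Nat.card F)
      (by rw [hpow]; exact dvd_pow_self _ hr.ne_zero) hn ((Dvd.intro _ rfl).trans hdvd)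
    omega
  · subst h1
    exact absurd (Nat.dvd_one.1 hrk) hr.ne_one
  · have hcen' : Nat.card (Subgroup.center (SL2 L')) = Nat.card (Subgroup.center (SL2 F)) := by
      by_cases h2 : p = 2
      · rw [SL2.card_center_of_natCard_even hL' h2, SL2.card_center_of_natCard_even hF h2]
      · rw [SL2.card_center_of_natCard_odd hL' h2, SL2.card_center_of_natCard_odd hF h2]
    rw [h1, ← hcen', L2.card_mul_card_center, hL'] at hdvd
    have h6 := Nat.dvd_of_pow_mul_dvd hp.out.two_le hdvd
    -- The maximal subgroup found is of subfield type, and `k / r` divides `k / r'`; both indices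
    -- being prime, they agree.
    have h7 : r' ∣ r := by
      have h8 : k / r * r' ∣ k / r * r := by
        rw [hkr]
        calc k / r * r' ∣ k / r' * r' := Nat.mul_dvd_mul_right h6 r'
          _ = k := Nat.div_mul_cancel hrk'
      exact (Nat.mul_dvd_mul_iff_left (Nat.pos_of_ne_zero hkr0)).1 h8
    have h8 := (Nat.prime_dvd_prime_iff_eq hr' hr).1 h7
    subst h8
    rw [h5, depth_L2_congr (hL'.trans hE.symm)]

end

/-- The quotients of an odd number by its prime divisors. -/
theorem Odd.div_prime {k r : ℕ} (hk : Odd k) (hr : r.Prime) (hrk : r ∣ k) :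
    k / r < k ∧ Odd (k / r) ∧ Ω k = Ω (k / r) + 1 ∧ k / r * r = k := by
  have hkr : k / r * r = k := Nat.div_mul_cancel hrk
  have hk0 := hk.pos
  have hkr0 : k / r ≠ 0 := by intro h; rw [h, zero_mul] at hkr; omega
  refine ⟨Nat.div_lt_self hk0 hr.one_lt, ?_, ?_, hkr⟩
  · rw [← hkr] at hk
    exact (Nat.odd_mul.1 hk).1
  · conv_lhs => rw [← hkr]
    rw [ArithmeticFunction.cardFactors_mul hkr0 hr.ne_zero,
      ArithmeticFunction.cardFactors_apply_prime hr]

/-! ### The depth of `L₂(p)` and of `L₂(q)` in odd characteristic -/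

section

variable {F : Type u} [Field F] [Finite F] {p : ℕ} [hp : Fact p.Prime]

theorem Nat.Prime.exists_eq_two_mul_add_one {p : ℕ} (hp : p.Prime) (hp3 : 3 ≤ p) :
    ∃ n, p = 2 * n + 1 ∧ 1 ≤ n := by
  obtain ⟨n, hn⟩ := hp.odd_of_ne_two (by omega)
  exact ⟨n, hn, by omega⟩

theorem cardFactors_two_mul {n : ℕ} (hn : n ≠ 0) : Ω (2 * n) = Ω n + 1 := by
  rw [ArithmeticFunction.cardFactors_mul two_ne_zero hn,
    ArithmeticFunction.cardFactors_apply_prime Nat.prime_two, add_comm]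

/-- The orders of the maximal subgroups of `L₂(p)`, with bounds for their depths. -/
theorem L2.card_and_depth_of_isCoatom_prime {K : Type*} [Field K] [Algebra F K] [Finite K]
    (hF : Nat.card F = p) (hp3 : 3 ≤ p)
    (hK : ∀ τ : F, ∃ c : K, c ^ 2 - algebraMap F K τ * c + 1 = 0)
    {M : Subgroup (L2 F)} (hM : IsCoatom M) :
    (Nat.card M = p * ((p - 1) / 2) ∧ Ω ((p - 1) / 2) + 1 ≤ depth M) ∨
    (∃ c, (c = (p - 1) / 2 ∨ c = (p + 1) / 2) ∧ Nat.card M = 2 * c ∧ Ω c + 1 ≤ depth M) ∨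
    (5 ≤ p ∧ ¬ p ∣ Nat.card M ∧ (∀ x : ℙ K (Fin 2 → K), (L2.unip F x).subgroupOf M = ⊥) ∧
      IsPolarAction.IsPolyhedral M (ℙ K (Fin 2 → K))) := by
  have hF' : Nat.card F = p ^ 1 := by rw [hF, pow_one]
  have hcen := SL2.card_center_of_natCard_odd hF' (by omega)
  obtain ⟨n, hn, hn1⟩ := hp.out.exists_eq_two_mul_add_one hp3
  rcases L2.card_and_depth_of_isCoatom odd_one hF' (by omega) hK hM with ⟨h1, h2⟩ |
    ⟨m, c, hm, h1, h2, h3⟩ | ⟨-, h⟩ | ⟨r, hr, hr1, -⟩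
  · left
    rw [hcen, hF] at h1
    rw [hF, Nat.gcd_eq_right (by omega : 2 ∣ p - 1)] at h2
    refine ⟨?_, h2⟩
    have h3 : p - 1 = 2 * n := by omega
    rw [h3] at h1 ⊢
    rw [Nat.mul_div_cancel_left n two_pos]
    linarith
  · right; left
    rw [hcen] at h1 h2
    rw [hF] at hm
    exact ⟨c, by omega, by omega, h3⟩
  · exact Or.inr (Or.inr h)
  · exact absurd (Nat.dvd_one.1 hr1) hr.ne_one

/-- A maximal subgroup over the Borel subgroup has order divisible by `p`, so it is of Borel type
with order `p (p - 1) / 2`. -/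
theorem L2.depth_le_of_pred (hF : Nat.card F = p) (hp3 : 3 ≤ p) :
    depth (L2 F) ≤ Ω ((p - 1) / 2) + 2 := by
  have hF' : Nat.card F = p ^ 1 := by rw [hF, pow_one]
  have hcen := SL2.card_center_of_natCard_odd hF' (by omega)
  obtain ⟨K, _, _, hKf, hK⟩ := exists_splitting_extension F
  obtain ⟨n, hn, hn1⟩ := hp.out.exists_eq_two_mul_add_one hp3
  obtain ⟨M, hM, hdvd, -⟩ := L2.exists_isCoatom_of_le (F := F) SL2.center_le_borel SL2.borel_ne_top
  rw [SL2.card_borel, hcen, hF] at hdvd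
  have hpM : p ∣ Nat.card M := by
    have h1 : p ∣ 2 * Nat.card M := (Dvd.intro _ rfl).trans hdvd
    rcases hp.out.dvd_mul.1 h1 with h | h
    · have := Nat.le_of_dvd two_pos h; omega
    · exact h
  have h := depth_le_depth_add_one hM
  rcases L2.card_and_depth_of_isCoatom_prime hF hp3 hK hM with ⟨h1, -⟩ | ⟨c, hc, h1, -⟩ | ⟨-, h1, -⟩
  · have h2 := depth_le_cardFactors _ M h1
    rw [ArithmeticFunction.cardFactors_mul hp.out.ne_zero (by omega),
      ArithmeticFunction.cardFactors_apply_prime hp.out] at h2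
    omega
  · exfalso
    have h2 := Nat.le_two_of_dvd_two_mul (x := p) (q := p) (n := 2 * c) (by omega) dvd_rfl
      (by omega) (by rw [← h1]; exact hpM.mul_left 2)
    omega
  · exact absurd hpM h1

/-- A maximal subgroup over the nonsplit torus normalizer is either of that type or polyhedral. A
polyhedral one gives depth at most 4, which suffices unless `(p + 1) / 2` is prime; being then a
prime factor of 120, it would be at most 5, which is impossible for a prime `p > 5`. -/
theorem L2.depth_le_of_succ (hF : Nat.card F = p) (hp3 : 3 ≤ p) :
    depth (L2 F) ≤ Ω ((p + 1) / 2) + 2 := by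
  have hF' : Nat.card F = p ^ 1 := by rw [hF, pow_one]
  have hcen := SL2.card_center_of_natCard_odd hF' (by omega)
  by_cases hp5 : p ≤ 5
  · refine (L2.depth_le_of_pred hF hp3).trans (Nat.add_le_add_right ?_ 2)
    have h4 : p ≠ 4 := by rintro rfl; exact absurd hp.out (by norm_num)
    have : p = 3 ∨ p = 5 := by omega
    rcases this with rfl | rfl
    · simp
    · rw [show (5 - 1) / 2 = 2 by norm_num, show (5 + 1) / 2 = 3 by norm_num,
        ArithmeticFunction.cardFactors_apply_prime Nat.prime_two,
        ArithmeticFunction.cardFactors_apply_prime Nat.prime_three]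
  push Not at hp5
  obtain ⟨K, _, _, hKf, hK⟩ := exists_splitting_extension F
  obtain ⟨n, hn, hn1⟩ := hp.out.exists_eq_two_mul_add_one hp3
  obtain ⟨X, hX, hirr⟩ := SL2.exists_irreducible F
  obtain ⟨M, hM, hdvd, -⟩ := L2.exists_isCoatom_of_le (SL2.center_le_invStab X)
    (SL2.invStab_ne_top (by omega) hX)
  rw [SL2.card_invStab hX, SL2.card_cent_of_irreducible hX hirr, hcen, hF,
    Nat.mul_dvd_mul_iff_left two_pos] at hdvd
  have h := depth_le_depth_add_one hM
  rcases L2.card_and_depth_of_isCoatom_prime hF hp3 hK hM with ⟨h1, -⟩ | ⟨c, hc, h1, -⟩ |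
    ⟨-, -, hbot, h1⟩
  · exfalso
    refine Nat.not_add_one_dvd_pow_mul_pow_sub_one (by omega : 2 ≤ p) odd_one ?_
    rw [pow_one]
    refine (hdvd.mul_left 2).trans (Eq.dvd ?_)
    rw [h1]
    have h3 : p - 1 = 2 * n := by omega
    rw [h3, Nat.mul_div_cancel_left n two_pos]
    ring
  · have h3 : c = (p + 1) / 2 := by
      have := Nat.le_of_dvd (by omega) hdvd
      omega
    have h2 := depth_le_cardFactors _ M h1
    rw [cardFactors_two_mul (by omega), h3] at h2
    omega
  · have h3 := IsPolarAction.IsPolyhedral.depth_le ((L2.isPolarAction hK).restrict M) hbot h1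
    by_cases hpr : ((p + 1) / 2).Prime
    · exfalso
      have h4 : (p + 1) / 2 ∣ Nat.card M := (Dvd.intro_left 2 (by omega)).trans hdvd
      have h60 : Nat.card M ∣ 8 * (3 * 5) := by
        rcases h1 with h | h | h <;> rw [h.1] <;> norm_num
      have hle5 : (p + 1) / 2 ≤ 5 := by
        rcases hpr.dvd_mul.1 (h4.trans h60) with h | h
        · exact (Nat.le_of_dvd two_pos (hpr.dvd_of_dvd_pow (show _ ∣ 2 ^ 3 from h))).trans
            (by norm_num)
        · rcases hpr.dvd_mul.1 h with h | h
          · exact (Nat.le_of_dvd (by norm_num) h).trans (by norm_num)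
          · exact Nat.le_of_dvd (by norm_num) h
      have : p = 7 ∨ p = 9 := by omega
      rcases this with rfl | rfl
      · exact absurd hpr (by norm_num)
      · exact absurd hp.out (by norm_num)
    · have := two_le_cardFactors (by omega) hpr
      omega

theorem L2.two_mul_card (hF : Nat.card F = p) (hp3 : 3 ≤ p) :
    2 * Nat.card (L2 F) = p * (p ^ 2 - 1) := by
  have hF' : Nat.card F = p ^ 1 := by rw [hF, pow_one]
  have h := L2.card_mul_card_center (F := F)
  rwa [SL2.card_center_of_natCard_odd hF' (by omega), hF] at h

theorem L2.one_lt_card_and_not_prime (hF : Nat.card F = p) (hp3 : 3 ≤ p) :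
    1 < Nat.card (L2 F) ∧ ¬ (Nat.card (L2 F)).Prime := by
  have h := L2.two_mul_card hF hp3
  obtain ⟨n, hn, hn1⟩ := hp.out.exists_eq_two_mul_add_one hp3
  have h1 : p ^ 2 - 1 = 2 * (2 * n * (n + 1)) := by
    rw [hn]
    have : (2 * n + 1) ^ 2 = 2 * (2 * n * (n + 1)) + 1 := by ring
    omega
  have h2 : Nat.card (L2 F) = p * (2 * n * (n + 1)) := by
    rw [h1] at h; linarith
  have h3 : 2 ≤ 2 * n * (n + 1) := by nlinarith
  rw [h2]
  exact ⟨by nlinarith, Nat.not_prime_mul (by omega) (by omega)⟩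

theorem L2.depth_eq_two_of_card_three (hF : Nat.card F = 3) : depth (L2 F) = 2 := by
  have : Fact (Nat.Prime 3) := ⟨Nat.prime_three⟩
  have h1 := L2.depth_le_of_pred hF le_rfl
  obtain ⟨h2, h3⟩ := L2.one_lt_card_and_not_prime hF le_rfl
  have := two_le_depth h2 h3
  simp at h1
  omega

/-- Depth two would need a maximal subgroup of prime order, and every order in the list is composite
once `p ≥ 5`. -/
theorem L2.three_le_depth (hF : Nat.card F = p) (hp5 : 5 ≤ p) : 3 ≤ depth (L2 F) := by
  by_contra hlt
  obtain ⟨h2, h3⟩ := L2.one_lt_card_and_not_prime hF (by omega)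
  obtain ⟨M, hM, hpr⟩ := exists_isCoatom_prime_card h2 h3 (by omega)
  obtain ⟨K, _, _, hKf, hK⟩ := exists_splitting_extension F
  obtain ⟨n, hn, hn1⟩ := hp.out.exists_eq_two_mul_add_one (by omega)
  rcases L2.card_and_depth_of_isCoatom_prime hF (by omega) hK hM with ⟨h1, -⟩ | ⟨c, hc, h1, -⟩ |
    ⟨-, -, -, h1⟩
  · rw [h1] at hpr
    exact Nat.not_prime_mul (by omega) (by omega) hpr
  · rw [h1] at hpr
    exact Nat.not_prime_mul (by omega) (by omega) hpr
  · rcases h1 with h | h | h <;> rw [h.1] at hpr <;> norm_num at hpr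

theorem L2.depth_le_of_isCoatom_isPolyhedral (hF : Nat.card F = p) (hp7 : 7 ≤ p) :
    depth (L2 F) ≤ 4 ∧ (¬ 24 ∣ Nat.card (L2 F) → ¬ 5 ∣ Nat.card (L2 F) → depth (L2 F) ≤ 3) := by
  obtain ⟨K, _, _, hKf, hK⟩ := exists_splitting_extension F
  obtain ⟨M, hM, -, hbot, h1⟩ := L2.exists_isCoatom_isPolyhedral hF hp7 hK
  have hU := (L2.isPolarAction (F := F) hK).restrict M
  have h := depth_le_depth_add_one hM
  have h3 := IsPolarAction.IsPolyhedral.depth_le hU hbot h1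
  refine ⟨by omega, fun h24 h5 => ?_⟩
  have hdvd := Subgroup.card_subgroup_dvd_card M
  rcases h1 with h1 | h1 | h1
  · have := hU.depth_le_two_of_card_twelve hbot h1.1 h1.2
    omega
  · exact absurd (h1.1 ▸ hdvd) h24
  · exact absurd ((by norm_num : 5 ∣ 60).trans (h1.1 ▸ hdvd)) h5

/-- The residues mean `p ≡ ±3` modulo 8 and `p ≡ ±2` modulo 5, so that `|L₂(p)| = p (p² - 1) / 2` is
divisible neither by 8 nor by 5. This leaves order 12 for the polyhedral maximal subgroup. -/
theorem L2.depth_le_three_of_mod (hF : Nat.card F = p) (hp7 : 7 ≤ p)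
    (hmod : p % 40 = 3 ∨ p % 40 = 37 ∨ p % 40 = 13 ∨ p % 40 = 27) : depth (L2 F) ≤ 3 := by
  have h := L2.two_mul_card hF (by omega)
  have h1 : 2 * Nat.card (L2 F) + p = p ^ 3 := by
    have : 1 ≤ p ^ 2 := Nat.one_le_pow _ _ (by omega)
    rw [h, Nat.mul_sub, mul_one, show p * p ^ 2 = p ^ 3 by ring]
    have : p ≤ p ^ 3 := Nat.le_self_pow (by norm_num) p
    omega
  refine (L2.depth_le_of_isCoatom_isPolyhedral hF hp7).2 ?_ ?_
  · rintro ⟨c, hc⟩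
    rw [hc] at h1
    have h2 : p ^ 3 % 16 = p % 16 := by omega
    rw [Nat.pow_mod] at h2
    have h3 : p % 16 < 16 := Nat.mod_lt _ (by norm_num)
    have h4 : p % 16 % 8 = 3 ∨ p % 16 % 8 = 5 := by omega
    generalize p % 16 = a at h2 h3 h4
    interval_cases a <;> omega
  · rintro ⟨c, hc⟩
    rw [hc] at h1
    have h2 : p ^ 3 % 5 = p % 5 := by omega
    rw [Nat.pow_mod] at h2
    have h4 : p % 5 = 2 ∨ p % 5 = 3 := by omega
    rcases h4 with h4 | h4 <;> rw [h4] at h2 <;> norm_num at h2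

theorem L2.four_le_depth (hF : Nat.card F = p) (hp5 : 5 ≤ p) (h1 : ¬ ((p - 1) / 2).Prime)
    (h2 : ¬ ((p + 1) / 2).Prime) (hsq : IsSquare (2 : F) ∨ IsSquare (5 : F)) :
    4 ≤ depth (L2 F) := by
  -- For `p = 5, 7, 11` the number `(p - 1) / 2` is prime.
  have hp13 : 13 ≤ p := by
    by_contra hlt
    have hpp := hp.out
    interval_cases p
    all_goals first | (norm_num at hpp; done) | norm_num at h1
  obtain ⟨hc1, -⟩ := L2.one_lt_card_and_not_prime hF (by omega)
  have : Nontrivial (L2 F) := Finite.one_lt_card_iff_nontrivial.1 hc1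
  obtain ⟨M, hM, hd⟩ := exists_isCoatom_depth_eq (G := L2 F)
  obtain ⟨K, _, _, hKf, hK⟩ := exists_splitting_extension F
  suffices 3 ≤ depth M by omega
  rcases L2.card_and_depth_of_isCoatom_prime hF (by omega) hK hM with ⟨-, h⟩ | ⟨c, hc, -, h⟩ |
    ⟨-, -, hbot, h⟩
  · have := two_le_cardFactors (by omega) h1
    omega
  · rcases hc with rfl | rfl
    · have := two_le_cardFactors (by omega) h1
      omega
    · have := two_le_cardFactors (by omega) h2
      omega
  · rcases h with h | h | h
    · obtain ⟨h3, h4⟩ := L2.not_isSquare_of_isCoatom_card_twelve hF hp13 hK hM hbot h.1 h.2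
      exact absurd hsq (by rintro (h | h) <;> contradiction)
    · exact three_le_depth_of_card (Or.inl h.1)
    · exact three_le_depth_of_card (Or.inr h.1)

omit hp in
-- The number 2 is a square for `p ≡ ±1` modulo 8 and, by reciprocity, 5 is a square for `p ≡ ±1`
-- modulo 5. Both fail exactly in the excluded classes.
theorem isSquare_two_or_five [Fact p.Prime] (hp7 : 7 ≤ p)
    (hmod : ¬ (p % 40 = 3 ∨ p % 40 = 37 ∨ p % 40 = 13 ∨ p % 40 = 27)) :
    IsSquare (2 : ZMod p) ∨ IsSquare (5 : ZMod p) := by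
  have hp := (Fact.out : p.Prime)
  have : Fact (Nat.Prime 5) := ⟨by norm_num⟩
  rw [ZMod.exists_sq_eq_two_iff (by omega)]
  by_cases h8 : p % 8 = 1 ∨ p % 8 = 7
  · exact Or.inl h8
  · right
    have h := (ZMod.exists_sq_eq_prime_iff_of_mod_four_eq_one (p := 5) (q := p) (by norm_num)
      (by omega)).1
    have h2 : p % 2 = 1 := hp.eq_two_or_odd.resolve_left (by omega)
    have h5 : p % 5 ≠ 0 := by
      intro h0
      have := (Nat.prime_dvd_prime_iff_eq (by norm_num) hp).1 (Nat.dvd_of_mod_eq_zero h0)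
      omega
    have h6 : p % 5 = 1 ∨ p % 5 = 4 := by
      have e1 : p % 8 = p % 40 % 8 := by omega
      have e2 : p % 5 = p % 40 % 5 := by omega
      have e3 : p % 2 = p % 40 % 2 := by omega
      rw [e1] at h8
      rw [e2] at h5 ⊢
      rw [e3] at h2
      have h40 : p % 40 < 40 := Nat.mod_lt _ (by norm_num)
      generalize p % 40 = m at *
      interval_cases m <;> omega
    have h7 : IsSquare ((p : ℕ) : ZMod 5) := by
      rw [← ZMod.natCast_mod]
      rcases h6 with h6 | h6 <;> rw [h6]
      · exact ⟨1, by norm_num⟩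
      · exact ⟨2, by norm_num⟩
    exact_mod_cast h h7

/-- The depth of `L₂(q)` in odd characteristic in terms of that of `L₂(p)`. -/
theorem L2.depth_eq_add (hp3 : 3 ≤ p) {k : ℕ} (hk : Odd k) (E : Type*) [Field E] [Finite E]
    (hE : Nat.card E = p) (F : Type u) [Field F] [Finite F] (hF : Nat.card F = p ^ k) :
    depth (L2 F) = Ω k + depth (L2 E) := by
  induction k using Nat.strong_induction_on generalizing F with
  | _ k ih =>
    by_cases hk1 : k = 1
    · subst hk1
      rw [ArithmeticFunction.cardFactors_one, zero_add]
      exact depth_L2_congr (by rw [hF, hE, pow_one])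
    have hk0 : 0 < k := hk.pos
    have hsub : ∀ r : ℕ, r.Prime → r ∣ k → k / r < k ∧ Odd (k / r) ∧ Ω k = Ω (k / r) + 1 ∧
        3 ≤ p ^ (k / r) := by
      intro r hr hrk
      obtain ⟨h1, h2, h3, -⟩ := hk.div_prime hr hrk
      exact ⟨h1, h2, h3, hp3.trans (Nat.le_self_pow h2.pos.ne' p)⟩
    have hq3 : 3 ≤ Nat.card F := by rw [hF]; exact hp3.trans (Nat.le_self_pow hk0.ne' p)
    apply le_antisymm
    · obtain ⟨r, hr, hrk⟩ := Nat.exists_prime_and_dvd hk1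
      obtain ⟨h1, h2, h3, h4⟩ := hsub r hr hrk
      obtain ⟨L, hL, -⟩ := Subfield.exists_card_eq hF (Nat.div_dvd_of_dvd hrk) h2.pos.ne'
      have h5 := L2.depth_le_depth_add_one_of_prime hk hF hr hrk h4 hL
      rw [ih _ h1 h2 L hL] at h5
      omega
    · have hnt : Nontrivial (L2 F) := by
        rw [← Finite.one_lt_card_iff_nontrivial]
        have h1 := L2.card_mul_card_center (F := F)
        rw [SL2.card_center_of_natCard_odd hF (by omega)] at h1
        have : Nat.card F ^ 2 - 1 ≥ 1 := by
          have : 3 * 3 ≤ Nat.card F ^ 2 := by rw [sq]; exact Nat.mul_le_mul hq3 hq3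
          omega
        nlinarith
      obtain ⟨M, hM, hd⟩ := exists_isCoatom_depth_eq (G := L2 F)
      obtain ⟨K, _, _, hKf, hK⟩ := exists_splitting_extension F
      rw [hd]
      have hpe : 2 ∣ p - 1 := by
        obtain ⟨n, hn, -⟩ := hp.out.exists_eq_two_mul_add_one hp3
        omega
      have hqe : 2 ∣ p ^ k - 1 := hpe.trans (by simpa using Nat.sub_dvd_pow_sub_pow p 1 k)
      have h3pk : 3 ≤ p ^ k := hF ▸ hq3
      -- The half torus orders of `L₂(q)` have at least `Ω k` more prime factors than those of
      -- `L₂(p)`, while the depth of `L₂(p)` is at most `Ω ((p ± 1) / 2) + 2`. So these maximal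
      -- subgroups meet the lower bound.
      have hm1 := cardFactors_pow_sub_one (x := p) (n := k) (by omega) hk0.ne'
      have hm2 := cardFactors_pow_add_one (x := p) (n := k) (by omega) hk
      rw [cardFactors_half hqe (by omega), cardFactors_half hpe (by omega)] at hm1
      rw [cardFactors_half (n := p ^ k + 1) (by omega) (by omega),
        cardFactors_half (n := p + 1) (by omega) (by omega)] at hm2
      have hu1 := L2.depth_le_of_pred hE hp3
      have hu2 := L2.depth_le_of_succ hE hp3
      have hcen := SL2.card_center_of_natCard_odd hF (by omega)
      rcases L2.card_and_depth_of_isCoatom hk hF hq3 hK hM with ⟨-, h1⟩ | ⟨n, c, hn, -, h1, h2⟩ |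
        ⟨h1, -⟩ | ⟨r, hr, hrk, -, L, hL, -, h1⟩
      · rw [hF, Nat.gcd_eq_right hqe] at h1
        omega
      · rw [hcen] at h1
        rw [hF] at hn
        have hc : c = (p ^ k - 1) / 2 ∨ c = (p ^ k + 1) / 2 := by omega
        rcases hc with rfl | rfl <;> omega
      · exact absurd h1 hk1
      · obtain ⟨h2, h3, h4, -⟩ := hsub r hr hrk
        rw [h1, ih _ h2 h3 L hL]
        omega

end

/-! ### Characteristic two -/

section

variable {F : Type u} [Field F] [Finite F]

omit [Finite F] in
theorem SL2.upper_mul (a c : Fˣ) (b d : F) :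
    SL2.upper a b * SL2.upper c d = SL2.upper (a * c) (a * d + b * (c⁻¹ : Fˣ)) := by
  apply Subtype.ext
  rw [Matrix.SpecialLinearGroup.coe_mul]
  ext i j
  fin_cases i <;> fin_cases j <;> simp [SL2.upper, Matrix.mul_apply, Fin.sum_univ_two, mul_comm]

theorem exists_sq_eq_of_two_eq_zero (h2 : (2 : F) = 0) (b : F) : ∃ a : F, a ^ 2 = b := by
  have hinj : Function.Injective fun a : F => a ^ 2 := by
    intro x y hxy
    have h : (x - y) ^ 2 = 0 := by
      have h1 : x ^ 2 = y ^ 2 := hxy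
      linear_combination h1 + (y ^ 2 - x * y) * h2
    exact sub_eq_zero.1 (pow_eq_zero_iff two_ne_zero |>.1 h)
  exact (Finite.injective_iff_surjective.1 hinj) b

/-- In characteristic two, the diagonal subgroup is maximal in the upper triangular group. -/
theorem SL2.depth_borel_le (h2 : (2 : F) = 0) (hq : 3 ≤ Nat.card F) :
    depth (SL2.borel F) ≤ Ω (Nat.card F - 1) + 1 := by
  let T : Subgroup (SL2.borel F) :=
    { carrier := {g | g.1.1 0 1 = 0}
      one_mem' := by simp
      mul_mem' := fun {a b} ha hb => by
        have ha' : a.1.1 0 1 = 0 := ha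
        have hb' : b.1.1 0 1 = 0 := hb
        change (a.1.1 * b.1.1) 0 1 = 0
        rw [Matrix.mul_apply, Fin.sum_univ_two, ha', hb']
        ring
      inv_mem' := fun {a} ha => by
        have ha' : a.1.1 0 1 = 0 := ha
        change (a.1⁻¹).1 0 1 = 0
        rw [SL2.inv_val]
        simp [ha'] }
  have hTtop : T ≠ ⊤ := by
    intro h
    have h1 : (⟨SL2.upper 1 1, SL2.upper_mem 1 1⟩ : SL2.borel F) ∈ T := by
      rw [h]; exact Subgroup.mem_top _
    have h3 : (SL2.upper (1 : Fˣ) (1 : F)).1 0 1 = 0 := h1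
    simp [SL2.upper] at h3
  obtain ⟨N, hN, hTN⟩ := (eq_top_or_exists_le_coatom T).resolve_left hTtop
  have hdiag : ∀ a : Fˣ, (⟨SL2.upper a 0, SL2.upper_mem a 0⟩ : SL2.borel F) ∈ N := fun a =>
    hTN (show (SL2.upper a (0 : F)).1 0 1 = 0 by simp [SL2.upper])
  -- Diagonal conjugation multiplies the parameter by squares, and in characteristic two every
  -- element is a square. A single nontrivial transvection would therefore generate all of them, so
  -- the overgroup `N` of the torus meets the unipotents trivially and embeds by the diagonal
  -- character.
  have hunip : ∀ x : F, (⟨SL2.upper 1 x, SL2.upper_mem 1 x⟩ : SL2.borel F) ∈ N → x = 0 := by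
    intro x hx
    by_contra hx0
    apply hN.1
    rw [eq_top_iff]
    have hall : ∀ b : F, (⟨SL2.upper 1 b, SL2.upper_mem 1 b⟩ : SL2.borel F) ∈ N := by
      intro b
      by_cases hb : b = 0
      · rw [hb]; exact hdiag 1
      obtain ⟨a, ha⟩ := exists_sq_eq_of_two_eq_zero h2 (b / x)
      have ha0 : a ≠ 0 := by
        rintro rfl
        rw [zero_pow two_ne_zero, eq_comm, div_eq_zero_iff] at ha
        rcases ha with h | h <;> contradiction
      have h1 := N.mul_mem (N.mul_mem (hdiag (Units.mk0 a ha0)) hx) (hdiag (Units.mk0 a ha0)⁻¹)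
      have h3 : (⟨SL2.upper 1 b, SL2.upper_mem 1 b⟩ : SL2.borel F) =
          ⟨SL2.upper (Units.mk0 a ha0) 0, SL2.upper_mem _ _⟩ * ⟨SL2.upper 1 x, SL2.upper_mem _ _⟩ *
            ⟨SL2.upper (Units.mk0 a ha0)⁻¹ 0, SL2.upper_mem _ _⟩ := by
        apply Subtype.ext
        change SL2.upper 1 b = SL2.upper (Units.mk0 a ha0) 0 * SL2.upper 1 x *
          SL2.upper (Units.mk0 a ha0)⁻¹ 0
        rw [SL2.upper_mul, SL2.upper_mul, mul_one, mul_inv_cancel]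
        congr 1
        simp only [inv_inv, Units.val_mk0, mul_zero, zero_mul, add_zero, zero_add]
        rw [mul_right_comm, ← sq, ha, div_mul_cancel₀ _ hx0]
      rw [h3]
      exact h1
    rintro ⟨g, hg⟩ -
    obtain ⟨a, b, rfl⟩ := SL2.exists_upper_eq hg
    have h3 : (⟨SL2.upper a b, hg⟩ : SL2.borel F) =
        ⟨SL2.upper a 0, SL2.upper_mem _ _⟩ * ⟨SL2.upper 1 ((a⁻¹ : Fˣ) * b), SL2.upper_mem _ _⟩ := by
      apply Subtype.ext
      change SL2.upper a b = SL2.upper a 0 * SL2.upper 1 ((a⁻¹ : Fˣ) * b)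
      rw [SL2.upper_mul]
      simp
    rw [h3]
    exact N.mul_mem (hdiag a) (hall _)
  have hinj : Function.Injective ((SL2.diagChar F).comp N.subtype) := by
    rw [injective_iff_map_eq_one]
    rintro ⟨⟨g, hg⟩, hgN⟩ h
    obtain ⟨a, b, rfl⟩ := SL2.exists_upper_eq hg
    have h1 := congrArg Units.val h
    have ha : a = 1 := Units.ext h1
    subst ha
    have hb := hunip b hgN
    subst hb
    exact Subtype.ext (Subtype.ext SL2.upper_one_zero)
  have hdvd := Subgroup.card_dvd_of_injective _ hinj
  rw [Nat.card_units] at hdvd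
  have h1 := depth_le_cardFactors _ N rfl
  have h3 := Nat.cardFactors_le_of_dvd hdvd (by omega)
  have h4 := depth_le_depth_add_one hN
  omega

/-- For prime degree a maximal subgroup over the Borel subgroup has its order, hence equals it: the
only subfield candidate is the field of two elements, which is excluded. -/
theorem L2.depth_le_of_pred_of_two_eq_zero {r : ℕ} (hr : r.Prime) (hodd : Odd r)
    (hF : Nat.card F = 2 ^ r) : depth (L2 F) ≤ Ω (2 ^ r - 1) + 2 := by
  have : Fact (Nat.Prime 2) := ⟨Nat.prime_two⟩
  have hq : 8 ≤ 2 ^ r := by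
    have h3 : 3 ≤ r := by
      have := hr.two_le
      obtain ⟨n, hn⟩ := hodd
      omega
    calc 8 = 2 ^ 3 := by norm_num
      _ ≤ 2 ^ r := Nat.pow_le_pow_right two_pos h3
  have h2 := (two_eq_zero_iff_of_natCard hF).2 rfl
  have hcen := SL2.card_center_of_two_eq_zero h2
  obtain ⟨K, _, _, hKf, hK⟩ := exists_splitting_extension F
  obtain ⟨M, hM, hdvd, hle⟩ := L2.exists_isCoatom_of_le (F := F) SL2.center_le_borel
    SL2.borel_ne_top
  rw [SL2.card_borel, hcen, one_mul] at hdvd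
  have h := depth_le_depth_add_one hM
  rcases L2.card_and_depth_of_isCoatom hodd hF (by omega) hK hM with ⟨h1, -⟩ | ⟨n, c, hn, h1, -⟩ |
    ⟨h1, -⟩ | ⟨r', hr', hrk', h3, -⟩
  · have heq : SL2.borel F = M.comap L2.mk := by
      refine Subgroup.eq_of_le_of_card_ge hle ?_
      rw [L2.card_comap, h1, SL2.card_borel]
    have hinj : Function.Injective (L2.mk.comp (SL2.borel F).subtype) := by
      rw [injective_iff_map_eq_one]
      rintro ⟨g, hg⟩ h
      have hbot := Subgroup.eq_bot_of_card_eq _ hcen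
      have hgc : g ∈ Subgroup.center (SL2 F) := SL2.mem_center_iff.2 (L2.mk_eq_one_iff.1 h)
      rw [hbot] at hgc
      exact Subtype.ext hgc
    have hrange : (L2.mk.comp (SL2.borel F).subtype).range = M := by
      rw [MonoidHom.range_comp, Subgroup.range_subtype, heq,
        Subgroup.map_comap_eq_self_of_surjective L2.mk_surjective]
    have e := (MonoidHom.ofInjective hinj).trans (MulEquiv.subgroupCongr hrange)
    have h4 := SL2.depth_borel_le h2 (by omega)
    rw [depth_congr e, hF] at h4
    omega
  · exfalso
    have h3 := Nat.le_two_of_dvd_two_mul (x := Nat.card F) (q := Nat.card F) (by omega) dvd_rfl hn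
      (by rw [← h1, hcen, one_mul]; exact (Dvd.intro _ rfl).trans hdvd)
    omega
  · exact absurd h1 hr.ne_one
  · exfalso
    rcases (Nat.dvd_prime hr).1 hrk' with h | h
    · exact hr'.ne_one h
    · rw [h, Nat.div_self hr.pos] at h3
      omega

theorem L2.depth_le_of_succ_of_two_eq_zero {r : ℕ} (hr : r.Prime) (hodd : Odd r)
    (hF : Nat.card F = 2 ^ r) : depth (L2 F) ≤ Ω (2 ^ r + 1) + 2 := by
  have : Fact (Nat.Prime 2) := ⟨Nat.prime_two⟩
  have hq : 8 ≤ 2 ^ r := by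
    have h3 : 3 ≤ r := by
      have := hr.two_le
      obtain ⟨n, hn⟩ := hodd
      omega
    calc 8 = 2 ^ 3 := by norm_num
      _ ≤ 2 ^ r := Nat.pow_le_pow_right two_pos h3
  have h2 := (two_eq_zero_iff_of_natCard hF).2 rfl
  have hcen := SL2.card_center_of_two_eq_zero h2
  obtain ⟨K, _, _, hKf, hK⟩ := exists_splitting_extension F
  obtain ⟨X, hX, hirr⟩ := SL2.exists_irreducible F
  obtain ⟨M, hM, hdvd, hle⟩ := L2.exists_isCoatom_of_le (SL2.center_le_invStab X)
    (SL2.invStab_ne_top (by omega) hX)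
  rw [SL2.card_invStab hX, SL2.card_cent_of_irreducible hX hirr, hcen, one_mul] at hdvd
  have h := depth_le_depth_add_one hM
  rcases L2.card_and_depth_of_isCoatom hodd hF (by omega) hK hM with ⟨h1, -⟩ | ⟨n, c, hn, h1, -⟩ |
    ⟨h1, -⟩ | ⟨r', hr', hrk', h3, -⟩
  · exfalso
    rw [hcen, one_mul] at h1
    rw [h1] at hdvd
    refine Nat.not_add_one_dvd_pow_mul_pow_sub_one (x := Nat.card F) (by omega) odd_one ?_
    rw [pow_one]
    exact (Dvd.intro_left _ rfl).trans hdvd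
  · rw [hcen, one_mul] at h1
    rw [h1, Nat.mul_dvd_mul_iff_left two_pos] at hdvd
    have h3 : n = Nat.card F + 1 := by
      have := Nat.le_of_dvd (by omega) hdvd
      omega
    have h4 := depth_le_cardFactors _ M h1
    rw [cardFactors_two_mul (by omega), h3, hF] at h4
    omega
  · exact absurd h1 hr.ne_one
  · exfalso
    rcases (Nat.dvd_prime hr).1 hrk' with h | h
    · exact hr'.ne_one h
    · rw [h, Nat.div_self hr.pos] at h3
      omega

end

/-- Primes are stripped from `k` one at a time, each costing one step, until only the chosen prime
`r₀` is left. -/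
theorem L2.depth_le_of_two_eq_zero {k r₀ : ℕ} (hk : Odd k) (hr₀ : r₀.Prime) (h₀ : r₀ ∣ k)
    (F : Type u) [Field F] [Finite F] (hF : Nat.card F = 2 ^ k) :
    depth (L2 F) ≤ Ω k + 1 + Ω (2 ^ r₀ - 1) ∧ depth (L2 F) ≤ Ω k + 1 + Ω (2 ^ r₀ + 1) := by
  have : Fact (Nat.Prime 2) := ⟨Nat.prime_two⟩
  induction k using Nat.strong_induction_on generalizing F with
  | _ k ih =>
    by_cases hk1 : k = r₀
    · subst hk1
      have h1 := L2.depth_le_of_pred_of_two_eq_zero hr₀ hk hF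
      have h2 := L2.depth_le_of_succ_of_two_eq_zero hr₀ hk hF
      rw [ArithmeticFunction.cardFactors_apply_prime hr₀]
      omega
    · obtain ⟨c, hc⟩ := h₀
      have hc1 : c ≠ 1 := by rintro rfl; exact hk1 (by rw [hc, mul_one])
      obtain ⟨r, hr, d, hd⟩ := Nat.exists_prime_and_dvd hc1
      have hrk : r ∣ k := ⟨r₀ * d, by rw [hc, hd]; ring⟩
      obtain ⟨h1, h2, h3, h4⟩ := hk.div_prime hr hrk
      have hd' : k / r = r₀ * d := by
        rw [hc, hd, show r₀ * (r * d) = r₀ * d * r by ring, Nat.mul_div_cancel _ hr.pos]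
      have hr₀k : r₀ ∣ k / r := ⟨d, hd'⟩
      have hge : 2 ≤ k / r := hr₀.two_le.trans (Nat.le_of_dvd h2.pos hr₀k)
      have h5 : 3 ≤ 2 ^ (k / r) := by
        have := Nat.pow_le_pow_right two_pos hge
        omega
      obtain ⟨L, hL, -⟩ := Subfield.exists_card_eq hF (Nat.div_dvd_of_dvd hrk) h2.pos.ne'
      have h6 := L2.depth_le_depth_add_one_of_prime hk hF hr hrk h5 hL
      have h7 := ih _ h1 h2 hr₀k L hL
      omega

/-- Borel subgroups and torus normalizers have depth at least `Ω(2 ^ k ∓ 1) + 1`, and for any prime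
`r` dividing `k` this is at least `m + Ω(k / r) + 1`. Subfield groups are covered by induction, the
field of two elements being excluded. -/
theorem L2.le_depth_of_two_eq_zero {k m : ℕ} (hk : Odd k) (hk1 : k ≠ 1)
    (hm : ∀ r : ℕ, r.Prime → r ∣ k → m ≤ Ω (2 ^ r - 1) ∧ m ≤ Ω (2 ^ r + 1))
    (F : Type u) [Field F] [Finite F] (hF : Nat.card F = 2 ^ k) :
    Ω k + 1 + m ≤ depth (L2 F) := by
  have : Fact (Nat.Prime 2) := ⟨Nat.prime_two⟩
  induction k using Nat.strong_induction_on generalizing F with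
  | _ k ih =>
    have hk3 : 3 ≤ k := by
      obtain ⟨n, hn⟩ := hk
      omega
    have hq : 8 ≤ 2 ^ k := by
      calc 8 = 2 ^ 3 := by norm_num
        _ ≤ 2 ^ k := Nat.pow_le_pow_right two_pos hk3
    have h2 := (two_eq_zero_iff_of_natCard hF).2 rfl
    have hcen := SL2.card_center_of_two_eq_zero h2
    have hnt : Nontrivial (L2 F) := by
      rw [← Finite.one_lt_card_iff_nontrivial]
      have h1 := L2.card_mul_card_center (F := F)
      rw [hcen, one_mul, hF] at h1
      have : 1 ≤ (2 ^ k) ^ 2 - 1 := by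
        have : 8 * 8 ≤ (2 ^ k) ^ 2 := by rw [sq]; exact Nat.mul_le_mul hq hq
        omega
      rw [h1]
      nlinarith
    obtain ⟨M, hM, hd⟩ := exists_isCoatom_depth_eq (G := L2 F)
    obtain ⟨K, _, _, hKf, hK⟩ := exists_splitting_extension F
    rw [hd]
    obtain ⟨r, hr, hrk⟩ := Nat.exists_prime_and_dvd hk1
    obtain ⟨-, ho, h3, h4⟩ := hk.div_prime hr hrk
    have hx : 2 ≤ 2 ^ r := Nat.le_self_pow hr.ne_zero 2
    have hm1 := cardFactors_pow_sub_one hx ho.pos.ne'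
    have hm2 := cardFactors_pow_add_one hx ho
    rw [← pow_mul, mul_comm r, h4] at hm1 hm2
    obtain ⟨hmr1, hmr2⟩ := hm r hr hrk
    rcases L2.card_and_depth_of_isCoatom hk hF (by omega) hK hM with ⟨-, h1⟩ | ⟨n, c, hn, -, h1, h5⟩ |
      ⟨h1, -⟩ | ⟨r', hr', hrk', h5, L, hL, -, h1⟩
    · have hodd : (Nat.card F - 1).gcd 2 = 1 := by
        rw [hF]
        refine Nat.Coprime.symm ((Nat.coprime_two_left).2 ?_)
        have : Even (2 ^ k) := (even_two.pow_of_ne_zero (by omega))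
        exact Nat.Even.sub_odd (by omega) this odd_one
      rw [hodd, Nat.div_one, hF] at h1
      omega
    · rw [hcen, one_mul] at h1
      subst h1
      rw [hF] at hn
      rcases hn with rfl | rfl <;> omega
    · exact absurd h1 hk1
    · obtain ⟨h6, h7, h8, -⟩ := hk.div_prime hr' hrk'
      have h9 := ih _ h6 h7 (by intro h; rw [h] at h5; omega)
        (fun s hs hsk => hm s hs (hsk.trans (Nat.div_dvd_of_dvd hrk'))) L hL
      rw [h1]
      omega

/-! ### The main theorem -/

theorem proposition3 (p k : ℕ) [Fact p.Prime] (hk : Odd k) (hpk : (p, k) ≠ (2, 1))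
    (F : Type*) [Field F] [Finite F] (hF : Nat.card F = p ^ k) :
    (p = 2 →
      ∃ m : ℕ,
        IsLeast {n : ℕ | ∃ r : ℕ, r.Prime ∧ r ∣ k ∧ (n = Ω (2 ^ r - 1) ∨ n = Ω (2 ^ r + 1))} m ∧
        depth (L2 F) = Ω k + 1 + m) ∧
    (3 ≤ p →
      depth (L2 F) = Ω k + depth (L2 (ZMod p)) ∧
      (p = 3 → depth (L2 (ZMod p)) = 2) ∧
      (5 ≤ p →
        (((p - 1) / 2).Prime ∨ ((p + 1) / 2).Prime ∨
          p ≡ 3 [MOD 40] ∨ p ≡ 37 [MOD 40] ∨ p ≡ 13 [MOD 40] ∨ p ≡ 27 [MOD 40]) →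
        depth (L2 (ZMod p)) = 3) ∧
      (5 ≤ p →
        ¬ (((p - 1) / 2).Prime ∨ ((p + 1) / 2).Prime ∨
          p ≡ 3 [MOD 40] ∨ p ≡ 37 [MOD 40] ∨ p ≡ 13 [MOD 40] ∨ p ≡ 27 [MOD 40]) →
        depth (L2 (ZMod p)) = 4)) := by

  have hk0 : 0 < k := hk.pos
  refine ⟨?_, fun hp3 => ?_⟩
  · rintro rfl
    have hk1 : k ≠ 1 := fun h => hpk (by rw [h])
    set S : Set ℕ := {n : ℕ | ∃ r : ℕ, r.Prime ∧ r ∣ k ∧ (n = Ω (2 ^ r - 1) ∨ n = Ω (2 ^ r + 1))}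
      with hS
    have hne : S.Nonempty := by
      obtain ⟨r, hr, hrk⟩ := Nat.exists_prime_and_dvd hk1
      exact ⟨_, r, hr, hrk, Or.inl rfl⟩
    have hmem := Nat.sInf_mem hne
    have hle : ∀ n ∈ S, sInf S ≤ n := fun n hn => Nat.sInf_le hn
    refine ⟨sInf S, ⟨hmem, hle⟩, le_antisymm ?_ ?_⟩
    · obtain ⟨r, hr, hrk, h⟩ := hmem
      obtain ⟨h1, h2⟩ := L2.depth_le_of_two_eq_zero hk hr hrk F hF
      rcases h with h | h <;> rw [h] <;> assumption
    · exact L2.le_depth_of_two_eq_zero hk hk1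
        (fun r hr hrk => ⟨hle _ ⟨r, hr, hrk, Or.inl rfl⟩, hle _ ⟨r, hr, hrk, Or.inr rfl⟩⟩) F hF
  · have hE : Nat.card (ZMod p) = p := Nat.card_zmod p
    refine ⟨L2.depth_eq_add hp3 hk _ hE F hF, ?_, fun hp5 h => ?_, fun hp5 h => ?_⟩
    · rintro rfl
      exact L2.depth_eq_two_of_card_three hE
    · refine le_antisymm ?_ (L2.three_le_depth hE hp5)
      rcases h with h | h | h
      · have := L2.depth_le_of_pred hE hp3
        rwa [ArithmeticFunction.cardFactors_apply_prime h] at this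
      · have := L2.depth_le_of_succ hE hp3
        rwa [ArithmeticFunction.cardFactors_apply_prime h] at this
      · simp only [Nat.ModEq] at h
        refine L2.depth_le_three_of_mod hE (by omega) (by omega)
    · push Not at h
      obtain ⟨h1, h2, h3⟩ := h
      simp only [Nat.ModEq] at h3
      -- The prime 5 belongs to the depth three case, since `(5 - 1) / 2 = 2` is prime.
      have hp7 : 7 ≤ p := by
        by_contra hlt
        have h6 : p ≠ 6 := by rintro rfl; exact absurd (Fact.out : Nat.Prime 6) (by norm_num)
        have h5 : p = 5 := by omega
        rw [h5] at h1
        exact h1 (by norm_num)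
      exact le_antisymm (L2.depth_le_of_isCoatom_isPolyhedral hE hp7).1
        (L2.four_le_depth hE hp5 h1 h2 (isSquare_two_or_five hp7 (by omega)))
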